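/- **Setting.** Let $c,a,b,\eta,\rho>0$ and $\delta>1$. For each $y\ge b$ let $N$ (depending on $y$) be a Hawkes process on a probability space: a counting process with $N_0=0$, unit jumps and stochastic intensity $\lambda$ given by $d\lambda_t=a(b-\lambda_t)\,dt+\eta\,dN_t$, $\lambda_0=y$. Let the claim sizes $(Y_k)_{k\ge1}$ be positive, i.i.d. with a density $f$, and independent of $N$; the law of the claim sizes does not depend on $y$. Let $\mathbb F$ be the complete right-continuous filtration generated by the claims, and $R^x_t=x+ct-\sum_{k=1}^{N_t}Y_k$, $R^x_{0^-}=x$. A strategy $\alpha=(Z,K)$ consists of two non-decreasing $\mathbb F$-adapted processes with $Z_{0^-}=K_{0^-}=0$: the cumulative dividends $Z$, which are càdlàg, and the cumulative capital injections $K$, which are càglàd. The controlled surplus is $X_t=R^x_t-Z_t+K_t$, $X_{0^-}=x$. The strategy is admissible, $\alpha\in\mathcal A(x,y)$, if lump dividends never exceed the available reserve: $$Z_t-Z_{t^-}\le\big(X_{t^-}+R^0_t-R^0_{t^-}\big)^+\qquad(t\ge0).$$ The ruin time is $T^\alpha=\inf\{t\ge0: X_{t^+}<0\}$, and $$J_\alpha(x,y)=\mathbb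 E\Big[\int_{[0,T^\alpha]}e^{-\rho s}\,dZ_s-\delta\int_{[0,T^\alpha]}e^{-\rho s}\,dK_s\Big],\qquad v(x,y)=\sup_{\alpha\in\mathcal A(x,y)}J_\alpha(x,y)$$ for $(x,y)\in\mathbb R\times[b,\infty)$ (the integrals run over $s\in[0,\infty)$ if $T^\alpha=\infty$, they include jumps at time $0$, and $J_\alpha=-\infty$ if the expected discounted injections are infinite). **Proposition (local Lipschitz continuity).** The value function $v$ is finite on $\mathbb R\times[b,\infty)$ and locally Lipschitz continuous on $\mathbb R\times(b,\infty)$. More precisely: i) Let $y\ge b$. If $0\le x<x'$, then $$x'-x\le v(x',y)-v(x,y)\le\delta(x'-x).$$ If $x<x'\le0$, then $$0\le v(x',y)-v(x,y)=\max(\delta x'+v(0,y),0)-\max(\delta x+v(0,y),0)\le\delta(x'-x).$$ ii) Let $\varepsilon>0$ and $b+\varepsilon\le y<y'$. If $x\ge0$, then $$0\le v(x,y)-v(x,y')\le\Big(x+\frac c\rho\Big)\frac{\rho+y}{a\,\varepsilon}\,(y'-y)+o(y'-y).$$ If $x\le0$, then $$v(x,y)-v(x,y')\le\max(\delta x+v(0,y),0)-\max(\delta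 x+v(0,y'),0)\le v(0,y)-v(0,y')\le\frac c\rho\,\frac{\rho+y}{a\,\varepsilon}\,(y'-y)+o(y'-y).$$ Here $o(y'-y)$ refers to $y'\downarrow y$ with the other quantities fixed; for $x\le 0$ it does not depend on $x$. -/

import Mathlib

open MeasureTheory ProbabilityTheory Filter Topology
open scoped NNReal ENNReal

namespace HawkesDividend

/-- The parameters: premium rate `c`, mean-reversion speed `a`, long-term level `b` and jump
size `η` of the claim intensity, discount rate `ρ`, injection penalty `δ > 1`. -/
structure Params where
  c : ℝ
  a : ℝ
  b : ℝ
  η : ℝ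
  ρ : ℝ
  δ : ℝ
  c_pos : 0 < c
  a_pos : 0 < a
  b_pos : 0 < b
  η_pos : 0 < η
  ρ_pos : 0 < ρ
  one_lt_δ : 1 < δ

/-- The number `N t` of claims up to time `t`, and the successive claim sizes
`Y 0, Y 1, …` (so `Y k` is the size of the `(k+1)`-st claim). -/
structure ClaimProcess (Ω : Type*) [MeasurableSpace Ω] where
  N : ℝ≥0 → Ω → ℕ
  Y : ℕ → Ω → ℝ
  measurable_N : ∀ t, Measurable (N t)
  measurable_Y : ∀ k, Measurable (Y k)

variable {Ω : Type*} [mΩ : MeasurableSpace Ω]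

namespace ClaimProcess

variable (C : ClaimProcess Ω)

/-- The aggregate claim amount up to time `t`. -/
noncomputable def total (t : ℝ≥0) (ω : Ω) : ℝ := ∑ k ∈ Finset.range (C.N t ω), C.Y k ω

theorem measurable_total (t : ℝ≥0) : Measurable (C.total t) := by
  have h : Measurable fun q : ℕ × Ω => ∑ k ∈ Finset.range q.1, C.Y k q.2 := by
    refine measurable_from_prod_countable_right fun n => ?_
    simpa using Finset.measurable_fun_sum (Finset.range n) fun k _ => C.measurable_Y k
  exact h.comp ((C.measurable_N t).prodMk measurable_id)

/-- The history of the claims (their number and their aggregate amount) up to time `t`,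
together with all null events. -/
noncomputable def history (P : Measure Ω) : Filtration ℝ≥0 mΩ where
  seq t := (⨆ s : {s : ℝ≥0 // s ≤ t}, MeasurableSpace.comap (C.N s) inferInstance ⊔
      MeasurableSpace.comap (C.total s) inferInstance) ⊔
    MeasurableSpace.generateFrom {A | MeasurableSet A ∧ P A = 0}
  mono' s t hst := by
    refine sup_le_sup (iSup_le fun r => ?_) le_rfl
    exact le_iSup (fun s : {s : ℝ≥0 // s ≤ t} => MeasurableSpace.comap (C.N s) inferInstance ⊔
      MeasurableSpace.comap (C.total s) inferInstance) ⟨r.1, r.2.trans hst⟩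
  le' t := by
    refine sup_le (iSup_le fun s => sup_le ?_ ?_) (MeasurableSpace.generateFrom_le fun A hA => hA.1)
    · exact (C.measurable_N s).comap_le
    · exact (C.measurable_total s).comap_le

/-- The information available to the shareholders: the complete right-continuous filtration
generated by the claims. -/
noncomputable def filtration (P : Measure Ω) : Filtration ℝ≥0 mΩ := (C.history P).rightCont

end ClaimProcess

/-- `C` is the claim process of the model with initial claim intensity `y`: `N` is a counting
process whose stochastic intensity `lam` starts at `y` and satisfies
`d lam = a (b - lam) dt + η dN`, and the claim sizes are positive, i.i.d. with density `f`, and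
independent of `N`. -/
structure IsHawkesModel (p : Params) (f : ℝ → ℝ) (P : Measure Ω) (y : ℝ)
    (C : ClaimProcess Ω) : Prop where
  N_zero : ∀ ω, C.N 0 ω = 0
  N_mono : ∀ ω, Monotone fun t => C.N t ω
  N_rightCont : ∀ ω t, ContinuousWithinAt (fun s => C.N s ω) (Set.Ici t) t
  /-- The jumps of `N` have size one. -/
  N_jump : ∀ ω, ∀ t > 0, ∀ᶠ s in 𝓝[<] t, C.N t ω ≤ C.N s ω + 1
  intensity : ∃ lam : ℝ≥0 → Ω → ℝ,
    (∀ ω (t : ℝ≥0), IntervalIntegrable (fun s : ℝ => lam s.toNNReal ω) volume 0 t) ∧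
    (∀ ω (t : ℝ≥0),
      lam t ω = y + (∫ s in (0 : ℝ)..t, p.a * (p.b - lam s.toNNReal ω)) + p.η * C.N t ω) ∧
    Martingale (fun t ω => (C.N t ω : ℝ) - ∫ s in (0 : ℝ)..t, lam s.toNNReal ω)
      (C.filtration P) P
  Y_pos : ∀ k, ∀ᵐ ω ∂P, 0 < C.Y k ω
  Y_density : ∀ k, P.map (C.Y k) = volume.withDensity fun z => ENNReal.ofReal (f z)
  Y_indep : iIndepFun C.Y P
  Y_indep_N : IndepFun (fun ω k => C.Y k ω) (fun ω t => C.N t ω) P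

/-- Extends a path on `[0, ∞)` to the real line by its value `u₀` "at time `0-`". -/
noncomputable def toLine (u₀ : ℝ) (u : ℝ≥0 → ℝ) (t : ℝ) : ℝ := if 0 ≤ t then u t.toNNReal else u₀

theorem monotone_toLine {u₀ : ℝ} {u : ℝ≥0 → ℝ} (hu : Monotone u) (h0 : u₀ ≤ u 0) :
    Monotone (toLine u₀ u) := by
  intro s t hst
  unfold toLine
  split_ifs with hs ht ht
  · exact hu (Real.toNNReal_le_toNNReal hst)
  · exact absurd (hs.trans hst) ht
  · exact h0.trans (hu bot_le)
  · exact le_rfl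

/-- Cumulative dividends `Z` (càdlàg) and cumulative capital injections `K` (càglàd), both
non-decreasing and with value `0` at time `0-`. As `K` is left-continuous, `K 0 = 0`, and an
injection made at time `0` is the jump `K (0+) - K 0`. -/
structure Strategy (Ω : Type*) where
  Z : ℝ≥0 → Ω → ℝ
  K : ℝ≥0 → Ω → ℝ
  Z_mono : ∀ ω, Monotone fun t => Z t ω
  K_mono : ∀ ω, Monotone fun t => K t ω
  Z_rightCont : ∀ ω t, ContinuousWithinAt (fun s => Z s ω) (Set.Ici t) t
  K_leftCont : ∀ ω t, ContinuousWithinAt (fun s => K s ω) (Set.Iic t) t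
  Z_zero : ∀ ω, 0 ≤ Z 0 ω
  K_zero : ∀ ω, K 0 ω = 0

/-- The random measure `dZ` on the line; its mass at `0` is `Z 0`. -/
noncomputable def Strategy.dZ (α : Strategy Ω) (ω : Ω) : Measure ℝ :=
  (monotone_toLine (α.Z_mono ω) (α.Z_zero ω)).stieltjesFunction.measure

/-- The random measure `dK` on the line; its mass at `t` is `K (t+) - K t`. -/
noncomputable def Strategy.dK (α : Strategy Ω) (ω : Ω) : Measure ℝ :=
  (monotone_toLine (α.K_mono ω) (α.K_zero ω).ge).stieltjesFunction.measure

variable (p : Params) (P : Measure Ω) (C : ClaimProcess Ω) (x : ℝ)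

/-- The uncontrolled reserve `R^x`, with value `x` before time `0`. -/
noncomputable def reserve (ω : Ω) : ℝ → ℝ := toLine x fun t => x + p.c * t - C.total t ω

/-- The controlled surplus `X = R^x - Z + K`, with value `x` before time `0`. -/
noncomputable def surplus (α : Strategy Ω) (ω : Ω) : ℝ → ℝ :=
  toLine x fun t => x + p.c * t - C.total t ω - α.Z t ω + α.K t ω

/-- Admissibility from the initial capital `x`. A lump dividend at time `t` cannot exceed the
available reserve `X (t-) + R t - R (t-)`; if the latter is negative, there is none. -/
structure IsAdmissible (α : Strategy Ω) : Prop where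
  Z_adapted : StronglyAdapted (C.filtration P) α.Z
  K_adapted : StronglyAdapted (C.filtration P) α.K
  dividend_le : ∀ ω (t : ℝ≥0),
    α.Z t ω - Function.leftLim (toLine 0 fun s => α.Z s ω) t ≤
      max (Function.leftLim (surplus p C x α ω) t
        + (reserve p C x ω t - Function.leftLim (reserve p C x ω) t)) 0

/-- The ruin time `inf {t ≥ 0 | X (t+) < 0}`, with `inf ∅ = ∞`. -/
noncomputable def ruinTime (α : Strategy Ω) (ω : Ω) : ℝ≥0∞ :=
  ⨅ (t : ℝ≥0) (_ : Function.rightLim (surplus p C x α ω) t < 0), (t : ℝ≥0∞)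

/-- The times `s` with `0 ≤ s ≤ T`. -/
def upToRuin (α : Strategy Ω) (ω : Ω) : Set ℝ :=
  {s | 0 ≤ s ∧ ENNReal.ofReal s ≤ ruinTime p C x α ω}

/-- Expected discounted dividends until ruin. -/
noncomputable def expectedDividends (α : Strategy Ω) : ℝ≥0∞ :=
  ∫⁻ ω, ∫⁻ s in upToRuin p C x α ω, ENNReal.ofReal (Real.exp (-p.ρ * s)) ∂α.dZ ω ∂P

/-- Expected discounted capital injections until ruin. -/
noncomputable def expectedInjections (α : Strategy Ω) : ℝ≥0∞ :=
  ∫⁻ ω, ∫⁻ s in upToRuin p C x α ω, ENNReal.ofReal (Real.exp (-p.ρ * s)) ∂α.dK ω ∂P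

/-- The reward `J_α`. It is `-∞` (by the convention `∞ - ∞ = -∞` of `EReal`) when the expected
discounted injections are infinite; since the discounted dividends exceed the discounted
injections by at most a constant, and `δ > 1`, that is the value of the expectation then. -/
noncomputable def reward (α : Strategy Ω) : EReal :=
  (expectedDividends p P C x α : EReal) - (p.δ : EReal) * (expectedInjections p P C x α : EReal)

/-- The value function `v(x, y)`, where `C` is the claim process with initial intensity `y`:
the supremum of the rewards of all admissible strategies. -/
noncomputable def value : EReal :=
  ⨆ (α : Strategy Ω) (_ : IsAdmissible p P C x α), reward p P C x α

end HawkesDividend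

/-!
The proof compares strategies for different initial data.

**Reduction.** Integrating by parts, the discounted integral of a control `V` stopped at ruin is
`∫ ρ exp (-ρ u) V u du` (`lintegral_exp_stieltjes`), so that integrals against controls turn into
integrals in time. A strategy may be stopped at ruin without loss (`isFrozen_frozen`), and a lump
dividend is admissible exactly if it leaves a non-negative surplus (`dividend_le_iff`). Before ruin,
dividends are covered by the reserve and the injections, whence `0 ≤ v(x, y) ≤ max x 0 + c / ρ`
(`value_finite`).

**Surplus.** An additional surplus can be paid out at once, and a lacking one can be injected at
once (`value_add_ge`, `value_add_le`). For a negative initial surplus, the `σ`-algebra at time `0`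
is trivial, because with a probability tending to `1` there is no claim before `t` as `t → 0`
(`zero_one`). So almost surely the same decision is taken at time `0`: to make up for the deficit,
or to accept ruin. This gives `v(x, y) = max (δ x + v(0, y)) 0` for `x ≤ 0` (`value_of_nonpos`).

**Laws of the claims.** For a solution `β` of the Riccati equation
`β' = a β - 1 + exp (-(η β + φ))`, `β T = 0`, the process
`exp (-a b ∫_t^T β - β_t λ_t - ∫_0^t φ dN)` is a martingale (`integral_expFunctional`). Therefore
the Laplace functional of the claim numbers is exponential in the initial intensity. The excess of
intensity contributes a factor of its own, which is the Laplace functional of a Hawkes process with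
base level `0`, constructed here from exponential waiting times (`integral_exp_excess`). Since
Laplace transforms determine laws (`ext_of_laplace`), two identities in law follow. The claims for
the initial intensity `y'` are those for `y < y'` together with independent excess claims
(`map_mergedPath`). Given that there is no claim until `h`, the process starts anew at `h` from the
intensity that has decayed in the meantime (`map_shiftPath`); the probability of no claim until `h`
is at least `exp (-(a b h ^ 2 + h y'))` (`no_claim_ge`).

**Transfer of strategies.** An adapted strategy is, up to null events, a function of the claim path
at rational times that looks ahead only infinitesimally (`exists_pathControl`), and its
admissibility is a measurable property of that path (`measurableSet_isRatControl`). It can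
therefore be followed for every claim process that is dominated by one with the right law
(`value_transfer`); an additional randomization is harmless, since some value of it does at least as
well as the average.

**Intensity.** Simulating the excess claims gives `v(x, y') ≤ v(x, y)` (`value_anti`). Conversely,
from the intensity `y'` one can wait for the time `h = log ((y' - b) / (y - b)) / a` in which the
intensity decays to `y`, and then follow a strategy for `y`. This gives
`exp (-((ρ + y') h + a b h ^ 2)) v(x, y) ≤ v(x, y')` (`exp_mul_value_le`), and `value_sub_le` is its
expansion in `y' - y`.
-/

namespace HawkesDividend

/-! ### The Riccati equation -/

/-- `β` solves the Riccati equation `β' = a β - 1 + exp (-(η β + φ))` on `[h, T]` with terminal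
value `β T = 0`. The bounds are consequences of the equation; they are recorded here because they
are what makes `exp (-β λ)` a bounded functional of the intensity. -/
structure IsRiccati (a η : ℝ) (φ β : ℝ → ℝ) (h T : ℝ) : Prop where
  continuous : Continuous β
  deriv : ∀ t ∈ Set.Icc h T,
    HasDerivWithinAt β (a * β t - 1 + Real.exp (-(η * β t + φ t))) (Set.Icc h T) t
  terminal : β T = 0
  nonneg : ∀ t ∈ Set.Icc h T, 0 ≤ β t
  le_inv : ∀ t ∈ Set.Icc h T, β t ≤ 1 / a
  le_sub : ∀ t ∈ Set.Icc h T, β t ≤ T - t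

/-- Solutions of the Riccati equation are invariant under time shifts. -/
theorem IsRiccati.shift {a η : ℝ} {φ β : ℝ → ℝ} {T : ℝ} (hβ : IsRiccati a η φ β 0 T) (h : ℝ) :
    IsRiccati a η (fun t => φ (t - h)) (fun t => β (t - h)) h (h + T) where
  continuous := hβ.continuous.comp (by fun_prop)
  deriv t ht := by
    have h1 : t - h ∈ Set.Icc 0 T := ⟨by linarith [ht.1], by linarith [ht.2]⟩
    have h2 : HasDerivWithinAt (fun t => t - h) 1 (Set.Icc h (h + T)) t :=
      ((hasDerivAt_id t).sub_const h).hasDerivWithinAt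
    have := HasDerivWithinAt.comp t (hβ.deriv _ h1) h2 fun s hs =>
      ⟨by linarith [hs.1], by linarith [hs.2]⟩
    simpa [Function.comp_def] using this
  terminal := by simp [hβ.terminal]
  nonneg t ht := hβ.nonneg _ ⟨by linarith [ht.1], by linarith [ht.2]⟩
  le_inv t ht := hβ.le_inv _ ⟨by linarith [ht.1], by linarith [ht.2]⟩
  le_sub t ht := by
    have := hβ.le_sub (t - h) ⟨by linarith [ht.1], by linarith [ht.2]⟩
    linarith

/-- The Riccati vector field in reversed time, with its argument clamped to `[0, 1/a]`. -/
noncomputable def clampedField (a η : ℝ) (φ : ℝ → ℝ) (T : ℝ) (t u : ℝ) : ℝ :=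
  1 - a * max 0 (min u (1 / a)) - Real.exp (-(η * max 0 (min u (1 / a)) + φ (T - t)))

theorem abs_clamp_sub_le (c u v : ℝ) : |max 0 (min u c) - max 0 (min v c)| ≤ |u - v| := by
  refine (abs_max_sub_max_le_max _ _ _ _).trans ?_
  simp only [sub_self, abs_zero]
  refine max_le (abs_nonneg _) ((abs_min_sub_min_le_max _ _ _ _).trans ?_)
  simp

theorem abs_exp_neg_sub_le {u v : ℝ} (hu : 0 ≤ u) (hv : 0 ≤ v) :
    |Real.exp (-u) - Real.exp (-v)| ≤ |u - v| := by
  wlog h : u ≤ v generalizing u v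
  · rw [abs_sub_comm, abs_sub_comm u]; exact this hv hu (le_of_not_ge h)
  have h1 : Real.exp (-v) ≤ Real.exp (-u) := Real.exp_le_exp.2 (by linarith)
  rw [abs_of_nonneg (by linarith), abs_of_nonpos (by linarith)]
  have h2 : Real.exp (-v) = Real.exp (-u) * Real.exp (-(v - u)) := by
    rw [← Real.exp_add]; congr 1; ring
  have h3 := Real.add_one_le_exp (-(v - u))
  have h4 : Real.exp (-u) ≤ 1 := Real.exp_le_one_iff.2 (by linarith)
  have h5 := Real.exp_pos (-u)
  rw [h2]
  nlinarith

/-- The reversed equation with the clamped field is Lipschitz and bounded, so that Picard–Lindelöf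
gives a solution on all of `[0, T]`; the barriers `0` and `1 / a` show that the clamp is never
active. -/
theorem exists_isRiccati {a η : ℝ} (ha : 0 < a) (hη : 0 ≤ η) {φ : ℝ → ℝ} (hφ : Continuous φ)
    (hφ0 : ∀ t, 0 ≤ φ t) {T : ℝ} (hT : 0 ≤ T) : ∃ β, IsRiccati a η φ β 0 T := by
  have hia : 0 < 1 / a := by positivity
  -- values of the clamp
  have hcl : ∀ u, 0 ≤ max 0 (min u (1 / a)) ∧ max 0 (min u (1 / a)) ≤ 1 / a := fun u =>
    ⟨le_max_left _ _, max_le hia.le (min_le_right _ _)⟩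
  have hexp : ∀ t u, 0 ≤ η * max 0 (min u (1 / a)) + φ (T - t) := fun t u =>
    add_nonneg (mul_nonneg hη (hcl u).1) (hφ0 _)
  have hbound : ∀ t u, |clampedField a η φ T t u| ≤ 2 := by
    intro t u
    have h1 : Real.exp (-(η * max 0 (min u (1 / a)) + φ (T - t))) ≤ 1 :=
      Real.exp_le_one_iff.2 (by linarith [hexp t u])
    have h2 := Real.exp_pos (-(η * max 0 (min u (1 / a)) + φ (T - t)))
    have h3 : a * max 0 (min u (1 / a)) ≤ 1 := by
      calc _ ≤ a * (1 / a) := by gcongr; exact (hcl u).2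
        _ = 1 := by field_simp
    have h4 : 0 ≤ a * max 0 (min u (1 / a)) := mul_nonneg ha.le (hcl u).1
    unfold clampedField
    rw [abs_le]; constructor <;> linarith
  have hPL : IsPicardLindelof (clampedField a η φ T) (tmin := 0) (tmax := T) ⟨0, le_rfl, hT⟩
      (0 : ℝ) (2 * T).toNNReal 0 2 (a + η).toNNReal := by
    refine ⟨fun t _ => LipschitzWith.lipschitzOnWith ?_, fun u _ => ?_, fun t _ u _ => ?_, ?_⟩
    · refine LipschitzWith.of_dist_le_mul fun u v => ?_
      rw [Real.coe_toNNReal _ (by positivity), Real.dist_eq, Real.dist_eq]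
      have e1 := abs_exp_neg_sub_le (hexp t u) (hexp t v)
      have e2 := abs_clamp_sub_le (1 / a) u v
      unfold clampedField
      set p := max 0 (min u (1 / a))
      set q := max 0 (min v (1 / a))
      have e3 : |η * p + φ (T - t) - (η * q + φ (T - t))| = η * |p - q| := by
        rw [show η * p + φ (T - t) - (η * q + φ (T - t)) = η * (p - q) by ring, abs_mul,
          abs_of_nonneg hη]
      have e4 : 1 - a * p - Real.exp (-(η * p + φ (T - t))) -
          (1 - a * q - Real.exp (-(η * q + φ (T - t)))) = -(a * (p - q)) -
          (Real.exp (-(η * p + φ (T - t))) - Real.exp (-(η * q + φ (T - t)))) := by ring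
      rw [e4]
      calc _ ≤ |-(a * (p - q))| + |Real.exp (-(η * p + φ (T - t))) -
            Real.exp (-(η * q + φ (T - t)))| := abs_sub _ _
        _ ≤ a * |p - q| + η * |p - q| := by
            rw [abs_neg, abs_mul, abs_of_pos ha]; linarith [e3 ▸ e1]
        _ ≤ (a + η) * |u - v| := by rw [← add_mul]; gcongr
    · unfold clampedField; fun_prop
    · simpa [Real.norm_eq_abs] using hbound t u
    · simp only [sub_zero, NNReal.coe_zero]
      rw [Real.coe_toNNReal _ (by positivity), max_eq_left hT]; simp
  obtain ⟨B, hB0, hB⟩ := hPL.exists_eq_forall_mem_Icc_hasDerivWithinAt₀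
  have hBc : ContinuousOn B (Set.Icc 0 T) := fun t ht => (hB t ht).continuousWithinAt
  have hBr : ∀ t ∈ Set.Ico 0 T,
      HasDerivWithinAt B (clampedField a η φ T t (B t)) (Set.Ici t) t := fun t ht =>
    (hB t ⟨ht.1, ht.2.le⟩).mono_of_mem_nhdsWithin
      (mem_of_superset (Icc_mem_nhdsGE ht.2) (Set.Icc_subset_Icc_left ht.1))
  -- `1 / a` is a strict upper barrier
  have hup : ∀ t ∈ Set.Icc 0 T, B t ≤ 1 / a := by
    intro t ht
    refine image_le_of_deriv_right_lt_deriv_boundary hBc hBr (B := fun _ => 1 / a)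
      (B' := fun _ => 0) (by rw [hB0]; exact hia.le) (fun s => hasDerivAt_const _ _) ?_ ht
    intro s _ hs
    have e : max 0 (min (B s) (1 / a)) = 1 / a := by rw [hs, min_self, max_eq_right hia.le]
    have h2 := Real.exp_pos (-(η * (1 / a) + φ (T - s)))
    have h3 : a * (1 / a) = 1 := by field_simp
    simp only [clampedField, e]
    linarith
  -- `-ε (1 + t)` is a strict lower barrier, for every `ε > 0`
  have hlo : ∀ t ∈ Set.Icc 0 T, 0 ≤ B t := by
    intro t ht
    refine le_of_forall_pos_le_add fun ε hε => ?_
    have hε' : 0 < ε / (1 + T) := by positivity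
    have := image_le_of_deriv_right_lt_deriv_boundary (f := fun s => -B s)
      (f' := fun s => -clampedField a η φ T s (B s)) hBc.neg
      (fun s hs => (hBr s hs).neg) (B := fun s => ε / (1 + T) * (1 + s))
      (B' := fun _ => ε / (1 + T)) (by simp only [hB0]; simp; positivity)
      (fun s => by
        simpa using ((hasDerivAt_id s).const_add 1).const_mul (ε / (1 + T))) ?_ ht
    · have h3 : ε / (1 + T) * (1 + t) ≤ ε := by
        rw [div_mul_eq_mul_div, div_le_iff₀ (by linarith)]
        nlinarith [ht.2]
      linarith
    · intro s hs heq
      have hneg : B s ≤ 0 := by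
        have : 0 ≤ ε / (1 + T) * (1 + s) := by have := hs.1; positivity
        linarith
      have e : max 0 (min (B s) (1 / a)) = 0 :=
        max_eq_left ((min_le_left _ _).trans hneg)
      have h1 : Real.exp (-(η * 0 + φ (T - s))) ≤ 1 :=
        Real.exp_le_one_iff.2 (by have := hφ0 (T - s); linarith)
      simp only [clampedField, e]
      linarith
  have hle : ∀ t ∈ Set.Icc 0 T, B t ≤ t := by
    intro t ht
    refine image_le_of_deriv_right_le_deriv_boundary hBc hBr (B := fun t => t)
      (B' := fun _ => 1) (by rw [hB0]) continuousOn_id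
      (fun s _ => (hasDerivAt_id s).hasDerivWithinAt) ?_ ht
    intro s _
    have h2 := Real.exp_pos (-(η * max 0 (min (B s) (1 / a)) + φ (T - s)))
    have h4 : 0 ≤ a * max 0 (min (B s) (1 / a)) := mul_nonneg ha.le (hcl _).1
    simp only [clampedField]
    linarith
  have hr : ∀ t ∈ Set.Icc 0 T, T - t ∈ Set.Icc 0 T := fun t ht =>
    ⟨by linarith [ht.2], by linarith [ht.1]⟩
  -- the reversed solution is extended by constants to a continuous function on the line
  have hc : ∀ t, T - max 0 (min t T) ∈ Set.Icc 0 T := fun t =>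
    hr _ ⟨le_max_left _ _, max_le hT (min_le_right _ _)⟩
  have hceq : ∀ t ∈ Set.Icc 0 T, B (T - max 0 (min t T)) = B (T - t) := fun t ht => by
    rw [min_eq_left ht.2, max_eq_right ht.1]
  refine ⟨fun t => B (T - max 0 (min t T)), hBc.comp_continuous (by fun_prop) hc, fun t ht => ?_,
    by simp [hB0, hT], fun t _ => hlo _ (hc t), fun t _ => hup _ (hc t),
    fun t ht => (hceq t ht).trans_le (hle _ (hr t ht))⟩
  have h2 : HasDerivWithinAt (fun t => T - t) (-1) (Set.Icc 0 T) t :=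
    ((hasDerivAt_id t).const_sub T).hasDerivWithinAt
  have h3 := (hB _ (hr t ht)).comp t h2 hr
  have e : max 0 (min (B (T - t)) (1 / a)) = B (T - t) := by
    rw [min_eq_left (hup _ (hr t ht)), max_eq_right (hlo _ (hr t ht))]
  refine HasDerivWithinAt.congr_deriv (HasDerivWithinAt.congr (f := fun t => B (T - t)) h3
    hceq (hceq t ht)) ?_
  simp only [clampedField, e, hceq t ht]
  rw [show T - (T - t) = t by ring]; ring

end HawkesDividend

namespace HawkesDividend

/-! ### Step functions on a grid -/

/-- The ramp `min (1, m u⁺)`, which increases to the indicator of `(0, ∞)`. -/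
noncomputable def ramp (m : ℕ) (u : ℝ) : ℝ := min 1 (m * max u 0)

theorem continuous_ramp (m : ℕ) : Continuous (ramp m) := by unfold ramp; fun_prop

theorem ramp_mono (m : ℕ) : Monotone (ramp m) := by
  intro u v huv
  unfold ramp
  gcongr

theorem ramp_nonneg (m : ℕ) (u : ℝ) : 0 ≤ ramp m u := le_min zero_le_one (by positivity)

theorem ramp_le_one (m : ℕ) (u : ℝ) : ramp m u ≤ 1 := min_le_left _ _

theorem tendsto_ramp (u : ℝ) :
    Tendsto (fun m => ramp m u) atTop (𝓝 (if 0 < u then 1 else 0)) := by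
  split_ifs with hu
  · refine tendsto_const_nhds.congr' ?_
    filter_upwards [eventually_ge_atTop ⌈1 / u⌉₊] with m hm
    have h1 : 1 / u ≤ m := (Nat.le_ceil _).trans (by exact_mod_cast hm)
    rw [div_le_iff₀ hu] at h1
    rw [ramp, max_eq_left hu.le, min_eq_left h1]
  · refine tendsto_const_nhds.congr fun m => ?_
    rw [ramp, max_eq_right (not_lt.1 hu)]; simp

/-- A continuous approximation of the function with value `w j` on `(j/M, (j+1)/M]`, `j < n`. -/
noncomputable def gridApprox (w : ℕ → ℝ) (M n m : ℕ) (t : ℝ) : ℝ :=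
  ∑ j ∈ Finset.range n, w j * (ramp m (t - j / M) - ramp m (t - (j + 1) / M))

/-- The function with value `w j` on `(j/M, (j+1)/M]`, `j < n`. -/
noncomputable def gridStep (w : ℕ → ℝ) (M n : ℕ) (t : ℝ) : ℝ :=
  ∑ j ∈ Finset.range n, w j *
    ((if 0 < t - j / M then 1 else 0) - (if 0 < t - (j + 1) / M then 1 else 0))

theorem continuous_gridApprox (w : ℕ → ℝ) (M n m : ℕ) : Continuous (gridApprox w M n m) := by
  unfold gridApprox
  refine continuous_finsetSum _ fun j _ => continuous_const.mul ?_
  exact ((continuous_ramp m).comp (by fun_prop)).sub ((continuous_ramp m).comp (by fun_prop))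

theorem gridApprox_nonneg {w : ℕ → ℝ} (hw : ∀ j, 0 ≤ w j) (M n m : ℕ) (t : ℝ) :
    0 ≤ gridApprox w M n m t := by
  refine Finset.sum_nonneg fun j _ => mul_nonneg (hw j) (sub_nonneg.2 (ramp_mono m ?_))
  gcongr
  linarith

theorem gridApprox_le {w : ℕ → ℝ} (hw : ∀ j, 0 ≤ w j) (M n m : ℕ) (t : ℝ) :
    gridApprox w M n m t ≤ ∑ j ∈ Finset.range n, w j := by
  refine Finset.sum_le_sum fun j _ => ?_
  have h1 := ramp_nonneg m (t - (j + 1) / M)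
  have h2 := ramp_le_one m (t - j / M)
  nlinarith [hw j]

theorem tendsto_gridApprox (w : ℕ → ℝ) (M n : ℕ) (t : ℝ) :
    Tendsto (fun m => gridApprox w M n m t) atTop (𝓝 (gridStep w M n t)) :=
  tendsto_finsetSum _ fun _ _ => ((tendsto_ramp _).sub (tendsto_ramp _)).const_mul _

/-! ### The excess claims of a higher initial intensity -/

/-! The claims caused by an initial intensity excess `y₀` form a Hawkes process with base level
`0`. It is built from independent exponential variables: when the intensity after the last claim
is `g`, the next claim comes when the integrated intensity `g (1 - exp (-a s)) / a` reaches the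
next exponential variable, and never if that variable is at least `g / a`. -/

/-- The standard exponential distribution of the waiting times. -/
noncomputable def expLaw : Measure ℝ := expMeasure 1

instance : IsProbabilityMeasure expLaw := isProbabilityMeasure_expMeasure one_pos

theorem integral_expLaw (f : ℝ → ℝ) : ∫ x, f x ∂expLaw = ∫ x in Set.Ioi 0, Real.exp (-x) * f x := by
  have h1 : expLaw = volume.withDensity (exponentialPDF 1) := rfl
  have h2 : exponentialPDF 1 = fun x => ((exponentialPDFReal 1 x).toNNReal : ℝ≥0∞) := rfl
  rw [h1, h2, integral_withDensity_eq_integral_smul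
    (measurable_exponentialPDFReal 1).real_toNNReal, ← integral_Ici_eq_integral_Ioi,
    ← integral_indicator measurableSet_Ici]
  congr 1
  ext x
  rw [NNReal.smul_def, Real.coe_toNNReal _ (exponentialPDFReal_nonneg one_pos x)]
  by_cases hx : 0 ≤ x
  · rw [Set.indicator_of_mem (show x ∈ Set.Ici 0 from hx)]
    simp [exponentialPDFReal, gammaPDFReal, hx]
  · rw [Set.indicator_of_notMem (show x ∉ Set.Ici 0 from hx)]
    simp [exponentialPDFReal, gammaPDFReal, hx]

theorem ae_pos_expLaw : ∀ᵐ x ∂expLaw, 0 < x := by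
  have h1 : expLaw = volume.withDensity (exponentialPDF 1) := rfl
  rw [ae_iff, h1]
  have h2 : {x : ℝ | ¬0 < x} = Set.Iic 0 := by ext; simp
  rw [h2, withDensity_apply _ measurableSet_Iic, ← setLIntegral_congr Iio_ae_eq_Iic]
  exact (setLIntegral_congr_fun measurableSet_Iio fun x hx => exponentialPDF_of_neg hx).trans
    lintegral_zero

/-- The law of the sequence of exponential waiting times. -/
noncomputable def expSeq : Measure (ℕ → ℝ) := Measure.infinitePi fun _ => expLaw

instance : IsProbabilityMeasure expSeq := by unfold expSeq; infer_instance

/-- Integrating out the `i`-th waiting time from a functional of it and of the earlier ones. -/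
theorem integral_expSeq_step {B : Type*} [MeasurableSpace B] (i : ℕ) {st : (ℕ → ℝ) → B}
    (hst : Measurable st) (hdep : ∀ e e' : ℕ → ℝ, (∀ j < i, e j = e' j) → st e = st e')
    {F : B × ℝ → ℝ} (hF : Measurable F) (hF1 : ∀ z, |F z| ≤ 1) :
    ∫ e, F (st e, e i) ∂expSeq = ∫ e, (∫ x, F (st e, x) ∂expLaw) ∂expSeq := by
  have hind : iIndepFun (fun (k : ℕ) (e : ℕ → ℝ) => e k) expSeq :=
    iIndepFun_infinitePi (X := fun _ x => x) (by fun_prop)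
  have h1 := hind.indepFun_finset (Finset.range i) {i} (by simp) (by fun_prop)
  let ext : ((k : Finset.range i) → ℝ) → ℕ → ℝ := fun v k =>
    if hk : k ∈ Finset.range i then v ⟨k, hk⟩ else 0
  have hext : Measurable ext := by
    refine measurable_pi_iff.2 fun k => ?_
    by_cases hk : k ∈ Finset.range i
    · simp only [ext, hk, dif_pos]; exact measurable_pi_apply _
    · simp only [ext, hk, dif_neg, not_false_eq_true]; exact measurable_const
  have h2 : IndepFun st (fun e : ℕ → ℝ => e i) expSeq := by
    have := h1.comp (hst.comp hext)
      (measurable_pi_apply (⟨i, Finset.mem_singleton_self i⟩ : ({i} : Finset ℕ)))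
    refine this.congr (Eventually.of_forall fun e => hdep _ _ fun j hj => ?_)
      (Eventually.of_forall fun e => rfl)
    simp [ext, hj]
  have hmap : expSeq.map (fun e : ℕ → ℝ => e i) = expLaw := Measure.infinitePi_map_eval _ i
  have hei : Measurable fun e : ℕ → ℝ => e i := measurable_pi_apply i
  have h3 := (indepFun_iff_map_prod_eq_prod_map_map hst.aemeasurable hei.aemeasurable).1 h2
  rw [hmap] at h3
  have hpm : IsProbabilityMeasure (expSeq.map st) :=
    Measure.isProbabilityMeasure_map hst.aemeasurable
  have hint : Integrable F ((expSeq.map st).prod expLaw) :=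
    Integrable.of_bound hF.aestronglyMeasurable 1 (Eventually.of_forall hF1)
  calc ∫ e, F (st e, e i) ∂expSeq = ∫ z, F z ∂(expSeq.map fun e => (st e, e i)) :=
        (integral_map (hst.prodMk hei).aemeasurable hF.aestronglyMeasurable).symm
    _ = ∫ b, ∫ x, F (b, x) ∂expLaw ∂(expSeq.map st) := by rw [h3, integral_prod _ hint]
    _ = _ := integral_map hst.aemeasurable
        (hF.stronglyMeasurable.integral_prod_right' (ν := expLaw)).aestronglyMeasurable

section Excess

variable (a η y₀ : ℝ)

/-- The time of the next claim, if the intensity after the last claim, at time `q.2`, is `q.1`. -/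
noncomputable def nextTime (q : ℝ × ℝ) (x : ℝ) : ℝ := q.2 - Real.log (1 - a * x / q.1) / a

/-- The pair (intensity, time) after the next claim; the intensity is `0` if there is none. -/
noncomputable def nextState (q : ℝ × ℝ) (x : ℝ) : ℝ × ℝ :=
  if a * x < q.1 then (q.1 - a * x + η, nextTime a q x) else (0, q.2)

/-- The successive pairs (intensity, time) just after the claims. -/
noncomputable def excessState (e : ℕ → ℝ) : ℕ → ℝ × ℝ
  | 0 => (y₀, 0)
  | i + 1 => nextState a η (excessState e i) (e i)

/-- The `(i+1)`-st claim occurs, and not after time `t`. -/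
def OccursBy (e : ℕ → ℝ) (t : ℝ) (i : ℕ) : Prop :=
  a * e i < (excessState a η y₀ e i).1 ∧ (excessState a η y₀ e (i + 1)).2 ≤ t

/-- The number of excess claims up to time `t`. -/
noncomputable def excessCount (t : ℝ≥0) (e : ℕ → ℝ) : ℕ := {i | OccursBy a η y₀ e t i}.ncard

variable {a η y₀}

theorem measurable_nextTime : Measurable fun z : (ℝ × ℝ) × ℝ => nextTime a z.1 z.2 := by
  unfold nextTime; fun_prop

theorem measurable_nextState : Measurable fun z : (ℝ × ℝ) × ℝ => nextState a η z.1 z.2 := by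
  unfold nextState
  refine Measurable.ite (measurableSet_lt (by fun_prop) (by fun_prop)) ?_ (by fun_prop)
  exact Measurable.prodMk (by fun_prop) measurable_nextTime

theorem measurable_excessState (i : ℕ) : Measurable fun e => excessState a η y₀ e i := by
  induction i with
  | zero => exact measurable_const
  | succ i ih => exact measurable_nextState.comp (ih.prodMk (measurable_pi_apply i))

theorem excessState_congr (i : ℕ) (e e' : ℕ → ℝ) (h : ∀ j < i, e j = e' j) :
    excessState a η y₀ e i = excessState a η y₀ e' i := by
  induction i with
  | zero => rfl
  | succ i ih =>
    simp only [excessState]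
    rw [ih fun j hj => h j (hj.trans i.lt_succ_self), h i i.lt_succ_self]

theorem measurableSet_occursBy (t : ℝ) (i : ℕ) : MeasurableSet {e | OccursBy a η y₀ e t i} := by
  refine MeasurableSet.inter ?_ ?_
  · exact measurableSet_lt ((measurable_pi_apply i).const_mul a) (measurable_excessState i).fst
  · exact measurableSet_le (measurable_excessState (i + 1)).snd measurable_const

theorem measurable_excessCount (t : ℝ≥0) : Measurable (excessCount a η y₀ t) := by
  have hF : ∀ F : Finset ℕ, MeasurableSet {e | {i | OccursBy a η y₀ e t i} = (F : Set ℕ)} := by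
    intro F
    have : {e | {i | OccursBy a η y₀ e t i} = (F : Set ℕ)} =
        ⋂ i, {e | OccursBy a η y₀ e t i ↔ i ∈ F} := by
      ext e; simp [Set.ext_iff]
    rw [this]
    refine MeasurableSet.iInter fun i => ?_
    by_cases hi : i ∈ F
    · simpa [hi] using measurableSet_occursBy (a := a) (η := η) (y₀ := y₀) t i
    · simp only [hi, iff_false]
      exact (measurableSet_occursBy (a := a) (η := η) (y₀ := y₀) t i).compl
  have hinf : MeasurableSet {e | {i | OccursBy a η y₀ e t i}.Infinite} := by
    have : {e | {i | OccursBy a η y₀ e t i}.Infinite} =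
        (⋃ F : Finset ℕ, {e | {i | OccursBy a η y₀ e t i} = (F : Set ℕ)})ᶜ := by
      ext e
      simp only [Set.mem_ofPred_eq, Set.mem_compl_iff, Set.mem_iUnion, not_exists]
      constructor
      · intro h F hF; exact h (hF ▸ F.finite_toSet)
      · intro h hfin; exact h hfin.toFinset (by simp)
    rw [this]
    exact (MeasurableSet.iUnion hF).compl
  refine measurable_to_countable' fun k => ?_
  have : excessCount a η y₀ t ⁻¹' {k} =
      (⋃ F : Finset ℕ, {e | {i | OccursBy a η y₀ e t i} = (F : Set ℕ)} ∩ {_e | F.card = k}) ∪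
      ({e | {i | OccursBy a η y₀ e t i}.Infinite} ∩ {_e | k = 0}) := by
    ext e
    simp only [Set.mem_preimage, Set.mem_singleton_iff, excessCount, Set.mem_union, Set.mem_iUnion,
      Set.mem_inter_iff, Set.mem_ofPred_eq]
    constructor
    · intro h
      rcases {i | OccursBy a η y₀ e t i}.finite_or_infinite with hf | hi
      · left
        exact ⟨hf.toFinset, by simp, by rw [← h, Set.ncard_eq_toFinset_card _ hf]⟩
      · right; exact ⟨hi, by rw [← h, hi.ncard]⟩
    · rintro (⟨F, hF, hk⟩ | ⟨hi, hk⟩)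
      · rw [hF, Set.ncard_coe_finset, hk]
      · rw [hi.ncard, hk]
  rw [this]
  exact (MeasurableSet.iUnion fun F => (hF F).inter (MeasurableSet.const _)).union
    (hinf.inter (MeasurableSet.const _))

/-- The exponential functional of the claim times is preserved, on average, by one more claim. -/
theorem integral_exp_nextState (ha : 0 < a) {φ β : ℝ → ℝ} (hφ : Continuous φ) {T : ℝ}
    (hT : 0 ≤ T) (hβ : IsRiccati a η φ β 0 T) {q : ℝ × ℝ} (hq1 : 0 ≤ q.1) (hq2 : 0 ≤ q.2) :
    ∫ x, (if a * x < q.1 then Real.exp (-(Set.Iic T).indicator φ (nextTime a q x)) else 1) *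
        Real.exp (-(β (max 0 (min (nextState a η q x).2 T)) * (nextState a η q x).1)) ∂expLaw =
      Real.exp (-(β (max 0 (min q.2 T)) * q.1)) := by
  obtain ⟨g, S⟩ := q
  simp only at hq1 hq2
  have hmono : ∀ x, 0 < x → a * x < g → S ≤ nextTime a (g, S) x := by
    intro x hx hxg
    have hg : 0 < g := (mul_pos ha hx).trans hxg
    have h1 : 1 - a * x / g ≤ 1 := by have : 0 < a * x / g := by positivity
                                      linarith
    have h2 : 0 < 1 - a * x / g := by rw [sub_pos, div_lt_one hg]; exact hxg
    have h3 := Real.log_nonpos h2.le h1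
    have : Real.log (1 - a * x / g) / a ≤ 0 := div_nonpos_of_nonpos_of_nonneg h3 ha.le
    simp only [nextTime]; linarith
  rw [integral_expLaw]
  have htail : ∀ c : ℝ, ∫ x in Set.Ioi c, Real.exp (-x) = Real.exp (-c) := integral_exp_neg_Ioi
  -- a claim after `T`, or no claim, contributes nothing
  have hlate : ∀ t, T ≤ t → ∀ u, Real.exp (-(β (max 0 (min t T)) * u)) = 1 := by
    intro t ht u
    rw [min_eq_right ht, max_eq_right hT, hβ.terminal]; simp
  have hone : ∀ x, 0 < x → (a * x < g → T < nextTime a (g, S) x) →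
      (if a * x < g then Real.exp (-(Set.Iic T).indicator φ (nextTime a (g, S) x)) else 1) *
        Real.exp (-(β (max 0 (min (nextState a η (g, S) x).2 T)) *
          (nextState a η (g, S) x).1)) = 1 := by
    intro x hx h
    by_cases hxg : a * x < g
    · have h1 := h hxg
      have e : nextState a η (g, S) x = (g - a * x + η, nextTime a (g, S) x) := by
        simp [nextState, hxg]
      rw [if_pos hxg, e, hlate _ h1.le, Set.indicator_of_notMem (by simpa using h1)]
      simp
    · have e : nextState a η (g, S) x = (0, S) := by simp [nextState, hxg]
      rw [if_neg hxg, e]; simp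
  rcases lt_or_ge T S with hTS | hST
  · refine Eq.trans ?_ (hlate _ hTS.le g).symm
    refine (setIntegral_congr_fun measurableSet_Ioi fun x hx => ?_).trans
      ((htail 0).trans (by simp))
    simp only [hone x hx fun h => hTS.trans_le (hmono x hx h), mul_one]
  -- `xs` is the waiting time for which the next claim comes at time `T`
  set xs : ℝ := g * (1 - Real.exp (-(a * (T - S)))) / a with hxs
  have hE1 : Real.exp (-(a * (T - S))) ≤ 1 :=
    Real.exp_le_one_iff.2 (by have := mul_nonneg ha.le (sub_nonneg.2 hST); linarith)
  have hE0 := Real.exp_pos (-(a * (T - S)))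
  have hxs0 : 0 ≤ xs := div_nonneg (mul_nonneg hq1 (by linarith)) ha.le
  have haxs : a * xs = g * (1 - Real.exp (-(a * (T - S)))) := by rw [hxs]; field_simp
  set K : ℝ → ℝ := fun x => Real.exp (-x) *
    ((if a * x < g then Real.exp (-(Set.Iic T).indicator φ (nextTime a (g, S) x)) else 1) *
        Real.exp (-(β (max 0 (min (nextState a η (g, S) x).2 T)) *
          (nextState a η (g, S) x).1))) with hK
  have hKtail : Set.EqOn K (fun x => Real.exp (-x)) (Set.Ioi xs) := by
    intro x hx
    have hx0 : 0 < x := hxs0.trans_lt hx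
    simp only [hK]
    rw [hone x hx0, mul_one]
    intro hxg
    have hg : 0 < g := (mul_pos ha hx0).trans hxg
    have h2 : 0 < 1 - a * x / g := by rw [sub_pos, div_lt_one hg]; exact hxg
    have h3 : 1 - a * x / g < Real.exp (-(a * (T - S))) := by
      have : a * xs < a * x := mul_lt_mul_of_pos_left hx ha
      rw [sub_lt_comm, lt_div_iff₀ hg]; nlinarith
    have h4 := (Real.log_lt_log h2 h3).trans_eq (Real.log_exp _)
    have h5 : Real.log (1 - a * x / g) / a < -(T - S) := by
      rw [div_lt_iff₀ ha]; linarith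
    simp only [nextTime]; linarith
  set Kc : ℝ → ℝ := fun x => Real.exp (-x) * (Real.exp (-φ (nextTime a (g, S) x)) *
    Real.exp (-(β (nextTime a (g, S) x) * (g - a * x + η)))) with hKc
  set ψ : ℝ → ℝ := fun x => Real.exp (-x - β (nextTime a (g, S) x) * (g - a * x)) with hψ
  have hβc : ContinuousOn β (Set.Icc 0 T) := fun t ht => (hβ.deriv t ht).continuousWithinAt
  have hmain : g = 0 ∨ (0 < g ∧ (∀ x ∈ Set.Icc 0 xs, 0 < 1 - a * x / g) ∧
      ∀ x ∈ Set.Icc 0 xs, nextTime a (g, S) x ∈ Set.Icc S T) := by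
    rcases hq1.eq_or_lt with h | hg
    · exact Or.inl h.symm
    refine Or.inr ⟨hg, ?_⟩
    have h1 : ∀ x ∈ Set.Icc 0 xs, Real.exp (-(a * (T - S))) ≤ 1 - a * x / g := by
      intro x hx
      have : a * x ≤ a * xs := mul_le_mul_of_nonneg_left hx.2 ha.le
      rw [le_sub_comm, div_le_iff₀ hg]; nlinarith
    refine ⟨fun x hx => hE0.trans_le (h1 x hx), fun x hx => ⟨?_, ?_⟩⟩
    · have h2 : 1 - a * x / g ≤ 1 := by
        have : 0 ≤ a * x / g := div_nonneg (mul_nonneg ha.le hx.1) hg.le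
        linarith
      have h3 := Real.log_nonpos (hE0.le.trans (h1 x hx)) h2
      have : Real.log (1 - a * x / g) / a ≤ 0 := div_nonpos_of_nonpos_of_nonneg h3 ha.le
      simp only [nextTime]; linarith
    · have h4 := (Real.log_exp _).symm.trans_le (Real.log_le_log hE0 (h1 x hx))
      have h5 : -(T - S) ≤ Real.log (1 - a * x / g) / a := by
        rw [le_div_iff₀ ha]; linarith
      simp only [nextTime]; linarith
  have hψ0 : ψ 0 = Real.exp (-(β (max 0 (min S T)) * g)) := by
    simp [hψ, nextTime, min_eq_left hST, max_eq_right hq2]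
  have hψ1 : ψ xs = Real.exp (-xs) := by
    rcases hmain with h0 | ⟨hg, hpos, hmem⟩
    · have : xs = 0 := by rw [hxs, h0]; simp
      simp [hψ, this, h0]
    · have e1 : 1 - a * xs / g = Real.exp (-(a * (T - S))) := by
        rw [haxs]; field_simp; ring
      have e2 : nextTime a (g, S) xs = T := by
        simp only [nextTime, e1, Real.log_exp]; field_simp; ring
      simp [hψ, e2, hβ.terminal]
  -- the integrand is the derivative of `-ψ`, which is the Riccati equation
  have hint : IntervalIntegrable Kc volume 0 xs ∧ ∫ x in (0 : ℝ)..xs, Kc x = ψ 0 - ψ xs := by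
    rcases hmain with h0 | ⟨hg, hpos, hmem⟩
    · have : xs = 0 := by rw [hxs, h0]; simp
      rw [this]; simp
    have hnc : ContinuousOn (fun x => nextTime a (g, S) x) (Set.Icc 0 xs) := by
      unfold nextTime
      refine continuousOn_const.sub (ContinuousOn.div_const (ContinuousOn.log (by fun_prop) ?_) _)
      exact fun x hx => (hpos x hx).ne'
    have hβn : ContinuousOn (fun x => β (nextTime a (g, S) x)) (Set.Icc 0 xs) :=
      hβc.comp hnc fun x hx => ⟨hq2.trans (hmem x hx).1, (hmem x hx).2⟩
    have hKcc : ContinuousOn Kc (Set.Icc 0 xs) := by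
      have := hφ.comp_continuousOn hnc
      simp only [hKc]
      exact (by fun_prop : ContinuousOn (fun x : ℝ => Real.exp (-x)) _).mul
        (this.neg.rexp.mul (hβn.mul (by fun_prop)).neg.rexp)
    have hi : IntervalIntegrable Kc volume 0 xs :=
      ContinuousOn.intervalIntegrable (by rwa [Set.uIcc_of_le hxs0])
    refine ⟨hi, ?_⟩
    have hψc : ContinuousOn ψ (Set.Icc 0 xs) := by
      simp only [hψ]
      exact ((by fun_prop : ContinuousOn (fun x : ℝ => -x) _).sub (hβn.mul (by fun_prop))).rexp
    have := intervalIntegral.integral_eq_sub_of_hasDerivAt_of_le hxs0 hψc (f' := fun x => -Kc x)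
      (fun x hx => ?_) hi.neg
    · rw [intervalIntegral.integral_neg] at this; linarith
    have hx' : x ∈ Set.Icc 0 xs := ⟨hx.1.le, hx.2.le⟩
    have h1 : HasDerivAt (fun x => nextTime a (g, S) x) (1 / (g - a * x)) x := by
      have hne := (hpos x hx').ne'
      have hgx : g - a * x ≠ 0 := by
        intro h; apply hne; rw [sub_eq_zero] at h; rw [← h]; field_simp; simp
      have d1 : HasDerivAt (fun x : ℝ => 1 - a * x / g) (-(a / g)) x := by
        simpa using (((hasDerivAt_id x).const_mul a).div_const g).const_sub 1
      have d2 := ((d1.log hne).div_const a).const_sub S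
      refine d2.congr_deriv ?_
      have : 1 - a * x / g = (g - a * x) / g := by field_simp
      rw [this]; field_simp
    have hgx : g - a * x ≠ 0 := by
      intro h; have := hpos x hx'; rw [sub_eq_zero] at h; rw [← h] at this
      rw [div_self hg.ne'] at this; simp at this
    have h2 : nextTime a (g, S) x ∈ Set.Ioo 0 T := by
      have hx1 : 0 < a * x / g := div_pos (mul_pos ha hx.1) hg
      have hlt : nextTime a (g, S) x < T := by
        have h3 : Real.exp (-(a * (T - S))) < 1 - a * x / g := by
          have : a * x < a * xs := mul_lt_mul_of_pos_left hx.2 ha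
          rw [lt_sub_comm, div_lt_iff₀ hg]; nlinarith
        have h4 := (Real.log_exp _).symm.trans_lt (Real.log_lt_log hE0 h3)
        have h5 : -(T - S) < Real.log (1 - a * x / g) / a := by
          rw [lt_div_iff₀ ha]; linarith
        simp only [nextTime]; linarith
      refine ⟨?_, hlt⟩
      have h3 := Real.log_neg (hpos x hx') (by linarith)
      have : Real.log (1 - a * x / g) / a < 0 := div_neg_of_neg_of_pos h3 ha
      simp only [nextTime]; linarith
    have h3 := (hβ.deriv _ ⟨h2.1.le, h2.2.le⟩).hasDerivAt (Icc_mem_nhds h2.1 h2.2)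
    have h4 : HasDerivAt (fun x => β (nextTime a (g, S) x)) _ x := h3.comp x h1
    have h5 : HasDerivAt (fun x : ℝ => g - a * x) (-a) x := by
      simpa using ((hasDerivAt_id x).const_mul a).const_sub g
    have h6 := ((hasDerivAt_neg x).sub (h4.mul h5)).exp
    refine h6.congr_deriv ?_
    simp only [hKc, Pi.sub_apply, Pi.mul_apply]
    rw [← Real.exp_add, ← Real.exp_add]
    have e7 : -x + (-φ (nextTime a (g, S) x) + -(β (nextTime a (g, S) x) * (g - a * x + η))) =
        (-x - β (nextTime a (g, S) x) * (g - a * x)) +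
          (-(η * β (nextTime a (g, S) x) + φ (nextTime a (g, S) x))) := by ring
    rw [e7, Real.exp_add, mul_assoc _ (1 / (g - a * x)) (g - a * x), one_div_mul_cancel hgx]
    ring
  have hKeq : Set.EqOn K Kc (Set.Ioc 0 xs) := by
    rcases hmain with h0 | ⟨hg, hpos, hmem⟩
    · have : xs = 0 := by rw [hxs, h0]; simp
      rw [this]; simp
    intro x hx
    have hx' : x ∈ Set.Icc 0 xs := ⟨hx.1.le, hx.2⟩
    have hxg : a * x < g := by have := hpos x hx'; rwa [sub_pos, div_lt_one hg] at this
    have hm := hmem x hx'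
    have e : nextState a η (g, S) x = (g - a * x + η, nextTime a (g, S) x) := by
      simp [nextState, hxg]
    simp only [hK, hKc]
    rw [if_pos hxg, e, Set.indicator_of_mem (show _ ∈ Set.Iic T from hm.2), min_eq_left hm.2,
      max_eq_right (hq2.trans hm.1)]
  have hi1 : IntegrableOn K (Set.Ioc 0 xs) :=
    (((intervalIntegrable_iff_integrableOn_Ioc_of_le hxs0).1 hint.1).congr_fun hKeq.symm
      measurableSet_Ioc)
  have hi2 : IntegrableOn K (Set.Ioi xs) :=
    ((integrableOn_exp_neg_Ioi xs)).congr_fun hKtail.symm measurableSet_Ioi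
  show ∫ x in Set.Ioi 0, K x = _
  rw [← Set.Ioc_union_Ioi_eq_Ioi hxs0,
    setIntegral_union (Set.Ioc_disjoint_Ioi le_rfl) measurableSet_Ioi hi1 hi2,
    setIntegral_congr_fun measurableSet_Ioc hKeq, setIntegral_congr_fun measurableSet_Ioi hKtail,
    htail, ← intervalIntegral.integral_of_le hxs0, hint.2, hψ0, hψ1]
  ring

/-- A claim is rather late: the discounted time of the next claim decreases on average, by a
factor that keeps the process from exploding. -/
theorem integral_exp_neg_nextTime_le (ha : 0 < a) {q : ℝ × ℝ} (hq1 : 0 ≤ q.1) :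
    ∫ x, (if a * x < q.1 then Real.exp (-nextTime a q x) else 0) ∂expLaw ≤
      (1 - 1 / (1 + q.1)) * Real.exp (-q.2) := by
  obtain ⟨g, S⟩ := q
  simp only at hq1 ⊢
  rcases hq1.eq_or_lt with h0 | hg
  · rw [integral_expLaw, setIntegral_congr_fun (g := fun _ => 0) measurableSet_Ioi]
    · simp [← h0]
    · intro x hx
      have : ¬ a * x < g := by have := mul_pos ha hx; linarith
      simp [this]
  have hk : 0 < 1 + 1 / g := by positivity
  rw [integral_expLaw]
  calc _ ≤ ∫ x in Set.Ioi 0, Real.exp (-S) * Real.exp (-(1 + 1 / g) * x) := by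
        refine integral_mono_of_nonneg (ae_of_all _ fun x => ?_) ?_
          ((ae_restrict_iff' measurableSet_Ioi).2 (ae_of_all _ fun x hx => ?_))
        · simp only [Pi.zero_apply]; split_ifs <;> positivity
        · exact (integrableOn_exp_mul_Ioi (by linarith) 0).const_mul _
        · simp only
          split_ifs with hxg
          · rw [← Real.exp_add, ← Real.exp_add]
            refine Real.exp_le_exp.2 ?_
            have h2 : 0 < 1 - a * x / g := by rw [sub_pos, div_lt_one hg]; exact hxg
            have h3 := Real.log_le_sub_one_of_pos h2
            have h4 : Real.log (1 - a * x / g) / a ≤ -(x / g) := by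
              rw [div_le_iff₀ ha]
              calc _ ≤ _ := h3
                _ = _ := by ring
            have h5 : (1 + 1 / g) * x = x + x / g := by ring
            simp only [nextTime, neg_mul, h5]
            linarith
          · rw [mul_zero]; positivity
    _ = _ := by
        rw [integral_const_mul, integral_exp_mul_Ioi (by linarith)]
        field_simp
        simp
        ring

theorem excessState_nonneg (ha : 0 < a) (hη : 0 ≤ η) (hy₀ : 0 ≤ y₀) {e : ℕ → ℝ}
    (he : ∀ i, 0 < e i) (i : ℕ) :
    0 ≤ (excessState a η y₀ e i).1 ∧ (excessState a η y₀ e i).1 ≤ y₀ + i * η ∧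
      0 ≤ (excessState a η y₀ e i).2 := by
  induction i with
  | zero => simp [excessState, hy₀]
  | succ i ih =>
    obtain ⟨h1, h2, h3⟩ := ih
    have hx := mul_pos ha (he i)
    simp only [excessState, nextState]
    split_ifs with h
    · have hg : 0 < (excessState a η y₀ e i).1 := hx.trans h
      have h4 : 1 - a * e i / (excessState a η y₀ e i).1 ≤ 1 := by
        have : 0 < a * e i / (excessState a η y₀ e i).1 := by positivity
        linarith
      have h5 : 0 < 1 - a * e i / (excessState a η y₀ e i).1 := by
        rw [sub_pos, div_lt_one hg]; exact h
      have h6 := div_nonpos_of_nonpos_of_nonneg (Real.log_nonpos h5.le h4) ha.le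
      refine ⟨by linarith, by push_cast; linarith, ?_⟩
      simp only [nextTime]; linarith
    · refine ⟨le_rfl, by positivity, h3⟩

theorem excessState_time_mono (ha : 0 < a) {e : ℕ → ℝ}
    (he : ∀ i, 0 < e i) : Monotone fun i => (excessState a η y₀ e i).2 := by
  refine monotone_nat_of_le_succ fun i => ?_
  have hx := mul_pos ha (he i)
  simp only [excessState, nextState]
  split_ifs with h
  · have hg : 0 < (excessState a η y₀ e i).1 := hx.trans h
    have h4 : 1 - a * e i / (excessState a η y₀ e i).1 ≤ 1 := by
      have : 0 < a * e i / (excessState a η y₀ e i).1 := by positivity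
      linarith
    have h5 : 0 < 1 - a * e i / (excessState a η y₀ e i).1 := by
      rw [sub_pos, div_lt_one hg]; exact h
    have h6 := div_nonpos_of_nonpos_of_nonneg (Real.log_nonpos h5.le h4) ha.le
    simp only [nextTime]; linarith
  · exact le_rfl

/-- The first claim, if any, comes at a positive time. -/
theorem excessState_time_pos (ha : 0 < a) (hη : 0 ≤ η) (hy₀ : 0 ≤ y₀) {e : ℕ → ℝ}
    (he : ∀ i, 0 < e i) {i : ℕ} (h : a * e i < (excessState a η y₀ e i).1) :
    0 < (excessState a η y₀ e (i + 1)).2 := by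
  have hx := mul_pos ha (he i)
  simp only [excessState, nextState, if_pos h]
  have hg : 0 < (excessState a η y₀ e i).1 := hx.trans h
  have h4 : 1 - a * e i / (excessState a η y₀ e i).1 < 1 := by
    have : 0 < a * e i / (excessState a η y₀ e i).1 := by positivity
    linarith
  have h5 : 0 < 1 - a * e i / (excessState a η y₀ e i).1 := by
    rw [sub_pos, div_lt_one hg]; exact h
  have h6 := div_neg_of_neg_of_pos (Real.log_neg h5 h4) ha
  have := (excessState_nonneg ha hη hy₀ he i).2.2
  simp only [nextTime]; linarith

/-- After the first claim that fails to come, the intensity is set to `0`, and no further claim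
comes. -/
theorem excessState_dead (ha : 0 < a) {e : ℕ → ℝ} (he : ∀ i, 0 < e i) {i : ℕ}
    (h : ¬ a * e i < (excessState a η y₀ e i).1) {j : ℕ} (hij : i < j) :
    (excessState a η y₀ e j).1 = 0 := by
  induction j, hij using Nat.le_induction with
  | base => simp [excessState, nextState, h]
  | succ j _ ih =>
    have : ¬ a * e j < (excessState a η y₀ e j).1 := by
      rw [ih]; have := mul_pos ha (he j); linarith
    simp [excessState, nextState, this]

theorem ae_pos_expSeq : ∀ᵐ e ∂expSeq, ∀ i, 0 < e i := by
  refine ae_all_iff.2 fun i => ?_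
  have h : expSeq.map (fun e : ℕ → ℝ => e i) = expLaw := Measure.infinitePi_map_eval _ i
  refine ae_of_ae_map (measurable_pi_apply i).aemeasurable (p := fun x => 0 < x) ?_
  rw [h]; exact ae_pos_expLaw

/-- The excess claims do not accumulate. -/
theorem ae_excess_nonexplosive (ha : 0 < a) (hη : 0 < η) (hy₀ : 0 < y₀) :
    ∀ᵐ e ∂expSeq, (∃ i, ¬ a * e i < (excessState a η y₀ e i).1) ∨
      Tendsto (fun i => (excessState a η y₀ e i).2) atTop atTop := by
  -- `D i` is `exp (-S i)` as long as claims still can come, and `0` afterwards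
  set D : ℕ → (ℕ → ℝ) → ℝ := fun i e =>
    if 0 < (excessState a η y₀ e i).1 then Real.exp (-(excessState a η y₀ e i).2) else 0 with hD
  have hDm : ∀ i, Measurable (D i) := fun i =>
    Measurable.ite (measurableSet_lt measurable_const (measurable_excessState i).fst)
      (measurable_excessState i).snd.neg.exp measurable_const
  have hD0 : ∀ i e, 0 ≤ D i e := fun i e => by simp only [hD]; split_ifs <;> positivity
  have hDstep : ∀ i e, 0 < e i → D (i + 1) e =
      if a * e i < (excessState a η y₀ e i).1 then
        Real.exp (-nextTime a (excessState a η y₀ e i) (e i)) else 0 := by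
    intro i e hei
    simp only [hD, excessState, nextState]
    split_ifs with h1 h2 h2
    · rfl
    · simp only [not_lt] at h2; linarith
    · simp at h2
    · rfl
  have hD1 : ∀ᵐ e ∂expSeq, ∀ i, D i e ≤ 1 := by
    filter_upwards [ae_pos_expSeq] with e he i
    simp only [hD]
    split_ifs
    · exact Real.exp_le_one_iff.2 (by linarith [(excessState_nonneg ha hη.le hy₀.le he i).2.2])
    · exact zero_le_one
  have hDi : ∀ i, Integrable (D i) expSeq := fun i => by
    refine Integrable.of_bound (hDm i).aestronglyMeasurable 1 ?_
    filter_upwards [hD1] with e he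
    rw [Real.norm_of_nonneg (hD0 i e)]; exact he i
  set r : ℕ → ℝ := fun i => 1 / (1 + (y₀ + i * η)) with hr
  have hr0 : ∀ i : ℕ, 0 < 1 + (y₀ + i * η) := fun i => by positivity
  have hstep : ∀ i, ∫ e, D (i + 1) e ∂expSeq ≤ (1 - r i) * ∫ e, D i e ∂expSeq := by
    intro i
    set F : (ℝ × ℝ) × ℝ → ℝ := fun z =>
      if 0 < z.2 ∧ 0 ≤ z.1.2 ∧ a * z.2 < z.1.1 then Real.exp (-nextTime a z.1 z.2) else 0 with hF
    have hFm : Measurable F := by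
      refine Measurable.ite ?_ (measurable_nextTime.neg.exp) measurable_const
      exact (measurableSet_lt measurable_const measurable_snd).inter
        ((measurableSet_le measurable_const measurable_fst.snd).inter
          (measurableSet_lt (measurable_snd.const_mul a) measurable_fst.fst))
    have hF1 : ∀ z, |F z| ≤ 1 := by
      rintro ⟨⟨g, S⟩, x⟩
      simp only [hF]
      split_ifs with h
      · obtain ⟨hx, hS, hxg⟩ := h
        rw [abs_of_pos (Real.exp_pos _)]
        refine Real.exp_le_one_iff.2 ?_
        have hx' := mul_pos ha hx
        have hg : 0 < g := hx'.trans hxg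
        have h4 : 1 - a * x / g ≤ 1 := by
          have : 0 < a * x / g := by positivity
          linarith
        have h5 : 0 < 1 - a * x / g := by rw [sub_pos, div_lt_one hg]; exact hxg
        have h6 := div_nonpos_of_nonpos_of_nonneg (Real.log_nonpos h5.le h4) ha.le
        simp only [nextTime]; linarith
      · simp
    have e1 : ∫ e, D (i + 1) e ∂expSeq = ∫ e, F (excessState a η y₀ e i, e i) ∂expSeq := by
      refine integral_congr_ae ?_
      filter_upwards [ae_pos_expSeq] with e he
      rw [hDstep i e (he i)]
      simp only [hF, he i, (excessState_nonneg ha hη.le hy₀.le he i).2.2, true_and]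
    rw [e1, integral_expSeq_step i (measurable_excessState i) (excessState_congr i) hFm hF1,
      ← integral_const_mul]
    have hFint : Integrable (fun e => ∫ x, F (excessState a η y₀ e i, x) ∂expLaw) expSeq := by
      refine Integrable.of_bound ?_ 1 (ae_of_all _ fun e => ?_)
      · exact ((hFm.stronglyMeasurable.integral_prod_right' (ν := expLaw)).comp_measurable
          (measurable_excessState i)).aestronglyMeasurable
      · refine (norm_integral_le_of_norm_le_const (ae_of_all _ fun x => hF1 _)).trans ?_
        simp
    refine integral_mono_ae hFint ((hDi i).const_mul _) ?_
    filter_upwards [ae_pos_expSeq] with e he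
    obtain ⟨hg0, hg1, hS⟩ := excessState_nonneg ha hη.le hy₀.le he i
    have e2 : ∫ x, F (excessState a η y₀ e i, x) ∂expLaw =
        ∫ x, (if a * x < (excessState a η y₀ e i).1 then
          Real.exp (-nextTime a (excessState a η y₀ e i) x) else 0) ∂expLaw := by
      refine integral_congr_ae ?_
      filter_upwards [ae_pos_expLaw] with x hx
      simp only [hF, hx, hS, true_and]
    rw [e2]
    refine (integral_exp_neg_nextTime_le ha hg0).trans ?_
    simp only [hD]
    split_ifs with h
    · refine mul_le_mul_of_nonneg_right ?_ (Real.exp_pos _).le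
      simp only [hr]
      gcongr
    · have : (excessState a η y₀ e i).1 = 0 := le_antisymm (not_lt.1 h) hg0
      rw [this]; simp
  have hr1 : ∀ i, 0 ≤ 1 - r i := fun i => by
    simp only [hr, sub_nonneg]
    rw [div_le_one (hr0 i)]
    have : 0 ≤ y₀ + i * η := by positivity
    linarith
  have hprod : ∀ n, ∫ e, D n e ∂expSeq ≤ Real.exp (-∑ i ∈ Finset.range n, r i) := by
    intro n
    induction n with
    | zero => simp [hD, excessState, hy₀]
    | succ n ih =>
      rw [Finset.sum_range_succ, neg_add, Real.exp_add, mul_comm]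
      refine (hstep n).trans (mul_le_mul ?_ ih (integral_nonneg (hD0 n)) (Real.exp_pos _).le)
      have := Real.add_one_le_exp (-r n); linarith
  have hsum : Tendsto (fun n => ∑ i ∈ Finset.range n, r i) atTop atTop := by
    set c := 1 + y₀ + η with hc
    have hc0 : 0 < c := by positivity
    refine tendsto_atTop_mono (f := fun n => ∑ i ∈ Finset.range n, (1 / c) * (1 / ((i : ℝ) + 1)))
      (fun n => Finset.sum_le_sum fun i _ => ?_) ?_
    · simp only [hr]
      rw [one_div_mul_one_div]
      refine one_div_le_one_div_of_le (hr0 i) ?_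
      have : (0 : ℝ) ≤ i := by positivity
      have h2 : 0 ≤ (i : ℝ) * y₀ := by positivity
      simp only [hc]; nlinarith
    · simp_rw [← Finset.mul_sum]
      exact Real.tendsto_sum_range_one_div_nat_succ_atTop.const_mul_atTop (by positivity)
  have hlim : Tendsto (fun n => Real.exp (-∑ i ∈ Finset.range n, r i)) atTop (𝓝 0) :=
    Real.tendsto_exp_neg_atTop_nhds_zero.comp hsum
  have hbdd : ∀ e, BddBelow (Set.range fun i => D i e) := fun e =>
    ⟨0, by rintro _ ⟨i, rfl⟩; exact hD0 i e⟩
  have hinf : ∀ᵐ e ∂expSeq, ⨅ i, D i e = 0 := by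
    have hinfm : Measurable fun e => ⨅ i, D i e := Measurable.iInf hDm
    have hi : Integrable (fun e => ⨅ i, D i e) expSeq := by
      refine Integrable.of_bound hinfm.aestronglyMeasurable 1 ?_
      filter_upwards [hD1] with e he
      rw [Real.norm_of_nonneg (le_ciInf fun i => hD0 i e)]
      exact (ciInf_le (hbdd e) 0).trans (he 0)
    refine (integral_eq_zero_iff_of_nonneg (fun e => le_ciInf fun i => hD0 i e) hi).1 ?_
    refine le_antisymm (ge_of_tendsto' hlim fun n => ?_)
      (integral_nonneg fun e => le_ciInf fun i => hD0 i e)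
    exact (integral_mono hi (hDi n) fun e => ciInf_le (hbdd e) n).trans (hprod n)
  filter_upwards [hinf, ae_pos_expSeq] with e he hpos
  refine or_iff_not_imp_left.2 fun hal => ?_
  push Not at hal
  refine tendsto_atTop_atTop_of_monotone (excessState_time_mono ha hpos) fun C => ?_
  obtain ⟨i, hi⟩ := exists_lt_of_ciInf_lt (f := fun i => D i e) (a := Real.exp (-C))
    (by rw [he]; exact Real.exp_pos _)
  refine ⟨i, ?_⟩
  have h1 : 0 < (excessState a η y₀ e i).1 := (mul_pos ha (hpos i)).trans (hal i)
  simp only [hD, if_pos h1] at hi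
  have := Real.exp_lt_exp.1 hi
  linarith

end Excess
end HawkesDividend

namespace HawkesDividend
section Excess
variable {a η y₀ : ℝ}

/-- The event that the excess claims come at positive times which do not accumulate. -/
def ExcessRegular (a η y₀ : ℝ) (e : ℕ → ℝ) : Prop :=
  (∀ i, 0 < e i) ∧ ∀ t, {i | OccursBy a η y₀ e t i}.Finite

theorem ae_excessRegular (ha : 0 < a) (hη : 0 < η) (hy₀ : 0 < y₀) :
    ∀ᵐ e ∂expSeq, ExcessRegular a η y₀ e := by
  filter_upwards [ae_pos_expSeq, ae_excess_nonexplosive ha hη hy₀] with e he h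
  refine ⟨he, fun t => ?_⟩
  rcases h with ⟨i, hi⟩ | h
  · refine (Set.finite_Iic i).subset fun j hj => ?_
    by_contra hij
    have h1 := excessState_dead ha he hi (not_le.1 hij)
    have h2 := hj.1
    rw [h1] at h2
    exact absurd (mul_pos ha (he j)) (not_lt.2 h2.le)
  · obtain ⟨i, hi⟩ := (h.eventually_gt_atTop t).exists_forall_of_atTop
    refine (Set.finite_Iio i).subset fun j hj => ?_
    by_contra hij
    exact absurd (hi (j + 1) ((not_lt.1 hij).trans j.le_succ)) (not_lt.2 hj.2)

theorem ExcessRegular.count_zero (ha : 0 < a) (hη : 0 < η) (hy₀ : 0 < y₀) {e : ℕ → ℝ}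
    (he : ExcessRegular a η y₀ e) : excessCount a η y₀ 0 e = 0 := by
  have : {i | OccursBy a η y₀ e ((0 : ℝ≥0) : ℝ) i} = ∅ := by
    ext i
    simp only [Set.mem_ofPred_eq, Set.mem_empty_iff_false, iff_false]
    intro h
    exact absurd (excessState_time_pos ha hη.le hy₀.le he.1 h.1) (not_lt.2 (by simpa using h.2))
  rw [excessCount, this, Set.ncard_empty]

theorem occursBy_mono {e : ℕ → ℝ} {s t : ℝ} (hst : s ≤ t) :
    {i | OccursBy a η y₀ e s i} ⊆ {i | OccursBy a η y₀ e t i} := fun _ h => ⟨h.1, h.2.trans hst⟩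

theorem ExcessRegular.count_mono {e : ℕ → ℝ} (he : ExcessRegular a η y₀ e) :
    Monotone fun t => excessCount a η y₀ t e := fun _ _ hst =>
  Set.ncard_le_ncard (occursBy_mono (NNReal.coe_le_coe.2 hst)) (he.2 _)

open Classical in
/-- The contribution of the `(i+1)`-st claim to the functional `∑ φ (claim times up to T)`. -/
noncomputable def claimWeight (a η y₀ : ℝ) (φ : ℝ → ℝ) (T : ℝ) (e : ℕ → ℝ) (i : ℕ) : ℝ :=
  if OccursBy a η y₀ e T i then φ (excessState a η y₀ e (i + 1)).2 else 0

theorem measurable_claimWeight {φ : ℝ → ℝ} (hφ : Continuous φ) (T : ℝ) (i : ℕ) :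
    Measurable fun e => claimWeight a η y₀ φ T e i := by
  classical
  exact Measurable.ite (measurableSet_occursBy T i)
    (hφ.measurable.comp (measurable_excessState (i + 1)).snd) measurable_const

theorem claimWeight_congr (φ : ℝ → ℝ) (T : ℝ) (i : ℕ) (e e' : ℕ → ℝ)
    (h : ∀ j ≤ i, e j = e' j) :
    claimWeight a η y₀ φ T e i = claimWeight a η y₀ φ T e' i := by
  have h1 := excessState_congr (a := a) (η := η) (y₀ := y₀) (i + 1) e e' fun j hj =>
    h j (Nat.lt_succ_iff.1 hj)
  have h2 : OccursBy a η y₀ e T i ↔ OccursBy a η y₀ e' T i := by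
    simp only [OccursBy]
    rw [excessState_congr i e e' fun j hj => h j hj.le, h1, h i le_rfl]
  by_cases h3 : OccursBy a η y₀ e T i
  · rw [claimWeight, claimWeight, if_pos h3, if_pos (h2.1 h3), h1]
  · rw [claimWeight, claimWeight, if_neg h3, if_neg fun h => h3 (h2.2 h)]

/-- The Laplace functional of the excess claims is exponential in the initial intensity. -/
theorem integral_exp_excess (ha : 0 < a) (hη : 0 < η) (hy₀ : 0 < y₀) {φ β : ℝ → ℝ}
    (hφ : Continuous φ) (hφ0 : ∀ t, 0 ≤ φ t) {T : ℝ} (hT : 0 ≤ T) (hβ : IsRiccati a η φ β 0 T) :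
    ∫ e, Real.exp (-∑' i, claimWeight a η y₀ φ T e i) ∂expSeq = Real.exp (-(β 0 * y₀)) := by
  have hcl : ∀ t, max 0 (min t T) ∈ Set.Icc 0 T := fun t =>
    ⟨le_max_left _ _, max_le hT (min_le_right _ _)⟩
  have hβc : Continuous fun t => β (max 0 (min t T)) := by
    have h1 : ContinuousOn β (Set.Icc 0 T) := fun t ht => (hβ.deriv t ht).continuousWithinAt
    exact h1.comp_continuous (by fun_prop) hcl
  have hw0 : ∀ e i, 0 ≤ claimWeight a η y₀ φ T e i := fun e i => by
    unfold claimWeight; split_ifs; exacts [hφ0 _, le_rfl]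
  set V : ℕ → (ℕ → ℝ) → ℝ := fun i e => ∑ k ∈ Finset.range i, claimWeight a η y₀ φ T e k with hV
  have hVm : ∀ i, Measurable (V i) := fun i =>
    Finset.measurable_fun_sum _ fun k _ => measurable_claimWeight hφ T k
  have hV0 : ∀ i e, 0 ≤ V i e := fun i e => Finset.sum_nonneg fun k _ => hw0 e k
  set Q : ℕ → (ℕ → ℝ) → ℝ := fun i e => Real.exp (-V i e) *
    Real.exp (-(β (max 0 (min (excessState a η y₀ e i).2 T)) * (excessState a η y₀ e i).1)) with hQ
  have hQm : ∀ i, Measurable (Q i) := fun i => (hVm i).neg.exp.mul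
    ((hβc.measurable.comp (measurable_excessState i).snd).mul
      (measurable_excessState i).fst).neg.exp
  have hQ1 : ∀ᵐ e ∂expSeq, ∀ i, ‖Q i e‖ ≤ 1 := by
    filter_upwards [ae_pos_expSeq] with e he i
    simp only [hQ]
    rw [Real.norm_of_nonneg (by positivity), ← Real.exp_add]
    refine Real.exp_le_one_iff.2 ?_
    have h1 := hV0 i e
    have h2 := mul_nonneg (hβ.nonneg _ (hcl (excessState a η y₀ e i).2))
      (excessState_nonneg ha hη.le hy₀.le he i).1
    linarith
  -- each claim preserves the expectation of `Q`
  have hstep : ∀ i, ∫ e, Q (i + 1) e ∂expSeq = ∫ e, Q i e ∂expSeq := by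
    intro i
    set G : (ℝ × ℝ) × ℝ → ℝ := fun z =>
      (if a * z.2 < z.1.1 then Real.exp (-(Set.Iic T).indicator φ (nextTime a z.1 z.2)) else 1) *
      Real.exp (-(β (max 0 (min (nextState a η z.1 z.2).2 T)) * (nextState a η z.1 z.2).1)) with hG
    have hGm : Measurable G := by
      refine Measurable.mul (Measurable.ite
        (measurableSet_lt (measurable_snd.const_mul a) measurable_fst.fst) ?_ measurable_const)
        ((hβc.measurable.comp measurable_nextState.snd).mul measurable_nextState.fst).neg.exp
      exact ((hφ.measurable.indicator measurableSet_Iic).comp measurable_nextTime).neg.exp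
    set F : ((ℝ × ℝ) × ℝ) × ℝ → ℝ := fun z =>
      max 0 (min 1 (Real.exp (-z.1.2) * G (z.1.1, z.2))) with hF
    have hFm : Measurable F := measurable_const.max (measurable_const.min
      (measurable_fst.snd.neg.exp.mul (hGm.comp (measurable_fst.fst.prodMk measurable_snd))))
    have hF1 : ∀ z, |F z| ≤ 1 := fun z => by
      rw [abs_of_nonneg (le_max_left _ _)]
      exact max_le zero_le_one (min_le_left _ _)
    have hG1 : ∀ q x, 0 ≤ q.1 → 0 < x → 0 < G (q, x) ∧ G (q, x) ≤ 1 := by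
      intro q x hq hx
      refine ⟨by simp only [hG]; split_ifs <;> positivity, ?_⟩
      simp only [hG]
      refine mul_le_one₀ ?_ (Real.exp_pos _).le ?_
      · split_ifs
        · refine Real.exp_le_one_iff.2 (neg_nonpos.2 (Set.indicator_nonneg (fun t _ => hφ0 t) _))
        · exact le_rfl
      · refine Real.exp_le_one_iff.2 (neg_nonpos.2 (mul_nonneg (hβ.nonneg _ (hcl _)) ?_))
        simp only [nextState]
        split_ifs with h
        · simp only; linarith
        · exact le_rfl
    have hFG : ∀ q v x, 0 ≤ q.1 → 0 ≤ v → 0 < x →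
        F ((q, v), x) = Real.exp (-v) * G (q, x) := by
      intro q v x hq hv hx
      obtain ⟨h1, h2⟩ := hG1 q x hq hx
      have h3 : Real.exp (-v) ≤ 1 := Real.exp_le_one_iff.2 (by linarith)
      have h4 := Real.exp_pos (-v)
      simp only [hF]
      rw [min_eq_right (mul_le_one₀ h3 h1.le h2), max_eq_right (by positivity)]
    have hst : Measurable fun e => (excessState a η y₀ e i, V i e) :=
      (measurable_excessState i).prodMk (hVm i)
    have hdep : ∀ e e' : ℕ → ℝ, (∀ j < i, e j = e' j) →
        (excessState a η y₀ e i, V i e) = (excessState a η y₀ e' i, V i e') := by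
      intro e e' h
      refine Prod.ext (excessState_congr i e e' h) ?_
      show V i e = V i e'
      refine Finset.sum_congr rfl fun k hk => ?_
      exact claimWeight_congr φ T k e e' fun j hj => h j (hj.trans_lt (Finset.mem_range.1 hk))
    have e1 : ∫ e, Q (i + 1) e ∂expSeq = ∫ e, F ((excessState a η y₀ e i, V i e), e i) ∂expSeq := by
      refine integral_congr_ae ?_
      filter_upwards [ae_pos_expSeq] with e he
      rw [hFG _ _ _ (excessState_nonneg ha hη.le hy₀.le he i).1 (hV0 i e) (he i)]
      simp only [hQ, hV, hG, Finset.sum_range_succ, neg_add, Real.exp_add, mul_assoc]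
      congr 1
      have e2 : excessState a η y₀ e (i + 1) = nextState a η (excessState a η y₀ e i) (e i) := rfl
      rw [← e2]
      congr 1
      by_cases h : a * e i < (excessState a η y₀ e i).1
      · have e3 : nextTime a (excessState a η y₀ e i) (e i) =
            (excessState a η y₀ e (i + 1)).2 := by rw [e2]; simp [nextState, h]
        rw [if_pos h, e3]
        by_cases h2 : (excessState a η y₀ e (i + 1)).2 ≤ T
        · rw [claimWeight, if_pos ⟨h, h2⟩, Set.indicator_of_mem (show _ ∈ Set.Iic T from h2)]
        · rw [claimWeight, if_neg fun hh => h2 hh.2,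
            Set.indicator_of_notMem (show _ ∉ Set.Iic T from h2)]
      · rw [if_neg h, claimWeight, if_neg fun hh => h hh.1]; simp
    rw [e1, integral_expSeq_step i hst hdep hFm hF1]
    refine integral_congr_ae ?_
    filter_upwards [ae_pos_expSeq] with e he
    obtain ⟨hg0, -, hS⟩ := excessState_nonneg ha hη.le hy₀.le he i
    have e2 : ∫ x, F ((excessState a η y₀ e i, V i e), x) ∂expLaw =
        ∫ x, Real.exp (-V i e) * G (excessState a η y₀ e i, x) ∂expLaw := by
      refine integral_congr_ae ?_
      filter_upwards [ae_pos_expLaw] with x hx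
      exact hFG _ _ _ hg0 (hV0 i e) hx
    rw [e2, integral_const_mul]
    simp only [hG, hQ]
    rw [integral_exp_nextState ha hφ hT hβ hg0 hS]
  have hall : ∀ i, ∫ e, Q i e ∂expSeq = Real.exp (-(β 0 * y₀)) := by
    intro i
    induction i with
    | zero => simp [hQ, hV, excessState, min_eq_left hT]
    | succ i ih => rw [hstep, ih]
  have hlim : Tendsto (fun i => ∫ e, Q i e ∂expSeq) atTop
      (𝓝 (∫ e, Real.exp (-∑' i, claimWeight a η y₀ φ T e i) ∂expSeq)) := by
    refine tendsto_integral_of_dominated_convergence (fun _ => 1)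
      (fun i => (hQm i).aestronglyMeasurable) (integrable_const _)
      (fun i => hQ1.mono fun e he => he i) ?_
    filter_upwards [ae_pos_expSeq, ae_excessRegular ha hη hy₀,
      ae_excess_nonexplosive ha hη hy₀] with e he hreg hne
    have hfin : (Function.support fun i => claimWeight a η y₀ φ T e i).Finite := by
      refine (hreg.2 T).subset fun i hi => ?_
      by_contra h
      exact hi (if_neg (c := OccursBy a η y₀ e T i) h)
    have h1 : Tendsto (fun i => V i e) atTop (𝓝 (∑' i, claimWeight a η y₀ φ T e i)) :=
      (summable_of_hasFiniteSupport hfin).hasSum.tendsto_sum_nat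
    have h2 : ∀ᶠ i in atTop, Real.exp (-(β (max 0 (min (excessState a η y₀ e i).2 T)) *
        (excessState a η y₀ e i).1)) = 1 := by
      rcases hne with ⟨i, hi⟩ | h
      · filter_upwards [eventually_gt_atTop i] with j hj
        rw [excessState_dead ha he hi hj]; simp
      · filter_upwards [h.eventually_ge_atTop T] with j hj
        rw [min_eq_right hj, max_eq_right hT, hβ.terminal]; simp
    refine Tendsto.congr' (h2.mono fun i hi => ?_) (h1.neg.rexp)
    simp only [hQ]; rw [hi, mul_one]
  exact tendsto_nhds_unique hlim (by simp only [hall]; exact tendsto_const_nhds)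

/-- The weighted number of claims in the intervals `(j/M, (j+1)/M]`, `j < n`, of a counting
path. -/
noncomputable def gridSum (w : ℕ → ℝ) (M n : ℕ) (N : ℝ≥0 → ℕ) : ℝ :=
  ∑ j ∈ Finset.range n, w j * ((N ((j + 1) / M) : ℝ) - N (j / M))

/-- Summing a step function over the excess claims gives the corresponding sum of increments of
their number. -/
theorem ExcessRegular.tsum_gridStep {e : ℕ → ℝ} (he : ExcessRegular a η y₀ e) (w : ℕ → ℝ)
    (M n : ℕ) :
    ∑ i ∈ (he.2 (n / M)).toFinset, gridStep w M n (excessState a η y₀ e (i + 1)).2 =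
      gridSum w M n fun t => excessCount a η y₀ t e := by
  set F := (he.2 (n / M)).toFinset with hF
  have hcount : ∀ t : ℝ≥0, (t : ℝ) ≤ n / M →
      ∑ i ∈ F, (if 0 < (excessState a η y₀ e (i + 1)).2 - t then (1 : ℝ) else 0) =
        F.card - excessCount a η y₀ t e := by
    intro t ht
    classical
    have h1 : {i | OccursBy a η y₀ e t i} =
        (F.filter fun i => ¬ 0 < (excessState a η y₀ e (i + 1)).2 - t : Set ℕ) := by
      ext i
      simp only [Set.mem_ofPred_eq, Finset.coe_filter, hF, Set.Finite.mem_toFinset, sub_pos, not_lt]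
      exact ⟨fun h => ⟨occursBy_mono ht h, h.2⟩, fun h => ⟨h.1.1, h.2⟩⟩
    rw [excessCount, h1, Set.ncard_coe_finset, Finset.sum_boole, eq_sub_iff_add_eq]
    exact_mod_cast Finset.card_filter_add_card_filter_not _
  simp only [gridStep, gridSum]
  rw [Finset.sum_comm]
  refine Finset.sum_congr rfl fun j hj => ?_
  have hj' : ((j : ℝ) + 1) ≤ n := by exact_mod_cast Finset.mem_range.1 hj
  have h1 := hcount (j / M) (by
    push_cast; exact div_le_div_of_nonneg_right (by linarith) (by positivity))
  have h2 := hcount ((j + 1) / M) (by push_cast; gcongr)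
  push_cast at h1 h2
  rw [← Finset.mul_sum, Finset.sum_sub_distrib, h1, h2]
  ring

/-- The Laplace transform of the excess claim numbers on a grid: the limit of the exponential
functionals of continuous functions that approximate the step function. It is exponential in `y₀`.
-/
theorem tendsto_excess_gridSum (ha : 0 < a) (hη : 0 < η) (hy₀ : 0 < y₀) {w : ℕ → ℝ}
    (hw : ∀ j, 0 ≤ w j) (M n : ℕ) {β : ℕ → ℝ → ℝ}
    (hβ : ∀ m, IsRiccati a η (gridApprox w M n m) (β m) 0 (n / M)) :
    Tendsto (fun m => Real.exp (-(β m 0 * y₀))) atTop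
      (𝓝 (∫ e, Real.exp (-gridSum w M n fun t => excessCount a η y₀ t e) ∂expSeq)) := by
  have h1 : ∀ m, Real.exp (-(β m 0 * y₀)) = ∫ e,
      Real.exp (-∑' i, claimWeight a η y₀ (gridApprox w M n m) (n / M) e i) ∂expSeq := fun m =>
    (integral_exp_excess ha hη hy₀ (continuous_gridApprox w M n m) (gridApprox_nonneg hw M n m)
      (by positivity) (hβ m)).symm
  simp only [h1]
  have hts : ∀ m, ∀ᵐ e ∂expSeq, ∃ he : ExcessRegular a η y₀ e,
      ∑' i, claimWeight a η y₀ (gridApprox w M n m) (n / M) e i =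
        ∑ i ∈ (he.2 (n / M)).toFinset,
          gridApprox w M n m (excessState a η y₀ e (i + 1)).2 := by
    intro m
    filter_upwards [ae_excessRegular ha hη hy₀] with e he
    refine ⟨he, ?_⟩
    rw [tsum_eq_sum (s := (he.2 (n / M)).toFinset)]
    · refine Finset.sum_congr rfl fun i hi => ?_
      rw [Set.Finite.mem_toFinset] at hi
      exact if_pos (c := OccursBy a η y₀ e (n / M) i) hi
    · intro i hi
      rw [Set.Finite.mem_toFinset] at hi
      exact if_neg (c := OccursBy a η y₀ e (n / M) i) hi
  have hmeas : ∀ m, AEStronglyMeasurable (fun e =>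
      Real.exp (-∑' i, claimWeight a η y₀ (gridApprox w M n m) (n / M) e i)) expSeq := fun m =>
    (Measurable.tsum fun i =>
      measurable_claimWeight (continuous_gridApprox w M n m) _ i).neg.exp.aestronglyMeasurable
  refine tendsto_integral_of_dominated_convergence (fun _ => 1) hmeas (integrable_const _)
    (fun m => ?_) ?_
  · filter_upwards with e
    rw [Real.norm_of_nonneg (Real.exp_pos _).le]
    refine Real.exp_le_one_iff.2 (neg_nonpos.2 (tsum_nonneg fun i => ?_))
    unfold claimWeight
    split_ifs; exacts [gridApprox_nonneg hw M n m _, le_rfl]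
  · filter_upwards [ae_all_iff.2 hts] with e he
    obtain ⟨hreg, -⟩ := he 0
    rw [← hreg.tsum_gridStep w M n]
    refine Tendsto.rexp (Tendsto.neg ?_)
    simp only [fun m => (he m).2]
    exact tendsto_finsetSum _ fun i _ => tendsto_gridApprox w M n _

end Excess
end HawkesDividend

namespace HawkesDividend

/-! ### Counting paths and their intensities -/

/-- A path of a counting process with unit jumps. -/
structure CountingPath (n : ℝ≥0 → ℕ) : Prop where
  zero : n 0 = 0
  mono : Monotone n
  rightCont : ∀ t, ContinuousWithinAt n (Set.Ici t) t
  jump : ∀ t > 0, ∀ᶠ s in 𝓝[<] t, n t ≤ n s + 1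

theorem tendsto_toNNReal_nhdsGE (t : ℝ) :
    Tendsto Real.toNNReal (𝓝[≥] t) (𝓝[≥] t.toNNReal) :=
  tendsto_nhdsWithin_iff.2 ⟨(continuous_real_toNNReal.tendsto t).mono_left nhdsWithin_le_nhds,
    eventually_nhdsWithin_of_forall fun _ hs => Real.toNNReal_le_toNNReal hs⟩

theorem tendsto_toNNReal_nhdsLT {t : ℝ} (ht : 0 < t) :
    Tendsto Real.toNNReal (𝓝[<] t) (𝓝[<] t.toNNReal) :=
  tendsto_nhdsWithin_iff.2 ⟨(continuous_real_toNNReal.tendsto t).mono_left nhdsWithin_le_nhds,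
    eventually_nhdsWithin_of_forall fun _ hs => (Real.toNNReal_lt_toNNReal_iff ht).2 hs⟩

namespace CountingPath

variable {n : ℝ≥0 → ℕ} (hn : CountingPath n)
include hn

theorem eventually_eq_right (t : ℝ≥0) : ∀ᶠ s in 𝓝[≥] t, n s = n t := by
  have := hn.rightCont t
  rw [ContinuousWithinAt, nhds_discrete, tendsto_pure] at this
  exact this

/-- Just before a positive time, a counting path is constant, with a value at most one below the
current one. -/
theorem exists_left {t : ℝ≥0} (ht : 0 < t) :
    ∃ k, (n t = k ∨ n t = k + 1) ∧ ∀ᶠ s in 𝓝[<] t, n s = k := by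
  have hne : (𝓝[<] t).NeBot := nhdsLT_neBot_of_exists_lt ⟨0, ht⟩
  have hbdd : ∀ s < t, n s ≤ n t := fun s hs => hn.mono hs.le
  obtain ⟨k, ⟨s₀, hs₀, hk⟩, hmax⟩ : ∃ k, (∃ s < t, n s = k) ∧ ∀ s < t, n s ≤ k := by
    have hex : ∃ k, ∀ s < t, n s ≤ k := ⟨n t, hbdd⟩
    classical
    refine ⟨Nat.find hex, ?_, Nat.find_spec hex⟩
    by_contra hno
    push Not at hno
    rcases Nat.eq_zero_or_pos (Nat.find hex) with h0 | h0
    · exact hno 0 ht (by have := Nat.find_spec hex 0 ht; omega)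
    · refine Nat.find_min hex (Nat.sub_lt h0 one_pos) fun s hs => ?_
      have h1 := Nat.find_spec hex s hs
      have h2 := hno s hs
      omega
  have hev : ∀ᶠ s in 𝓝[<] t, n s = k := by
    filter_upwards [Ioo_mem_nhdsLT hs₀] with s hs
    exact le_antisymm (hmax s hs.2) (hk ▸ hn.mono hs.1.le)
  refine ⟨k, ?_, hev⟩
  obtain ⟨s, h1, h2, h3⟩ := ((hn.jump t ht).and (hev.and self_mem_nhdsWithin)).exists
  have := hbdd s h3
  omega

/-- The path, extended by `0` to the negative line, as a Stieltjes function. -/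
noncomputable def stieltjes : StieltjesFunction ℝ where
  toFun t := n t.toNNReal
  mono' s t hst := Nat.cast_le.2 (hn.mono (Real.toNNReal_le_toNNReal hst))
  right_continuous' t := by
    rcases lt_or_ge t 0 with ht | ht
    · refine ContinuousAt.continuousWithinAt (tendsto_const_nhds.congr' ?_)
      filter_upwards [Iio_mem_nhds ht] with s hs
      rw [Real.toNNReal_of_nonpos (le_of_lt hs), Real.toNNReal_of_nonpos ht.le]
    · refine Tendsto.congr' ?_ tendsto_const_nhds
      filter_upwards [(tendsto_toNNReal_nhdsGE t).eventually
        (hn.eventually_eq_right t.toNNReal)] with s hs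
      rw [hs]

theorem stieltjes_apply (t : ℝ) : hn.stieltjes t = n t.toNNReal := rfl

theorem eventually_eq_right' (t : ℝ) : ∀ᶠ s in 𝓝[≥] t, hn.stieltjes s = hn.stieltjes t := by
  simp only [stieltjes_apply]
  rcases lt_or_ge t 0 with ht | ht
  · filter_upwards [nhdsWithin_le_nhds (Iio_mem_nhds ht)] with s hs
    rw [Real.toNNReal_of_nonpos (le_of_lt hs), Real.toNNReal_of_nonpos ht.le]
  · filter_upwards [(tendsto_toNNReal_nhdsGE t).eventually
        (hn.eventually_eq_right t.toNNReal)] with s hs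
    rw [hs]

/-- The size of the jump at time `t`. -/
noncomputable def jumpAt (t : ℝ) : ℝ := hn.stieltjes t - Function.leftLim hn.stieltjes t

theorem eventually_eq_left {t : ℝ} (ht : 0 < t) : (hn.jumpAt t = 0 ∨ hn.jumpAt t = 1) ∧
    ∀ᶠ s in 𝓝[<] t, hn.stieltjes s = hn.stieltjes t - hn.jumpAt t := by
  obtain ⟨k, hk, hev⟩ := hn.exists_left (Real.toNNReal_pos.2 ht)
  have hev' : ∀ᶠ s in 𝓝[<] t, hn.stieltjes s = (k : ℝ) := by
    filter_upwards [(tendsto_toNNReal_nhdsLT ht).eventually hev] with s hs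
    rw [stieltjes_apply, hs]
  have hlim : Function.leftLim hn.stieltjes t = k :=
    leftLim_eq_of_tendsto
      (Tendsto.congr' (hev'.mono fun s hs => hs.symm) tendsto_const_nhds)
  refine ⟨?_, ?_⟩
  · rw [jumpAt, hlim, stieltjes_apply]
    rcases hk with h | h <;> rw [h] <;> simp
  · filter_upwards [hev'] with s hs
    rw [jumpAt, hlim, hs]; ring

theorem measure_Ioc (s t : ℝ) :
    hn.stieltjes.measure (Set.Ioc s t) = ENNReal.ofReal (hn.stieltjes t - hn.stieltjes s) :=
  hn.stieltjes.measure_Ioc s t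

theorem measureReal_Ioc {s t : ℝ} (hst : s ≤ t) :
    hn.stieltjes.measure.real (Set.Ioc s t) = hn.stieltjes t - hn.stieltjes s := by
  rw [measureReal_def, hn.measure_Ioc, ENNReal.toReal_ofReal (sub_nonneg.2 (hn.stieltjes.mono hst))]

/-- Close to the left of `t`, the counting measure only sees the jump at `t`. -/
theorem eventually_setIntegral_left {t : ℝ} (ht : 0 < t) (g : ℝ → ℝ) :
    ∀ᶠ s in 𝓝[<] t, ∫ u in Set.Ioc s t, g u ∂hn.stieltjes.measure = g t * hn.jumpAt t := by
  filter_upwards [(hn.eventually_eq_left ht).2, self_mem_nhdsWithin] with s hs hst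
  have h1 : hn.stieltjes.measure (Set.Ioo s t) = 0 := by
    rw [StieltjesFunction.measure_Ioo, hs]
    simp [jumpAt]
  have h2 : (Set.Ioc s t : Set ℝ) =ᵐ[hn.stieltjes.measure] ({t} : Set ℝ) := by
    rw [← Set.Ioo_union_right hst]
    have h3 : (Set.Ioo s t : Set ℝ) =ᵐ[hn.stieltjes.measure] (∅ : Set ℝ) := ae_eq_empty.2 h1
    simpa using h3.union (ae_eq_refl ({t} : Set ℝ))
  rw [setIntegral_congr_set h2, integral_singleton, smul_eq_mul, mul_comm, measureReal_def,
    StieltjesFunction.measure_singleton, ENNReal.toReal_ofReal, jumpAt]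
  exact sub_nonneg.2 (hn.stieltjes.mono.leftLim_le le_rfl)

theorem eventually_setIntegral_right (t : ℝ) (g : ℝ → ℝ) :
    ∀ᶠ s in 𝓝[≥] t, ∫ u in Set.Ioc t s, g u ∂hn.stieltjes.measure = 0 := by
  filter_upwards [hn.eventually_eq_right' t] with s hs
  refine setIntegral_measure_zero _ ?_
  rw [hn.measure_Ioc, hs]; simp

end CountingPath

/-- `l` is the intensity path of the counting path `n`, for the initial intensity `y`. -/
structure IntensityPath (p : Params) (y : ℝ) (n : ℝ≥0 → ℕ) (l : ℝ≥0 → ℝ) : Prop where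
  integrable : ∀ t : ℝ≥0, IntervalIntegrable (fun s : ℝ => l s.toNNReal) volume 0 t
  eq : ∀ t : ℝ≥0, l t = y + (∫ s in (0 : ℝ)..t, p.a * (p.b - l s.toNNReal)) + p.η * n t

/-- The intensity at time `t` if there has been no claim before. -/
noncomputable def freeIntensity (p : Params) (y t : ℝ) : ℝ :=
  p.b + (y - p.b) * Real.exp (-(p.a * t))

theorem continuous_freeIntensity (p : Params) (y : ℝ) : Continuous (freeIntensity p y) := by
  unfold freeIntensity; fun_prop

theorem freeIntensity_eq (p : Params) (y t : ℝ) :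
    freeIntensity p y t = y + ∫ s in (0 : ℝ)..t, p.a * (p.b - freeIntensity p y s) := by
  have h : ∀ s, HasDerivAt (freeIntensity p y) (p.a * (p.b - freeIntensity p y s)) s := by
    intro s
    have h1 : HasDerivAt (fun s : ℝ => -(p.a * s)) (-p.a) s := by
      exact (((hasDerivAt_id s).const_mul p.a).neg).congr_deriv (by simp)
    have h2 := (h1.exp.const_mul (y - p.b)).const_add p.b
    refine HasDerivAt.congr_deriv (f := freeIntensity p y) h2 ?_
    simp only [freeIntensity]; ring
  rw [intervalIntegral.integral_eq_sub_of_hasDerivAt (fun s _ => h s)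
    (Continuous.intervalIntegrable (by have := continuous_freeIntensity p y; fun_prop) _ _)]
  simp [freeIntensity]

theorem freeIntensity_le (p : Params) {y t : ℝ} (hy : p.b ≤ y) (ht : 0 ≤ t) :
    freeIntensity p y t ≤ y := by
  have h1 : Real.exp (-(p.a * t)) ≤ 1 :=
    Real.exp_le_one_iff.2 (neg_nonpos.2 (mul_nonneg p.a_pos.le ht))
  have h2 : 0 ≤ y - p.b := by linarith
  unfold freeIntensity
  nlinarith

theorem freeIntensity_pos (p : Params) {y : ℝ} (hy : p.b ≤ y) (t : ℝ) :
    0 < freeIntensity p y t := by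
  have h1 := mul_nonneg (sub_nonneg.2 hy) (Real.exp_pos (-(p.a * t))).le
  have := p.b_pos
  unfold freeIntensity
  linarith

namespace IntensityPath

variable {p : Params} {y : ℝ} {n : ℝ≥0 → ℕ} {l : ℝ≥0 → ℝ} (hl : IntensityPath p y n l)
include hl

theorem integrable' (s t : ℝ) (hs : 0 ≤ s) (ht : 0 ≤ t) :
    IntervalIntegrable (fun s : ℝ => l s.toNNReal) volume s t := by
  have h1 := hl.integrable ⟨s, hs⟩
  have h2 := hl.integrable ⟨t, ht⟩
  exact h1.symm.trans h2

/-- The excess of the intensity over its value without claims, and its integral. -/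
theorem excess_eq {t : ℝ} (ht : 0 ≤ t) :
    l t.toNNReal - freeIntensity p y t =
      p.η * n t.toNNReal - p.a * ∫ s in (0 : ℝ)..t, (l s.toNNReal - freeIntensity p y s) := by
  have h1 := hl.eq t.toNNReal
  rw [Real.coe_toNNReal t ht] at h1
  have hi := hl.integrable' 0 t le_rfl ht
  have hf := (continuous_freeIntensity p y).intervalIntegrable 0 t (μ := volume)
  have e1 : ∫ s in (0 : ℝ)..t, p.a * (p.b - l s.toNNReal) =
      p.a * (p.b * t) - p.a * ∫ s in (0 : ℝ)..t, l s.toNNReal := by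
    rw [intervalIntegral.integral_const_mul, intervalIntegral.integral_sub (by simp) hi]
    simp; ring
  have e2 : ∫ s in (0 : ℝ)..t, p.a * (p.b - freeIntensity p y s) =
      p.a * (p.b * t) - p.a * ∫ s in (0 : ℝ)..t, freeIntensity p y s := by
    rw [intervalIntegral.integral_const_mul, intervalIntegral.integral_sub (by simp) hf]
    simp; ring
  have h2 := freeIntensity_eq p y t
  rw [h1, h2, e1, ← freeIntensity_eq p y t, intervalIntegral.integral_sub hi hf]
  rw [e2] at h2
  linarith

theorem continuousWithinAt (hn : CountingPath n) {t : ℝ} (ht : 0 ≤ t) :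
    ContinuousWithinAt (fun s : ℝ => l s.toNNReal) (Set.Ici t) t := by
  have hI : ContinuousWithinAt (fun s : ℝ => ∫ u in (0 : ℝ)..s, p.a * (p.b - l u.toNNReal))
      (Set.Ici t) t := by
    have hi : IntervalIntegrable (fun u : ℝ => p.a * (p.b - l u.toNNReal)) volume 0 (t + 1) :=
      ((intervalIntegrable_const (c := p.b)).sub
        (hl.integrable' 0 (t + 1) le_rfl (by linarith))).const_mul _
    have h01 : (0 : ℝ) ≤ t + 1 := by linarith
    have hc := intervalIntegral.continuousOn_primitive_interval' hi Set.left_mem_uIcc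
    rw [Set.uIcc_of_le h01] at hc
    refine (hc t ⟨ht, by linarith⟩).mono_of_mem_nhdsWithin ?_
    exact mem_of_superset (Icc_mem_nhdsGE (by linarith : t < t + 1)) (Set.Icc_subset_Icc_left ht)
  have h2 : Tendsto (fun s : ℝ => y + (∫ u in (0 : ℝ)..s, p.a * (p.b - l u.toNNReal)) +
      p.η * n t.toNNReal) (𝓝[≥] t) (𝓝 (l t.toNNReal)) := by
    have := (hI.tendsto.const_add y).add_const (p.η * (n t.toNNReal : ℝ))
    rwa [show l t.toNNReal = _ from hl.eq t.toNNReal, Real.coe_toNNReal t ht]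
  refine h2.congr' ?_
  filter_upwards [(tendsto_toNNReal_nhdsGE t).eventually (hn.eventually_eq_right t.toNNReal),
    self_mem_nhdsWithin] with s hs hts
  rw [hl.eq s.toNNReal, hs, Real.coe_toNNReal s (ht.trans hts)]

/-- The intensity lies above its value without claims, by at most `η` per claim. -/
theorem bounds (hn : CountingPath n) {t : ℝ} (ht : 0 ≤ t) :
    freeIntensity p y t ≤ l t.toNNReal ∧
      l t.toNNReal ≤ freeIntensity p y t + p.η * n t.toNNReal := by
  set g : ℝ → ℝ := fun s => l s.toNNReal - freeIntensity p y s with hg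
  have hgi : ∀ t, 0 ≤ t → IntervalIntegrable g volume 0 t := fun t ht =>
    (hl.integrable' 0 t le_rfl ht).sub ((continuous_freeIntensity p y).intervalIntegrable _ _)
  -- Gronwall: `(∫ g - η N_t / a) exp (a s)` is non-increasing in `s ≤ t`
  have key : ∀ t, 0 ≤ t → 0 ≤ g t := by
    intro t ht
    set K : ℝ → ℝ := fun s => ∫ u in (0 : ℝ)..s, g u with hK
    set c : ℝ := p.η * n t.toNNReal / p.a with hc
    have hc0 : 0 ≤ c := div_nonneg (mul_nonneg p.η_pos.le (Nat.cast_nonneg _)) p.a_pos.le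
    have hKc : ContinuousOn K (Set.Icc 0 t) := by
      have hc := intervalIntegral.continuousOn_primitive_interval' (hgi t ht) Set.left_mem_uIcc
      rwa [Set.uIcc_of_le ht] at hc
    have hKd : ∀ s ∈ Set.Ico 0 t, HasDerivWithinAt K (g s) (Set.Ici s) s := by
      intro s hs
      have hrc : ContinuousWithinAt g (Set.Ici s) s :=
        (hl.continuousWithinAt hn hs.1).sub (continuous_freeIntensity p y).continuousWithinAt
      refine intervalIntegral.integral_hasDerivWithinAt_right (hgi s hs.1) ?_
        (hrc.mono Set.Ioi_subset_Ici_self)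
      refine ⟨Set.Ioc s t, Ioc_mem_nhdsGT hs.2, ?_⟩
      exact ((intervalIntegrable_iff_integrableOn_Ioc_of_le ht).1
        (hgi t ht)).aestronglyMeasurable.mono_measure
          (Measure.restrict_mono (Set.Ioc_subset_Ioc_left hs.1) le_rfl)
    have hle := image_le_of_deriv_right_le_deriv_boundary
      (f := fun s => (K s - c) * Real.exp (p.a * s))
      (f' := fun s => g s * Real.exp (p.a * s) + (K s - c) * (Real.exp (p.a * s) * p.a))
      (a := 0) (b := t) (B := fun _ => 0) (B' := fun _ => 0)
      ((hKc.sub continuousOn_const).mul (by fun_prop)) ?_ (by simp [hK, hc0]) continuousOn_const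
      (fun s _ => hasDerivWithinAt_const _ _ _) ?_ (Set.right_mem_Icc.2 ht)
    · have h1 : K t - c ≤ 0 := by
        by_contra h; push Not at h
        exact absurd hle (not_le.2 (mul_pos h (Real.exp_pos _)))
      have h2 := hl.excess_eq ht
      have h3 : p.a * c = p.η * n t.toNNReal := by rw [hc]; field_simp [p.a_pos.ne']
      have h4 : p.a * (K t - c) ≤ 0 := mul_nonpos_of_nonneg_of_nonpos p.a_pos.le h1
      change g t = _ - p.a * K t at h2
      rw [h2]; linarith
    · intro s hs
      have he : HasDerivAt (fun s : ℝ => Real.exp (p.a * s)) (Real.exp (p.a * s) * p.a) s := by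
        simpa using ((hasDerivAt_id s).const_mul p.a).exp
      exact ((hKd s hs).sub_const c).mul he.hasDerivWithinAt
    · intro s hs
      have h2 := hl.excess_eq hs.1
      change g s = _ - p.a * K s at h2
      have h3 : p.a * c = p.η * n t.toNNReal := by rw [hc]; field_simp [p.a_pos.ne']
      have h4 : (n s.toNNReal : ℝ) ≤ n t.toNNReal :=
        Nat.cast_le.2 (hn.mono (Real.toNNReal_le_toNNReal hs.2.le))
      have h5 : g s + (K s - c) * p.a ≤ 0 := by
        have := mul_le_mul_of_nonneg_left h4 p.η_pos.le
        rw [h2]; linarith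
      have := mul_nonpos_of_nonpos_of_nonneg h5 (Real.exp_pos (p.a * s)).le
      linarith
  refine ⟨by have := key t ht; simp only [hg] at this; linarith, ?_⟩
  have h2 := hl.excess_eq ht
  have h3 : 0 ≤ ∫ s in (0 : ℝ)..t, g s :=
    intervalIntegral.integral_nonneg ht fun s hs => key s hs.1
  have := mul_nonneg p.a_pos.le h3
  simp only [hg] at this
  linarith

/-- The lower and the upper bound of the intensity agree as long as there is no claim. -/
theorem eq_freeIntensity (hn : CountingPath n) {t : ℝ} (ht : 0 ≤ t) (h0 : n t.toNNReal = 0) :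
    l t.toNNReal = freeIntensity p y t := by
  have := hl.bounds hn ht
  rw [h0] at this
  exact le_antisymm (by simpa using this.2) this.1

end IntensityPath

end HawkesDividend

namespace HawkesDividend

/-! ### The exponential functional along a path -/

/-- The `i`-th point of the partition of `[h, T]` into `K` equal intervals. -/
noncomputable def partPoint (h T : ℝ) (K i : ℕ) : ℝ := h + i * ((T - h) / K)

theorem partPoint_zero (h T : ℝ) (K : ℕ) : partPoint h T K 0 = h := by simp [partPoint]

theorem partPoint_last (h T : ℝ) {K : ℕ} (hK : 0 < K) : partPoint h T K K = T := by
  have : (K : ℝ) ≠ 0 := by positivity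
  simp only [partPoint]; field_simp; ring

theorem partPoint_mono {h T : ℝ} (hT : h ≤ T) (K : ℕ) : Monotone (partPoint h T K) := by
  intro i j hij
  have : 0 ≤ (T - h) / K := div_nonneg (by linarith) (Nat.cast_nonneg _)
  have h2 : (i : ℝ) ≤ j := Nat.cast_le.2 hij
  unfold partPoint
  nlinarith

theorem partPoint_mem {h T : ℝ} (hT : h ≤ T) {K i : ℕ} (hK : 0 < K) (hi : i ≤ K) :
    partPoint h T K i ∈ Set.Icc h T :=
  ⟨(partPoint_zero h T K).symm.trans_le (partPoint_mono hT K (Nat.zero_le i)),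
    (partPoint_mono hT K hi).trans_eq (partPoint_last h T hK)⟩

/-- Riemann sums with left endpoints converge to the integral of the left limits. -/
theorem tendsto_riemannSum {μ : Measure ℝ} {g H Hl : ℝ → ℝ} {h T B : ℝ} (hT : h < T)
    (hg : IntervalIntegrable g μ h T) (hB : ∀ u ∈ Set.Icc h T, |H u| ≤ B)
    (hlim : ∀ u ∈ Set.Ioc h T, Tendsto H (𝓝[<] u) (𝓝 (Hl u))) :
    IntervalIntegrable (fun u => Hl u * g u) μ h T ∧
    Tendsto (fun K : ℕ => ∑ i ∈ Finset.range K, H (partPoint h T K i) *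
      ∫ u in (partPoint h T K i)..(partPoint h T K (i + 1)), g u ∂μ) atTop
      (𝓝 (∫ u in h..T, Hl u * g u ∂μ)) := by
  have hTh : 0 < T - h := sub_pos.2 hT
  -- the left endpoint of the interval that contains `u`
  set q : ℕ → ℝ → ℝ := fun K u => h + ((⌈(u - h) / ((T - h) / K)⌉ : ℤ) - 1) * ((T - h) / K) with hq
  have hδ : ∀ K : ℕ, 0 < K → 0 < (T - h) / K := fun K hK => div_pos hTh (Nat.cast_pos.2 hK)
  have hqi : ∀ K : ℕ, 0 < K → ∀ i, ∀ u ∈ Set.Ioc (partPoint h T K i) (partPoint h T K (i + 1)),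
      q K u = partPoint h T K i := by
    intro K hK i u hu
    have h1 : ⌈(u - h) / ((T - h) / K)⌉ = (i : ℤ) + 1 := by
      rw [Int.ceil_eq_iff]
      simp only [partPoint] at hu
      push_cast at hu ⊢
      constructor
      · rw [lt_div_iff₀ (hδ K hK)]; linarith [hu.1]
      · rw [div_le_iff₀ (hδ K hK)]; linarith [hu.2]
    simp only [hq, h1, partPoint]
    push_cast; ring
  have hq1 : ∀ K : ℕ, 0 < K → ∀ u, q K u < u ∧ u - (T - h) / K ≤ q K u := by
    intro K hK u
    have h1 := Int.ceil_lt_add_one ((u - h) / ((T - h) / K))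
    have h2 := Int.le_ceil ((u - h) / ((T - h) / K))
    rw [div_le_iff₀ (hδ K hK)] at h2
    have h3 : ((⌈(u - h) / ((T - h) / K)⌉ : ℤ) - 1 : ℝ) * ((T - h) / K) < u - h := by
      rw [← lt_div_iff₀ (hδ K hK)]; linarith
    simp only [hq]
    constructor <;> linarith
  have hq0 : ∀ K : ℕ, 0 < K → ∀ u ∈ Set.Ioc h T, q K u ∈ Set.Icc h T := by
    intro K hK u hu
    refine ⟨?_, (hq1 K hK u).1.le.trans hu.2⟩
    have : 0 < ⌈(u - h) / ((T - h) / K)⌉ := Int.ceil_pos.2 (div_pos (by linarith [hu.1]) (hδ K hK))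
    have h2 : (1 : ℝ) ≤ (⌈(u - h) / ((T - h) / K)⌉ : ℤ) := by exact_mod_cast this
    have := mul_nonneg (sub_nonneg.2 h2) (hδ K hK).le
    simp only [hq]; linarith
  have hqm : ∀ K : ℕ, Measurable fun u => H (q K u) := by
    intro K
    have h1 : Measurable fun u : ℝ => ⌈(u - h) / ((T - h) / K)⌉ :=
      Int.measurable_ceil.comp (by fun_prop)
    exact (measurable_from_top (f := fun z : ℤ => H (h + (z - 1) * ((T - h) / K)))).comp h1
  have hgm : AEStronglyMeasurable g (μ.restrict (Set.Ioc h T)) := hg.1.aestronglyMeasurable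
  have hptw : ∀ u ∈ Set.Ioc h T, Tendsto (fun K => H (q K u) * g u) atTop (𝓝 (Hl u * g u)) := by
    intro u hu
    refine Tendsto.mul_const _ ((hlim u hu).comp (tendsto_nhdsWithin_iff.2 ⟨?_, ?_⟩))
    · have h0 : Tendsto (fun K : ℕ => u - (T - h) / K) atTop (𝓝 (u - 0)) :=
        (tendsto_const_div_atTop_nhds_zero_nat _).const_sub u
      rw [sub_zero] at h0
      refine tendsto_of_tendsto_of_tendsto_of_le_of_le' h0 tendsto_const_nhds ?_ ?_
      · filter_upwards [eventually_gt_atTop 0] with K hK using (hq1 K hK u).2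
      · filter_upwards [eventually_gt_atTop 0] with K hK using (hq1 K hK u).1.le
    · filter_upwards [eventually_gt_atTop 0] with K hK using (hq1 K hK u).1
  have hbd : ∀ᶠ K : ℕ in atTop, ∀ᵐ u ∂μ.restrict (Set.Ioc h T), ‖H (q K u) * g u‖ ≤ B * ‖g u‖ := by
    filter_upwards [eventually_gt_atTop 0] with K hK
    refine (ae_restrict_iff' measurableSet_Ioc).2 (ae_of_all _ fun u hu => ?_)
    rw [norm_mul]
    exact mul_le_mul_of_nonneg_right (hB _ (hq0 K hK u hu)) (norm_nonneg _)
  have hfm : ∀ K, AEStronglyMeasurable (fun u => H (q K u) * g u) (μ.restrict (Set.Ioc h T)) :=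
    fun K => (hqm K).aestronglyMeasurable.mul hgm
  have hint : ∀ K : ℕ, 0 < K → IntervalIntegrable (fun u => H (q K u) * g u) μ h T := by
    intro K hK
    rw [intervalIntegrable_iff_integrableOn_Ioc_of_le hT.le]
    refine Integrable.mono' (hg.1.norm.const_mul B) (hfm K) ?_
    refine (ae_restrict_iff' measurableSet_Ioc).2 (ae_of_all _ fun u hu => ?_)
    rw [norm_mul]
    exact mul_le_mul_of_nonneg_right (hB _ (hq0 K hK u hu)) (norm_nonneg _)
  have hptw' := (ae_restrict_iff' (μ := μ) (measurableSet_Ioc (a := h) (b := T))).2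
    (ae_of_all _ hptw)
  constructor
  · rw [intervalIntegrable_iff_integrableOn_Ioc_of_le hT.le]
    refine Integrable.mono' (hg.1.norm.const_mul B)
      (aestronglyMeasurable_of_tendsto_ae atTop hfm hptw') ?_
    refine (ae_restrict_iff' measurableSet_Ioc).2 (ae_of_all _ fun u hu => ?_)
    refine le_of_tendsto ((hptw u hu).norm) ?_
    filter_upwards [eventually_gt_atTop 0] with K hK
    rw [norm_mul]
    exact mul_le_mul_of_nonneg_right (hB _ (hq0 K hK u hu)) (norm_nonneg _)
  · rw [intervalIntegral.integral_of_le hT.le]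
    refine Tendsto.congr' ?_ (tendsto_integral_filter_of_dominated_convergence (fun u => B * ‖g u‖)
      (Eventually.of_forall hfm) hbd (hg.1.norm.const_mul B) hptw')
    filter_upwards [eventually_gt_atTop 0] with K hK
    have hsub : ∀ i < K, Set.Icc (partPoint h T K i) (partPoint h T K (i + 1)) ⊆ Set.Icc h T :=
      fun i hi => Set.Icc_subset_Icc (partPoint_mem hT.le hK hi.le).1 (partPoint_mem hT.le hK hi).2
    have h1 := intervalIntegral.sum_integral_adjacent_intervals (μ := μ)
      (f := fun u => H (q K u) * g u) (a := partPoint h T K) (n := K) fun i hi =>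
      (hint K hK).mono_set (by
        rw [Set.uIcc_of_le (partPoint_mono hT.le K i.le_succ), Set.uIcc_of_le hT.le]
        exact hsub i hi)
    rw [partPoint_zero, partPoint_last h T hK, intervalIntegral.integral_of_le hT.le] at h1
    rw [← h1]
    refine Finset.sum_congr rfl fun i _ => ?_
    rw [intervalIntegral.integral_of_le (partPoint_mono hT.le K i.le_succ),
      intervalIntegral.integral_of_le (partPoint_mono hT.le K i.le_succ), ← integral_const_mul]
    exact setIntegral_congr_fun measurableSet_Ioc fun u hu => by
      simp only [hqi K hK i u hu]

section Functional

variable {p : Params} {y : ℝ} {n : ℝ≥0 → ℕ} {l : ℝ≥0 → ℝ} (hn : CountingPath n)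
  (hl : IntensityPath p y n l) (φ β : ℝ → ℝ) (h T : ℝ)

/-- The exponential functional `exp (-a b ∫_t^T β - β λ - ∫_h^t φ dN)`, a martingale in `t` when
`β` solves the Riccati equation. -/
noncomputable def expFunctional (p : Params) (hn : CountingPath n) (l : ℝ≥0 → ℝ) (φ β : ℝ → ℝ)
    (h T t : ℝ) : ℝ :=
  Real.exp (-(p.a * p.b * ∫ s in t..T, β s) - β t * l t.toNNReal -
    ∫ u in h..t, φ u ∂hn.stieltjes.measure)

/-- The left limits of the exponential functional. -/
noncomputable def expFunctionalLeft (p : Params) (hn : CountingPath n) (l : ℝ≥0 → ℝ)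
    (φ β : ℝ → ℝ) (h T t : ℝ) : ℝ :=
  Real.exp (-(p.a * p.b * ∫ s in t..T, β s) - β t * (l t.toNNReal - p.η * hn.jumpAt t) -
    ((∫ u in h..t, φ u ∂hn.stieltjes.measure) - φ t * hn.jumpAt t))

/-- The relative jump of the exponential functional at a claim. -/
noncomputable def relJump (p : Params) (φ β : ℝ → ℝ) (t : ℝ) : ℝ :=
  Real.exp (-(p.η * β t + φ t)) - 1

variable {φ β h T} (hφ : Continuous φ) (hφ0 : ∀ t, 0 ≤ φ t) (hβ : IsRiccati p.a p.η φ β h T)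
  (hy : p.b ≤ y) (h0 : 0 ≤ h)
include hφ0 hβ in
theorem relJump_bounds {t : ℝ} (ht : t ∈ Set.Icc h T) : |relJump p φ β t| ≤ 1 := by
  have h1 : Real.exp (-(p.η * β t + φ t)) ≤ 1 := Real.exp_le_one_iff.2
    (neg_nonpos.2 (add_nonneg (mul_nonneg p.η_pos.le (hβ.nonneg t ht)) (hφ0 t)))
  have h2 := Real.exp_pos (-(p.η * β t + φ t))
  rw [relJump, abs_le]
  constructor <;> linarith

include hn

/-- A claim at time `t` multiplies the functional by `1 + relJump`: the intensity rises by `η`,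
and the integral by `φ t`. -/
theorem expFunctional_eq {t : ℝ} (hJ : hn.jumpAt t = 0 ∨ hn.jumpAt t = 1) :
    expFunctional p hn l φ β h T t =
      expFunctionalLeft p hn l φ β h T t * (1 + relJump p φ β t * hn.jumpAt t) := by
  rcases hJ with hJ | hJ
  · simp [expFunctional, expFunctionalLeft, hJ]
  · simp only [expFunctional, expFunctionalLeft, relJump, hJ]
    rw [show ∀ x : ℝ, 1 + (x - 1) * 1 = x from fun x => by ring, ← Real.exp_add]
    congr 1; ring

include hφ hl hβ h0 in
theorem tendsto_expFunctional_left {t : ℝ} (ht : t ∈ Set.Ioc h T) :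
    Tendsto (expFunctional p hn l φ β h T) (𝓝[<] t) (𝓝 (expFunctionalLeft p hn l φ β h T t)) := by
  have ht0 : 0 < t := h0.trans_lt ht.1
  have hβc := hβ.continuous
  have hI : ∀ a b, IntervalIntegrable φ hn.stieltjes.measure a b := fun a b =>
    hφ.intervalIntegrable a b
  have e1 : Tendsto (fun s => ∫ u in s..T, β u) (𝓝[<] t) (𝓝 (∫ u in t..T, β u)) := by
    have : Continuous fun s => ∫ u in T..s, β u :=
      intervalIntegral.continuous_primitive (fun a b => hβc.intervalIntegrable a b) T
    simp_rw [intervalIntegral.integral_symm T]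
    exact (this.tendsto t).neg.mono_left nhdsWithin_le_nhds
  have e2 : Tendsto (fun s : ℝ => l s.toNNReal) (𝓝[<] t)
      (𝓝 (l t.toNNReal - p.η * hn.jumpAt t)) := by
    have hi : IntervalIntegrable (fun u : ℝ => p.a * (p.b - l u.toNNReal)) volume 0 t :=
      ((intervalIntegrable_const (c := p.b)).sub (hl.integrable' 0 t le_rfl ht0.le)).const_mul _
    have hc := intervalIntegral.continuousOn_primitive_interval' hi Set.left_mem_uIcc
    rw [Set.uIcc_of_le ht0.le] at hc
    have hc1 := (hc t ⟨ht0.le, le_rfl⟩).tendsto.mono_left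
      (nhdsWithin_le_iff.2 (mem_of_superset (Ioo_mem_nhdsLT ht0) Set.Ioo_subset_Icc_self) :
        𝓝[<] t ≤ 𝓝[Set.Icc 0 t] t)
    have e3 : l t.toNNReal - p.η * hn.jumpAt t = y +
        (∫ u in (0 : ℝ)..t, p.a * (p.b - l u.toNNReal)) +
          p.η * (hn.stieltjes t - hn.jumpAt t) := by
      rw [hl.eq, Real.coe_toNNReal t ht0.le, hn.stieltjes_apply]; ring
    rw [e3]
    refine Tendsto.congr' ?_ ((hc1.const_add y).add_const _)
    filter_upwards [(hn.eventually_eq_left ht0).2, Ioo_mem_nhdsLT ht0] with s hs hs0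
    rw [← hs, hl.eq s.toNNReal, Real.coe_toNNReal s hs0.1.le, hn.stieltjes_apply]
  have e4 : Tendsto (fun s : ℝ => ∫ u in h..s, φ u ∂hn.stieltjes.measure) (𝓝[<] t)
      (𝓝 ((∫ u in h..t, φ u ∂hn.stieltjes.measure) - φ t * hn.jumpAt t)) := by
    refine Tendsto.congr' ?_ tendsto_const_nhds
    filter_upwards [hn.eventually_setIntegral_left ht0 φ, self_mem_nhdsWithin] with s hs hst
    rw [← hs, ← intervalIntegral.integral_of_le (le_of_lt hst),
      ← intervalIntegral.integral_add_adjacent_intervals (hI h s) (hI s t)]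
    ring
  exact (((e1.const_mul _).neg.sub (((hβc.tendsto t).mono_left nhdsWithin_le_nhds).mul e2)).sub
    e4).rexp

include hφ hl hβ h0 in
/-- Between claims, the functional grows at the rate that compensates the jumps. This is where the
Riccati equation enters. -/
theorem hasDerivWithinAt_expFunctional {t : ℝ} (ht : t ∈ Set.Ico h T) :
    HasDerivWithinAt (expFunctional p hn l φ β h T)
      (-(relJump p φ β t * expFunctional p hn l φ β h T t * l t.toNNReal)) (Set.Ici t) t := by
  have ht0 : 0 ≤ t := h0.trans ht.1
  have hβc := hβ.continuous
  have hI : ∀ a b, IntervalIntegrable φ hn.stieltjes.measure a b := fun a b =>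
    hφ.intervalIntegrable a b
  have d1 : HasDerivAt (fun s => ∫ u in s..T, β u) (-β t) t := by
    simp_rw [intervalIntegral.integral_symm T]
    exact (hβc.integral_hasStrictDerivAt T t).hasDerivAt.neg
  have d2 : HasDerivWithinAt β (p.a * β t - 1 + Real.exp (-(p.η * β t + φ t))) (Set.Ici t) t :=
    (hβ.deriv t ⟨ht.1, ht.2.le⟩).mono_of_mem_nhdsWithin
      (mem_of_superset (Icc_mem_nhdsGE ht.2) (Set.Icc_subset_Icc_left ht.1))
  have hrc := hl.continuousWithinAt hn ht0
  have d3 : HasDerivWithinAt (fun s => l t.toNNReal + ∫ u in t..s, p.a * (p.b - l u.toNNReal))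
      (p.a * (p.b - l t.toNNReal)) (Set.Ici t) t := by
    have hi : IntervalIntegrable (fun u : ℝ => p.a * (p.b - l u.toNNReal)) volume t T :=
      ((intervalIntegrable_const (c := p.b)).sub
        (hl.integrable' t T ht0 (ht0.trans ht.2.le))).const_mul _
    refine HasDerivWithinAt.const_add _
      (intervalIntegral.integral_hasDerivWithinAt_right (by simp) ?_ ?_)
    · refine ⟨Set.Ioc t T, Ioc_mem_nhdsGT ht.2, ?_⟩
      exact ((intervalIntegrable_iff_integrableOn_Ioc_of_le ht.2.le).1 hi).aestronglyMeasurable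
    · exact ((continuousWithinAt_const.sub hrc).const_mul p.a).mono Set.Ioi_subset_Ici_self
  have d4 := (((d1.const_mul (p.a * p.b)).hasDerivWithinAt (s := Set.Ici t)).neg.sub
    (d2.mul d3)).sub_const (∫ u in h..t, φ u ∂hn.stieltjes.measure)
  have d5 := d4.exp
  have heq : ∀ᶠ s in 𝓝[≥] t, expFunctional p hn l φ β h T s =
      Real.exp (-(p.a * p.b * ∫ s in s..T, β s) -
        β s * (l t.toNNReal + ∫ u in t..s, p.a * (p.b - l u.toNNReal)) -
        ∫ u in h..t, φ u ∂hn.stieltjes.measure) := by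
    filter_upwards [hn.eventually_setIntegral_right t φ, hn.eventually_eq_right' t,
      self_mem_nhdsWithin] with s hs hns hts
    have hts' : t ≤ s := hts
    have hs0 : 0 ≤ s := ht0.trans hts'
    have hi : ∀ a b, 0 ≤ a → 0 ≤ b →
        IntervalIntegrable (fun u : ℝ => p.a * (p.b - l u.toNNReal)) volume a b := fun a b ha hb =>
      ((intervalIntegrable_const (c := p.b)).sub (hl.integrable' a b ha hb)).const_mul _
    rw [← intervalIntegral.integral_of_le hts'] at hs
    have e1 : l s.toNNReal = l t.toNNReal + ∫ u in t..s, p.a * (p.b - l u.toNNReal) := by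
      rw [hl.eq s.toNNReal, hl.eq t.toNNReal, Real.coe_toNNReal s hs0, Real.coe_toNNReal t ht0,
        ← intervalIntegral.integral_add_adjacent_intervals (hi 0 t le_rfl ht0) (hi t s ht0 hs0)]
      simp only [hn.stieltjes_apply] at hns
      rw [hns]; ring
    rw [expFunctional, e1, ← intervalIntegral.integral_add_adjacent_intervals (hI h t) (hI t s), hs,
      add_zero]
  refine (HasDerivWithinAt.congr_of_eventuallyEq (d5.congr_deriv ?_) heq
    (heq.self_of_nhdsWithin Set.self_mem_Ici))
  simp only [Pi.sub_apply, Pi.neg_apply, Pi.mul_apply, intervalIntegral.integral_same, add_zero,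
    relJump, expFunctional]
  ring

include hφ0 hl hβ hy h0 in
theorem expFunctional_le_one {t : ℝ} (ht : t ∈ Set.Icc h T) :
    expFunctional p hn l φ β h T t ≤ 1 := by
  refine Real.exp_le_one_iff.2 ?_
  have h1 : 0 ≤ ∫ s in t..T, β s :=
    intervalIntegral.integral_nonneg ht.2 fun s hs => hβ.nonneg s ⟨ht.1.trans hs.1, hs.2⟩
  have h2 : 0 ≤ l t.toNNReal :=
    (freeIntensity_pos p hy t).le.trans (hl.bounds hn (h0.trans ht.1)).1
  have h3 := mul_nonneg (hβ.nonneg t ht) h2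
  have h4 : 0 ≤ ∫ u in h..t, φ u ∂hn.stieltjes.measure :=
    intervalIntegral.integral_nonneg ht.1 fun s _ => hφ0 s
  have h5 := mul_nonneg (mul_pos p.a_pos p.b_pos).le h1
  linarith

/-- Along every path, the increment of the exponential functional is the integral of its relative
jumps against the compensated counting path, and hence a limit of Riemann sums. -/
theorem tendsto_expFunctional_sum (hl : IntensityPath p y n l) (hφ : Continuous φ)
    (hφ0 : ∀ t, 0 ≤ φ t) (hβ : IsRiccati p.a p.η φ β h T) (hy : p.b ≤ y) (h0 : 0 ≤ h)
    (hT : h < T) :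
    Tendsto (fun K : ℕ => ∑ i ∈ Finset.range K,
      relJump p φ β (partPoint h T K i) * expFunctional p hn l φ β h T (partPoint h T K i) *
        ((n (partPoint h T K (i + 1)).toNNReal : ℝ) - n (partPoint h T K i).toNNReal -
          ∫ u in (partPoint h T K i)..(partPoint h T K (i + 1)), l u.toNNReal)) atTop
      (𝓝 (expFunctional p hn l φ β h T T - expFunctional p hn l φ β h T h)) := by
  set ν := hn.stieltjes.measure with hν
  set M := expFunctional p hn l φ β h T with hM
  set Ml := expFunctionalLeft p hn l φ β h T with hMl
  set κ := relJump p φ β with hκ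
  have hκc : Continuous κ := by
    have := hβ.continuous
    simp only [hκ]; unfold relJump; fun_prop
  have hB : ∀ u ∈ Set.Icc h T, |κ u * M u| ≤ 1 := by
    intro u hu
    have hMpos : 0 < M u := Real.exp_pos _
    rw [abs_mul, abs_of_pos hMpos]
    exact mul_le_one₀ (relJump_bounds hφ0 hβ hu) hMpos.le
      (expFunctional_le_one hn hl hφ0 hβ hy h0 hu)
  have hlim : ∀ u ∈ Set.Ioc h T, Tendsto (fun u => κ u * M u) (𝓝[<] u) (𝓝 (κ u * Ml u)) :=
    fun u hu => ((hκc.tendsto u).mono_left nhdsWithin_le_nhds).mul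
      (tendsto_expFunctional_left hn hl hφ hβ h0 hu)
  have hli := hl.integrable' h T h0 (h0.trans hT.le)
  obtain ⟨hi1, ht1⟩ := tendsto_riemannSum (μ := ν) (g := fun _ => 1) hT
    (continuous_const.intervalIntegrable _ _) hB hlim
  obtain ⟨hi2, ht2⟩ := tendsto_riemannSum (μ := volume) (g := fun u => l u.toNNReal) hT
    hli hB hlim
  simp only [mul_one] at hi1 ht1
  have hMM : ∀ᵐ u ∂(volume : Measure ℝ), Ml u = M u := by
    have hc : {u | Function.leftLim hn.stieltjes u ≠ hn.stieltjes u}.Countable :=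
      hn.stieltjes.countable_leftLim_ne
    filter_upwards [hc.ae_notMem volume] with u hu
    have hu0 : Function.leftLim hn.stieltjes u = hn.stieltjes u := not_not.1 hu
    have hJ : hn.jumpAt u = 0 := by rw [CountingPath.jumpAt, hu0, sub_self]
    rw [hM, expFunctional_eq hn (Or.inl hJ), hJ, mul_zero, add_zero, mul_one]
  have hMMae : ∀ (S : Set ℝ), (fun u => κ u * Ml u * l u.toNNReal) =ᵐ[volume.restrict S]
      fun u => κ u * M u * l u.toNNReal := fun S => by
    filter_upwards [ae_restrict_of_ae (s := S) hMM] with u hu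
    rw [hu]
  have hi3 : IntervalIntegrable (fun u => κ u * M u * l u.toNNReal) volume h T :=
    hi2.congr_ae (hMMae _)
  have hcore : ∀ t ∈ Set.Icc h T, M t + (∫ u in h..t, κ u * M u * l u.toNNReal) -
      (∫ u in h..t, κ u * Ml u ∂ν) = M h + (∫ u in h..h, κ u * M u * l u.toNNReal) -
      (∫ u in h..h, κ u * Ml u ∂ν) := by
    have hsub : ∀ {s t}, s ∈ Set.Icc h T → t ∈ Set.Icc h T → Set.uIcc s t ⊆ Set.uIcc h T := by
      intro s t hs ht
      rw [Set.uIcc_of_le hT.le]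
      exact Set.uIcc_subset_Icc hs ht
    have hderiv : ∀ t ∈ Set.Ico h T, HasDerivWithinAt (fun t => M t +
        (∫ u in h..t, κ u * M u * l u.toNNReal) - (∫ u in h..t, κ u * Ml u ∂ν)) 0
        (Set.Ici t) t := by
      intro t ht
      have ht' : t ∈ Set.Icc h T := ⟨ht.1, ht.2.le⟩
      have hhT : h ∈ Set.Icc h T := ⟨le_rfl, hT.le⟩
      have d1 := hasDerivWithinAt_expFunctional hn hl hφ hβ h0 ht
      have d2 : HasDerivWithinAt (fun t => ∫ u in h..t, κ u * M u * l u.toNNReal)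
          (κ t * M t * l t.toNNReal) (Set.Ici t) t := by
        refine intervalIntegral.integral_hasDerivWithinAt_right (hi3.mono_set (hsub hhT ht'))
          ⟨Set.Ioc t T, Ioc_mem_nhdsGT ht.2, ?_⟩ ?_
        · exact (hi3.1.mono_set (Set.Ioc_subset_Ioc_left ht.1)).aestronglyMeasurable
        · exact ((hκc.continuousWithinAt.mul d1.continuousWithinAt).mul
            (hl.continuousWithinAt hn (h0.trans ht.1))).mono Set.Ioi_subset_Ici_self
      have d3 : HasDerivWithinAt (fun t => ∫ u in h..t, κ u * Ml u ∂ν) 0 (Set.Ici t) t := by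
        refine (hasDerivWithinAt_const t _ (∫ u in h..t, κ u * Ml u ∂ν)).congr_of_eventuallyEq
          ?_ rfl
        filter_upwards [hn.eventually_setIntegral_right t (fun u => κ u * Ml u),
          Icc_mem_nhdsGE ht.2] with s hs hts
        have hs' : s ∈ Set.Icc h T := ⟨ht.1.trans hts.1, hts.2⟩
        rw [← intervalIntegral.integral_add_adjacent_intervals
          (hi1.mono_set (hsub hhT ht')) (hi1.mono_set (hsub ht' hs')),
          intervalIntegral.integral_of_le hts.1, hs, add_zero]
      exact ((d1.add d2).sub d3).congr_deriv (by ring)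
    refine constant_of_has_deriv_right_zero (fun t ht => ?_) hderiv
    have hhT : h ∈ Set.Icc h T := ⟨le_rfl, hT.le⟩
    have hleft : h < t → ContinuousWithinAt (fun t => M t +
        (∫ u in h..t, κ u * M u * l u.toNNReal) - (∫ u in h..t, κ u * Ml u ∂ν)) (Set.Iio t) t := by
      intro hht
      have ht0 : 0 < t := h0.trans_lt hht
      have e1 := tendsto_expFunctional_left hn hl hφ hβ h0 ⟨hht, ht.2⟩
      have e2 : Tendsto (fun t => ∫ u in h..t, κ u * M u * l u.toNNReal) (𝓝[<] t)
          (𝓝 (∫ u in h..t, κ u * M u * l u.toNNReal)) := by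
        have hc := intervalIntegral.continuousOn_primitive_interval' hi3 Set.left_mem_uIcc
        rw [Set.uIcc_of_le hT.le] at hc
        exact (hc t ht).tendsto.mono_left (nhdsWithin_le_iff.2 (mem_of_superset (Ioo_mem_nhdsLT hht)
          fun u hu => ⟨hu.1.le, hu.2.le.trans ht.2⟩))
      have e3 : Tendsto (fun t => ∫ u in h..t, κ u * Ml u ∂ν) (𝓝[<] t)
          (𝓝 ((∫ u in h..t, κ u * Ml u ∂ν) - κ t * Ml t * hn.jumpAt t)) := by
        refine Tendsto.congr' ?_ tendsto_const_nhds
        filter_upwards [hn.eventually_setIntegral_left ht0 (fun u => κ u * Ml u),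
          Ioo_mem_nhdsLT hht] with s hs hst
        have hs' : s ∈ Set.Icc h T := ⟨hst.1.le, hst.2.le.trans ht.2⟩
        rw [← hs, ← intervalIntegral.integral_of_le hst.2.le,
          ← intervalIntegral.integral_add_adjacent_intervals (hi1.mono_set (hsub hhT hs'))
            (hi1.mono_set (hsub hs' ht))]
        ring
      have e4 := (e1.add e2).sub e3
      have e5 : M t = Ml t * (1 + κ t * hn.jumpAt t) :=
        expFunctional_eq hn (hn.eventually_eq_left ht0).1
      have e6 : Ml t + (∫ u in h..t, κ u * M u * l u.toNNReal) -
          ((∫ u in h..t, κ u * Ml u ∂ν) - κ t * Ml t * hn.jumpAt t) =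
          M t + (∫ u in h..t, κ u * M u * l u.toNNReal) - (∫ u in h..t, κ u * Ml u ∂ν) := by
        rw [e5]; ring
      rw [← hMl, e6] at e4
      exact e4
    rcases eq_or_lt_of_le ht.1 with rfl | hht
    · exact (hderiv _ ⟨le_rfl, hT⟩).continuousWithinAt.mono fun u hu => hu.1
    rcases eq_or_lt_of_le ht.2 with rfl | htT
    · exact (continuousWithinAt_Iio_iff_Iic.1 (hleft hht)).mono fun u hu => hu.2
    · have := (continuousWithinAt_Iio_iff_Iic.1 (hleft hht)).union
        (hderiv t ⟨ht.1, htT⟩).continuousWithinAt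
      exact this.mono (by rw [Set.Iic_union_Ici]; exact Set.subset_univ _)
  have hfin := hcore T ⟨hT.le, le_rfl⟩
  simp only [intervalIntegral.integral_same, add_zero, sub_zero] at hfin
  have e1 : (∫ u in h..T, κ u * Ml u * l u.toNNReal) = ∫ u in h..T, κ u * M u * l u.toNNReal := by
    rw [intervalIntegral.integral_of_le hT.le, intervalIntegral.integral_of_le hT.le]
    exact integral_congr_ae (hMMae _)
  rw [e1] at ht2
  have ht3 := ht1.sub ht2
  have e2 : M T - M h = (∫ u in h..T, κ u * Ml u ∂ν) -
      ∫ u in h..T, κ u * M u * l u.toNNReal := by linarith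
  rw [e2]
  refine ht3.congr fun K => ?_
  rw [← Finset.sum_sub_distrib]
  refine Finset.sum_congr rfl fun i _ => ?_
  have hle := partPoint_mono hT.le K i.le_succ
  have e3 : ∫ _ in (partPoint h T K i)..(partPoint h T K (i + 1)), (1 : ℝ) ∂ν =
      (n (partPoint h T K (i + 1)).toNNReal : ℝ) - n (partPoint h T K i).toNNReal := by
    rw [intervalIntegral.integral_of_le hle, setIntegral_const, hν, smul_eq_mul, mul_one,
      hn.measureReal_Ioc hle, hn.stieltjes_apply, hn.stieltjes_apply]
  rw [e3]; ring

end Functional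

end HawkesDividend

namespace HawkesDividend

/-! ### Laplace functionals of the claim numbers -/

variable {Ω : Type*} [mΩ : MeasurableSpace Ω] {P : Measure Ω} {p : Params} {y : ℝ}
  {C : ClaimProcess Ω} {f : ℝ → ℝ}

/-- The increments of a martingale integrate to zero against bounded functions of the past. -/
theorem integral_mul_martingale_sub [IsProbabilityMeasure P] {𝓕 : Filtration ℝ≥0 mΩ}
    {X : ℝ≥0 → Ω → ℝ} (hX : Martingale X 𝓕 P) {s t : ℝ≥0} (hst : s ≤ t) {g : Ω → ℝ}
    (hg : StronglyMeasurable[𝓕 s] g) {B : ℝ} (hB : ∀ ω, |g ω| ≤ B) :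
    ∫ ω, g ω * (X t ω - X s ω) ∂P = 0 := by
  have hgm : AEStronglyMeasurable g P := (hg.mono (𝓕.le s)).aestronglyMeasurable
  have hi : ∀ u, Integrable (g * X u) P := fun u =>
    (hX.integrable u).bdd_mul hgm (ae_of_all _ hB)
  have h1 := condExp_mul_of_stronglyMeasurable_left hg (hi t) (hX.integrable t)
  have h2 : P[g * X t|𝓕 s] =ᵐ[P] g * X s := h1.trans ((hX.2 s t hst).mono fun ω hω => by
    simp [hω])
  have h3 : ∫ ω, (g * X t) ω ∂P = ∫ ω, (g * X s) ω ∂P := by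
    rw [← integral_condExp (𝓕.le s), integral_congr_ae h2]
  have h4 : ∫ ω, ((g * X t) ω - (g * X s) ω) ∂P = 0 := by
    rw [integral_sub (hi t) (hi s), h3, sub_self]
  simpa only [Pi.mul_apply, ← mul_sub] using h4

theorem IsHawkesModel.countingPath (hC : IsHawkesModel p f P y C) (ω : Ω) :
    CountingPath fun t => C.N t ω :=
  ⟨hC.N_zero ω, hC.N_mono ω, hC.N_rightCont ω, hC.N_jump ω⟩

theorem ClaimProcess.measurable_N_filtration (C : ClaimProcess Ω) (P : Measure Ω) {s t : ℝ≥0}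
    (hst : s ≤ t) : Measurable[C.filtration P t] (C.N s) := by
  have h1 : Measurable[C.history P t] (C.N s) := by
    refine Measurable.mono (comap_measurable (C.N s)) ?_ le_rfl
    exact le_sup_of_le_left (le_sup_left.trans
      (le_iSup (fun r : {r : ℝ≥0 // r ≤ t} => MeasurableSpace.comap (C.N r) inferInstance ⊔
        MeasurableSpace.comap (C.total r) inferInstance) ⟨s, hst⟩))
  exact h1.mono ((C.history P).le_rightCont t) le_rfl

theorem ClaimProcess.measurable_total_filtration (C : ClaimProcess Ω) (P : Measure Ω) {s t : ℝ≥0}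
    (hst : s ≤ t) : Measurable[C.filtration P t] (C.total s) := by
  have h1 : Measurable[C.history P t] (C.total s) := by
    refine Measurable.mono (comap_measurable (C.total s)) ?_ le_rfl
    exact le_sup_of_le_left (le_sup_right.trans
      (le_iSup (fun r : {r : ℝ≥0 // r ≤ t} => MeasurableSpace.comap (C.N r) inferInstance ⊔
        MeasurableSpace.comap (C.total r) inferInstance) ⟨s, hst⟩))
  exact h1.mono ((C.history P).le_rightCont t) le_rfl

section

variable {lam : ℝ≥0 → Ω → ℝ}
  (hcp : ∀ ω, CountingPath fun t => C.N t ω)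
  (hip : ∀ ω, IntensityPath p y (fun t => C.N t ω) fun t => lam t ω)
  (hmart : Martingale (fun t ω => (C.N t ω : ℝ) - ∫ s in (0 : ℝ)..t, lam s.toNNReal ω)
    (C.filtration P) P) (hy : p.b ≤ y)

include hcp hip hmart hy in
/-- On short time intervals, the compensator of `N` is at most half of `N`, up to a constant;
stepping through such intervals shows that `N` is integrable. -/
theorem integrable_N [IsProbabilityMeasure P] (t : ℝ≥0) :
    Integrable (fun ω => (C.N t ω : ℝ)) P := by
  have hmeas : ∀ t, AEStronglyMeasurable (fun ω => (C.N t ω : ℝ)) P := fun t =>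
    ((measurable_from_top (f := fun k : ℕ => (k : ℝ))).comp
      (C.measurable_N t)).aestronglyMeasurable
  set d : ℝ := 1 / (2 * p.η) with hd
  have hη := p.η_pos
  have hd0 : 0 < d := by positivity
  have hstep : ∀ s t : ℝ≥0, s ≤ t → (t : ℝ) - s ≤ d → Integrable (fun ω => (C.N s ω : ℝ)) P →
      Integrable (fun ω => (C.N t ω : ℝ)) P := by
    intro s t hst htd hs
    refine Integrable.mono' ((((hmart.integrable t).sub (hmart.integrable s)).norm.add
      (hs.add (integrable_const (d * y)))).const_mul 2) (hmeas t) (ae_of_all _ fun ω => ?_)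
    have hst' : (s : ℝ) ≤ t := NNReal.coe_le_coe.2 hst
    have h1 : ∫ u in (s : ℝ)..t, lam u.toNNReal ω ≤ d * (y + p.η * C.N t ω) := by
      have h2 : ∫ u in (s : ℝ)..t, lam u.toNNReal ω ≤
          ∫ u in (s : ℝ)..t, (y + p.η * C.N t ω) := by
        refine intervalIntegral.integral_mono_on hst' ((hip ω).integrable' _ _ s.2 t.2)
          (by simp) fun u hu => ?_
        have hu0 : 0 ≤ u := s.2.trans hu.1
        have h3 := ((hip ω).bounds (hcp ω) hu0).2
        have h4 := freeIntensity_le p hy hu0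
        have h5 : (C.N u.toNNReal ω : ℝ) ≤ C.N t ω :=
          Nat.cast_le.2 ((hcp ω).mono (Real.toNNReal_le_iff_le_coe.2 hu.2))
        have := mul_le_mul_of_nonneg_left h5 hη.le
        linarith
      rw [intervalIntegral.integral_const, smul_eq_mul] at h2
      have h6 : 0 ≤ y + p.η * C.N t ω := by
        have := p.b_pos
        have : 0 ≤ p.η * C.N t ω := by positivity
        linarith
      exact h2.trans (mul_le_mul_of_nonneg_right htd h6)
    have h2 := intervalIntegral.integral_add_adjacent_intervals
      ((hip ω).integrable' 0 s le_rfl s.2) ((hip ω).integrable' s t s.2 t.2)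
    have h3 : d * (p.η * C.N t ω) = C.N t ω / 2 := by rw [hd]; field_simp
    have h4 : (C.N t ω : ℝ) / 2 ≤
        (((C.N t ω : ℝ) - ∫ u in (0 : ℝ)..t, lam u.toNNReal ω) -
        ((C.N s ω : ℝ) - ∫ u in (0 : ℝ)..s, lam u.toNNReal ω)) + (C.N s ω + d * y) := by
      rw [mul_add, h3] at h1
      linarith
    have h5 := le_abs_self ((((C.N t ω : ℝ) - ∫ u in (0 : ℝ)..t, lam u.toNNReal ω) -
        ((C.N s ω : ℝ) - ∫ u in (0 : ℝ)..s, lam u.toNNReal ω)))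
    simp only [Pi.sub_apply, Pi.add_apply, Real.norm_eq_abs, Nat.abs_cast]
    linarith
  have hind : ∀ k : ℕ, Integrable (fun ω => (C.N (k * d).toNNReal ω : ℝ)) P := by
    intro k
    induction k with
    | zero => simp [(hcp _).zero]
    | succ k ih =>
      refine hstep _ _ (Real.toNNReal_le_toNNReal (by push_cast; nlinarith)) ?_ ih
      rw [Real.coe_toNNReal _ (by positivity), Real.coe_toNNReal _ (by positivity)]
      push_cast; linarith
  obtain ⟨k, hk⟩ := exists_nat_gt ((t : ℝ) / d)
  refine Integrable.mono' (hind k) (hmeas t) (ae_of_all _ fun ω => ?_)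
  rw [div_lt_iff₀ hd0] at hk
  rw [Real.norm_eq_abs, Nat.abs_cast]
  exact Nat.cast_le.2 ((hcp ω).mono (NNReal.coe_le_coe.1
    (hk.le.trans (Real.coe_toNNReal _ (by positivity)).ge)))

include hmart in
theorem measurable_compensator {s t : ℝ≥0} (hst : s ≤ t) :
    Measurable[C.filtration P t] fun ω => ∫ u in (0 : ℝ)..s, lam u.toNNReal ω := by
  have h1 : Measurable[C.filtration P t] fun ω =>
      (C.N s ω : ℝ) - ∫ u in (0 : ℝ)..s, lam u.toNNReal ω :=
    (hmart.1 s).measurable.mono ((C.filtration P).mono hst) le_rfl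
  have h2 : Measurable[C.filtration P t] fun ω => (C.N s ω : ℝ) :=
    (measurable_from_top (f := fun k : ℕ => (k : ℝ))).comp (C.measurable_N_filtration P hst)
  convert h2.sub h1 using 1
  funext ω
  simp

include hip hmart in
theorem measurable_intensity (t : ℝ≥0) : Measurable[C.filtration P t] (lam t) := by
  have h1 : lam t = fun ω => y + (p.a * p.b * t - p.a * ∫ u in (0 : ℝ)..t, lam u.toNNReal ω) +
      p.η * C.N t ω := by
    funext ω
    rw [(hip ω).eq t, intervalIntegral.integral_const_mul, intervalIntegral.integral_sub (by simp)
      ((hip ω).integrable t), intervalIntegral.integral_const, smul_eq_mul, sub_zero]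
    ring
  have h2 : Measurable[C.filtration P t] fun ω => (C.N t ω : ℝ) :=
    (measurable_from_top (f := fun k : ℕ => (k : ℝ))).comp (C.measurable_N_filtration P le_rfl)
  have h3 := measurable_compensator hmart (le_refl t)
  rw [h1]
  exact (((h3.const_mul p.a).const_sub (p.a * p.b * t)).const_add y).add (h2.const_mul p.η)

/-- The integral up to time `t` depends on the claims up to time `t` only, as a limit of Riemann
sums. -/
theorem measurable_setIntegral_path {φ : ℝ → ℝ} (hφ : Continuous φ) {h t : ℝ} (ht : h ≤ t) :
    Measurable[C.filtration P t.toNNReal] fun ω =>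
      ∫ u in h..t, φ u ∂(hcp ω).stieltjes.measure := by
  rcases eq_or_lt_of_le ht with rfl | ht
  · simp
  obtain ⟨B, hB⟩ := isCompact_Icc.exists_bound_of_continuousOn (hφ.continuousOn (s := Set.Icc h t))
  refine @measurable_of_tendsto_metrizable _ _ (C.filtration P t.toNNReal) _ _ _ _
    (fun (K : ℕ) ω => ∑ i ∈ Finset.range K, φ (partPoint h t K i) *
      ((C.N (partPoint h t K (i + 1)).toNNReal ω : ℝ) - C.N (partPoint h t K i).toNNReal ω)) _
    (fun K => ?_) ?_
  · refine Finset.measurable_fun_sum _ fun i hi => Measurable.const_mul ?_ _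
    have hi' : i < K := Finset.mem_range.1 hi
    have hm : ∀ j ≤ K, Measurable[C.filtration P t.toNNReal] fun ω =>
        (C.N (partPoint h t K j).toNNReal ω : ℝ) := fun j hj =>
      (measurable_from_top (f := fun k : ℕ => (k : ℝ))).comp (C.measurable_N_filtration P
        (Real.toNNReal_le_toNNReal (partPoint_mem ht.le (by lia) hj).2))
    exact (hm _ hi').sub (hm _ hi'.le)
  · rw [tendsto_pi_nhds]
    intro ω
    have h1 := (tendsto_riemannSum (μ := (hcp ω).stieltjes.measure) (g := fun _ => 1) (H := φ)
      (Hl := φ) (B := B) ht (continuous_const.intervalIntegrable _ _) hB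
      fun u _ => (hφ.tendsto u).mono_left nhdsWithin_le_nhds).2
    simp only [mul_one] at h1
    refine h1.congr fun K => Finset.sum_congr rfl fun i _ => ?_
    have hle := partPoint_mono ht.le K i.le_succ
    rw [intervalIntegral.integral_of_le hle, setIntegral_const, smul_eq_mul, mul_one,
      (hcp ω).measureReal_Ioc hle, (hcp ω).stieltjes_apply, (hcp ω).stieltjes_apply]

include hip hmart hy in
/-- The exponential functional is a martingale. -/
theorem integral_expFunctional [IsProbabilityMeasure P] {φ β : ℝ → ℝ} {h T : ℝ}
    (hφ : Continuous φ) (hφ0 : ∀ t, 0 ≤ φ t) (hβ : IsRiccati p.a p.η φ β h T)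
    (h0 : 0 ≤ h) (hT : h ≤ T) {A : Set Ω} (hA : MeasurableSet[C.filtration P h.toNNReal] A) :
    ∫ ω in A, Real.exp (-∫ u in h..T, φ u ∂(hcp ω).stieltjes.measure) ∂P =
      ∫ ω in A, Real.exp (-(p.a * p.b * ∫ s in h..T, β s) - β h * lam h.toNNReal ω) ∂P := by
  rcases eq_or_lt_of_le hT with rfl | hT
  · simp [hβ.terminal]
  have hAm : MeasurableSet A := (C.filtration P).le _ _ hA
  set M : ℝ → Ω → ℝ := fun t ω => expFunctional p (hcp ω) (fun t => lam t ω) φ β h T t with hM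
  have hMm : ∀ t ∈ Set.Icc h T, Measurable[C.filtration P t.toNNReal] (M t) := by
    intro t ht
    have h1 := measurable_setIntegral_path (P := P) hcp hφ ht.1
    have h2 := measurable_intensity hip hmart t.toNNReal
    simp only [hM, expFunctional]
    exact Real.measurable_exp.comp (((h2.const_mul (β t)).const_sub _).sub h1)
  have hM1 : ∀ t ∈ Set.Icc h T, ∀ ω, |M t ω| ≤ 1 := fun t ht ω => by
    have h1 : 0 < M t ω := Real.exp_pos _
    rw [abs_of_pos h1]
    exact expFunctional_le_one (hcp ω) (hip ω) hφ0 hβ hy h0 ht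
  have hMi : ∀ t ∈ Set.Icc h T, Integrable (M t) P := fun t ht =>
    Integrable.mono' (integrable_const 1)
      ((hMm t ht).mono ((C.filtration P).le _) le_rfl).aestronglyMeasurable
      (ae_of_all _ (hM1 t ht))
  set X : ℝ≥0 → Ω → ℝ := fun t ω => (C.N t ω : ℝ) - ∫ s in (0 : ℝ)..t, lam s.toNNReal ω with hX
  set κ := relJump p φ β with hκ
  set G : ℕ → Ω → ℝ := fun K ω => A.indicator 1 ω * ∑ i ∈ Finset.range K,
    κ (partPoint h T K i) * M (partPoint h T K i) ω *
      (X (partPoint h T K (i + 1)).toNNReal ω - X (partPoint h T K i).toNNReal ω) with hG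
  have hterm : ∀ K : ℕ, ∀ i < K, ∀ ω,
      X (partPoint h T K (i + 1)).toNNReal ω - X (partPoint h T K i).toNNReal ω =
        (C.N (partPoint h T K (i + 1)).toNNReal ω : ℝ) - C.N (partPoint h T K i).toNNReal ω -
          ∫ u in (partPoint h T K i)..(partPoint h T K (i + 1)), lam u.toNNReal ω := by
    intro K i hi ω
    have h1 := h0.trans (partPoint_mem hT.le (by lia) hi.le).1
    have h2 := h0.trans (partPoint_mem hT.le (K := K) (i := i + 1) (by lia) hi).1
    have h3 := intervalIntegral.integral_add_adjacent_intervals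
      ((hip ω).integrable' 0 _ le_rfl h1) ((hip ω).integrable' _ _ h1 h2)
    simp only [hX]
    rw [Real.coe_toNNReal _ h1, Real.coe_toNNReal _ h2, ← h3]
    ring
  have hXi : ∀ t, Integrable (X t) P := hmart.integrable
  have hgm : ∀ K : ℕ, ∀ i < K, Measurable[C.filtration P (partPoint h T K i).toNNReal] fun ω =>
      A.indicator 1 ω * (κ (partPoint h T K i) * M (partPoint h T K i) ω) := by
    intro K i hi
    have hmem := partPoint_mem hT.le (K := K) (by lia) hi.le
    have hA' : MeasurableSet[C.filtration P (partPoint h T K i).toNNReal] A :=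
      (C.filtration P).mono (Real.toNNReal_le_toNNReal hmem.1) _ hA
    exact ((@measurable_const _ _ _ (C.filtration P (partPoint h T K i).toNNReal) (1 : ℝ)).indicator
      hA').mul ((hMm _ hmem).const_mul _)
  have hgb : ∀ K : ℕ, ∀ i < K, ∀ ω,
      |A.indicator 1 ω * (κ (partPoint h T K i) * M (partPoint h T K i) ω)| ≤ 1 := by
    intro K i hi ω
    have hmem := partPoint_mem hT.le (K := K) (by lia) hi.le
    have h1 : |A.indicator (1 : Ω → ℝ) ω| ≤ 1 := by
      by_cases hω : ω ∈ A <;> simp [hω]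
    rw [abs_mul, abs_mul]
    exact mul_le_one₀ h1 (by positivity) (mul_le_one₀ (relJump_bounds hφ0 hβ hmem) (abs_nonneg _)
      (hM1 _ hmem ω))
  have hGeq : ∀ K ω, G K ω = ∑ i ∈ Finset.range K,
      (A.indicator 1 ω * (κ (partPoint h T K i) * M (partPoint h T K i) ω)) *
      (X (partPoint h T K (i + 1)).toNNReal ω - X (partPoint h T K i).toNNReal ω) := by
    intro K ω
    simp only [hG, Finset.mul_sum, mul_assoc]
  have hGi : ∀ K : ℕ, ∀ i < K, Integrable (fun ω =>
      (A.indicator 1 ω * (κ (partPoint h T K i) * M (partPoint h T K i) ω)) *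
      (X (partPoint h T K (i + 1)).toNNReal ω - X (partPoint h T K i).toNNReal ω)) P :=
    fun K i hi => ((hXi _).sub (hXi _)).bdd_mul
      ((hgm K i hi).mono ((C.filtration P).le _) le_rfl).aestronglyMeasurable
      (ae_of_all _ (hgb K i hi))
  have hG0 : ∀ K, ∫ ω, G K ω ∂P = 0 := by
    intro K
    simp only [hGeq]
    rw [integral_finsetSum _ fun i hi => hGi K i (Finset.mem_range.1 hi)]
    refine Finset.sum_eq_zero fun i hi => ?_
    have hi' := Finset.mem_range.1 hi
    exact integral_mul_martingale_sub hmart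
      (Real.toNNReal_le_toNNReal (partPoint_mono hT.le K i.le_succ))
      (hgm K i hi').stronglyMeasurable (hgb K i hi')
  have hGm : ∀ K, AEStronglyMeasurable (G K) P := fun K => by
    have h1 : Integrable (fun ω => ∑ i ∈ Finset.range K,
      (A.indicator 1 ω * (κ (partPoint h T K i) * M (partPoint h T K i) ω)) *
      (X (partPoint h T K (i + 1)).toNNReal ω - X (partPoint h T K i).toNNReal ω)) P :=
      integrable_finsetSum _ fun i hi => hGi K i (Finset.mem_range.1 hi)
    simpa only [← hGeq] using h1.aestronglyMeasurable
  have hTi := integrable_N hcp hip hmart hy T.toNNReal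
  have hcomp : Integrable (fun ω => ∫ s in (0 : ℝ)..T.toNNReal, lam s.toNNReal ω) P := by
    have := hTi.sub (hXi T.toNNReal)
    refine this.congr (ae_of_all _ fun ω => ?_)
    simp [hX]
  have hlim : Tendsto (fun K => ∫ ω, G K ω ∂P) atTop
      (𝓝 (∫ ω, A.indicator 1 ω * (M T ω - M h ω) ∂P)) := by
    refine tendsto_integral_filter_of_dominated_convergence
      (fun ω => C.N T.toNNReal ω + ∫ s in (0 : ℝ)..T.toNNReal, lam s.toNNReal ω)
      (Eventually.of_forall hGm) ?_ (hTi.add hcomp) ?_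
    · filter_upwards [eventually_gt_atTop 0] with K hK
      refine ae_of_all _ fun ω => ?_
      have hpos : ∀ u : ℝ, 0 ≤ u → 0 ≤ lam u.toNNReal ω := fun u hu =>
        (freeIntensity_pos p hy u).le.trans ((hip ω).bounds (hcp ω) hu).1
      have hmem : ∀ i ≤ K, 0 ≤ partPoint h T K i := fun i hi =>
        h0.trans (partPoint_mem hT.le hK hi).1
      have h1 : ‖G K ω‖ ≤ ∑ i ∈ Finset.range K,
          (((C.N (partPoint h T K (i + 1)).toNNReal ω : ℝ) +
            ∫ u in (0 : ℝ)..(partPoint h T K (i + 1)), lam u.toNNReal ω) -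
          (C.N (partPoint h T K i).toNNReal ω +
            ∫ u in (0 : ℝ)..(partPoint h T K i), lam u.toNNReal ω)) := by
        rw [hGeq]
        refine (norm_sum_le _ _).trans (Finset.sum_le_sum fun i hi => ?_)
        have hi' := Finset.mem_range.1 hi
        have hle := partPoint_mono hT.le K i.le_succ
        rw [norm_mul]
        refine (mul_le_of_le_one_left (norm_nonneg _) (hgb K i hi' ω)).trans ?_
        rw [hterm K i hi']
        have h2 : (C.N (partPoint h T K i).toNNReal ω : ℝ) ≤
            C.N (partPoint h T K (i + 1)).toNNReal ω :=
          Nat.cast_le.2 ((hcp ω).mono (Real.toNNReal_le_toNNReal hle))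
        have h3 : 0 ≤ ∫ u in (partPoint h T K i)..(partPoint h T K (i + 1)), lam u.toNNReal ω :=
          intervalIntegral.integral_nonneg hle fun u hu => hpos u ((hmem i hi'.le).trans hu.1)
        have h4 := intervalIntegral.integral_add_adjacent_intervals
          ((hip ω).integrable' 0 _ le_rfl (hmem i hi'.le))
          ((hip ω).integrable' _ _ (hmem i hi'.le) (hmem (i + 1) hi'))
        rw [Real.norm_eq_abs, abs_le]
        constructor <;> linarith
      refine h1.trans ?_
      rw [Finset.sum_range_sub (fun i => (C.N (partPoint h T K i).toNNReal ω : ℝ) +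
        ∫ u in (0 : ℝ)..(partPoint h T K i), lam u.toNNReal ω) K, partPoint_last h T hK,
        partPoint_zero, Real.coe_toNNReal _ (h0.trans hT.le)]
      have h5 : 0 ≤ ∫ u in (0 : ℝ)..h, lam u.toNNReal ω :=
        intervalIntegral.integral_nonneg h0 fun u hu => hpos u hu.1
      have h6 : (0 : ℝ) ≤ C.N h.toNNReal ω := Nat.cast_nonneg _
      linarith
    · refine ae_of_all _ fun ω => ?_
      refine ((tendsto_expFunctional_sum (hcp ω) (hip ω) hφ hφ0 hβ hy h0 hT).const_mul
        (A.indicator 1 ω)).congr fun K => ?_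
      simp only [hG]
      congr 1
      refine Finset.sum_congr rfl fun i hi => ?_
      rw [hterm K i (Finset.mem_range.1 hi)]
  have hzero : ∫ ω, A.indicator 1 ω * (M T ω - M h ω) ∂P = 0 := by
    simp only [hG0] at hlim
    exact (tendsto_nhds_unique hlim tendsto_const_nhds)
  have hTT : T ∈ Set.Icc h T := ⟨hT.le, le_rfl⟩
  have hhh : h ∈ Set.Icc h T := ⟨le_rfl, hT.le⟩
  have h1 : ∫ ω in A, (M T ω - M h ω) ∂P = 0 := by
    rw [← integral_indicator hAm, ← hzero]
    congr 1; funext ω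
    by_cases hω : ω ∈ A <;> simp [hω]
  rw [integral_sub (hMi T hTT).integrableOn (hMi h hhh).integrableOn, sub_eq_zero] at h1
  simpa [hM, expFunctional, hβ.terminal] using h1

end

end HawkesDividend

namespace HawkesDividend

variable {Ω : Type*} [mΩ : MeasurableSpace Ω] {P : Measure Ω} {p : Params} {y : ℝ}
  {C : ClaimProcess Ω} {f : ℝ → ℝ}

/-- Integrating a step function on the grid against a counting path. -/
theorem CountingPath.tendsto_integral_gridApprox {n : ℝ≥0 → ℕ} (hn : CountingPath n) {w : ℕ → ℝ}
    (hw : ∀ j, 0 ≤ w j) (M k : ℕ) (h : ℝ≥0) :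
    Tendsto (fun m => ∫ u in (h : ℝ)..(h + k / M), gridApprox w M k m (u - h) ∂hn.stieltjes.measure)
      atTop (𝓝 (gridSum w M k fun t => n (h + t))) := by
  have hT : (h : ℝ) ≤ h + k / M := le_add_of_nonneg_right (by positivity)
  set μ := hn.stieltjes.measure.restrict (Set.Ioc (h : ℝ) (h + k / M)) with hμ
  have hfin : IsFiniteMeasure μ := ⟨by
    rw [hμ, Measure.restrict_apply_univ, hn.measure_Ioc]; exact ENNReal.ofReal_lt_top⟩
  have h1 : Tendsto (fun m => ∫ u, gridApprox w M k m (u - h) ∂μ) atTop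
      (𝓝 (∫ u, gridStep w M k (u - h) ∂μ)) := by
    refine tendsto_integral_of_dominated_convergence (fun _ => ∑ j ∈ Finset.range k, w j)
      (fun m => ((continuous_gridApprox w M k m).comp (by fun_prop)).aestronglyMeasurable)
      (integrable_const _) (fun m => ae_of_all _ fun u => ?_)
      (ae_of_all _ fun u => tendsto_gridApprox w M k (u - h))
    rw [Real.norm_eq_abs, abs_of_nonneg (gridApprox_nonneg hw M k m _)]
    exact gridApprox_le hw M k m _
  have hind : ∀ j : ℕ, j ≤ k →
      Integrable (fun u : ℝ => if 0 < u - h - j / M then (1 : ℝ) else 0) μ ∧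
      ∫ u, (if 0 < u - h - j / M then (1 : ℝ) else 0) ∂μ =
        (n (h + k / M) : ℝ) - n (h + j / M) := by
    intro j hj
    have hs : MeasurableSet {u : ℝ | 0 < u - h - j / M} :=
      measurableSet_lt measurable_const (by fun_prop)
    have he : (fun u : ℝ => if 0 < u - h - j / M then (1 : ℝ) else 0) =
        {u : ℝ | 0 < u - h - j / M}.indicator fun _ => 1 := by
      funext u; simp [Set.indicator_apply]
    have hjk : ((h : ℝ) + j / M) ≤ h + k / M := by gcongr
    rw [he]
    refine ⟨(integrable_const 1).indicator hs, ?_⟩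
    rw [integral_indicator hs, hμ, Measure.restrict_restrict hs]
    have h2 : {u : ℝ | 0 < u - h - j / M} ∩ Set.Ioc (h : ℝ) (h + k / M) =
        Set.Ioc ((h : ℝ) + j / M) (h + k / M) := by
      ext u
      have : (0 : ℝ) ≤ j / M := by positivity
      simp only [Set.mem_inter_iff, Set.mem_ofPred_eq, Set.mem_Ioc]
      constructor
      · rintro ⟨h1, h2, h3⟩; exact ⟨by linarith, h3⟩
      · rintro ⟨h1, h2⟩; exact ⟨by linarith, by linarith, h2⟩
    rw [h2, setIntegral_const, smul_eq_mul, mul_one, hn.measureReal_Ioc hjk, hn.stieltjes_apply,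
      hn.stieltjes_apply]
    have e : ∀ i : ℕ, ((h : ℝ) + i / M).toNNReal = h + i / M := fun i => by
      rw [← NNReal.coe_natCast i, ← NNReal.coe_natCast M, ← NNReal.coe_div, ← NNReal.coe_add,
        Real.toNNReal_coe]
    rw [e, e]
  have h2 : ∫ u, gridStep w M k (u - h) ∂μ = gridSum w M k fun t => n (h + t) := by
    unfold gridStep gridSum
    have hi : ∀ j ∈ Finset.range k, Integrable (fun u : ℝ => w j *
        ((if 0 < u - h - j / M then (1 : ℝ) else 0) -
          (if 0 < u - h - (j + 1) / M then (1 : ℝ) else 0))) μ := fun j hj => by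
      have hj' := Finset.mem_range.1 hj
      have := (hind (j + 1) hj').1
      push_cast at this
      exact ((hind j hj'.le).1.sub this).const_mul _
    rw [integral_finsetSum _ hi]
    refine Finset.sum_congr rfl fun j hj => ?_
    have hj' := Finset.mem_range.1 hj
    have e1 := hind j hj'.le
    have e2 := hind (j + 1) hj'
    push_cast at e2
    rw [integral_const_mul, integral_sub e1.1 e2.1, e1.2, e2.2]
    ring
  rw [← h2]
  simpa only [intervalIntegral.integral_of_le hT, hμ] using h1

variable [IsProbabilityMeasure P] {lam : ℝ≥0 → Ω → ℝ}
  (hcp : ∀ ω, CountingPath fun t => C.N t ω)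
  (hip : ∀ ω, IntensityPath p y (fun t => C.N t ω) fun t => lam t ω)
  (hmart : Martingale (fun t ω => (C.N t ω : ℝ) - ∫ s in (0 : ℝ)..t, lam s.toNNReal ω)
    (C.filtration P) P) (hy : p.b ≤ y)

include hcp hip hmart hy in
/-- On the event of no claim until `h` the intensity at time `h` is deterministic, so that the
martingale property of the exponential functional gives the Laplace transform explicitly. -/
theorem tendsto_gridSum_of_intensity {w : ℕ → ℝ} (hw : ∀ j, 0 ≤ w j) (M n : ℕ) (h : ℝ≥0)
    {β : ℕ → ℝ → ℝ} (hβ : ∀ m, IsRiccati p.a p.η (gridApprox w M n m) (β m) 0 (n / M)) :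
    Tendsto (fun m => P.real {ω | C.N h ω = 0} *
        Real.exp (-(p.a * p.b * ∫ s in (0 : ℝ)..(n / M), β m s) - β m 0 * freeIntensity p y h))
      atTop (𝓝 (∫ ω in {ω | C.N h ω = 0},
        Real.exp (-gridSum w M n fun t => C.N (h + t) ω) ∂P)) := by
  have hT : (h : ℝ) ≤ h + n / M := le_add_of_nonneg_right (by positivity)
  set A : Set Ω := {ω | C.N h ω = 0} with hA
  have hAm : MeasurableSet[C.filtration P (h : ℝ).toNNReal] A := by
    rw [Real.toNNReal_coe]
    exact C.measurable_N_filtration P le_rfl (measurableSet_singleton 0)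
  have hAm' : MeasurableSet A := (C.filtration P).le _ _ hAm
  have h1 : ∀ m, ∫ ω in A, Real.exp (-∫ u in (h : ℝ)..(h + n / M), gridApprox w M n m (u - h)
      ∂(hcp ω).stieltjes.measure) ∂P = P.real A *
      Real.exp (-(p.a * p.b * ∫ s in (0 : ℝ)..(n / M), β m s) - β m 0 * freeIntensity p y h) := by
    intro m
    rw [integral_expFunctional hcp hip hmart hy (φ := fun u => gridApprox w M n m (u - h))
      ((continuous_gridApprox w M n m).comp (by fun_prop))
      (fun t => gridApprox_nonneg hw M n m _) ((hβ m).shift h) h.coe_nonneg hT hAm]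
    rw [← smul_eq_mul (a := P.real A), ← setIntegral_const]
    refine setIntegral_congr_fun hAm' fun ω hω => ?_
    have e := (hip ω).eq_freeIntensity (hcp ω) h.coe_nonneg (by rw [Real.toNNReal_coe]; exact hω)
    simp only [intervalIntegral.integral_comp_sub_right, sub_self, add_sub_cancel_left, e]
  simp only [← h1]
  refine tendsto_integral_of_dominated_convergence (fun _ => (1 : ℝ)) (fun m => ?_)
    (integrable_const _) (fun m => ae_of_all _ fun ω => ?_) (ae_of_all _ fun ω => ?_)
  · have := measurable_setIntegral_path (P := P) hcp
      (φ := fun u => gridApprox w M n m (u - h))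
      ((continuous_gridApprox w M n m).comp (by fun_prop)) hT
    exact (Real.measurable_exp.comp
      (this.mono ((C.filtration P).le _) le_rfl).neg).aestronglyMeasurable
  · rw [Real.norm_eq_abs, Real.abs_exp]
    exact Real.exp_le_one_iff.2 (neg_nonpos.2 (intervalIntegral.integral_nonneg hT
      fun u _ => gridApprox_nonneg hw M n m _))
  · exact ((hcp ω).tendsto_integral_gridApprox hw M n h).neg.rexp

include hcp hip hmart hy in
/-- The probability of no claim is the limit, as `k → ∞`, of the Laplace transform of the number
of claims at `k`; the solution of the Riccati equation at time `s` is at most `h - s`, whatever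
`k` is. -/
theorem measureReal_no_claim_ge (h : ℝ≥0) :
    Real.exp (-(p.a * p.b * h ^ 2 + h * y)) ≤ P.real {ω | C.N h ω = 0} := by
  have hy0 : 0 < y := p.b_pos.trans_le hy
  have hab := mul_pos p.a_pos p.b_pos
  have hge : ∀ k : ℕ, Real.exp (-(p.a * p.b * h ^ 2 + h * y)) ≤
      ∫ ω, Real.exp (-((k : ℝ) * C.N h ω)) ∂P := by
    intro k
    obtain ⟨β, hβ⟩ := exists_isRiccati (φ := fun _ => (k : ℝ)) p.a_pos p.η_pos.le
      continuous_const (fun _ => Nat.cast_nonneg k) h.coe_nonneg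
    have h1 := integral_expFunctional hcp hip hmart hy (continuous_const (y := (k : ℝ)))
      (fun _ => Nat.cast_nonneg k) hβ le_rfl h.coe_nonneg (A := Set.univ) MeasurableSet.univ
    simp only [Measure.restrict_univ] at h1
    have h2 : ∀ ω, ∫ _ in (0 : ℝ)..h, (k : ℝ) ∂(hcp ω).stieltjes.measure = k * C.N h ω := by
      intro ω
      rw [intervalIntegral.integral_of_le h.coe_nonneg, setIntegral_const,
        (hcp ω).measureReal_Ioc h.coe_nonneg, (hcp ω).stieltjes_apply, (hcp ω).stieltjes_apply,
        Real.toNNReal_coe, Real.toNNReal_zero,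
        (hcp ω).zero]
      simp [mul_comm]
    have h3 : ∀ ω, lam (0 : ℝ).toNNReal ω = y := by
      intro ω
      rw [Real.toNNReal_zero, (hip ω).eq 0]
      simp [(hcp ω).zero]
    simp only [h2, h3, integral_const, probReal_univ, one_smul] at h1
    rw [h1]
    refine Real.exp_le_exp.2 ?_
    have h4 : ∫ s in (0 : ℝ)..h, β s ≤ ∫ s in (0 : ℝ)..h, (h : ℝ) :=
      intervalIntegral.integral_mono_on h.coe_nonneg (hβ.continuous.intervalIntegrable _ _)
        (by simp) fun s hs => (hβ.le_sub s hs).trans (by simpa using hs.1)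
    simp only [intervalIntegral.integral_const, smul_eq_mul, sub_zero] at h4
    have h5 := hβ.le_sub 0 ⟨le_rfl, h.coe_nonneg⟩
    simp only [sub_zero] at h5
    have h6 := mul_le_mul_of_nonneg_left h4 hab.le
    have h7 := mul_le_mul_of_nonneg_right h5 hy0.le
    nlinarith
  have hm : MeasurableSet {ω | C.N h ω = 0} := C.measurable_N h (measurableSet_singleton 0)
  have hlim : Tendsto (fun k : ℕ => ∫ ω, Real.exp (-((k : ℝ) * C.N h ω)) ∂P) atTop
      (𝓝 (∫ ω, {ω | C.N h ω = 0}.indicator 1 ω ∂P)) := by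
    refine tendsto_integral_of_dominated_convergence (fun _ => (1 : ℝ)) (fun k => ?_)
      (integrable_const _) (fun k => ae_of_all _ fun ω => ?_) (ae_of_all _ fun ω => ?_)
    · have : Measurable fun ω => (C.N h ω : ℝ) :=
        (measurable_from_top (f := fun k : ℕ => (k : ℝ))).comp (C.measurable_N h)
      exact (Real.measurable_exp.comp (this.const_mul _).neg).aestronglyMeasurable
    · rw [Real.norm_eq_abs, Real.abs_exp]
      exact Real.exp_le_one_iff.2 (neg_nonpos.2 (by positivity))
    · by_cases h0 : C.N h ω = 0
      · simp [h0]
      · rw [Set.indicator_of_notMem (by simpa using h0)]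
        have : (0 : ℝ) < C.N h ω := by exact_mod_cast Nat.pos_of_ne_zero h0
        exact Real.tendsto_exp_neg_atTop_nhds_zero.comp
          (tendsto_natCast_atTop_atTop.atTop_mul_const this)
  rw [integral_indicator_one hm] at hlim
  exact ge_of_tendsto' hlim hge

end HawkesDividend

namespace HawkesDividend

/-! ### Uniqueness of laws from Laplace transforms -/

section Laplace

variable {ι : Type*} [Fintype ι]

/-- The function `x ↦ exp (-⟨u, x⟩)` on the positive orthant. -/
noncomputable def laplaceFun (u : ι → ℝ≥0) : BoundedContinuousFunction (ι → ℝ≥0) ℝ :=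
  BoundedContinuousFunction.ofNormedAddCommGroup
    (fun x => Real.exp (-∑ i, (u i : ℝ) * x i)) (by fun_prop) 1 fun x => by
      rw [Real.norm_eq_abs, Real.abs_exp]
      exact Real.exp_le_one_iff.2 (neg_nonpos.2 (Finset.sum_nonneg fun i _ =>
        mul_nonneg (u i).2 (x i).2))

theorem laplaceFun_apply (u x : ι → ℝ≥0) :
    laplaceFun u x = Real.exp (-∑ i, (u i : ℝ) * x i) := rfl

/-- The exponentials `laplaceFun u` form a monoid. -/
noncomputable def laplaceMonoid (ι : Type*) [Fintype ι] :
    Submonoid (BoundedContinuousFunction (ι → ℝ≥0) ℝ) where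
  carrier := Set.range laplaceFun
  one_mem' := ⟨0, by ext x; simp [laplaceFun_apply]⟩
  mul_mem' := by
    rintro _ _ ⟨u, rfl⟩ ⟨v, rfl⟩
    refine ⟨u + v, ?_⟩
    ext x
    simp only [laplaceFun_apply, BoundedContinuousFunction.coe_mul, Pi.mul_apply, ← Real.exp_add,
      Pi.add_apply, NNReal.coe_add, add_mul, Finset.sum_add_distrib]
    congr 1; ring

/-- The algebra of exponential polynomials, dense by the Stone-Weierstrass theorem. -/
noncomputable def laplaceAlgebra (ι : Type*) [Fintype ι] :
    StarSubalgebra ℝ (BoundedContinuousFunction (ι → ℝ≥0) ℝ) where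
  toSubalgebra := Algebra.adjoin ℝ (laplaceMonoid ι)
  star_mem' := by
    intro g hg
    have : star g = g := by ext x; simp
    rwa [this]

/-- A finite measure on the positive orthant is determined by its Laplace transform. -/
theorem ext_of_laplace {μ ν : Measure (ι → ℝ≥0)} [IsFiniteMeasure μ] [IsFiniteMeasure ν]
    (h : ∀ u : ι → ℝ≥0, ∫ x, Real.exp (-∑ i, (u i : ℝ) * x i) ∂μ =
      ∫ x, Real.exp (-∑ i, (u i : ℝ) * x i) ∂ν) : μ = ν := by
  refine ext_of_forall_mem_subalgebra_integral_eq_of_polish (𝕜 := ℝ) (A := laplaceAlgebra ι) ?_ ?_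
  · classical
    intro x y hxy
    obtain ⟨i, hi⟩ := Function.ne_iff.1 hxy
    refine ⟨laplaceFun (Pi.single i 1), ⟨(laplaceFun (Pi.single i 1)).toContinuousMap,
      ⟨laplaceFun (Pi.single i 1), Algebra.subset_adjoin ⟨_, rfl⟩, rfl⟩, rfl⟩, ?_⟩
    have e : ∀ z : ι → ℝ≥0, laplaceFun (Pi.single i 1) z = Real.exp (-(z i : ℝ)) := by
      intro z
      rw [laplaceFun_apply, Finset.sum_eq_single i]
      · simp
      · intro j _ hj; simp [hj]
      · simp
    rw [e, e]
    intro he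
    exact hi (NNReal.coe_injective (neg_injective (Real.exp_injective he)))
  · intro g hg
    have hg' : g ∈ Submodule.span ℝ (laplaceMonoid ι : Set _) := by
      have : g ∈ Subalgebra.toSubmodule (Algebra.adjoin ℝ (laplaceMonoid ι : Set _)) := hg
      rwa [Algebra.adjoin_eq_span, Submonoid.closure_eq] at this
    clear hg
    induction hg' using Submodule.span_induction with
    | mem x hx => obtain ⟨u, rfl⟩ := hx; exact h u
    | zero => simp
    | add x z _ _ hx hz =>
      simp only [BoundedContinuousFunction.coe_add, Pi.add_apply]
      rw [integral_add (x.integrable μ) (z.integrable μ), integral_add (x.integrable ν)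
        (z.integrable ν), hx, hz]
    | smul c x _ hx =>
      simp only [BoundedContinuousFunction.coe_smul]
      rw [integral_smul, integral_smul, hx]

end Laplace

/-- A pair of increasing processes starting at zero. -/
structure IsIncreasingPair {Ω : Type*} [MeasurableSpace Ω] (μ : Measure Ω)
    (N T : ℝ≥0 → Ω → ℝ) : Prop where
  measurable_fst : ∀ t, Measurable (N t)
  measurable_snd : ∀ t, Measurable (T t)
  zero : ∀ᵐ ω ∂μ, N 0 ω = 0 ∧ T 0 ω = 0
  mono : ∀ᵐ ω ∂μ, Monotone (fun t => N t ω) ∧ Monotone fun t => T t ω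

/-- The space of pairs of real paths, observed at rational times. -/
abbrev PathSpace : Type := ℚ≥0 → ℝ × ℝ

/-- The paths of a pair of processes, observed at rational times. -/
def ratPath {Ω : Type*} (N T : ℝ≥0 → Ω → ℝ) (ω : Ω) : PathSpace := fun q => (N q ω, T q ω)

theorem IsIncreasingPair.measurable_ratPath {Ω : Type*} [MeasurableSpace Ω] {μ : Measure Ω}
    {N T : ℝ≥0 → Ω → ℝ} (h : IsIncreasingPair μ N T) : Measurable (ratPath N T) :=
  measurable_pi_lambda _ fun q => (h.measurable_fst q).prodMk (h.measurable_snd q)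

/-- The Laplace transform of the increments on a grid. -/
noncomputable def gridLaplace {Ω : Type*} [MeasurableSpace Ω] (μ : Measure Ω) (N T : ℝ≥0 → Ω → ℝ)
    (u v : ℕ → ℝ) (M n : ℕ) : ℝ :=
  ∫ ω, Real.exp (-(∑ j ∈ Finset.range n, (u j * (N ((j + 1) / M) ω - N (j / M) ω) +
    v j * (T ((j + 1) / M) ω - T (j / M) ω)))) ∂μ

/-- Finitely many rational times lie on a common grid. -/
theorem exists_common_grid (I : Finset ℚ≥0) : ∃ M n : ℕ, 0 < M ∧ ∀ q ∈ I, ∃ j ≤ n,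
    (q : ℝ≥0) = j / M := by
  classical
  have hM : 0 < ∏ q ∈ I, q.den := Finset.prod_pos fun q _ => q.den_pos
  refine ⟨∏ q ∈ I, q.den, ∑ q ∈ I, q.num * ∏ r ∈ I.erase q, r.den, hM, fun q hq =>
    ⟨q.num * ∏ r ∈ I.erase q, r.den, ?_, ?_⟩⟩
  · exact Finset.single_le_sum (f := fun q : ℚ≥0 => q.num * ∏ r ∈ I.erase q, r.den)
      (fun _ _ => Nat.zero_le _) hq
  · have h1 : (∏ r ∈ I.erase q, (r.den : ℝ≥0)) ≠ 0 :=
      Finset.prod_ne_zero_iff.2 fun r _ => Nat.cast_ne_zero.2 r.den_pos.ne'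
    rw [← Finset.mul_prod_erase I _ hq]
    push_cast
    rw [mul_div_mul_right _ _ h1, NNRat.cast_def]

/-- The increments of a pair of processes on the grid `j / M`, `j ≤ n`. -/
noncomputable def gridIncr {Ω : Type*} (N T : ℝ≥0 → Ω → ℝ) (M n : ℕ) (ω : Ω) :
    Fin n × Bool → ℝ≥0 := fun i =>
  if i.2 then (N ((i.1 + 1) / M) ω - N (i.1 / M) ω).toNNReal
  else (T ((i.1 + 1) / M) ω - T (i.1 / M) ω).toNNReal

/-- The values of a pair of processes at the grid points `j q / M`, in terms of its increments. -/
noncomputable def gridRebuild (n : ℕ) (I : Finset ℚ≥0) (j : ℚ≥0 → ℕ) (x : Fin n × Bool → ℝ≥0)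
    (q : I) : ℝ × ℝ :=
  (∑ i : Fin n, if (i : ℕ) < j q then (x (i, true) : ℝ) else 0,
    ∑ i : Fin n, if (i : ℕ) < j q then (x (i, false) : ℝ) else 0)

theorem measurable_gridRebuild (n : ℕ) (I : Finset ℚ≥0) (j : ℚ≥0 → ℕ) :
    Measurable (gridRebuild n I j) := by
  refine measurable_pi_lambda _ fun q => Measurable.prodMk ?_ ?_
  all_goals
    refine Finset.measurable_fun_sum _ fun i _ => ?_
    split_ifs
    · exact measurable_coe_nnreal_real.comp (measurable_pi_apply _)
    · exact measurable_const

section Grid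

variable {Ω : Type*} [MeasurableSpace Ω] {μ : Measure Ω} {N T : ℝ≥0 → Ω → ℝ}
  (h : IsIncreasingPair μ N T)
include h

theorem IsIncreasingPair.measurable_gridIncr (M n : ℕ) : Measurable (gridIncr N T M n) := by
  refine measurable_pi_lambda _ fun i => ?_
  unfold gridIncr
  split_ifs
  · exact ((h.measurable_fst _).sub (h.measurable_fst _)).real_toNNReal
  · exact ((h.measurable_snd _).sub (h.measurable_snd _)).real_toNNReal

theorem IsIncreasingPair.coe_gridIncr (M n : ℕ) : ∀ᵐ ω ∂μ, ∀ i : Fin n,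
    (gridIncr N T M n ω (i, true) : ℝ) = N ((i + 1) / M) ω - N (i / M) ω ∧
    (gridIncr N T M n ω (i, false) : ℝ) = T ((i + 1) / M) ω - T (i / M) ω := by
  filter_upwards [h.mono] with ω hω i
  have hle : ((i : ℕ) / M : ℝ≥0) ≤ ((i : ℕ) + 1) / M := by gcongr; simp
  constructor
  · exact Real.coe_toNNReal _ (sub_nonneg.2 (hω.1 hle))
  · exact Real.coe_toNNReal _ (sub_nonneg.2 (hω.2 hle))

theorem IsIncreasingPair.rebuild (M n : ℕ) (I : Finset ℚ≥0) (j : ℚ≥0 → ℕ)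
    (hj : ∀ q ∈ I, j q ≤ n ∧ (q : ℝ≥0) = j q / M) :
    ∀ᵐ ω ∂μ, I.restrict (ratPath N T ω) = gridRebuild n I j (gridIncr N T M n ω) := by
  filter_upwards [h.coe_gridIncr M n, h.zero] with ω hω h0
  funext q
  have hsum : ∀ g : ℕ → ℝ, ∑ i : Fin n, (if (i : ℕ) < j q then g (i + 1) - g i else 0) =
      g (j q) - g 0 := by
    intro g
    rw [Fin.sum_univ_eq_sum_range (fun i => if i < j q then g (i + 1) - g i else 0) n,
      ← Finset.sum_filter, ← Finset.sum_range_sub]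
    congr 1
    ext i
    have := (hj q q.2).1
    simp only [Finset.mem_filter, Finset.mem_range]
    lia
  have e1 := hsum fun i => N (i / M) ω
  have e2 := hsum fun i => T (i / M) ω
  simp only [Nat.cast_add, Nat.cast_one, Nat.cast_zero, zero_div, h0.1, h0.2, sub_zero] at e1 e2
  simp only [gridRebuild, (hω _).1, (hω _).2, e1, e2, Finset.restrict, ratPath, (hj q q.2).2]

theorem IsIncreasingPair.integral_exp_gridIncr (M n : ℕ) (x : Fin n × Bool → ℝ≥0) :
    ∫ z, Real.exp (-∑ i, (x i : ℝ) * z i) ∂(μ.map (gridIncr N T M n)) =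
      gridLaplace μ N T (fun j => if hj : j < n then (x (⟨j, hj⟩, true) : ℝ) else 0)
        (fun j => if hj : j < n then (x (⟨j, hj⟩, false) : ℝ) else 0) M n := by
  rw [integral_map (h.measurable_gridIncr M n).aemeasurable
    (Continuous.aestronglyMeasurable (by fun_prop)), gridLaplace]
  refine integral_congr_ae ?_
  filter_upwards [h.coe_gridIncr M n] with ω hω
  congr 2
  rw [Fintype.sum_prod_type, Finset.sum_range]
  refine Finset.sum_congr rfl fun i _ => ?_
  simp [(hω i).1, (hω i).2]

end Grid

/-- Pairs of increasing processes with the same Laplace transforms on all grids have the same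
law. -/
theorem IsIncreasingPair.map_ratPath_eq {Ω₁ Ω₂ : Type*} [MeasurableSpace Ω₁] [MeasurableSpace Ω₂]
    {μ₁ : Measure Ω₁} {μ₂ : Measure Ω₂} [IsFiniteMeasure μ₁] [IsFiniteMeasure μ₂]
    {N₁ T₁ : ℝ≥0 → Ω₁ → ℝ} {N₂ T₂ : ℝ≥0 → Ω₂ → ℝ} (h₁ : IsIncreasingPair μ₁ N₁ T₁)
    (h₂ : IsIncreasingPair μ₂ N₂ T₂)
    (h : ∀ (u v : ℕ → ℝ) (M n : ℕ), (∀ j, 0 ≤ u j) → (∀ j, 0 ≤ v j) → 0 < M →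
      gridLaplace μ₁ N₁ T₁ u v M n = gridLaplace μ₂ N₂ T₂ u v M n) :
    μ₁.map (ratPath N₁ T₁) = μ₂.map (ratPath N₂ T₂) := by
  have hpl : IsProjectiveLimit (μ₁.map (ratPath N₁ T₁))
      fun I => (μ₁.map (ratPath N₁ T₁)).map I.restrict := fun I => rfl
  refine IsProjectiveLimit.unique hpl fun I => ?_
  obtain ⟨M, n, hM, hI⟩ := exists_common_grid I
  choose! j hj using hI
  have hlaw : μ₁.map (gridIncr N₁ T₁ M n) = μ₂.map (gridIncr N₂ T₂ M n) := by
    refine ext_of_laplace fun x => ?_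
    rw [h₁.integral_exp_gridIncr, h₂.integral_exp_gridIncr]
    refine h _ _ M n (fun j => ?_) (fun j => ?_) hM <;> · split_ifs <;> simp
  have hI : Measurable (I.restrict : PathSpace → _) := Finset.measurable_restrict I
  rw [Measure.map_map hI h₁.measurable_ratPath, Measure.map_map hI h₂.measurable_ratPath]
  have e₁ : I.restrict ∘ ratPath N₁ T₁ =ᵐ[μ₁] gridRebuild n I j ∘ gridIncr N₁ T₁ M n :=
    h₁.rebuild M n I j hj
  have e₂ : I.restrict ∘ ratPath N₂ T₂ =ᵐ[μ₂] gridRebuild n I j ∘ gridIncr N₂ T₂ M n :=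
    h₂.rebuild M n I j hj
  rw [Measure.map_congr e₁, Measure.map_congr e₂,
    ← Measure.map_map (measurable_gridRebuild n I j) (h₁.measurable_gridIncr M n),
    ← Measure.map_map (measurable_gridRebuild n I j) (h₂.measurable_gridIncr M n), hlaw]

end HawkesDividend

namespace HawkesDividend

/-! ### Laplace transforms of the claim amounts -/

/-- A sum over consecutive blocks is a weighted sum, and so for products. -/
theorem exists_block_weights {K : ℕ → ℕ} (hK : Monotone K) {v : ℕ → ℝ} (n : ℕ) :
    ∃ c : ℕ → ℝ, (∀ x : ℕ → ℝ, ∑ j ∈ Finset.range n, v j * ∑ k ∈ Finset.Ico (K j) (K (j + 1)), x k =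
      ∑ k ∈ Finset.Ico (K 0) (K n), c k * x k) ∧
      ∀ θ : ℝ → ℝ, ∏ k ∈ Finset.Ico (K 0) (K n), θ (c k) =
        ∏ j ∈ Finset.range n, θ (v j) ^ (K (j + 1) - K j) := by
  induction n with
  | zero => exact ⟨fun _ => 0, by simp, by simp⟩
  | succ n ih =>
    obtain ⟨c, hc, hθ⟩ := ih
    refine ⟨fun k => if k < K n then c k else v n, fun x => ?_, fun θ => ?_⟩
    · rw [Finset.sum_range_succ, hc, ← Finset.sum_Ico_consecutive _ (hK (Nat.zero_le n))
        (hK n.le_succ), Finset.mul_sum]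
      congr 1
      · exact Finset.sum_congr rfl fun k hk => by simp only [if_pos (Finset.mem_Ico.1 hk).2]
      · exact Finset.sum_congr rfl fun k hk => by
          simp only [if_neg (not_lt.2 (Finset.mem_Ico.1 hk).1)]
    · rw [Finset.prod_range_succ, ← hθ, ← Finset.prod_Ico_consecutive _ (hK (Nat.zero_le n))
        (hK n.le_succ)]
      congr 1
      · exact Finset.prod_congr rfl fun k hk => by simp only [if_pos (Finset.mem_Ico.1 hk).2]
      · rw [← Nat.card_Ico, ← Finset.prod_const]
        exact Finset.prod_congr rfl fun k hk => by
          simp only [if_neg (not_lt.2 (Finset.mem_Ico.1 hk).1)]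

/-- Marks `Y` attached to the points counted by an independent sequence `K`: the marks are
positive, independent and identically distributed with law `κ`. -/
structure IsMarking {Ω : Type*} [MeasurableSpace Ω] (Q : Measure Ω) (κ : Measure ℝ)
    (Y : ℕ → Ω → ℝ) (K : Ω → ℕ → ℕ) : Prop where
  measurable_Y : ∀ k, Measurable (Y k)
  measurable_K : Measurable K
  mono : ∀ᵐ ω ∂Q, Monotone (K ω)
  pos : ∀ k, ∀ᵐ ω ∂Q, 0 < Y k ω
  law : ∀ k, Q.map (Y k) = κ
  indep : iIndepFun Y Q
  indep_K : IndepFun (fun ω k => Y k ω) K Q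

/-- The Laplace transform of a mark. -/
noncomputable def markLaplace (κ : Measure ℝ) (v : ℝ) : ℝ := ∫ z, Real.exp (-(v * z)) ∂κ

theorem markLaplace_mem {Ω : Type*} [MeasurableSpace Ω] {Q : Measure Ω} [IsProbabilityMeasure Q]
    {Y : Ω → ℝ} (hY : Measurable Y) (hpos : ∀ᵐ ω ∂Q, 0 < Y ω) {v : ℝ} (hv : 0 ≤ v) :
    0 < markLaplace (Q.map Y) v ∧ markLaplace (Q.map Y) v ≤ 1 := by
  have hm : Measurable fun z : ℝ => Real.exp (-(v * z)) := by fun_prop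
  have hle : ∀ᵐ ω ∂Q, Real.exp (-(v * Y ω)) ≤ 1 := hpos.mono fun ω hω =>
    Real.exp_le_one_iff.2 (neg_nonpos.2 (mul_nonneg hv hω.le))
  have hi : Integrable (fun ω => Real.exp (-(v * Y ω))) Q :=
    Integrable.mono' (integrable_const 1) (hm.comp hY).aestronglyMeasurable
      (hle.mono fun ω hω => by rwa [Real.norm_eq_abs, Real.abs_exp])
  rw [markLaplace, integral_map hY.aemeasurable hm.aestronglyMeasurable]
  refine ⟨integral_exp_pos hi, (integral_mono_ae hi (integrable_const 1) hle).trans (by simp)⟩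

/-- Integrating out the marks: given the numbers `K`, the marks in the `j`-th block contribute one
factor `markLaplace κ (v j)` each. -/
theorem IsMarking.integral_eq {Ω : Type*} [MeasurableSpace Ω] {Q : Measure Ω}
    [IsProbabilityMeasure Q] {κ : Measure ℝ} {Y : ℕ → Ω → ℝ} {K : Ω → ℕ → ℕ}
    (hm : IsMarking Q κ Y K) {g : (ℕ → ℕ) → ℝ} (hg : Measurable g) (hg1 : ∀ k, |g k| ≤ 1)
    {v : ℕ → ℝ} (hv : ∀ j, 0 ≤ v j) (n : ℕ) :
    ∫ ω, g (K ω) * Real.exp (-∑ j ∈ Finset.range n, v j *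
      ∑ k ∈ Finset.Ico (K ω j) (K ω (j + 1)), Y k ω) ∂Q =
    ∫ ω, g (K ω) * Real.exp (-∑ j ∈ Finset.range n, -Real.log (markLaplace κ (v j)) *
      ((K ω (j + 1) : ℝ) - K ω j)) ∂Q := by
  have hYm : Measurable fun ω k => Y k ω := measurable_pi_lambda _ hm.measurable_Y
  set F : (ℕ → ℕ) × (ℕ → ℝ) → ℝ := fun z => g z.1 * Real.exp (-∑ j ∈ Finset.range n, v j *
      ∑ k ∈ Finset.Ico (z.1 j) (z.1 (j + 1)), z.2 k) with hF
  have hblock : ∀ j : ℕ, Measurable fun z : (ℕ → ℕ) × (ℕ → ℝ) =>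
      ∑ k ∈ Finset.Ico (z.1 j) (z.1 (j + 1)), z.2 k := by
    intro j
    have h1 : Measurable fun q : (ℕ × ℕ) × (ℕ → ℝ) => ∑ k ∈ Finset.Ico q.1.1 q.1.2, q.2 k :=
      measurable_from_prod_countable_right fun a =>
        Finset.measurable_fun_sum (Finset.Ico a.1 a.2) fun k _ => measurable_pi_apply k
    have h2 : Measurable fun z : (ℕ → ℕ) × (ℕ → ℝ) => ((z.1 j, z.1 (j + 1)), z.2) := by fun_prop
    exact h1.comp h2
  have hFm : Measurable F := (hg.comp measurable_fst).mul (Real.measurable_exp.comp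
    (Finset.measurable_fun_sum _ fun j _ => (hblock j).const_mul _).neg)
  have hKY : Measurable fun ω => (K ω, fun k => Y k ω) := hm.measurable_K.prodMk hYm
  have hmap := (indepFun_iff_map_prod_eq_prod_map_map hm.measurable_K.aemeasurable
    hYm.aemeasurable).1 hm.indep_K.symm
  have hposall : ∀ᵐ ω ∂Q, ∀ k, 0 < Y k ω := ae_all_iff.2 hm.pos
  have hFi : Integrable (fun ω => F (K ω, fun k => Y k ω)) Q := by
    refine Integrable.mono' (integrable_const 1) (hFm.comp hKY).aestronglyMeasurable ?_
    filter_upwards [hposall] with ω hω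
    rw [hF, norm_mul, Real.norm_eq_abs, Real.norm_eq_abs, Real.abs_exp]
    refine mul_le_one₀ (hg1 _) (Real.exp_pos _).le (Real.exp_le_one_iff.2 (neg_nonpos.2 ?_))
    exact Finset.sum_nonneg fun j _ => mul_nonneg (hv j) (Finset.sum_nonneg fun k _ => (hω k).le)
  have hFi' : Integrable F ((Q.map K).prod (Q.map fun ω k => Y k ω)) := by
    rw [← hmap, integrable_map_measure hFm.aestronglyMeasurable hKY.aemeasurable]
    exact hFi
  have h1 : ∫ ω, F (K ω, fun k => Y k ω) ∂Q = ∫ ω, ∫ ω', F (K ω, fun k => Y k ω') ∂Q ∂Q := by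
    rw [← integral_map (f := F) hKY.aemeasurable hFm.aestronglyMeasurable, hmap,
      integral_prod F hFi', integral_map hm.measurable_K.aemeasurable
        hFi'.integral_prod_left.aestronglyMeasurable]
    congr 1; funext ω
    rw [integral_map (f := fun z => F (K ω, z)) hYm.aemeasurable
      (hFm.comp (measurable_const.prodMk measurable_id)).aestronglyMeasurable]
  refine h1.trans (integral_congr_ae ?_)
  filter_upwards [hm.mono] with ω hω
  obtain ⟨c, hc, hθ⟩ := exists_block_weights hω (v := v) n
  have hθpos : ∀ j, 0 < markLaplace κ (v j) := fun j =>
    (hm.law 0) ▸ (markLaplace_mem (hm.measurable_Y 0) (hm.pos 0) (hv j)).1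
  simp only [hF, hc, integral_const_mul]
  congr 1
  have h2 : ∀ ω', Real.exp (-∑ k ∈ Finset.Ico (K ω 0) (K ω n), c k * Y k ω') =
      ∏ k : Finset.Ico (K ω 0) (K ω n), Real.exp (-(c k * Y k ω')) := by
    intro ω'
    rw [← Finset.sum_neg_distrib, Real.exp_sum, ← Finset.prod_coe_sort]
  have h3 := iIndepFun.integral_fun_prod_comp
    (X := fun (k : Finset.Ico (K ω 0) (K ω n)) => Y k) (μ := Q)
    (hm.indep.precomp (g := ((↑) : Finset.Ico (K ω 0) (K ω n) → ℕ)) Subtype.val_injective)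
    (f := fun k z => Real.exp (-(c k * z))) (fun k => (hm.measurable_Y k).aemeasurable)
    (fun k => Continuous.aestronglyMeasurable (by fun_prop))
  simp only [h2]
  rw [h3]
  have h4 : ∀ k, ∫ ω', Real.exp (-(c k * Y k ω')) ∂Q = markLaplace κ (c k) := by
    intro k
    rw [markLaplace, ← hm.law k, integral_map (hm.measurable_Y k).aemeasurable
      (Continuous.aestronglyMeasurable (by fun_prop))]
  simp only [h4]
  rw [Finset.prod_coe_sort (Finset.Ico (K ω 0) (K ω n)) fun k => markLaplace κ (c k), hθ,
    ← Finset.sum_neg_distrib, Real.exp_sum]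
  refine Finset.prod_congr rfl fun j _ => ?_
  rw [neg_mul, neg_neg, ← Nat.cast_sub (hω j.le_succ), mul_comm, Real.exp_nat_mul,
    Real.exp_log (hθpos j)]

end HawkesDividend

namespace HawkesDividend

/-! ### Identities in law between claim processes -/

variable {Ω : Type*} [mΩ : MeasurableSpace Ω] {P : Measure Ω}
  {p : Params} {y : ℝ} {C : ClaimProcess Ω} {f : ℝ → ℝ}

/-- The weight of a claim in a Laplace transform, once its size has been integrated out. -/
noncomputable def claimCost (f : ℝ → ℝ) (u v : ℕ → ℝ) (j : ℕ) : ℝ :=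
  u j - Real.log (markLaplace (volume.withDensity fun z => ENNReal.ofReal (f z)) (v j))

theorem IsHawkesModel.claimCost_nonneg [IsProbabilityMeasure P] (hC : IsHawkesModel p f P y C)
    {u v : ℕ → ℝ} (hu : ∀ j, 0 ≤ u j) (hv : ∀ j, 0 ≤ v j) (j : ℕ) : 0 ≤ claimCost f u v j := by
  have h := markLaplace_mem (C.measurable_Y 0) (hC.Y_pos 0) (hv j)
  rw [hC.Y_density 0] at h
  have := Real.log_nonpos h.1.le h.2
  unfold claimCost
  linarith [hu j]

theorem IsHawkesModel.isIncreasingPair (hC : IsHawkesModel p f P y C) :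
    IsIncreasingPair P (fun t ω => (C.N t ω : ℝ)) C.total where
  measurable_fst t := (measurable_from_top (f := fun k : ℕ => (k : ℝ))).comp (C.measurable_N t)
  measurable_snd := C.measurable_total
  zero := ae_of_all _ fun ω => by simp [ClaimProcess.total, hC.N_zero]
  mono := by
    filter_upwards [ae_all_iff.2 hC.Y_pos] with ω hω
    refine ⟨fun s t hst => Nat.cast_le.2 (hC.N_mono ω hst), fun s t hst => ?_⟩
    exact Finset.sum_le_sum_of_subset_of_nonneg (Finset.range_mono (hC.N_mono ω hst))
      fun k _ _ => (hω k).le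

/-- The claims after time `h`, observed when there is none before. -/
theorem IsHawkesModel.isIncreasingPair_shift (hC : IsHawkesModel p f P y C) (h : ℝ≥0) :
    IsIncreasingPair (P.restrict {ω | C.N h ω = 0}) (fun t ω => (C.N (h + t) ω : ℝ))
      (fun t => C.total (h + t)) where
  measurable_fst t := hC.isIncreasingPair.measurable_fst _
  measurable_snd t := C.measurable_total _
  zero := by
    refine (ae_restrict_iff' (C.measurable_N h (measurableSet_singleton 0))).2
      (ae_of_all _ fun ω hω => ?_)
    have : C.N h ω = 0 := hω
    simp [ClaimProcess.total, this]
  mono := by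
    filter_upwards [ae_restrict_of_ae hC.isIncreasingPair.mono] with ω hω
    exact ⟨fun s t hst => hω.1 (by gcongr), fun s t hst => hω.2 (by gcongr)⟩

/-- Integrating the marks out of a Laplace transform, on the event that `K` starts from zero. -/
theorem IsMarking.integral_exp_blocks {Q : Measure Ω} [IsProbabilityMeasure Q] {κ : Measure ℝ}
    {Y : ℕ → Ω → ℝ} {K : Ω → ℕ → ℕ} (hm : IsMarking Q κ Y K) {u v : ℕ → ℝ}
    (hu : ∀ j, 0 ≤ u j) (hv : ∀ j, 0 ≤ v j) (n : ℕ) :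
    ∫ ω in {ω | K ω 0 = 0}, Real.exp (-∑ j ∈ Finset.range n,
      (u j * ((K ω (j + 1) : ℝ) - K ω j) +
        v j * ∑ k ∈ Finset.Ico (K ω j) (K ω (j + 1)), Y k ω)) ∂Q =
    ∫ ω in {ω | K ω 0 = 0}, Real.exp (-∑ j ∈ Finset.range n,
      (u j - Real.log (markLaplace κ (v j))) * ((K ω (j + 1) : ℝ) - K ω j)) ∂Q := by
  have hA : MeasurableSet {ω | K ω 0 = 0} :=
    ((measurable_pi_apply 0).comp hm.measurable_K) (measurableSet_singleton 0)
  set g : (ℕ → ℕ) → ℝ := fun k => {k : ℕ → ℕ | k 0 = 0 ∧ ∀ j < n, k j ≤ k (j + 1)}.indicator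
    (fun k => Real.exp (-∑ j ∈ Finset.range n, u j * ((k (j + 1) : ℝ) - k j))) k with hg
  have hgm : Measurable g := by
    refine Measurable.indicator (by fun_prop) ?_
    measurability
  have hg1 : ∀ k, |g k| ≤ 1 := by
    intro k
    simp only [hg]
    by_cases hk : k ∈ {k : ℕ → ℕ | k 0 = 0 ∧ ∀ j < n, k j ≤ k (j + 1)}
    · rw [Set.indicator_of_mem hk, Real.abs_exp]
      refine Real.exp_le_one_iff.2
        (neg_nonpos.2 (Finset.sum_nonneg fun j hj => mul_nonneg (hu j) ?_))
      exact sub_nonneg.2 (Nat.cast_le.2 (hk.2 j (Finset.mem_range.1 hj)))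
    · rw [Set.indicator_of_notMem hk]; simp
  have hgK : ∀ᵐ ω ∂Q, g (K ω) = {ω | K ω 0 = 0}.indicator
      (fun ω => Real.exp (-∑ j ∈ Finset.range n, u j * ((K ω (j + 1) : ℝ) - K ω j))) ω := by
    filter_upwards [hm.mono] with ω hmono
    have h1 : K ω ∈ {k : ℕ → ℕ | k 0 = 0 ∧ ∀ j < n, k j ≤ k (j + 1)} ↔ ω ∈ {ω | K ω 0 = 0} :=
      ⟨fun h => h.1, fun h => ⟨h, fun j _ => hmono j.le_succ⟩⟩
    simp only [hg]
    by_cases hω : ω ∈ {ω | K ω 0 = 0}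
    · rw [Set.indicator_of_mem hω, Set.indicator_of_mem (h1.2 hω)]
    · rw [Set.indicator_of_notMem hω, Set.indicator_of_notMem (fun hh => hω (h1.1 hh))]
  have hind : ∀ F : Ω → ℝ, ∫ ω, g (K ω) * Real.exp (F ω) ∂Q = ∫ ω in {ω | K ω 0 = 0},
      Real.exp (-∑ j ∈ Finset.range n, u j * ((K ω (j + 1) : ℝ) - K ω j) + F ω) ∂Q := by
    intro F
    rw [← integral_indicator hA]
    refine integral_congr_ae ?_
    filter_upwards [hgK] with ω hω
    rw [hω]
    by_cases h0 : ω ∈ {ω | K ω 0 = 0}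
    · rw [Set.indicator_of_mem h0, Set.indicator_of_mem h0, Real.exp_add]
    · rw [Set.indicator_of_notMem h0, Set.indicator_of_notMem h0, zero_mul]
  have hmain := hm.integral_eq hgm hg1 hv n
  rw [hind, hind] at hmain
  simp only [← neg_add, ← Finset.sum_add_distrib] at hmain
  rw [hmain]
  congr 1; funext ω
  congr 2
  exact Finset.sum_congr rfl fun j _ => by ring

/-- The joint Laplace transform after time `h` reduces to one of the claim numbers alone, each claim
being charged with `claimCost`. -/
theorem IsHawkesModel.gridLaplace_shift [IsProbabilityMeasure P] (hC : IsHawkesModel p f P y C)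
    {u v : ℕ → ℝ} (hu : ∀ j, 0 ≤ u j) (hv : ∀ j, 0 ≤ v j) (M n : ℕ) (h : ℝ≥0) :
    gridLaplace (P.restrict {ω | C.N h ω = 0}) (fun t ω => (C.N (h + t) ω : ℝ))
      (fun t => C.total (h + t)) u v M n =
    ∫ ω in {ω | C.N h ω = 0},
      Real.exp (-gridSum (claimCost f u v) M n fun t => C.N (h + t) ω) ∂P := by
  have hm : IsMarking P (volume.withDensity fun z => ENNReal.ofReal (f z)) C.Y
      (fun ω j => C.N (h + j / M) ω) :=
    { measurable_Y := C.measurable_Y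
      measurable_K := measurable_pi_lambda _ fun j => C.measurable_N _
      mono := ae_of_all _ fun ω i j hij => hC.N_mono ω (by gcongr)
      pos := hC.Y_pos
      law := hC.Y_density
      indep := hC.Y_indep
      indep_K := hC.Y_indep_N.comp (φ := id)
        (ψ := fun (c : ℝ≥0 → ℕ) (j : ℕ) => c (h + j / M)) measurable_id
        (measurable_pi_lambda _ fun j => measurable_pi_apply (h + j / M : ℝ≥0)) }
  have hmain := hm.integral_exp_blocks hu hv n
  have htot : ∀ ω (j : ℕ), ∑ k ∈ Finset.Ico (C.N (h + j / M) ω) (C.N (h + (j + 1) / M) ω),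
      C.Y k ω = C.total (h + (j + 1) / M) ω - C.total (h + j / M) ω := by
    intro ω j
    rw [Finset.sum_Ico_eq_sub _ (hC.N_mono ω (by gcongr; simp))]
    rfl
  simp only [Nat.cast_add, Nat.cast_one, Nat.cast_zero, zero_div, add_zero, htot] at hmain
  exact hmain

/-- The number of excess claims when the initial intensity increases by `y₀`. -/
noncomputable def excessN (Ω : Type*) (p : Params) (y₀ : ℝ) (t : ℝ≥0) (z : (ℕ → ℝ) × Ω) : ℝ :=
  excessCount p.a p.η y₀ t z.1

/-- The aggregate amount of the excess claims. -/
noncomputable def excessTotal (C : ClaimProcess Ω) (p : Params) (y₀ : ℝ) (t : ℝ≥0)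
    (z : (ℕ → ℝ) × Ω) : ℝ := ∑ k ∈ Finset.range (excessCount p.a p.η y₀ t z.1), C.Y k z.2

theorem IsHawkesModel.isIncreasingPair_excess [IsProbabilityMeasure P]
    (hC : IsHawkesModel p f P y C) {y₀ : ℝ} (hy₀ : 0 < y₀) :
    IsIncreasingPair (expSeq.prod P) (excessN Ω p y₀) (excessTotal C p y₀) where
  measurable_fst t := (measurable_from_top (f := fun k : ℕ => (k : ℝ))).comp
    ((measurable_excessCount t).comp measurable_fst)
  measurable_snd t := by
    have h : Measurable fun q : ℕ × Ω => ∑ k ∈ Finset.range q.1, C.Y k q.2 :=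
      measurable_from_prod_countable_right fun n =>
        Finset.measurable_fun_sum (Finset.range n) fun k _ => C.measurable_Y k
    exact h.comp (((measurable_excessCount t).comp measurable_fst).prodMk measurable_snd)
  zero := by
    filter_upwards [Measure.quasiMeasurePreserving_fst.ae (ae_excessRegular p.a_pos p.η_pos hy₀)]
      with z hz
    simp [excessN, excessTotal, hz.count_zero p.a_pos p.η_pos hy₀]
  mono := by
    filter_upwards [Measure.quasiMeasurePreserving_fst.ae (ae_excessRegular p.a_pos p.η_pos hy₀),
      Measure.quasiMeasurePreserving_snd.ae (ae_all_iff.2 hC.Y_pos)] with z hz hY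
    refine ⟨fun s t hst => Nat.cast_le.2 (hz.count_mono hst), fun s t hst => ?_⟩
    exact Finset.sum_le_sum_of_subset_of_nonneg (Finset.range_mono (hz.count_mono hst))
      fun k _ _ => (hY k).le

/-- The same reduction to claim numbers for the excess claims. -/
theorem IsHawkesModel.gridLaplace_excess [IsProbabilityMeasure P] (hC : IsHawkesModel p f P y C)
    {y₀ : ℝ} (hy₀ : 0 < y₀) {u v : ℕ → ℝ} (hu : ∀ j, 0 ≤ u j) (hv : ∀ j, 0 ≤ v j) (M n : ℕ) :
    gridLaplace (expSeq.prod P) (excessN Ω p y₀) (excessTotal C p y₀) u v M n =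
    ∫ e, Real.exp (-gridSum (claimCost f u v) M n fun t => excessCount p.a p.η y₀ t e) ∂expSeq := by
  have hYm : Measurable fun ω k => C.Y k ω := measurable_pi_lambda _ C.measurable_Y
  have hKm : Measurable fun (e : ℕ → ℝ) (j : ℕ) => excessCount p.a p.η y₀ (j / M : ℝ≥0) e :=
    measurable_pi_lambda _ fun j => measurable_excessCount _
  have hsnd : (expSeq.prod P).map Prod.snd = P := by simp
  have hlaw : ∀ k, (expSeq.prod P).map (fun z : (ℕ → ℝ) × Ω => C.Y k z.2) = P.map (C.Y k) := by
    intro k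
    conv_rhs => rw [← hsnd]
    rw [Measure.map_map (C.measurable_Y k) measurable_snd]; rfl
  have hreg := Measure.quasiMeasurePreserving_fst (μ := expSeq) (ν := P) |>.ae
    (ae_excessRegular p.a_pos p.η_pos hy₀)
  have hm : IsMarking (expSeq.prod P) (volume.withDensity fun z => ENNReal.ofReal (f z))
      (fun k z => C.Y k z.2) (fun z j => excessCount p.a p.η y₀ (j / M : ℝ≥0) z.1) :=
    { measurable_Y := fun k => (C.measurable_Y k).comp measurable_snd
      measurable_K := hKm.comp measurable_fst
      mono := by
        filter_upwards [hreg] with z hz i j hij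
        exact hz.count_mono (by gcongr)
      pos := fun k => Measure.quasiMeasurePreserving_snd.ae (hC.Y_pos k)
      law := fun k => (hlaw k).trans (hC.Y_density k)
      indep := by
        refine (iIndepFun_iff_map_fun_eq_infinitePi_map fun k =>
          (C.measurable_Y k).comp measurable_snd).2 ?_
        have h1 := (iIndepFun_iff_map_fun_eq_infinitePi_map C.measurable_Y).1 hC.Y_indep
        have h2 : (expSeq.prod P).map (fun z k => C.Y k z.2) = P.map fun ω k => C.Y k ω := by
          conv_rhs => rw [← hsnd]
          rw [Measure.map_map hYm measurable_snd]; rfl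
        exact h2.trans (h1.trans (congrArg Measure.infinitePi (funext fun k => (hlaw k).symm)))
      indep_K := (indepFun_prod hKm hYm).symm }
  have hmain := hm.integral_exp_blocks hu hv n
  have h0 : {z : (ℕ → ℝ) × Ω | excessCount p.a p.η y₀ ((0 : ℕ) / M : ℝ≥0) z.1 = 0}
      =ᵐ[expSeq.prod P] Set.univ := by
    filter_upwards [hreg] with z hz
    refine propext ⟨fun _ => trivial, fun _ => ?_⟩
    change excessCount p.a p.η y₀ ((0 : ℕ) / M : ℝ≥0) z.1 = 0
    rw [Nat.cast_zero, zero_div, hz.count_zero p.a_pos p.η_pos hy₀]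
  rw [setIntegral_congr_set h0, setIntegral_congr_set h0, Measure.restrict_univ] at hmain
  have hright : ∫ z : (ℕ → ℝ) × Ω, Real.exp (-gridSum (claimCost f u v) M n
      fun t => excessCount p.a p.η y₀ t z.1) ∂(expSeq.prod P) =
      ∫ e, Real.exp
        (-gridSum (claimCost f u v) M n fun t => excessCount p.a p.η y₀ t e) ∂expSeq := by
    have h2 : (expSeq.prod P).map Prod.fst = expSeq := by simp
    conv_rhs => rw [← h2]
    rw [integral_map measurable_fst.aemeasurable]
    unfold gridSum
    refine (Real.measurable_exp.comp (Finset.measurable_fun_sum _ fun j _ =>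
      Measurable.const_mul (Measurable.sub ?_ ?_) _).neg).aestronglyMeasurable
    · exact (measurable_from_top (f := fun k : ℕ => (k : ℝ))).comp (measurable_excessCount _)
    · exact (measurable_from_top (f := fun k : ℕ => (k : ℝ))).comp (measurable_excessCount _)
  rw [← hright, gridLaplace]
  simp only [gridSum, claimCost]
  simp only [Nat.cast_add, Nat.cast_one] at hmain
  rw [← hmain]
  refine integral_congr_ae ?_
  filter_upwards [hreg] with z hz
  congr 2
  refine Finset.sum_congr rfl fun j _ => ?_
  rw [Finset.sum_Ico_eq_sub _ (hz.count_mono (by gcongr; simp))]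
  rfl

end HawkesDividend

namespace HawkesDividend

variable {Ω : Type*} [mΩ : MeasurableSpace Ω] {P : Measure Ω} [IsProbabilityMeasure P]
  {p : Params} {y y' : ℝ} {C C' : ClaimProcess Ω} {f : ℝ → ℝ}

/-- The claim history at rational times. -/
noncomputable def ClaimProcess.path (C : ClaimProcess Ω) : Ω → PathSpace :=
  ratPath (fun t ω => (C.N t ω : ℝ)) C.total

omit [IsProbabilityMeasure P] in
theorem IsHawkesModel.measurable_path (hC : IsHawkesModel p f P y C) : Measurable C.path :=
  hC.isIncreasingPair.measurable_ratPath

theorem exists_isRiccati_grid (p : Params) {w : ℕ → ℝ} (hw : ∀ j, 0 ≤ w j) (M n : ℕ) :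
    ∃ β : ℕ → ℝ → ℝ, ∀ m, IsRiccati p.a p.η (gridApprox w M n m) (β m) 0 (n / M) :=
  ⟨_, fun m => (exists_isRiccati p.a_pos p.η_pos.le (continuous_gridApprox w M n m)
    (gridApprox_nonneg hw M n m) (by positivity)).choose_spec⟩

omit [IsProbabilityMeasure P] in
theorem IsHawkesModel.exists_intensity (hC : IsHawkesModel p f P y C) : ∃ lam : ℝ≥0 → Ω → ℝ,
    (∀ ω, IntensityPath p y (fun t => C.N t ω) fun t => lam t ω) ∧
    Martingale (fun t ω => (C.N t ω : ℝ) - ∫ s in (0 : ℝ)..t, lam s.toNNReal ω)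
      (C.filtration P) P := by
  obtain ⟨lam, h1, h2, h3⟩ := hC.intensity
  exact ⟨lam, fun ω => ⟨h1 ω, h2 ω⟩, h3⟩

/-- The Laplace transform of the claim numbers on a grid after time `h`, if there is no claim
before, in terms of the Riccati equation. -/
theorem IsHawkesModel.tendsto_gridSum (hC : IsHawkesModel p f P y C) (hy : p.b ≤ y) {w : ℕ → ℝ}
    (hw : ∀ j, 0 ≤ w j) (M n : ℕ) (h : ℝ≥0) {β : ℕ → ℝ → ℝ}
    (hβ : ∀ m, IsRiccati p.a p.η (gridApprox w M n m) (β m) 0 (n / M)) :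
    Tendsto (fun m => P.real {ω | C.N h ω = 0} *
        Real.exp (-(p.a * p.b * ∫ s in (0 : ℝ)..(n / M), β m s) - β m 0 * freeIntensity p y h))
      atTop (𝓝 (∫ ω in {ω | C.N h ω = 0},
        Real.exp (-gridSum w M n fun t => C.N (h + t) ω) ∂P)) := by
  obtain ⟨lam, hip, hmart⟩ := hC.exists_intensity
  exact tendsto_gridSum_of_intensity hC.countingPath hip hmart hy hw M n h hβ

theorem IsHawkesModel.no_claim_ge (hC : IsHawkesModel p f P y C) (hy : p.b ≤ y) (h : ℝ≥0) :
    Real.exp (-(p.a * p.b * h ^ 2 + h * y)) ≤ P.real {ω | C.N h ω = 0} := by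
  obtain ⟨lam, hip, hmart⟩ := hC.exists_intensity
  exact measureReal_no_claim_ge hC.countingPath hip hmart hy h

theorem IsHawkesModel.tendsto_gridSum_zero (hC : IsHawkesModel p f P y C) (hy : p.b ≤ y)
    {w : ℕ → ℝ} (hw : ∀ j, 0 ≤ w j) (M n : ℕ) {β : ℕ → ℝ → ℝ}
    (hβ : ∀ m, IsRiccati p.a p.η (gridApprox w M n m) (β m) 0 (n / M)) :
    Tendsto (fun m => Real.exp (-(p.a * p.b * ∫ s in (0 : ℝ)..(n / M), β m s) - β m 0 * y))
      atTop (𝓝 (∫ ω, Real.exp (-gridSum w M n fun t => C.N t ω) ∂P)) := by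
  have h := hC.tendsto_gridSum hy hw M n 0 hβ
  simpa [hC.N_zero, freeIntensity] using h

theorem IsHawkesModel.gridLaplace_eq (hC : IsHawkesModel p f P y C) {u v : ℕ → ℝ}
    (hu : ∀ j, 0 ≤ u j) (hv : ∀ j, 0 ≤ v j) (M n : ℕ) :
    gridLaplace P (fun t ω => (C.N t ω : ℝ)) C.total u v M n =
    ∫ ω, Real.exp (-gridSum (claimCost f u v) M n fun t => C.N t ω) ∂P := by
  have h := hC.gridLaplace_shift hu hv M n 0
  simpa [hC.N_zero] using h

/-- The claims from initial intensity `y` together with independent excess claims. -/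
noncomputable def ClaimProcess.mergedPath (C : ClaimProcess Ω) (p : Params) (y₀ : ℝ) :
    Ω × ((ℕ → ℝ) × Ω) → PathSpace :=
  ratPath (fun t z => C.N t z.1 + excessN Ω p y₀ t z.2)
    (fun t z => C.total t z.1 + excessTotal C p y₀ t z.2)

theorem IsHawkesModel.isIncreasingPair_merged (hC : IsHawkesModel p f P y C) {y₀ : ℝ}
    (hy₀ : 0 < y₀) :
    IsIncreasingPair (P.prod (expSeq.prod P)) (fun t z => C.N t z.1 + excessN Ω p y₀ t z.2)
      (fun t z => C.total t z.1 + excessTotal C p y₀ t z.2) := by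
  have h1 := hC.isIncreasingPair
  have h2 := hC.isIncreasingPair_excess hy₀
  refine ⟨fun t => ((h1.measurable_fst t).comp measurable_fst).add
    ((h2.measurable_fst t).comp measurable_snd), fun t => ((h1.measurable_snd t).comp
    measurable_fst).add ((h2.measurable_snd t).comp measurable_snd), ?_, ?_⟩
  · filter_upwards [Measure.quasiMeasurePreserving_fst.ae h1.zero,
      Measure.quasiMeasurePreserving_snd.ae h2.zero] with z hz1 hz2
    exact ⟨by rw [hz1.1, hz2.1, add_zero], by rw [hz1.2, hz2.2, add_zero]⟩
  · filter_upwards [Measure.quasiMeasurePreserving_fst.ae h1.mono,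
      Measure.quasiMeasurePreserving_snd.ae h2.mono] with z hz1 hz2
    exact ⟨hz1.1.add hz2.1, hz1.2.add hz2.2⟩

/-- Adding independent excess claims of initial intensity `y' - y` to the claims from initial
intensity `y` yields the law of the claims from initial intensity `y'`. -/
theorem IsHawkesModel.map_mergedPath (hC : IsHawkesModel p f P y C)
    (hC' : IsHawkesModel p f P y' C') (hy : p.b ≤ y) (hyy' : y < y') :
    (P.prod (expSeq.prod P)).map (C.mergedPath p (y' - y)) = P.map C'.path := by
  have hy₀ : 0 < y' - y := sub_pos.2 hyy'
  refine (hC.isIncreasingPair_merged hy₀).map_ratPath_eq hC'.isIncreasingPair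
    fun u v M n hu hv _ => ?_
  set w := claimCost f u v with hw
  have hw0 : ∀ j, 0 ≤ w j := hC.claimCost_nonneg hu hv
  obtain ⟨β, hβ⟩ := exists_isRiccati_grid p hw0 M n
  have h1 := hC.tendsto_gridSum_zero hy hw0 M n hβ
  have h2 := tendsto_excess_gridSum p.a_pos p.η_pos hy₀ hw0 M n hβ
  have h3 := hC'.tendsto_gridSum_zero (hy.trans hyy'.le) hw0 M n hβ
  have h4 := h1.mul h2
  have h5 : ∀ m, Real.exp (-(p.a * p.b * ∫ s in (0 : ℝ)..(n / M), β m s) - β m 0 * y) *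
      Real.exp (-(β m 0 * (y' - y))) =
      Real.exp (-(p.a * p.b * ∫ s in (0 : ℝ)..(n / M), β m s) - β m 0 * y') := fun m => by
    rw [← Real.exp_add]; congr 1; ring
  simp only [h5] at h4
  have h6 := tendsto_nhds_unique h4 h3
  rw [hC'.gridLaplace_eq hu hv, ← h6, ← hC.gridLaplace_eq hu hv, ← hC.gridLaplace_excess hy₀ hu hv,
    gridLaplace, gridLaplace, gridLaplace, ← integral_prod_mul]
  congr 1; funext z
  rw [← Real.exp_add, ← neg_add, ← Finset.sum_add_distrib]
  congr 2
  exact Finset.sum_congr rfl fun j _ => by ring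

/-- The claims after time `h`, at rational times. -/
noncomputable def ClaimProcess.shiftPath (C : ClaimProcess Ω) (h : ℝ≥0) : Ω → PathSpace :=
  ratPath (fun t ω => (C.N (h + t) ω : ℝ)) fun t => C.total (h + t)

/-- If there is no claim before time `h`, then the claims start afresh with the intensity that has
been reached. -/
theorem IsHawkesModel.map_shiftPath (hC : IsHawkesModel p f P y C)
    (hC' : IsHawkesModel p f P y' C') (hy : p.b ≤ y) (hy' : p.b ≤ y') (h : ℝ≥0)
    (hh : freeIntensity p y' h = y) :
    (P.restrict {ω | C'.N h ω = 0}).map (C'.shiftPath h) =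
      P {ω | C'.N h ω = 0} • P.map C.path := by
  set c := P {ω | C'.N h ω = 0} with hc
  have hcfin : c ≠ ∞ := measure_ne_top P _
  have hinc := hC.isIncreasingPair
  have hpair : IsIncreasingPair (c • P) (fun t ω => (C.N t ω : ℝ)) C.total :=
    ⟨hinc.1, hinc.2, Measure.ae_smul_measure hinc.3 c, Measure.ae_smul_measure hinc.4 c⟩
  have hfin : IsFiniteMeasure (c • P) := ⟨by
    simpa using hcfin.lt_top⟩
  rw [← Measure.map_smul]
  refine (hC'.isIncreasingPair_shift h).map_ratPath_eq hpair fun u v M n hu hv _ => ?_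
  set w := claimCost f u v with hw
  have hw0 : ∀ j, 0 ≤ w j := hC.claimCost_nonneg hu hv
  obtain ⟨β, hβ⟩ := exists_isRiccati_grid p hw0 M n
  have h1 := (hC.tendsto_gridSum_zero hy hw0 M n hβ).const_mul (P.real {ω | C'.N h ω = 0})
  have h2 := hC'.tendsto_gridSum hy' hw0 M n h hβ
  rw [hh] at h2
  rw [hC'.gridLaplace_shift hu hv, tendsto_nhds_unique h2 h1, ← hC.gridLaplace_eq hu hv,
    gridLaplace, gridLaplace, integral_smul_measure, smul_eq_mul, measureReal_def]

end HawkesDividend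

namespace HawkesDividend

/-! ### Discounted values of stopped controls -/

/-- The discounted value `∫ ρ e^{-ρu} V u du` of a cumulative payment `V`. -/
noncomputable def discounted (p : Params) (V : ℝ≥0 → ℝ) : ℝ≥0∞ :=
  ∫⁻ u in Set.Ioi (0 : ℝ), ENNReal.ofReal (p.ρ * Real.exp (-p.ρ * u)) *
    ENNReal.ofReal (V u.toNNReal)

theorem lintegral_discount (p : Params) {s : ℝ} :
    ∫⁻ u in Set.Ioi s, ENNReal.ofReal (p.ρ * Real.exp (-p.ρ * u)) =
      ENNReal.ofReal (Real.exp (-p.ρ * s)) := by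
  have hρ := p.ρ_pos
  have hi : IntegrableOn (fun u => p.ρ * Real.exp (-p.ρ * u)) (Set.Ioi s) :=
    (integrableOn_exp_mul_Ioi (neg_neg_of_pos hρ) s).const_mul _
  rw [← ofReal_integral_eq_lintegral_ofReal hi (ae_of_all _ fun u => by positivity),
    integral_const_mul, integral_exp_mul_Ioi (neg_neg_of_pos hρ)]
  congr 1
  field_simp

/-- A path, stopped at time `T`; a jump of the path immediately after `T` is included. -/
noncomputable def stopAt (T : ℝ≥0∞) (V : ℝ≥0 → ℝ) (t : ℝ≥0) : ℝ :=
  if (t : ℝ≥0∞) ≤ T then V t else ⨅ r : {r : ℝ≥0 // T < r}, V r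

section StopAt

variable {T : ℝ≥0∞} {V : ℝ≥0 → ℝ} (hV : Monotone V) (h0 : 0 ≤ V 0)

theorem stopAt_of_le {t : ℝ≥0} (h : (t : ℝ≥0∞) ≤ T) : stopAt T V t = V t := if_pos h

theorem stopAt_of_lt {t : ℝ≥0} (h : T < t) :
    stopAt T V t = ⨅ r : {r : ℝ≥0 // T < r}, V r := if_neg (not_le.2 h)

theorem stopAt_eq_of_lt {s t : ℝ≥0} (hs : T < s) (ht : T < t) : stopAt T V s = stopAt T V t := by
  rw [stopAt_of_lt hs, stopAt_of_lt ht]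

theorem exists_lt_of_stopAt_lt {t : ℝ≥0} (h : T < t) {b : ℝ} (hb : stopAt T V t < b) :
    ∃ r : ℝ≥0, T < r ∧ V r < b := by
  rw [stopAt_of_lt h] at hb
  have : Nonempty {r : ℝ≥0 // T < r} := ⟨⟨t, h⟩⟩
  obtain ⟨r, hr⟩ := exists_lt_of_ciInf_lt hb
  exact ⟨r, r.2, hr⟩

include hV

theorem bddBelow_stop (T : ℝ≥0∞) : BddBelow (Set.range fun r : {r : ℝ≥0 // T < r} => V r) :=
  ⟨V 0, by rintro _ ⟨r, rfl⟩; exact hV (zero_le)⟩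

theorem stopAt_le {t r : ℝ≥0} (hT : T < r) (htr : t ≤ r) : stopAt T V t ≤ V r := by
  by_cases h : (t : ℝ≥0∞) ≤ T
  · rw [stopAt_of_le h]; exact hV htr
  · rw [stopAt_of_lt (not_le.1 h)]; exact ciInf_le (bddBelow_stop hV T) ⟨r, hT⟩

theorem stopAt_le_self (t : ℝ≥0) : stopAt T V t ≤ V t := by
  by_cases h : (t : ℝ≥0∞) ≤ T
  · rw [stopAt_of_le h]
  · exact stopAt_le hV (not_le.1 h) le_rfl

theorem le_stopAt {s t : ℝ≥0} (hs : (s : ℝ≥0∞) ≤ T) (ht : s ≤ t) : V s ≤ stopAt T V t := by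
  by_cases h : (t : ℝ≥0∞) ≤ T
  · rw [stopAt_of_le h]; exact hV ht
  · rw [stopAt_of_lt (not_le.1 h)]
    have : Nonempty {r : ℝ≥0 // T < r} := ⟨⟨t, not_le.1 h⟩⟩
    exact le_ciInf fun r => hV (ENNReal.coe_le_coe.1 (hs.trans r.2.le))

theorem monotone_stopAt (T : ℝ≥0∞) : Monotone (stopAt T V) := by
  intro s t hst
  by_cases hs : (s : ℝ≥0∞) ≤ T
  · rw [stopAt_of_le hs]; exact le_stopAt hV hs hst
  · have hs' := not_le.1 hs
    exact (stopAt_eq_of_lt hs' (hs'.trans_le (ENNReal.coe_le_coe.2 hst))).le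

theorem stopAt_eq_of_le (hc : ∀ t, ContinuousWithinAt V (Set.Ici t) t) {t s : ℝ≥0} (h : T ≤ t)
    (hs : t ≤ s) : stopAt T V s = stopAt T V t := by
  refine le_antisymm ?_ (monotone_stopAt hV T hs)
  rcases eq_or_lt_of_le h with rfl | h
  · rw [stopAt_of_le (le_refl (t : ℝ≥0∞))]
    refine ge_of_tendsto ((hc t).tendsto.mono_left (nhdsWithin_mono t Set.Ioi_subset_Ici_self)) ?_
    filter_upwards [self_mem_nhdsWithin] with r hr
    have hr' : ((t : ℝ≥0) : ℝ≥0∞) < r := ENNReal.coe_lt_coe.2 hr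
    by_cases hs' : (s : ℝ≥0∞) ≤ t
    · rw [stopAt_of_le hs']; exact hV ((ENNReal.coe_le_coe.1 hs').trans (le_of_lt hr))
    · rw [stopAt_of_lt (not_le.1 hs')]; exact ciInf_le (bddBelow_stop hV _) ⟨r, hr'⟩
  · exact (stopAt_eq_of_lt (h.trans_le (ENNReal.coe_le_coe.2 hs)) h).le

theorem stopAt_rightCont (hc : ∀ t, ContinuousWithinAt V (Set.Ici t) t) (T : ℝ≥0∞) (t : ℝ≥0) :
    ContinuousWithinAt (stopAt T V) (Set.Ici t) t := by
  rcases lt_or_ge (t : ℝ≥0∞) T with h | h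
  · have hev : ∀ᶠ s : ℝ≥0 in 𝓝 t, (s : ℝ≥0∞) < T :=
      (ENNReal.continuous_coe.tendsto t).eventually (gt_mem_nhds h)
    refine (hc t).congr_of_eventuallyEq ?_ (stopAt_of_le h.le)
    filter_upwards [nhdsWithin_le_nhds hev] with s hs using stopAt_of_le hs.le
  · exact (continuousWithinAt_const (b := stopAt T V t)).congr
      (fun s hs => stopAt_eq_of_le hV hc h hs) rfl

omit hV in
theorem stopAt_leftCont (hc : ∀ t, ContinuousWithinAt V (Set.Iic t) t) (T : ℝ≥0∞) (t : ℝ≥0) :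
    ContinuousWithinAt (stopAt T V) (Set.Iic t) t := by
  rcases le_or_gt (t : ℝ≥0∞) T with h | h
  · exact (hc t).congr (fun s hs => stopAt_of_le ((ENNReal.coe_le_coe.2 hs).trans h))
      (stopAt_of_le h)
  · have hev : ∀ᶠ s : ℝ≥0 in 𝓝 t, T < (s : ℝ≥0∞) :=
      (ENNReal.continuous_coe.tendsto t).eventually (lt_mem_nhds h)
    refine (continuousWithinAt_const (b := stopAt T V t)).congr_of_eventuallyEq ?_ rfl
    filter_upwards [nhdsWithin_le_nhds hev] with s hs using stopAt_eq_of_lt hs h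

include h0

/-- The discounted payments up to time `T`, by Fubini's theorem applied to
`e^{-ρs} = ∫_s^∞ ρ e^{-ρu} du`. -/
theorem lintegral_exp_stieltjes (p : Params) (T : ℝ≥0∞) :
    ∫⁻ s in {s : ℝ | 0 ≤ s ∧ ENNReal.ofReal s ≤ T}, ENNReal.ofReal (Real.exp (-p.ρ * s))
      ∂(monotone_toLine hV h0).stieltjesFunction.measure = discounted p (stopAt T V) := by
  set f := toLine 0 V with hf
  have hfm : Monotone f := monotone_toLine hV h0
  set F := hfm.stieltjesFunction with hF
  set S : Set ℝ := {s : ℝ | 0 ≤ s ∧ ENNReal.ofReal s ≤ T} with hS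
  have hSm : MeasurableSet S := by
    rw [hS]; measurability
  have hFx : ∀ t, F t = Function.rightLim f t := fun t => rfl
  have hF0 : Function.leftLim F 0 = 0 := by
    refine leftLim_eq_of_tendsto (tendsto_const_nhds.congr' ?_)
    filter_upwards [self_mem_nhdsWithin] with s hs
    rw [hFx]
    refine (rightLim_eq_of_tendsto (tendsto_const_nhds.congr' ?_)).symm
    filter_upwards [Ioo_mem_nhdsGT (show s < 0 from hs)] with r hr
    rw [hf, toLine, if_neg (not_le.2 hr.2)]
  have hIcc : ∀ u, F.measure (Set.Icc 0 u) = ENNReal.ofReal (Function.rightLim f u) := fun u => by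
    rw [StieltjesFunction.measure_Icc, hF0, sub_zero, hFx]
  have hmass : ∀ᵐ u ∂(volume.restrict (Set.Ioi (0 : ℝ))),
      F.measure (S ∩ Set.Iic u) = ENNReal.ofReal (stopAt T V u.toNNReal) := by
    have hcount := hfm.countable_not_continuousAt
    filter_upwards [ae_restrict_of_ae (hcount.ae_notMem volume),
      ae_restrict_mem measurableSet_Ioi] with u hu hu0
    have hu0' : 0 < u := hu0
    rcases le_or_gt (ENNReal.ofReal u) T with h | h
    · have hset : S ∩ Set.Iic u = Set.Icc 0 u := by
        ext s
        exact ⟨fun hs => ⟨hs.1.1, hs.2⟩,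
          fun hs => ⟨⟨hs.1, (ENNReal.ofReal_le_ofReal hs.2).trans h⟩, hs.2⟩⟩
      have hcont : ContinuousAt f u := not_not.1 hu
      rw [hset, hIcc, stopAt_of_le (show ((u.toNNReal : ℝ≥0) : ℝ≥0∞) ≤ T from h),
        rightLim_eq_of_tendsto (hcont.tendsto.mono_left nhdsWithin_le_nhds), hf, toLine,
        if_pos hu0'.le]
    · lift T to ℝ≥0 using h.ne_top
      have hTu : (T : ℝ) < u := by
        rw [← ENNReal.ofReal_coe_nnreal] at h
        exact (ENNReal.ofReal_lt_ofReal_iff hu0').1 h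
      have hset : S ∩ Set.Iic u = Set.Icc 0 (T : ℝ) := by
        ext s
        have e : ENNReal.ofReal s ≤ (T : ℝ≥0∞) ↔ s ≤ T := by
          rw [← ENNReal.ofReal_coe_nnreal, ENNReal.ofReal_le_ofReal_iff T.coe_nonneg]
        simp only [hS, Set.mem_inter_iff, Set.mem_ofPred_eq, e, Set.mem_Iic, Set.mem_Icc]
        exact ⟨fun hs => hs.1, fun hs => ⟨hs, hs.2.trans hTu.le⟩⟩
      rw [hset, hIcc, stopAt_of_lt (show (T : ℝ≥0∞) < (u.toNNReal : ℝ≥0) from h)]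
      congr 1
      rw [hfm.rightLim_eq_sInf, iInf]
      congr 1
      ext z
      simp only [Set.mem_image, Set.mem_Ioi, Set.mem_range, Subtype.exists, ENNReal.coe_lt_coe]
      constructor
      · rintro ⟨s, hs, rfl⟩
        have hs0 : 0 ≤ s := T.coe_nonneg.trans hs.le
        exact ⟨s.toNNReal, by rwa [← NNReal.coe_lt_coe, Real.coe_toNNReal s hs0],
          by rw [hf, toLine, if_pos hs0]⟩
      · rintro ⟨s, hs, rfl⟩
        exact ⟨s, NNReal.coe_lt_coe.2 hs, by
          rw [hf, toLine, if_pos s.coe_nonneg, Real.toNNReal_coe]⟩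
  have h1 : ∀ s ∈ S, ENNReal.ofReal (Real.exp (-p.ρ * s)) = ∫⁻ u in Set.Ioi (0 : ℝ),
      (Set.Ici s).indicator (fun u => ENNReal.ofReal (p.ρ * Real.exp (-p.ρ * u))) u := by
    intro s hs
    rw [lintegral_indicator measurableSet_Ici, Measure.restrict_restrict measurableSet_Ici,
      ← lintegral_discount]
    refine setLIntegral_congr ?_
    have h2 : (Set.Ici s ∩ Set.Ioi 0 : Set ℝ) =ᵐ[volume] (Set.Ioi s ∩ Set.Ioi 0 : Set ℝ) :=
      Ioi_ae_eq_Ici.symm.inter (ae_eq_refl _)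
    have h3 : (Set.Ioi s ∩ Set.Ioi 0 : Set ℝ) = Set.Ioi s :=
      Set.inter_eq_left.2 fun u hu => hs.1.trans_lt hu
    rw [h3] at h2
    exact h2.symm
  rw [setLIntegral_congr_fun hSm h1, lintegral_lintegral_swap]
  · refine lintegral_congr_ae ?_
    filter_upwards [hmass] with u hu
    rw [← hu]
    have h4 : ∀ s, (Set.Ici s).indicator (fun u => ENNReal.ofReal (p.ρ * Real.exp (-p.ρ * u))) u =
        (Set.Iic u).indicator (fun _ => ENNReal.ofReal (p.ρ * Real.exp (-p.ρ * u))) s := by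
      intro s
      simp [Set.indicator_apply]
    simp only [h4]
    rw [lintegral_indicator_const measurableSet_Iic, Measure.restrict_apply measurableSet_Iic,
      Set.inter_comm]
  · refine Measurable.aemeasurable ?_
    have h5 : (Function.uncurry fun s u => (Set.Ici s).indicator
        (fun u => ENNReal.ofReal (p.ρ * Real.exp (-p.ρ * u))) u) =
        {z : ℝ × ℝ | z.1 ≤ z.2}.indicator
          fun z => ENNReal.ofReal (p.ρ * Real.exp (-p.ρ * z.2)) := by
      funext z
      simp [Function.uncurry, Set.indicator_apply]
    rw [h5]
    exact Measurable.indicator (by fun_prop) (measurableSet_le measurable_fst measurable_snd)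

end StopAt

/-! ### Admissible controls -/

/-- The cumulative dividends `Z` have no lump at time `t`. -/
def NoLump (Z : ℝ≥0 → ℝ) (t : ℝ≥0) : Prop :=
  (t = 0 → Z 0 = 0) ∧ (0 < t → ∀ ε > 0, ∃ s < t, Z t < Z s + ε)

/-- Ruin for the reserve `R` under the controls `Z`, `K`: the surplus just after `t` is
negative. -/
def Ruined (R Z K : ℝ≥0 → ℝ) (t : ℝ≥0) : Prop := ∃ t' > t, R t - Z t + K t' < 0

/-- There is no action after ruin. -/
def NoAction (R Z K : ℝ≥0 → ℝ) : Prop :=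
  ∀ t t', t < t' → R t - Z t + K t' < 0 → ∀ r > t, Z r = Z t ∧ K r = K t'

/-- There are no lump dividends while the surplus is negative. -/
def LumpsCovered (R Z K : ℝ≥0 → ℝ) : Prop := ∀ t, 0 ≤ R t - Z t + K t ∨ NoLump Z t

variable {Ω : Type*} [mΩ : MeasurableSpace Ω]

/-- The uncontrolled reserve on `[0, ∞)`. -/
noncomputable def reservePath (p : Params) (C : ClaimProcess Ω) (x : ℝ) (ω : Ω) (t : ℝ≥0) : ℝ :=
  x + p.c * t - C.total t ω

end HawkesDividend

namespace HawkesDividend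

theorem exists_nnrat_btwn_nnreal {a b : ℝ≥0} (h : a < b) : ∃ q : ℚ≥0, a < q ∧ (q : ℝ≥0) < b := by
  obtain ⟨q, hq, h1, h2⟩ := (NNReal.lt_iff_exists_rat_btwn a b).1 h
  lift q to ℚ≥0 using hq
  have e : Real.toNNReal ((q : ℚ) : ℝ) = (q : ℝ≥0) := by
    rw [← NNReal.coe_inj, Real.coe_toNNReal _ (by exact_mod_cast q.2)]
    norm_cast
  exact ⟨q, e ▸ h1, e ▸ h2⟩

/-- A path of the reserve, with paths of the cumulative dividends and capital injections. -/
structure ControlledPath (R Z K : ℝ≥0 → ℝ) : Prop where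
  R_rightCont : ∀ t, ContinuousWithinAt R (Set.Ici t) t
  Z_mono : Monotone Z
  Z_rightCont : ∀ t, ContinuousWithinAt Z (Set.Ici t) t
  Z_zero : 0 ≤ Z 0
  K_mono : Monotone K
  K_zero : K 0 = 0

/-- The time of ruin. -/
noncomputable def ruinAt (R Z K : ℝ≥0 → ℝ) : ℝ≥0∞ :=
  ⨅ (t : ℝ≥0) (_ : Ruined R Z K t), (t : ℝ≥0∞)

section Path

variable {R Z K : ℝ≥0 → ℝ}

theorem ruinAt_le {t : ℝ≥0} (h : Ruined R Z K t) : ruinAt R Z K ≤ t := iInf₂_le t h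

theorem exists_ruined_lt {a : ℝ≥0∞} (h : ruinAt R Z K < a) :
    ∃ t : ℝ≥0, Ruined R Z K t ∧ (t : ℝ≥0∞) < a := by
  simp only [ruinAt, iInf_lt_iff] at h
  obtain ⟨t, ht, hta⟩ := h
  exact ⟨t, ht, hta⟩

theorem NoAction.eq_of_ruined (h : NoAction R Z K) {t : ℝ≥0} (ht : Ruined R Z K t) {r s : ℝ≥0}
    (hr : t < r) (hs : t < s) : Z r = Z s ∧ K r = K s := by
  obtain ⟨t', htt', hneg⟩ := ht
  have h1 := h t t' htt' hneg r hr
  have h2 := h t t' htt' hneg s hs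
  exact ⟨h1.1.trans h2.1.symm, h1.2.trans h2.2.symm⟩

/-- Stopping at ruin does not change controls without action after ruin. -/
theorem NoAction.stopAt_eq (h : NoAction R Z K) :
    stopAt (ruinAt R Z K) Z = Z ∧ stopAt (ruinAt R Z K) K = K := by
  refine ⟨funext fun t => ?_, funext fun t => ?_⟩
  all_goals
    by_cases ht : (t : ℝ≥0∞) ≤ ruinAt R Z K
    · exact stopAt_of_le ht
    · have ht' := not_le.1 ht
      rw [stopAt_of_lt ht']
      have : Nonempty {r : ℝ≥0 // ruinAt R Z K < r} := ⟨⟨t, ht'⟩⟩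
      have hc : ∀ r : {r : ℝ≥0 // ruinAt R Z K < r}, Z r = Z t ∧ K r = K t := by
        intro r
        obtain ⟨s, hs, hslt⟩ := exists_ruined_lt (lt_min r.2 ht')
        have hs1 : s < r.1 := ENNReal.coe_lt_coe.1 (hslt.trans_le (min_le_left _ _))
        have hs2 : s < t := ENNReal.coe_lt_coe.1 (hslt.trans_le (min_le_right _ _))
        exact h.eq_of_ruined hs hs1 hs2
      simp only [(hc _).1, (hc _).2, ciInf_const]

variable (hp : ControlledPath R Z K)
include hp

/-- Ruin is witnessed by rational times. -/
theorem ControlledPath.exists_rat_ruined {s b : ℝ≥0} (hs : Ruined R Z K s) (hsb : s < b) :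
    ∃ q₁ q₂ : ℚ≥0, s < q₁ ∧ q₁ < q₂ ∧ (q₂ : ℝ≥0) < b ∧ R q₁ - Z q₁ + K q₂ < 0 := by
  obtain ⟨t', hst', hneg⟩ := hs
  have h1 : ∀ᶠ r in 𝓝[>] s, R r - Z r + K t' < 0 := by
    have h2 : Tendsto (fun r => R r - Z r + K t') (𝓝[>] s) (𝓝 (R s - Z s + K t')) :=
      (((hp.R_rightCont s).tendsto.sub (hp.Z_rightCont s).tendsto).add_const _).mono_left
        (nhdsWithin_mono s Set.Ioi_subset_Ici_self)
    exact h2.eventually (gt_mem_nhds hneg)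
  obtain ⟨u, hu, hu'⟩ := (mem_nhdsGT_iff_exists_Ioo_subset' hst').1 h1
  have hm : s < min u (min b t') := lt_min hu (lt_min hsb hst')
  obtain ⟨q₁, hq1, hq1'⟩ := exists_nnrat_btwn_nnreal hm
  obtain ⟨q₂, hq2, hq2'⟩ := exists_nnrat_btwn_nnreal hq1'
  refine ⟨q₁, q₂, hq1, by exact_mod_cast hq2, hq2'.trans_le ((min_le_right _ _).trans
    (min_le_left _ _)), ?_⟩
  have h3 : R q₁ - Z q₁ + K t' < 0 := hu' ⟨hq1, hq1'.trans_le (min_le_left _ _)⟩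
  have h4 : K q₂ ≤ K t' := hp.K_mono (hq2'.le.trans ((min_le_right _ _).trans (min_le_right _ _)))
  linarith

/-- Sublevel sets of a control stopped at ruin, in terms of rational times before `t`. This
description makes the stopped control adapted. -/
theorem ControlledPath.stopAt_lt_iff {V : ℝ≥0 → ℝ} (hV : Monotone V) {t : ℝ≥0} {b : ℝ} :
    stopAt (ruinAt R Z K) V t < b ↔ V t < b ∨ ∃ q : ℚ≥0 × ℚ≥0, (q.1 < q.2 ∧ (q.2 : ℝ≥0) < t) ∧
      R q.1 - Z q.1 + K q.2 < 0 ∧ V q.2 < b := by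
  constructor
  · intro h
    by_cases ht : (t : ℝ≥0∞) ≤ ruinAt R Z K
    · rw [stopAt_of_le ht] at h; exact Or.inl h
    · obtain ⟨r, hr, hrb⟩ := exists_lt_of_stopAt_lt (not_le.1 ht) h
      obtain ⟨s, hs, hslt⟩ := exists_ruined_lt (lt_min hr (not_le.1 ht))
      have hs1 : s < r := ENNReal.coe_lt_coe.1 (hslt.trans_le (min_le_left _ _))
      have hs2 : s < t := ENNReal.coe_lt_coe.1 (hslt.trans_le (min_le_right _ _))
      obtain ⟨q₁, q₂, -, h12, h2, hneg⟩ := hp.exists_rat_ruined hs (lt_min hs1 hs2)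
      exact Or.inr ⟨(q₁, q₂), ⟨h12, h2.trans_le (min_le_right _ _)⟩, hneg,
        (hV (h2.trans_le (min_le_left _ _)).le).trans_lt hrb⟩
  · rintro (h | ⟨q, ⟨h12, h2⟩, hneg, hb⟩)
    · exact (stopAt_le_self hV t).trans_lt h
    · have hq : (q.1 : ℝ≥0) < q.2 := by exact_mod_cast h12
      have hT : ruinAt R Z K < ((q.2 : ℝ≥0) : ℝ≥0∞) :=
        (ruinAt_le ⟨q.2, hq, hneg⟩).trans_lt (ENNReal.coe_lt_coe.2 hq)
      have h3 : stopAt (ruinAt R Z K) V t ≤ V q.2 := by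
        rw [stopAt_eq_of_lt (hT.trans (ENNReal.coe_lt_coe.2 h2)) hT]
        exact stopAt_le hV hT le_rfl
      exact h3.trans_lt hb

/-- A control stopped at ruin does not act after its own ruin, which does not come earlier than that
of the original control. -/
theorem ControlledPath.noAction_stopAt :
    NoAction R (stopAt (ruinAt R Z K) Z) (stopAt (ruinAt R Z K) K) := by
  set T := ruinAt R Z K with hT
  intro t t' htt' hneg
  have hTt : T ≤ t := by
    by_contra h
    have h' := not_le.1 h
    obtain ⟨r, hr1, hr2⟩ := ENNReal.lt_iff_exists_nnreal_btwn.1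
      (lt_min h' (ENNReal.coe_lt_coe.2 htt'))
    have hr1' := ENNReal.coe_lt_coe.1 hr1
    rw [stopAt_of_le h'.le] at hneg
    have h1 : K r ≤ stopAt T K t' := le_stopAt hp.K_mono (hr2.le.trans (min_le_left _ _))
      (ENNReal.coe_le_coe.1 (hr2.le.trans (min_le_right _ _)))
    exact h (ruinAt_le ⟨r, hr1', by linarith⟩)
  have hlt : ∀ {r : ℝ≥0}, t < r → T < r := fun hr => hTt.trans_lt (ENNReal.coe_lt_coe.2 hr)
  exact fun r hr => ⟨stopAt_eq_of_le hp.Z_mono hp.Z_rightCont hTt (le_of_lt hr),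
    stopAt_eq_of_lt (hlt hr) (hlt htt')⟩

omit hp in
/-- Stopping removes lumps after time `T` and changes nothing before. -/
theorem LumpsCovered.stopAt (h : LumpsCovered R Z K) (T : ℝ≥0∞) :
    LumpsCovered R (stopAt T Z) (stopAt T K) := by
  intro t
  by_cases ht : (t : ℝ≥0∞) ≤ T
  · have hs : ∀ V : ℝ≥0 → ℝ, ∀ s ≤ t, HawkesDividend.stopAt T V s = V s := fun V s hst =>
      stopAt_of_le ((ENNReal.coe_le_coe.2 hst).trans ht)
    rw [hs Z t le_rfl, hs K t le_rfl]
    refine (h t).imp_right fun hl => ⟨fun h0 => ?_, fun h0 ε hε => ?_⟩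
    · rw [hs Z 0 zero_le]; exact hl.1 h0
    · obtain ⟨s, hst, hlt⟩ := hl.2 h0 ε hε
      exact ⟨s, hst, by rwa [hs Z t le_rfl, hs Z s hst.le]⟩
  · have ht' := not_le.1 ht
    refine Or.inr ⟨fun h0 => absurd ht' (by simp [h0]), fun _ ε hε => ?_⟩
    obtain ⟨s, hs1, hs2⟩ := ENNReal.lt_iff_exists_nnreal_btwn.1 ht'
    exact ⟨s, ENNReal.coe_lt_coe.1 hs2, by rw [stopAt_eq_of_lt ht' hs1]; linarith⟩

/-- Before ruin, the dividends are covered by the reserve and the injections. -/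
theorem ControlledPath.dividends_le {x c : ℝ} (hc : 0 ≤ c) (hL : LumpsCovered R Z K)
    (hNA : NoAction R Z K) (hR : ∀ t : ℝ≥0, R t ≤ x + c * t) (t : ℝ≥0) :
    Z t ≤ max x 0 + c * t + K t := by
  have hx0 := le_max_left x 0
  have hx1 := le_max_right x 0
  have key : ∀ t : ℝ≥0, (∀ s < t, ¬ Ruined R Z K s) → Z t ≤ max x 0 + c * t + K t := by
    intro t ht
    rcases hL t with h | h
    · linarith [hR t]
    · rcases eq_or_lt_of_le (zero_le (a := t)) with rfl | h0
      · rw [h.1 rfl, hp.K_zero]; simp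
      · refine le_of_forall_pos_le_add fun ε hε => ?_
        obtain ⟨s, hst, hlt⟩ := h.2 h0 ε hε
        have h1 : 0 ≤ R s - Z s + K t := by
          by_contra hneg
          exact ht s hst ⟨t, hst, not_le.1 hneg⟩
        have h2 : c * s ≤ c * t := mul_le_mul_of_nonneg_left (NNReal.coe_le_coe.2 hst.le) hc
        linarith [hR s]
  by_cases hex : ∃ s < t, Ruined R Z K s
  · obtain ⟨s₀, hs₀t, hs₀⟩ := hex
    set S := {s | Ruined R Z K s} with hS
    have hlb : ∀ s ∈ S, sInf S ≤ s := fun s hs => csInf_le (OrderBot.bddBelow S) hs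
    have hTt : sInf S < t := (hlb s₀ hs₀).trans_lt hs₀t
    have hconst : ∀ r, sInf S < r → Z r = Z t := by
      intro r hr
      obtain ⟨s, hs, hsr⟩ := exists_lt_of_csInf_lt ⟨s₀, hs₀⟩ (lt_min hr hTt)
      exact (hNA.eq_of_ruined hs (hsr.trans_le (min_le_left _ _))
        (hsr.trans_le (min_le_right _ _))).1
    have hZT : Z (sInf S) = Z t := by
      refine tendsto_nhds_unique ((hp.Z_rightCont (sInf S)).tendsto.mono_left
        (nhdsWithin_mono _ Set.Ioi_subset_Ici_self)) (tendsto_const_nhds.congr' ?_)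
      filter_upwards [self_mem_nhdsWithin] with r hr using (hconst r hr).symm
    have h1 := key (sInf S) fun s hs hbad => absurd (hlb s hbad) (not_le.2 hs)
    have h2 : c * (sInf S : ℝ≥0) ≤ c * t :=
      mul_le_mul_of_nonneg_left (NNReal.coe_le_coe.2 hTt.le) hc
    have h3 := hp.K_mono hTt.le
    linarith
  · push Not at hex
    exact key t hex

end Path

/-! ### The admissibility condition and the ruin time -/

section Link

variable {Ω : Type*} [mΩ : MeasurableSpace Ω] {P : Measure Ω} {p : Params} {y : ℝ}
  {C : ClaimProcess Ω} {f : ℝ → ℝ} (hC : IsHawkesModel p f P y C)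
include hC

theorem IsHawkesModel.total_right (ω : Ω) (t : ℝ≥0) :
    ∀ᶠ s in 𝓝[≥] t, C.total s ω = C.total t ω := by
  filter_upwards [(hC.countingPath ω).eventually_eq_right t] with s hs
  simp only [ClaimProcess.total, hs]

theorem IsHawkesModel.total_left (ω : Ω) {t : ℝ≥0} (ht : 0 < t) :
    ∃ L, ∀ᶠ s in 𝓝[<] t, C.total s ω = L := by
  obtain ⟨k, -, hk⟩ := (hC.countingPath ω).exists_left ht
  refine ⟨∑ i ∈ Finset.range k, C.Y i ω, ?_⟩
  filter_upwards [hk] with s hs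
  simp only [ClaimProcess.total, hs]

theorem IsHawkesModel.total_zero (ω : Ω) : C.total 0 ω = 0 := by
  simp [ClaimProcess.total, hC.N_zero]

theorem IsHawkesModel.reservePath_rightCont (x : ℝ) (ω : Ω) (t : ℝ≥0) :
    ContinuousWithinAt (reservePath p C x ω) (Set.Ici t) t := by
  have h1 : ContinuousWithinAt (fun s : ℝ≥0 => x + p.c * s - C.total t ω) (Set.Ici t) t :=
    Continuous.continuousWithinAt (by fun_prop)
  refine h1.congr_of_eventuallyEq ?_ rfl
  filter_upwards [hC.total_right ω t] with s hs
  simp only [reservePath, hs]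

theorem IsHawkesModel.controlledPath (x : ℝ) (α : Strategy Ω) (ω : Ω) :
    ControlledPath (reservePath p C x ω) (fun t => α.Z t ω) fun t => α.K t ω :=
  ⟨hC.reservePath_rightCont x ω, α.Z_mono ω, α.Z_rightCont ω, α.Z_zero ω, α.K_mono ω, α.K_zero ω⟩

omit hC in
theorem surplus_eq (p : Params) (C : ClaimProcess Ω) (x : ℝ) (α : Strategy Ω) (ω : Ω) (t : ℝ) :
    surplus p C x α ω t = reserve p C x ω t - toLine 0 (fun t => α.Z t ω) t +
      toLine 0 (fun t => α.K t ω) t := by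
  unfold surplus reserve toLine
  split_ifs <;> ring

theorem IsHawkesModel.tendsto_reserve_left (x : ℝ) (ω : Ω) (t : ℝ≥0) :
    ∃ L, Tendsto (reserve p C x ω) (𝓝[<] (t : ℝ)) (𝓝 L) := by
  rcases eq_or_lt_of_le (zero_le (a := t)) with rfl | h0
  · refine ⟨x, tendsto_const_nhds.congr' ?_⟩
    filter_upwards [self_mem_nhdsWithin] with s hs
    rw [reserve, toLine, if_neg (not_le.2 hs)]
  · obtain ⟨L, hL⟩ := hC.total_left ω h0
    have h1 : Tendsto (fun s : ℝ => x + p.c * s - L) (𝓝[<] (t : ℝ)) (𝓝 (x + p.c * t - L)) :=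
      (Continuous.tendsto (by fun_prop) _).mono_left nhdsWithin_le_nhds
    refine ⟨_, h1.congr' ?_⟩
    have h2 := tendsto_toNNReal_nhdsLT (t := (t : ℝ)) (NNReal.coe_pos.2 h0)
    rw [Real.toNNReal_coe] at h2
    filter_upwards [h2.eventually hL, Ioo_mem_nhdsLT (NNReal.coe_pos.2 h0)] with s hs hs0
    rw [reserve, toLine, if_pos hs0.1.le, hs, Real.coe_toNNReal s hs0.1.le]

/-- The admissibility condition at time `t`. The left limit of the surplus plus the jump of the
reserve is the surplus after `t` plus the lump; so a positive lump is covered exactly if the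
surplus remains non-negative. -/
theorem IsHawkesModel.dividend_le_iff (x : ℝ) (α : Strategy Ω) (ω : Ω) (t : ℝ≥0) :
    (α.Z t ω - Function.leftLim (toLine 0 fun s => α.Z s ω) t ≤
      max (Function.leftLim (surplus p C x α ω) t
        + (reserve p C x ω t - Function.leftLim (reserve p C x ω) t)) 0) ↔
    (0 ≤ reservePath p C x ω t - α.Z t ω + α.K t ω ∨ NoLump (fun t => α.Z t ω) t) := by
  obtain ⟨L, hL⟩ := hC.tendsto_reserve_left x ω t
  have hm := monotone_toLine (α.Z_mono ω) (α.Z_zero ω)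
  have hK : Tendsto (toLine 0 fun t => α.K t ω) (𝓝[<] (t : ℝ)) (𝓝 (α.K t ω)) := by
    rcases eq_or_lt_of_le (zero_le (a := t)) with rfl | h0
    · rw [α.K_zero ω]
      refine tendsto_const_nhds.congr' ?_
      filter_upwards [self_mem_nhdsWithin] with s hs
      rw [toLine, if_neg (not_le.2 hs)]
    · have h2 := tendsto_toNNReal_nhdsLT (t := (t : ℝ)) (NNReal.coe_pos.2 h0)
      rw [Real.toNNReal_coe] at h2
      have h3 := ((α.K_leftCont ω t).tendsto.mono_left
        (nhdsWithin_mono t Set.Iio_subset_Iic_self)).comp h2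
      refine h3.congr' ?_
      filter_upwards [Ioo_mem_nhdsLT (NNReal.coe_pos.2 h0)] with s hs
      simp only [Function.comp, toLine, if_pos hs.1.le]
  have hS : Tendsto (surplus p C x α ω) (𝓝[<] (t : ℝ))
      (𝓝 (L - Function.leftLim (toLine 0 fun s => α.Z s ω) t + α.K t ω)) :=
    ((hL.sub (hm.tendsto_leftLim t)).add hK).congr fun s => (surplus_eq p C x α ω s).symm
  rw [leftLim_eq_of_tendsto hS, leftLim_eq_of_tendsto hL]
  have hr : reserve p C x ω t = reservePath p C x ω t := by
    rw [reserve, toLine, if_pos t.coe_nonneg, Real.toNNReal_coe, reservePath]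
  rw [hr, le_max_iff]
  have hZt : toLine 0 (fun s => α.Z s ω) t = α.Z t ω := by
    rw [toLine, if_pos t.coe_nonneg, Real.toNNReal_coe]
  refine or_congr ⟨fun h => by linarith, fun h => by linarith⟩ ?_
  constructor
  · intro h
    refine ⟨fun h0 => ?_, fun h0 ε hε => ?_⟩
    · subst h0
      have h1 : Function.leftLim (toLine 0 fun s => α.Z s ω) ((0 : ℝ≥0) : ℝ) = 0 := by
        refine leftLim_eq_of_tendsto (tendsto_const_nhds.congr' ?_)
        filter_upwards [self_mem_nhdsWithin] with s hs
        rw [toLine, if_neg (not_le.2 hs)]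
      rw [h1] at h
      exact le_antisymm (by linarith) (α.Z_zero ω)
    · have h1 : ∀ᶠ s in 𝓝[<] (t : ℝ), α.Z t ω - ε < toLine 0 (fun s => α.Z s ω) s :=
        (hm.tendsto_leftLim t).eventually (lt_mem_nhds (by linarith))
      obtain ⟨s, hs1, hs2⟩ := (h1.and (Ioo_mem_nhdsLT (NNReal.coe_pos.2 h0))).exists
      rw [toLine, if_pos hs2.1.le] at hs1
      exact ⟨s.toNNReal, by rw [← NNReal.coe_lt_coe, Real.coe_toNNReal s hs2.1.le]; exact hs2.2,
        by linarith⟩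
  · rintro ⟨h1, h2⟩
    rcases eq_or_lt_of_le (zero_le (a := t)) with rfl | h0
    · have h1' : α.Z 0 ω = 0 := h1 rfl
      rw [h1']
      have h3 : (0 : ℝ) ≤ Function.leftLim (toLine 0 fun s => α.Z s ω) ((0 : ℝ≥0) : ℝ) := by
        have := hm.le_leftLim (show (-1 : ℝ) < ((0 : ℝ≥0) : ℝ) by simp)
        rwa [toLine, if_neg (by norm_num)] at this
      linarith
    · refine le_of_forall_pos_le_add fun ε hε => ?_
      obtain ⟨s, hst, hlt⟩ := h2 h0 ε hε
      have h3 := hm.le_leftLim (NNReal.coe_lt_coe.2 hst)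
      rw [toLine, if_pos s.coe_nonneg, Real.toNNReal_coe] at h3
      linarith

/-- The right limit `X_{t+}` is the infimum of `R t - Z t + K t'` over `t' > t`. -/
theorem IsHawkesModel.ruinTime_eq (x : ℝ) (α : Strategy Ω) (ω : Ω) : ruinTime p C x α ω =
    ruinAt (reservePath p C x ω) (fun t => α.Z t ω) fun t => α.K t ω := by
  unfold ruinTime ruinAt
  congr 1; funext t
  refine iInf_congr_Prop ?_ fun _ => rfl
  have hKm := monotone_toLine (α.K_mono ω) (α.K_zero ω).ge
  have hr : Tendsto Real.toNNReal (𝓝[>] (t : ℝ)) (𝓝[≥] t) := by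
    have := tendsto_toNNReal_nhdsGE (t : ℝ)
    rw [Real.toNNReal_coe] at this
    exact this.mono_left (nhdsWithin_mono _ Set.Ioi_subset_Ici_self)
  have hlim : Tendsto (surplus p C x α ω) (𝓝[>] (t : ℝ)) (𝓝 (reservePath p C x ω t - α.Z t ω +
      Function.rightLim (toLine 0 fun t => α.K t ω) t)) := by
    have h1 := (((hC.reservePath_rightCont x ω t).tendsto.sub (α.Z_rightCont ω t).tendsto).comp
      hr).add (hKm.tendsto_rightLim t)
    refine h1.congr' ?_
    filter_upwards [self_mem_nhdsWithin] with s hs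
    have hs0 : 0 ≤ s := t.coe_nonneg.trans (le_of_lt hs)
    simp only [Function.comp, surplus, toLine, if_pos hs0, reservePath]
  rw [rightLim_eq_of_tendsto hlim]
  constructor
  · intro h
    have h1 : ∀ᶠ s in 𝓝[>] (t : ℝ), reservePath p C x ω t - α.Z t ω +
        toLine 0 (fun t => α.K t ω) s < 0 :=
      ((hKm.tendsto_rightLim t).const_add _).eventually (gt_mem_nhds h)
    obtain ⟨s, hs1, hs2⟩ := (h1.and self_mem_nhdsWithin).exists
    have hts : (t : ℝ) < s := hs2
    have hs0 : 0 ≤ s := t.coe_nonneg.trans hts.le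
    rw [toLine, if_pos hs0] at hs1
    exact ⟨s.toNNReal, by rw [gt_iff_lt, ← NNReal.coe_lt_coe, Real.coe_toNNReal s hs0]; exact hts,
      hs1⟩
  · rintro ⟨s, hts, hneg⟩
    have h1 := hKm.rightLim_le (NNReal.coe_lt_coe.2 hts)
    rw [toLine, if_pos s.coe_nonneg, Real.toNNReal_coe] at h1
    linarith

end Link

end HawkesDividend

namespace HawkesDividend

/-! ### The value function in terms of strategies without action after ruin -/

variable {Ω : Type*} [mΩ : MeasurableSpace Ω] {P : Measure Ω} {p : Params} {y : ℝ}
  {C : ClaimProcess Ω} {f : ℝ → ℝ}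

/-- The strategy that stops all payments after ruin. -/
noncomputable def Strategy.frozen (p : Params) (C : ClaimProcess Ω) (x : ℝ) (α : Strategy Ω) :
    Strategy Ω where
  Z t ω := stopAt (ruinAt (reservePath p C x ω) (fun t => α.Z t ω) fun t => α.K t ω)
    (fun t => α.Z t ω) t
  K t ω := stopAt (ruinAt (reservePath p C x ω) (fun t => α.Z t ω) fun t => α.K t ω)
    (fun t => α.K t ω) t
  Z_mono ω := monotone_stopAt (α.Z_mono ω) _
  K_mono ω := monotone_stopAt (α.K_mono ω) _
  Z_rightCont ω := stopAt_rightCont (α.Z_mono ω) (α.Z_rightCont ω) _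
  K_leftCont ω := stopAt_leftCont (α.K_leftCont ω) _
  Z_zero ω := by rw [stopAt_of_le (by simp)]; exact α.Z_zero ω
  K_zero ω := by rw [stopAt_of_le (by simp)]; exact α.K_zero ω

/-- An admissible strategy with almost surely no action after ruin. -/
structure IsFrozen (p : Params) (P : Measure Ω) (C : ClaimProcess Ω) (x : ℝ) (α : Strategy Ω) :
    Prop where
  Z_adapted : ∀ t, Measurable[C.filtration P t] (α.Z t)
  K_adapted : ∀ t, Measurable[C.filtration P t] (α.K t)
  lumps : ∀ ω, LumpsCovered (reservePath p C x ω) (fun t => α.Z t ω) fun t => α.K t ω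
  noAction : ∀ᵐ ω ∂P, NoAction (reservePath p C x ω) (fun t => α.Z t ω) fun t => α.K t ω

/-- The expected discounted value of a random cumulative payment. -/
noncomputable def expectedDiscounted (p : Params) (P : Measure Ω) (V : ℝ≥0 → Ω → ℝ) : ℝ≥0∞ :=
  ∫⁻ ω, discounted p (fun t => V t ω) ∂P

theorem ClaimProcess.measurable_reservePath (p : Params) (C : ClaimProcess Ω) (P : Measure Ω)
    (x : ℝ) {s t : ℝ≥0} (hst : s ≤ t) :
    Measurable[C.filtration P t] fun ω => reservePath p C x ω s :=
  (C.measurable_total_filtration P hst).const_sub _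

section

variable (hC : IsHawkesModel p f P y C) {x : ℝ}
include hC

theorem IsHawkesModel.isAdmissible_iff {α : Strategy Ω} : IsAdmissible p P C x α ↔
    StronglyAdapted (C.filtration P) α.Z ∧ StronglyAdapted (C.filtration P) α.K ∧
    ∀ ω, LumpsCovered (reservePath p C x ω) (fun t => α.Z t ω) fun t => α.K t ω :=
  ⟨fun h => ⟨h.1, h.2, fun ω t => (hC.dividend_le_iff x α ω t).1 (h.3 ω t)⟩,
    fun h => ⟨h.1, h.2.1, fun ω t => (hC.dividend_le_iff x α ω t).2 (h.2.2 ω t)⟩⟩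

theorem IsFrozen.isAdmissible {α : Strategy Ω} (h : IsFrozen p P C x α) :
    IsAdmissible p P C x α :=
  hC.isAdmissible_iff.2 ⟨fun t => (h.Z_adapted t).stronglyMeasurable,
    fun t => (h.K_adapted t).stronglyMeasurable, h.lumps⟩

/-- The expected discounted dividends and injections up to ruin are those of the frozen strategy. -/
theorem IsHawkesModel.expected_eq (α : Strategy Ω) :
    expectedDividends p P C x α = expectedDiscounted p P (α.frozen p C x).Z ∧
    expectedInjections p P C x α = expectedDiscounted p P (α.frozen p C x).K := by
  constructor
  · refine lintegral_congr fun ω => ?_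
    rw [upToRuin, hC.ruinTime_eq]
    exact lintegral_exp_stieltjes (α.Z_mono ω) (α.Z_zero ω) p _
  · refine lintegral_congr fun ω => ?_
    rw [upToRuin, hC.ruinTime_eq]
    exact lintegral_exp_stieltjes (α.K_mono ω) (α.K_zero ω).ge p _

theorem IsFrozen.expected_eq {α : Strategy Ω} (h : IsFrozen p P C x α) :
    expectedDividends p P C x α = expectedDiscounted p P α.Z ∧
    expectedInjections p P C x α = expectedDiscounted p P α.K := by
  rw [(hC.expected_eq α).1, (hC.expected_eq α).2]
  constructor
  · refine lintegral_congr_ae (h.noAction.mono fun ω hω => ?_)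
    exact congrArg (discounted p) hω.stopAt_eq.1
  · refine lintegral_congr_ae (h.noAction.mono fun ω hω => ?_)
    exact congrArg (discounted p) hω.stopAt_eq.2

/-- Freezing an admissible strategy at ruin gives an admissible strategy without action after
ruin. -/
theorem IsHawkesModel.isFrozen_frozen {α : Strategy Ω} (h : IsAdmissible p P C x α) :
    IsFrozen p P C x (α.frozen p C x) := by
  obtain ⟨hZ, hK, hL⟩ := hC.isAdmissible_iff.1 h
  have hmeas : ∀ (V : ℝ≥0 → Ω → ℝ), (∀ t, Measurable[C.filtration P t] (V t)) →
      (∀ ω, Monotone fun t => V t ω) → ∀ t, Measurable[C.filtration P t] fun ω =>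
      stopAt (ruinAt (reservePath p C x ω) (fun t => α.Z t ω) fun t => α.K t ω)
        (fun t => V t ω) t := by
    intro V hV hVm t
    refine @measurable_of_Iio _ _ _ _ _ (C.filtration P t) _ _ _ _ fun b => ?_
    have hset : (fun ω => stopAt (ruinAt (reservePath p C x ω) (fun t => α.Z t ω)
        fun t => α.K t ω) (fun t => V t ω) t) ⁻¹' Set.Iio b = {ω | V t ω < b} ∪
        ⋃ q : ℚ≥0 × ℚ≥0, {ω | (q.1 < q.2 ∧ (q.2 : ℝ≥0) < t) ∧
          reservePath p C x ω q.1 - α.Z q.1 ω + α.K q.2 ω < 0 ∧ V q.2 ω < b} := by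
      ext ω
      simp only [Set.mem_preimage, Set.mem_Iio, Set.mem_union, Set.mem_iUnion, Set.mem_ofPred_eq]
      exact (hC.controlledPath x α ω).stopAt_lt_iff (hVm ω)
    rw [hset]
    refine (measurableSet_lt (hV t) measurable_const).union (MeasurableSet.iUnion fun q => ?_)
    by_cases hq : q.1 < q.2 ∧ (q.2 : ℝ≥0) < t
    · have h12 : (q.1 : ℝ≥0) ≤ t := le_trans (by exact_mod_cast hq.1.le) hq.2.le
      simp only [hq, and_self, true_and]
      have hm1 := C.measurable_reservePath p P x h12
      have hm2 := (hZ q.1).measurable.mono ((C.filtration P).mono h12) le_rfl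
      have hm3 := (hK q.2).measurable.mono ((C.filtration P).mono hq.2.le) le_rfl
      have hm4 := (hV q.2).mono ((C.filtration P).mono hq.2.le) le_rfl
      exact (measurableSet_lt ((hm1.sub hm2).add hm3) measurable_const).inter
        (measurableSet_lt hm4 measurable_const)
    · simp [hq]
  exact ⟨hmeas α.Z (fun t => (hZ t).measurable) α.Z_mono,
    hmeas α.K (fun t => (hK t).measurable) α.K_mono, fun ω => (hL ω).stopAt _,
    ae_of_all _ fun ω => (hC.controlledPath x α ω).noAction_stopAt⟩

theorem IsHawkesModel.total_nonneg : ∀ᵐ ω ∂P, ∀ t, 0 ≤ C.total t ω := by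
  filter_upwards [ae_all_iff.2 hC.Y_pos] with ω hω t
  exact Finset.sum_nonneg fun k _ => (hω k).le

end

theorem lintegral_discount_id (p : Params) :
    ∫⁻ u in Set.Ioi (0 : ℝ), ENNReal.ofReal (p.ρ * Real.exp (-p.ρ * u)) * ENNReal.ofReal (p.c * u) =
      ENNReal.ofReal (p.c / p.ρ) := by
  have hρ := p.ρ_pos
  have hc := p.c_pos
  have h1 := Real.integral_rpow_mul_exp_neg_mul_Ioi (a := 2) two_pos hρ
  have h2 : ∫ u in Set.Ioi (0 : ℝ), p.ρ * Real.exp (-p.ρ * u) * (p.c * u) = p.c / p.ρ := by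
    have h3 : ∀ u : ℝ, p.ρ * Real.exp (-p.ρ * u) * (p.c * u) =
        p.ρ * p.c * (u ^ ((2 : ℝ) - 1) * Real.exp (-(p.ρ * u))) := by
      intro u
      rw [show (2 : ℝ) - 1 = 1 by norm_num, Real.rpow_one, neg_mul]
      ring
    simp only [h3, integral_const_mul, h1, Real.Gamma_two]
    rw [show (2 : ℝ) = ((2 : ℕ) : ℝ) by norm_num, Real.rpow_natCast]
    field_simp
  have hi : IntegrableOn (fun u => p.ρ * Real.exp (-p.ρ * u) * (p.c * u)) (Set.Ioi 0) := by
    refine Integrable.of_integral_ne_zero ?_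
    rw [h2]; positivity
  rw [← h2, ofReal_integral_eq_lintegral_ofReal hi]
  · refine setLIntegral_congr_fun measurableSet_Ioi fun u hu => ?_
    rw [← ENNReal.ofReal_mul (by positivity)]
  · refine (ae_restrict_iff' measurableSet_Ioi).2 (ae_of_all _ fun u hu => ?_)
    have : 0 < u := hu
    positivity

theorem discounted_mono {V W : ℝ≥0 → ℝ} (h : ∀ t, V t ≤ W t) : discounted p V ≤ discounted p W :=
  lintegral_mono fun _ => mul_le_mul_right (ENNReal.ofReal_le_ofReal (h _)) _

/-- A payment of `m` at time zero is not discounted. -/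
theorem discounted_add_const {V : ℝ≥0 → ℝ} {m : ℝ} (hm : 0 ≤ m)
    (hV : ∀ t > 0, 0 ≤ V t) {W : ℝ≥0 → ℝ} (hW : ∀ t > 0, W t = V t + m) :
    discounted p W = discounted p V + ENNReal.ofReal m := by
  have h1 : ∀ u ∈ Set.Ioi (0 : ℝ), ENNReal.ofReal (p.ρ * Real.exp (-p.ρ * u)) *
      ENNReal.ofReal (W u.toNNReal) = ENNReal.ofReal (p.ρ * Real.exp (-p.ρ * u)) *
      ENNReal.ofReal (V u.toNNReal) + ENNReal.ofReal (p.ρ * Real.exp (-p.ρ * u)) *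
      ENNReal.ofReal m := by
    intro u hu
    have hu' : 0 < u.toNNReal := Real.toNNReal_pos.2 hu
    rw [hW _ hu', ENNReal.ofReal_add (hV _ hu') hm, mul_add]
  rw [discounted, setLIntegral_congr_fun measurableSet_Ioi h1, lintegral_add_right _ (by fun_prop),
    lintegral_mul_const _ (by fun_prop), lintegral_discount]
  simp [discounted]

section

variable [IsProbabilityMeasure P] (hC : IsHawkesModel p f P y C) {x : ℝ}
include hC

theorem IsFrozen.dividends_le {α : Strategy Ω} (h : IsFrozen p P C x α) :
    expectedDiscounted p P α.Z ≤
      ENNReal.ofReal (max x 0 + p.c / p.ρ) + expectedDiscounted p P α.K := by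
  have hpath : ∀ᵐ ω ∂P, discounted p (fun t => α.Z t ω) ≤
      ENNReal.ofReal (max x 0 + p.c / p.ρ) + discounted p (fun t => α.K t ω) := by
    filter_upwards [h.noAction, hC.total_nonneg] with ω hω htot
    have h1 := (hC.controlledPath x α ω).dividends_le (x := x) p.c_pos.le (h.lumps ω) hω
      fun t => by unfold reservePath; linarith [htot t]
    have h2 : discounted p (fun t => α.Z t ω) ≤
        discounted p fun t => (p.c * t + α.K t ω) + max x 0 :=
      discounted_mono fun t => by linarith [h1 t]
    have hK0 : ∀ t, 0 ≤ α.K t ω := fun t => (α.K_zero ω).ge.trans (α.K_mono ω zero_le)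
    rw [discounted_add_const (V := fun t => p.c * t + α.K t ω) (le_max_right x 0)
      (fun t _ => add_nonneg (mul_nonneg p.c_pos.le t.coe_nonneg) (hK0 t)) fun t _ => rfl] at h2
    refine h2.trans ?_
    have h3 : discounted p (fun t => p.c * t + α.K t ω) =
        ENNReal.ofReal (p.c / p.ρ) + discounted p fun t => α.K t ω := by
      rw [← lintegral_discount_id, discounted, discounted, ← lintegral_add_left (by fun_prop)]
      refine setLIntegral_congr_fun measurableSet_Ioi fun u hu => ?_
      have hu' : (0 : ℝ) < u := hu
      rw [ENNReal.ofReal_add (mul_nonneg p.c_pos.le (NNReal.coe_nonneg _)) (hK0 _), mul_add,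
        Real.coe_toNNReal u hu'.le]
    rw [h3, ENNReal.ofReal_add (le_max_right x 0) (div_pos p.c_pos p.ρ_pos).le]
    exact le_of_eq (by ring)
  refine (lintegral_mono_ae hpath).trans ?_
  rw [lintegral_add_left measurable_const, lintegral_const, measure_univ, mul_one]
  rfl

theorem IsFrozen.reward_eq {α : Strategy Ω} (h : IsFrozen p P C x α)
    (hI : expectedDiscounted p P α.K ≠ ∞) : reward p P C x α =
      (((expectedDiscounted p P α.Z).toReal -
        p.δ * (expectedDiscounted p P α.K).toReal : ℝ) : EReal) := by
  have hD : expectedDiscounted p P α.Z ≠ ∞ :=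
    ne_top_of_le_ne_top (ENNReal.add_ne_top.2 ⟨ENNReal.ofReal_ne_top, hI⟩) (h.dividends_le hC)
  rw [reward, (h.expected_eq hC).1, (h.expected_eq hC).2, EReal.coe_sub, EReal.coe_mul,
    EReal.coe_ennreal_toReal hD, EReal.coe_ennreal_toReal hI]

/-- To bound the value function from above, strategies without action after ruin are enough. -/
theorem IsHawkesModel.value_le {B : ℝ} (hB : ∀ α, IsFrozen p P C x α →
    expectedDiscounted p P α.K ≠ ∞ →
    (expectedDiscounted p P α.Z).toReal - p.δ * (expectedDiscounted p P α.K).toReal ≤ B) :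
    value p P C x ≤ (B : EReal) := by
  refine iSup₂_le fun α hα => ?_
  have hf := hC.isFrozen_frozen hα
  have e := hC.expected_eq (x := x) α
  have e' := hf.expected_eq hC
  have hr : reward p P C x α = reward p P C x (α.frozen p C x) := by
    rw [reward, reward, e.1, e.2, e'.1, e'.2]
  rw [hr]
  by_cases hI : expectedDiscounted p P (α.frozen p C x).K = ∞
  · have hδ : (0 : ℝ) < p.δ := one_pos.trans p.one_lt_δ
    rw [reward, e'.2, hI, EReal.coe_ennreal_top, EReal.coe_mul_top_of_pos hδ]
    simp [sub_eq_add_neg]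
  · rw [hf.reward_eq hC hI, EReal.coe_le_coe_iff]
    exact hB _ hf hI

omit [IsProbabilityMeasure P] hC in
theorem exists_isFrozen_zero : ∃ α : Strategy Ω, IsFrozen p P C x α ∧
    expectedDiscounted p P α.Z = 0 ∧ expectedDiscounted p P α.K = 0 := by
  refine ⟨⟨fun _ _ => 0, fun _ _ => 0, fun _ => monotone_const, fun _ => monotone_const,
    fun _ _ => continuousWithinAt_const, fun _ _ => continuousWithinAt_const, fun _ => le_rfl,
    fun _ => rfl⟩, ⟨fun t => measurable_const, fun t => measurable_const, fun ω t => ?_,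
    ae_of_all _ fun ω t t' _ _ r _ => ⟨rfl, rfl⟩⟩, ?_, ?_⟩
  · exact Or.inr ⟨fun _ => rfl, fun h0 ε hε => ⟨0, h0, by simpa using hε⟩⟩
  · simp [expectedDiscounted, discounted]
  · simp [expectedDiscounted, discounted]

/-- The value function is finite. -/
theorem IsHawkesModel.value_finite : value p P C x = ((value p P C x).toReal : EReal) ∧
    0 ≤ (value p P C x).toReal ∧ (value p P C x).toReal ≤ max x 0 + p.c / p.ρ := by
  have hup : value p P C x ≤ ((max x 0 + p.c / p.ρ : ℝ) : EReal) := by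
    refine hC.value_le fun α hα hI => ?_
    have h1 := ENNReal.toReal_mono (ENNReal.add_ne_top.2 ⟨ENNReal.ofReal_ne_top, hI⟩)
      (hα.dividends_le hC)
    have h0 : 0 ≤ max x 0 + p.c / p.ρ :=
      add_nonneg (le_max_right x 0) (div_pos p.c_pos p.ρ_pos).le
    rw [ENNReal.toReal_add ENNReal.ofReal_ne_top hI, ENNReal.toReal_ofReal h0] at h1
    have h2 := mul_nonneg (sub_nonneg.2 p.one_lt_δ.le)
      (ENNReal.toReal_nonneg (a := expectedDiscounted p P α.K))
    nlinarith
  have hlo : ((0 : ℝ) : EReal) ≤ value p P C x := by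
    obtain ⟨α, hα, hZ, hK⟩ := exists_isFrozen_zero (P := P) (p := p) (C := C) (x := x)
    have h1 := hα.reward_eq hC (by simp [hK])
    rw [hZ, hK] at h1
    simp only [ENNReal.toReal_zero, mul_zero, sub_zero] at h1
    rw [← h1]
    exact le_iSup₂ (f := fun α (_ : IsAdmissible p P C x α) => reward p P C x α) α
      (hα.isAdmissible hC)
  have hfin : value p P C x = ((value p P C x).toReal : EReal) :=
    (EReal.coe_toReal (ne_top_of_le_ne_top (EReal.coe_ne_top _) hup)
      (ne_bot_of_le_ne_bot (EReal.coe_ne_bot _) hlo)).symm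
  refine ⟨hfin, ?_, ?_⟩
  · rw [hfin] at hlo; exact EReal.coe_le_coe_iff.1 hlo
  · rw [hfin] at hup; exact EReal.coe_le_coe_iff.1 hup

theorem IsHawkesModel.le_value {α : Strategy Ω} (hα : IsFrozen p P C x α)
    (hI : expectedDiscounted p P α.K ≠ ∞) :
    (expectedDiscounted p P α.Z).toReal - p.δ * (expectedDiscounted p P α.K).toReal ≤
      (value p P C x).toReal := by
  have h1 := le_iSup₂ (f := fun α (_ : IsAdmissible p P C x α) => reward p P C x α) α
    (hα.isAdmissible hC)
  rw [hα.reward_eq hC hI] at h1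
  have h2 : _ ≤ value p P C x := h1
  rw [hC.value_finite.1] at h2
  exact EReal.coe_le_coe_iff.1 h2

theorem IsHawkesModel.value_toReal_le {B : ℝ} (hB : ∀ α, IsFrozen p P C x α →
    expectedDiscounted p P α.K ≠ ∞ →
    (expectedDiscounted p P α.Z).toReal - p.δ * (expectedDiscounted p P α.K).toReal ≤ B) :
    (value p P C x).toReal ≤ B := by
  have h := hC.value_le hB
  rw [hC.value_finite.1] at h
  exact EReal.coe_le_coe_iff.1 h

end

end HawkesDividend

namespace HawkesDividend

/-! ### Dependence of the value function on the surplus -/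

variable {Ω : Type*} [mΩ : MeasurableSpace Ω] {P : Measure Ω} {p : Params} {y : ℝ}
  {C : ClaimProcess Ω} {f : ℝ → ℝ}

theorem reservePath_add (p : Params) (C : ClaimProcess Ω) (x d : ℝ) (ω : Ω) (t : ℝ≥0) :
    reservePath p C (x + d) ω t = reservePath p C x ω t + d := by
  unfold reservePath; ring

variable (hC : IsHawkesModel p f P y C)
include hC

/-- The initial dividend does not exceed the initial surplus, and vanishes if that is negative. -/
theorem IsFrozen.nonneg_or {x : ℝ} {α : Strategy Ω} (h : IsFrozen p P C x α) (ω : Ω) :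
    0 ≤ x - α.Z 0 ω ∨ α.Z 0 ω = 0 := by
  rcases h.lumps ω 0 with h0 | h0
  · left
    simpa [reservePath, hC.total_zero, α.K_zero] using h0
  · exact Or.inr (h0.1 rfl)

variable [IsProbabilityMeasure P]

/-- An additional surplus can be paid out at once. -/
theorem IsHawkesModel.value_add_ge {x d : ℝ} (hx : 0 ≤ x) (hd : 0 ≤ d) :
    (value p P C x).toReal + d ≤ (value p P C (x + d)).toReal := by
  rw [← le_sub_iff_add_le]
  refine hC.value_toReal_le fun α hα hI => ?_
  have hD : expectedDiscounted p P α.Z ≠ ∞ :=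
    ne_top_of_le_ne_top (ENNReal.add_ne_top.2 ⟨ENNReal.ofReal_ne_top, hI⟩) (hα.dividends_le hC)
  set β : Strategy Ω :=
    { α with
      Z := fun t ω => α.Z t ω + d
      Z_mono := fun ω s t hst => by simpa using α.Z_mono ω hst
      Z_rightCont := fun ω t => (α.Z_rightCont ω t).add continuousWithinAt_const
      Z_zero := fun ω => add_nonneg (α.Z_zero ω) hd } with hβ
  have hR : ∀ ω t, reservePath p C (x + d) ω t - (α.Z t ω + d) =
      reservePath p C x ω t - α.Z t ω := fun ω t => by rw [reservePath_add]; ring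
  have hf : IsFrozen p P C (x + d) β := by
    refine ⟨fun t => (hα.Z_adapted t).add_const d, hα.K_adapted, fun ω t => ?_, ?_⟩
    · simp only [hβ, hR]
      rcases eq_or_lt_of_le (zero_le (a := t)) with rfl | h0
      · left
        have h1 := hα.nonneg_or hC ω
        have h2 : reservePath p C x ω 0 = x := by simp [reservePath, hC.total_zero]
        rw [h2, α.K_zero]
        rcases h1 with h1 | h1
        · linarith
        · rw [h1]; linarith
      · refine (hα.lumps ω t).imp_right fun hl => ⟨fun h => absurd h h0.ne', fun _ ε hε => ?_⟩
        obtain ⟨s, hs, hlt⟩ := hl.2 h0 ε hε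
        exact ⟨s, hs, by simp only at hlt ⊢; linarith⟩
    · filter_upwards [hα.noAction] with ω hω t t' htt' hneg r hr
      simp only [hβ, hR] at hneg ⊢
      have := hω t t' htt' hneg r hr
      exact ⟨congrArg (· + d) this.1, this.2⟩
  have hZ : expectedDiscounted p P β.Z = expectedDiscounted p P α.Z + ENNReal.ofReal d := by
    have h1 : ∀ ω, discounted p (fun t => β.Z t ω) =
        discounted p (fun t => α.Z t ω) + ENNReal.ofReal d := fun ω =>
      discounted_add_const hd (fun t _ => (α.Z_zero ω).trans (α.Z_mono ω zero_le)) fun t _ => rfl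
    unfold expectedDiscounted
    simp only [h1]
    rw [lintegral_add_right _ measurable_const, lintegral_const, measure_univ, mul_one]
  have hle := hC.le_value hf (show expectedDiscounted p P β.K ≠ ∞ from hI)
  rw [hZ, ENNReal.toReal_add hD ENNReal.ofReal_ne_top, ENNReal.toReal_ofReal hd] at hle
  change _ + d - p.δ * (expectedDiscounted p P α.K).toReal ≤ _ at hle
  linarith

/-- A smaller surplus can be topped up at time zero: by lowering an initial lump dividend as far
as possible, and by an injection for the rest. -/
theorem IsHawkesModel.value_add_le {x d : ℝ} (hd : 0 ≤ d) :
    (value p P C (x + d)).toReal ≤ (value p P C x).toReal + p.δ * d := by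
  refine hC.value_toReal_le fun α hα hI => ?_
  have hD : expectedDiscounted p P α.Z ≠ ∞ :=
    ne_top_of_le_ne_top (ENNReal.add_ne_top.2 ⟨ENNReal.ofReal_ne_top, hI⟩) (hα.dividends_le hC)
  set m : Ω → ℝ := fun ω => min d (α.Z 0 ω) with hm
  have hm0 : ∀ ω, 0 ≤ m ω := fun ω => le_min hd (α.Z_zero ω)
  have hmd : ∀ ω, m ω ≤ d := fun ω => min_le_left _ _
  have hmF : ∀ t, Measurable[C.filtration P t] m := fun t =>
    (measurable_const.min (hα.Z_adapted 0)).mono ((C.filtration P).mono zero_le) le_rfl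
  set β : Strategy Ω :=
    { Z := fun t ω => α.Z t ω - m ω
      K := fun t ω => if t = 0 then 0 else α.K t ω + (d - m ω)
      Z_mono := fun ω s t hst => by simpa using α.Z_mono ω hst
      K_mono := fun ω s t hst => by
        have h1 := α.K_mono ω hst
        have h2 := (α.K_zero ω).ge.trans (α.K_mono ω (zero_le (a := t)))
        have h3 := hmd ω
        simp only at h1 ⊢
        split_ifs with hs ht ht
        · exact le_rfl
        · linarith
        · exact absurd (le_antisymm (hst.trans ht.le) zero_le) hs
        · linarith
      Z_rightCont := fun ω t => (α.Z_rightCont ω t).sub continuousWithinAt_const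
      K_leftCont := fun ω t => by
        rcases eq_or_lt_of_le (zero_le (a := t)) with rfl | h0
        · exact continuousWithinAt_const.congr (fun s hs => if_pos (le_antisymm hs zero_le))
            (if_pos rfl)
        · refine ((α.K_leftCont ω t).add
            (continuousWithinAt_const (b := d - m ω))).congr_of_eventuallyEq ?_ (if_neg h0.ne')
          filter_upwards [nhdsWithin_le_nhds (lt_mem_nhds h0)] with s hs using if_neg hs.ne'
      Z_zero := fun ω => sub_nonneg.2 (min_le_right _ _)
      K_zero := fun ω => if_pos rfl } with hβ
  have hR : ∀ ω t, ∀ t' ≠ 0, reservePath p C x ω t - β.Z t ω + β.K t' ω =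
      reservePath p C (x + d) ω t - α.Z t ω + α.K t' ω := fun ω t t' ht' => by
    simp only [hβ, if_neg ht']
    rw [reservePath_add]; ring
  have hf : IsFrozen p P C x β := by
    refine ⟨fun t => (hα.Z_adapted t).sub (hmF t), fun t => ?_, fun ω t => ?_, ?_⟩
    · by_cases ht : t = 0
      · simp only [hβ, if_pos ht]; exact measurable_const
      · simp only [hβ, if_neg ht]; exact (hα.K_adapted t).add ((hmF t).const_sub d)
    · rcases eq_or_lt_of_le (zero_le (a := t)) with rfl | h0
      · have h2 : reservePath p C x ω 0 = x := by simp [reservePath, hC.total_zero]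
        by_cases hZ : α.Z 0 ω ≤ d
        · right
          refine ⟨fun _ => ?_, fun h => absurd h (lt_irrefl _)⟩
          simp only [hβ, hm, min_eq_right hZ, sub_self]
        · left
          have h1 := hα.nonneg_or hC ω
          simp only [hβ, h2, hm, min_eq_left (not_le.1 hZ).le, if_true]
          rcases h1 with h1 | h1
          · linarith
          · exact absurd (h1.trans_le hd) hZ
      · have hl := hα.lumps ω t
        refine hl.imp (fun h => ?_) fun hl => ⟨fun h => absurd h h0.ne', fun _ ε hε => ?_⟩
        · rw [hR ω t t h0.ne']; exact h
        · obtain ⟨s, hs, hlt⟩ := hl.2 h0 ε hε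
          exact ⟨s, hs, by simp only [hβ] at hlt ⊢; linarith⟩
    · filter_upwards [hα.noAction] with ω hω t t' htt' hneg r hr
      rw [hR ω t t' (zero_le.trans_lt htt').ne'] at hneg
      have := hω t t' htt' hneg r hr
      simp only [hβ, if_neg (zero_le.trans_lt htt').ne', if_neg (zero_le.trans_lt hr).ne']
      exact ⟨congrArg (· - m ω) this.1, congrArg (· + (d - m ω)) this.2⟩
  have hmm : Measurable fun ω => ENNReal.ofReal (m ω) :=
    ((hmF 0).mono ((C.filtration P).le 0) le_rfl).ennreal_ofReal
  set Em := ∫⁻ ω, ENNReal.ofReal (m ω) ∂P with hEm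
  have hEmd : Em ≤ ENNReal.ofReal d := by
    refine (lintegral_mono fun ω => ENNReal.ofReal_le_ofReal (hmd ω)).trans ?_
    simp
  have hEmfin : Em ≠ ∞ := ne_top_of_le_ne_top ENNReal.ofReal_ne_top hEmd
  have hZ : expectedDiscounted p P α.Z = expectedDiscounted p P β.Z + Em := by
    have h1 : ∀ ω, discounted p (fun t => α.Z t ω) =
        discounted p (fun t => β.Z t ω) + ENNReal.ofReal (m ω) := fun ω =>
      discounted_add_const (hm0 ω) (fun t _ => (β.Z_zero ω).trans (β.Z_mono ω zero_le))
        fun t _ => by simp [hβ]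
    unfold expectedDiscounted
    simp only [h1]
    rw [lintegral_add_right _ hmm]
  have hK : expectedDiscounted p P β.K + Em = expectedDiscounted p P α.K + ENNReal.ofReal d := by
    have h1 : ∀ ω, discounted p (fun t => β.K t ω) + ENNReal.ofReal (m ω) =
        discounted p (fun t => α.K t ω) + ENNReal.ofReal d := by
      intro ω
      rw [discounted_add_const (V := fun t => α.K t ω) (W := fun t => β.K t ω) (m := d - m ω)
        (sub_nonneg.2 (hmd ω)) (fun t _ => (α.K_zero ω).ge.trans (α.K_mono ω zero_le))
        fun t ht => by simp only [hβ, if_neg ht.ne'], add_assoc,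
        ← ENNReal.ofReal_add (sub_nonneg.2 (hmd ω)) (hm0 ω), sub_add_cancel]
    unfold expectedDiscounted
    rw [← lintegral_add_right _ hmm]
    simp only [h1]
    rw [lintegral_add_right _ measurable_const, lintegral_const, measure_univ, mul_one]
  have hKfin : expectedDiscounted p P β.K ≠ ∞ :=
    ne_top_of_le_ne_top (ENNReal.add_ne_top.2 ⟨hI, ENNReal.ofReal_ne_top⟩) (hK ▸ le_self_add)
  have hZfin : expectedDiscounted p P β.Z ≠ ∞ := ne_top_of_le_ne_top hD (hZ ▸ le_self_add)
  have hle := hC.le_value hf hKfin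
  have e1 := congrArg ENNReal.toReal hZ
  have e2 := congrArg ENNReal.toReal hK
  rw [ENNReal.toReal_add hZfin hEmfin] at e1
  rw [ENNReal.toReal_add hKfin hEmfin, ENNReal.toReal_add hI ENNReal.ofReal_ne_top,
    ENNReal.toReal_ofReal hd] at e2
  have h3 := mul_nonneg (sub_nonneg.2 p.one_lt_δ.le) (ENNReal.toReal_nonneg (a := Em))
  have e3 := congrArg (p.δ * ·) e2
  simp only [mul_add] at e3
  linarith

/-- The events whose occurrence is almost surely decided on `E`. -/
abbrev trivialOn (P : Measure Ω) (E : Set Ω) : MeasurableSpace Ω where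
  MeasurableSet' B := P (B ∩ E) = 0 ∨ P (Bᶜ ∩ E) = 0
  measurableSet_empty := by simp
  measurableSet_compl B hB := by rw [compl_compl]; exact hB.symm
  measurableSet_iUnion B hB := by
    by_cases h : ∀ i, P (B i ∩ E) = 0
    · left
      rw [Set.iUnion_inter]
      exact measure_iUnion_null h
    · push Not at h
      obtain ⟨i, hi⟩ := h
      right
      refine measure_mono_null ?_ ((hB i).resolve_left hi)
      exact Set.inter_subset_inter_left _ (Set.compl_subset_compl.2 (Set.subset_iUnion B i))

/-- The information available at time zero is trivial. -/
theorem IsHawkesModel.zero_one (hy : p.b ≤ y) {A : Set Ω}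
    (hA : MeasurableSet[C.filtration P 0] A) : P A = 0 ∨ P Aᶜ = 0 := by
  have hAm : MeasurableSet A := (C.filtration P).le 0 A hA
  -- the events that are trivial as long as there is no claim
  have hE : ∀ s : ℝ≥0, 0 < s → P (A ∩ {ω | C.N s ω = 0}) = 0 ∨ P (Aᶜ ∩ {ω | C.N s ω = 0}) = 0 := by
    intro s hs
    set E := {ω | C.N s ω = 0} with hEdef
    have hsub : C.history P s ≤ trivialOn P E := by
      refine sup_le (iSup_le fun r => ?_) (MeasurableSpace.generateFrom_le fun B hB => ?_)
      · have hN : ∀ ω ∈ E, C.N r ω = 0 := fun ω hω =>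
          Nat.le_zero.1 ((hC.N_mono ω r.2).trans_eq hω)
        have hconst : ∀ {β : Type} (g : Ω → β) (b : β), (∀ ω ∈ E, g ω = b) → ∀ S : Set β,
            P (g ⁻¹' S ∩ E) = 0 ∨ P ((g ⁻¹' S)ᶜ ∩ E) = 0 := by
          intro β g b hg S
          by_cases hb : b ∈ S
          · right
            convert measure_empty (μ := P)
            refine Set.eq_empty_of_forall_notMem fun ω hω => hω.1 ?_
            rw [Set.mem_preimage, hg ω hω.2]; exact hb
          · left
            convert measure_empty (μ := P)
            refine Set.eq_empty_of_forall_notMem fun ω hω => hb ?_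
            rw [← hg ω hω.2]; exact hω.1
        refine sup_le ?_ ?_
        · rintro _ ⟨S, -, rfl⟩
          exact hconst (C.N r) 0 hN S
        · rintro _ ⟨S, -, rfl⟩
          exact hconst (C.total r) 0 (fun ω hω => by simp [ClaimProcess.total, hN ω hω]) S
      · exact Or.inl (measure_mono_null Set.inter_subset_left hB.2)
    have hAs : MeasurableSet[C.history P s] A := by
      have h1 : C.filtration P 0 ≤ C.history P s := by
        rw [ClaimProcess.filtration, Filtration.rightCont_eq]
        exact iInf₂_le s hs
      exact h1 A hA
    exact hsub A hAs
  have hlim : Tendsto (fun s : ℝ≥0 => Real.exp (-(p.a * p.b * s ^ 2 + s * y))) (𝓝[>] 0) (𝓝 1) := by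
    have : Continuous fun s : ℝ≥0 => Real.exp (-(p.a * p.b * s ^ 2 + s * y)) := by fun_prop
    have h1 := this.tendsto 0
    simp only [NNReal.coe_zero, ne_eq, OfNat.ofNat_ne_zero, not_false_eq_true, zero_pow, mul_zero,
      zero_mul, add_zero, neg_zero, Real.exp_zero] at h1
    exact h1.mono_left nhdsWithin_le_nhds
  by_contra hcon
  push Not at hcon
  have h1 : 0 < P.real A := measureReal_def P A ▸ ENNReal.toReal_pos hcon.1 (measure_ne_top P _)
  have h2 : 0 < P.real Aᶜ := measureReal_def P Aᶜ ▸ ENNReal.toReal_pos hcon.2 (measure_ne_top P _)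
  obtain ⟨s, hs, hs0⟩ := ((hlim.eventually (lt_mem_nhds (show 1 - min (P.real A) (P.real Aᶜ) < 1 by
    linarith [lt_min h1 h2]))).and self_mem_nhdsWithin).exists
  have h3 := hC.no_claim_ge hy s
  have hEm : MeasurableSet {ω | C.N s ω = 0} := C.measurable_N s (measurableSet_singleton 0)
  have h4 : P.real {ω | C.N s ω = 0}ᶜ = 1 - P.real {ω | C.N s ω = 0} := by
    rw [measureReal_compl hEm, probReal_univ]
  have key : ∀ B : Set Ω, P (B ∩ {ω | C.N s ω = 0}) = 0 →
      P.real B ≤ P.real {ω | C.N s ω = 0}ᶜ := by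
    intro B hB
    refine ENNReal.toReal_mono (measure_ne_top P _) ?_
    have h5 : B ⊆ (B ∩ {ω | C.N s ω = 0}) ∪ {ω | C.N s ω = 0}ᶜ := fun ω hω => by
      by_cases h : ω ∈ {ω | C.N s ω = 0}
      · exact Or.inl ⟨hω, h⟩
      · exact Or.inr h
    refine (measure_mono h5).trans ((measure_union_le _ _).trans ?_)
    rw [hB, zero_add]
  have hmA := min_le_left (P.real A) (P.real Aᶜ)
  have hmA' := min_le_right (P.real A) (P.real Aᶜ)
  rcases hE s hs0 with h | h
  · linarith [key A h]
  · linarith [key Aᶜ h]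

/-- Starting from a deficit, either the deficit is made up for at once, or the company is given
up. -/
theorem IsHawkesModel.value_of_nonpos (hy : p.b ≤ y) {x : ℝ} (hx : x ≤ 0) :
    (value p P C x).toReal = max (p.δ * x + (value p P C 0).toReal) 0 := by
  refine le_antisymm ?_ (max_le ?_ hC.value_finite.2.1)
  swap
  · have := hC.value_add_le (x := x) (d := -x) (by linarith)
    rw [add_neg_cancel] at this
    linarith
  rcases eq_or_lt_of_le hx with rfl | hx
  · simp
  refine hC.value_toReal_le fun α hα hI => ?_
  have hZ0 : ∀ ω, α.Z 0 ω = 0 := fun ω => (hα.nonneg_or hC ω).resolve_left fun h => by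
    linarith [α.Z_zero ω]
  -- the event that the deficit is not made up for at time zero
  set A : Set Ω := {ω | ∃ q : ℚ≥0, 0 < q ∧ α.K q ω < -x} with hA
  have hAeq : ∀ q₀ : ℚ≥0, 0 < q₀ → A = ⋃ q : {q : ℚ≥0 // 0 < q ∧ q ≤ q₀}, {ω | α.K q.1 ω < -x} := by
    intro q₀ hq₀
    ext ω
    simp only [hA, Set.mem_ofPred_eq, Set.mem_iUnion, Subtype.exists]
    constructor
    · rintro ⟨q, hq, hlt⟩
      refine ⟨min q q₀, ⟨lt_min hq hq₀, min_le_right _ _⟩, (α.K_mono ω ?_).trans_lt hlt⟩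
      exact_mod_cast min_le_left q q₀
    · rintro ⟨q, ⟨hq, -⟩, hlt⟩
      exact ⟨q, hq, hlt⟩
  have hAm : MeasurableSet[C.filtration P 0] A := by
    have h1 : C.filtration P 0 = ⨅ s > (0 : ℝ≥0), C.filtration P s := by
      conv_lhs => rw [ClaimProcess.filtration, ← Filtration.rightCont_self, Filtration.rightCont_eq]
      rfl
    rw [h1]
    simp only [MeasurableSpace.measurableSet_iInf]
    intro s hs
    obtain ⟨q₀, h0, hq₀⟩ := exists_nnrat_btwn_nnreal hs
    rw [hAeq q₀ (by exact_mod_cast h0)]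
    refine MeasurableSet.iUnion fun q => ?_
    have hqs : ((q.1 : ℚ≥0) : ℝ≥0) ≤ s := le_trans (by exact_mod_cast q.2.2) hq₀.le
    exact measurableSet_lt ((hα.K_adapted q.1).mono ((C.filtration P).mono hqs) le_rfl)
      measurable_const
  have hres0 : ∀ ω, reservePath p C x ω 0 = x := fun ω => by simp [reservePath, hC.total_zero]
  rcases hC.zero_one hy hAm with hP | hP
  · -- the deficit is made up for: the injections exceed `-x` at once
    have hae : ∀ᵐ ω ∂P, ∀ t > (0 : ℝ≥0), -x ≤ α.K t ω := by
      have h1 : ∀ᵐ ω ∂P, ω ∉ A := measure_eq_zero_iff_ae_notMem.1 hP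
      filter_upwards [h1] with ω hω t ht
      by_contra hlt
      obtain ⟨q, h0, hq⟩ := exists_nnrat_btwn_nnreal ht
      exact hω ⟨q, by exact_mod_cast h0, (α.K_mono ω hq.le).trans_lt (not_le.1 hlt)⟩
    set β : Strategy Ω :=
      { α with
        K := fun t ω => max (α.K t ω + x) 0
        K_mono := fun ω s t hst => max_le_max_right 0 (by simpa using α.K_mono ω hst)
        K_leftCont := fun ω t =>
          ((α.K_leftCont ω t).add continuousWithinAt_const).max continuousWithinAt_const
        K_zero := fun ω => by rw [α.K_zero, zero_add, max_eq_right hx.le] } with hβ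
    have hres : ∀ ω t, reservePath p C 0 ω t + x = reservePath p C x ω t := fun ω t => by
      unfold reservePath; ring
    have hf : IsFrozen p P C 0 β := by
      refine ⟨hα.Z_adapted, fun t => ((hα.K_adapted t).add_const x).max measurable_const,
        fun ω t => ?_, ?_⟩
      · refine (hα.lumps ω t).imp_left fun h => ?_
        rw [← hres] at h
        have h1 := le_max_left (α.K t ω + x) 0
        change 0 ≤ reservePath p C 0 ω t - α.Z t ω + max (α.K t ω + x) 0
        linarith
      · filter_upwards [hα.noAction, hae] with ω hω hKx t t' htt' hneg r hr
        have h1 : ∀ s > (0 : ℝ≥0), max (α.K s ω + x) 0 = α.K s ω + x := fun s hs =>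
          max_eq_left (by linarith [hKx s hs])
        change reservePath p C 0 ω t - α.Z t ω + max (α.K t' ω + x) 0 < 0 at hneg
        rw [h1 t' (zero_le.trans_lt htt')] at hneg
        have := hω t t' htt' (by rw [← hres]; linarith) r hr
        refine ⟨this.1, ?_⟩
        exact congrArg (fun k => max (k + x) 0) this.2
    have hK : expectedDiscounted p P α.K = expectedDiscounted p P β.K + ENNReal.ofReal (-x) := by
      have h1 : ∀ᵐ ω ∂P, discounted p (fun t => α.K t ω) =
          discounted p (fun t => β.K t ω) + ENNReal.ofReal (-x) := by
        filter_upwards [hae] with ω hω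
        refine discounted_add_const (by linarith) (fun t _ => le_max_right _ _) fun t ht => ?_
        change α.K t ω = max (α.K t ω + x) 0 + -x
        rw [max_eq_left (by linarith [hω t ht])]
        ring
      unfold expectedDiscounted
      rw [lintegral_congr_ae h1, lintegral_add_right _ measurable_const, lintegral_const,
        measure_univ, mul_one]
    have hKfin : expectedDiscounted p P β.K ≠ ∞ := ne_top_of_le_ne_top hI (hK ▸ le_self_add)
    have hle := hC.le_value hf hKfin
    rw [hK, ENNReal.toReal_add hKfin ENNReal.ofReal_ne_top, ENNReal.toReal_ofReal (by linarith)]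
    refine le_max_of_le_left ?_
    change (expectedDiscounted p P α.Z).toReal - _ ≤ _ at hle
    linarith
  · -- the company is given up: there are no dividends
    have hae : ∀ᵐ ω ∂P, discounted p (fun t => α.Z t ω) = 0 := by
      have h1 : ∀ᵐ ω ∂P, ω ∈ A := by
        have := measure_eq_zero_iff_ae_notMem.1 hP
        filter_upwards [this] with ω hω using not_not.1 hω
      filter_upwards [h1, hα.noAction] with ω hω hNA
      obtain ⟨q, hq, hlt⟩ := hω
      have hq' : (0 : ℝ≥0) < q := by exact_mod_cast hq
      have h2 : ∀ t, α.Z t ω = 0 := by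
        intro t
        rcases eq_or_lt_of_le (zero_le (a := t)) with rfl | h0
        · exact hZ0 ω
        · refine ((hNA 0 q hq' ?_ t h0).1).trans (hZ0 ω)
          have := hZ0 ω
          have := hres0 ω
          simp only at *
          linarith
      simp [discounted, h2]
    have hD : expectedDiscounted p P α.Z = 0 := by
      rw [expectedDiscounted, lintegral_congr_ae hae]; simp
    rw [hD]
    refine le_max_of_le_right ?_
    have := mul_nonneg (zero_le_one.trans p.one_lt_δ.le)
      (ENNReal.toReal_nonneg (a := expectedDiscounted p P α.K))
    simp only [ENNReal.toReal_zero]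
    linarith

end HawkesDividend

namespace HawkesDividend

/-! ### Controls as functions of the claim path -/

/-- The information contained in a path up to time `r`. -/
abbrev pathHistory (r : ℚ≥0) : MeasurableSpace PathSpace :=
  ⨆ q : {q : ℚ≥0 // q ≤ r}, MeasurableSpace.comap (fun w : PathSpace => w q) inferInstance

theorem measurable_eval_pathHistory {q r : ℚ≥0} (h : q ≤ r) :
    Measurable[pathHistory r] fun w : PathSpace => w q :=
  (comap_measurable _).mono (le_iSup (fun q : {q : ℚ≥0 // q ≤ r} =>
    MeasurableSpace.comap (fun w : PathSpace => w q) inferInstance) ⟨q, h⟩) le_rfl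

theorem pathHistory_mono {q r : ℚ≥0} (h : q ≤ r) : pathHistory q ≤ pathHistory r :=
  iSup_le fun s => le_iSup (fun q : {q : ℚ≥0 // q ≤ r} =>
    MeasurableSpace.comap (fun w : PathSpace => w q) inferInstance) ⟨s.1, s.2.trans h⟩

theorem pathHistory_le (r : ℚ≥0) : pathHistory r ≤ (inferInstance : MeasurableSpace PathSpace) :=
  iSup_le fun q => (measurable_pi_apply q.1).comap_le

theorem measurable_of_pathHistory {Ω : Type*} {m : MeasurableSpace Ω} {r : ℚ≥0}
    {Θ : Ω → PathSpace} (h : ∀ q ≤ r, Measurable[m] fun ω => Θ ω q) :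
    @Measurable _ _ m (pathHistory r) Θ := by
  rw [measurable_iff_comap_le, pathHistory, MeasurableSpace.comap_iSup]
  refine iSup_le fun q => ?_
  rw [MeasurableSpace.comap_comp]
  exact (h q.1 q.2).comap_le

section Version

variable {Ω E : Type*} [mΩ : MeasurableSpace Ω] {P : Measure Ω} {π : Ω → E}

/-- The events that agree, up to a null event, with an event described by `π` and `m`. -/
abbrev aeComap (P : Measure Ω) (π : Ω → E) (m : MeasurableSpace E) : MeasurableSpace Ω where
  MeasurableSet' A := ∃ B, MeasurableSet[m] B ∧ A =ᵐ[P] π ⁻¹' B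
  measurableSet_empty := ⟨∅, @MeasurableSet.empty _ m, by simp⟩
  measurableSet_compl A := by
    rintro ⟨B, hB, h⟩
    exact ⟨Bᶜ, @MeasurableSet.compl _ _ m hB, h.compl⟩
  measurableSet_iUnion A hA := by
    choose B hB h using hA
    exact ⟨⋃ i, B i, @MeasurableSet.iUnion _ _ m _ _ hB, by
      rw [Set.preimage_iUnion]; exact Filter.EventuallyEq.countable_iUnion h⟩

/-- A function measurable for the `σ`-algebra `aeComap` is almost surely a measurable function of
`π`. -/
theorem exists_version {m : MeasurableSpace E} {g : Ω → ℝ}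
    (hg : Measurable[aeComap P π m] g) :
    ∃ φ : E → ℝ, Measurable[m] φ ∧ g =ᵐ[P] fun ω => φ (π ω) := by
  have h1 : ∀ b : ℚ, ∃ B, MeasurableSet[m] B ∧ (g ⁻¹' Set.Iio (b : ℝ)) =ᵐ[P] π ⁻¹' B :=
    fun b => hg measurableSet_Iio
  choose B hB h using h1
  classical
  -- a function is recovered from its sublevel sets at rational levels
  set ψ : E → EReal := fun e => ⨅ b : ℚ, if e ∈ B b then ((b : ℝ) : EReal) else ⊤ with hψ
  have hψm : Measurable[m] ψ := Measurable.iInf fun b =>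
    Measurable.ite (hB b) measurable_const measurable_const
  refine ⟨fun e => (ψ e).toReal, measurable_ereal_toReal.comp hψm, ?_⟩
  filter_upwards [ae_all_iff.2 fun b => (h b).mem_iff] with ω hω
  have h2 : ψ (π ω) = ((g ω : ℝ) : EReal) := by
    refine le_antisymm ?_ (le_iInf fun b => ?_)
    · refine le_of_forall_gt_imp_ge_of_dense fun c hc => ?_
      obtain ⟨b, hb1, hb2⟩ := EReal.lt_iff_exists_rat_btwn.1 hc
      have hb1' : g ω < b := EReal.coe_lt_coe_iff.1 hb1
      refine (iInf_le _ b).trans ?_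
      rw [if_pos (show π ω ∈ B b from (hω b).1 hb1')]
      exact hb2.le
    · split_ifs with hb
      · exact EReal.coe_le_coe_iff.2 (le_of_lt ((hω b).2 hb))
      · exact le_top
  simp only [h2, EReal.toReal_coe]

/-- A function that is almost surely determined by each of a decreasing sequence of
`σ`-algebras is almost surely determined by their intersection. -/
theorem exists_version_iInf {m : ℕ → MeasurableSpace E} (hm : Antitone m) {g : Ω → ℝ}
    (hg : ∀ n, Measurable[aeComap P π (m n)] g) :
    ∃ φ : E → ℝ, (∀ n, Measurable[m n] φ) ∧ g =ᵐ[P] fun ω => φ (π ω) := by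
  choose φ hφ h using fun n => exists_version (hg n)
  refine ⟨fun e => (limsup (fun n => ((φ n e : ℝ) : EReal)) atTop).toReal, fun n => ?_, ?_⟩
  · refine measurable_ereal_toReal.comp ?_
    have : (fun e => limsup (fun n => ((φ n e : ℝ) : EReal)) atTop) =
        fun e => limsup (fun k => ((φ (k + n) e : ℝ) : EReal)) atTop := by
      funext e
      exact (limsup_nat_add (fun n => ((φ n e : ℝ) : EReal)) n).symm
    rw [this]
    exact Measurable.limsup fun k => measurable_coe_real_ereal.comp
      ((hφ (k + n)).mono (hm (Nat.le_add_left n k)) le_rfl)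
  · filter_upwards [ae_all_iff.2 h] with ω hω
    simp only [← hω, limsup_const, EReal.toReal_coe]

end Version

variable {Ω : Type*} [mΩ : MeasurableSpace Ω] {P : Measure Ω} {p : Params} {y : ℝ}
  {C : ClaimProcess Ω} {f : ℝ → ℝ}

/-- Up to null events, the history of the claims is described by the path at rational times. -/
theorem IsHawkesModel.history_le (hC : IsHawkesModel p f P y C) (r : ℚ≥0) :
    C.history P r ≤ aeComap P C.path (pathHistory r) := by
  have hr : ∀ q ≤ r, @Measurable _ _ (aeComap P C.path (pathHistory r)) _
      (fun ω => ((C.N q ω : ℝ), C.total q ω)) := fun q hq S hS =>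
    ⟨(fun w : PathSpace => w q) ⁻¹' S, measurable_eval_pathHistory hq hS, by rfl⟩
  have hlim : ∀ s : ℝ≥0, s ≤ r → @Measurable _ _ (aeComap P C.path (pathHistory r)) _
      (fun ω => ((C.N s ω : ℝ), C.total s ω)) := by
    intro s hs
    rcases eq_or_lt_of_le hs with rfl | hs
    · exact hr r le_rfl
    obtain ⟨u, -, hu, hulim⟩ := exists_seq_strictAnti_tendsto' hs
    choose q hq1 hq2 using fun n => exists_nnrat_btwn_nnreal (hu n).1
    have hqr : ∀ n, q n ≤ r := fun n => by
      have := (hq2 n).trans (hu n).2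
      exact_mod_cast this.le
    have hqlim : Tendsto (fun n => (q n : ℝ≥0)) atTop (𝓝[≥] s) := by
      refine tendsto_nhdsWithin_iff.2 ⟨?_, Eventually.of_forall fun n => (hq1 n).le⟩
      exact tendsto_of_tendsto_of_tendsto_of_le_of_le tendsto_const_nhds hulim
        (fun n => (hq1 n).le) fun n => (hq2 n).le
    refine @measurable_of_tendsto_metrizable _ _ (aeComap P C.path (pathHistory r)) _ _ _ _ _ _
      (fun n => hr (q n) (hqr n)) (tendsto_pi_nhds.2 fun ω => tendsto_const_nhds.congr' ?_)
    filter_upwards [hqlim.eventually ((hC.countingPath ω).eventually_eq_right s),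
      hqlim.eventually (hC.total_right ω s)] with n h1 h2
    rw [h1, h2]
  refine sup_le (iSup_le fun s => sup_le ?_ ?_) (MeasurableSpace.generateFrom_le ?_)
  · have h1 : @Measurable _ _ (aeComap P C.path (pathHistory r)) _ (fun ω => (C.N s.1 ω : ℝ)) :=
      measurable_fst.comp (hlim s.1 s.2)
    have h2 := (Nat.measurable_floor (R := ℝ)).comp h1
    simp only [Function.comp_def, Nat.floor_natCast] at h2
    exact h2.comap_le
  · exact (measurable_snd.comp (hlim s.1 s.2)).comap_le
  · rintro A ⟨-, hA⟩
    exact ⟨∅, @MeasurableSet.empty _ (pathHistory r), by simpa using ae_eq_empty.2 hA⟩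

/-- An adapted control at a rational time is almost surely a function of the claim path that looks
ahead only infinitesimally. -/
theorem IsHawkesModel.exists_path_version (hC : IsHawkesModel p f P y C) (q : ℚ≥0) {g : Ω → ℝ}
    (hg : Measurable[C.filtration P q] g) :
    ∃ φ : PathSpace → ℝ,
      (∀ r > q, Measurable[pathHistory r] φ) ∧ g =ᵐ[P] fun ω => φ (C.path ω) := by
  obtain ⟨φ, hφ, h⟩ := exists_version_iInf (P := P) (π := C.path)
    (m := fun n : ℕ => pathHistory (q + 1 / (n + 1 : ℚ≥0)))
    (fun n k hnk => pathHistory_mono (by gcongr)) (g := g) fun n => by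
      refine hg.mono (le_trans ?_ (hC.history_le _)) le_rfl
      rw [ClaimProcess.filtration, Filtration.rightCont_eq]
      refine iInf₂_le _ ?_
      have : q < q + 1 / (n + 1 : ℚ≥0) := lt_add_of_pos_right _ (by positivity)
      exact_mod_cast this
  refine ⟨φ, fun r hr => ?_, h⟩
  obtain ⟨n, hn⟩ := exists_nat_one_div_lt (tsub_pos_of_lt hr)
  exact (hφ n).mono (pathHistory_mono (by
    have := add_le_add_right hn.le q
    rwa [add_tsub_cancel_of_le (le_of_lt hr)] at this)) le_rfl

end HawkesDividend

namespace HawkesDividend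

/-! ### Controls given at rational times -/

/-- The right-continuous path with the given values at rational times. -/
noncomputable def rightExt (z : ℚ≥0 → ℝ) (t : ℝ≥0) : ℝ := ⨅ q : {q : ℚ≥0 // t < q}, z q

/-- The left-continuous path with the given values at rational times; its value at time `0` is
`0`, the supremum of the empty set. -/
noncomputable def leftExt (k : ℚ≥0 → ℝ) (t : ℝ≥0) : ℝ := ⨆ q : {q : ℚ≥0 // (q : ℝ≥0) < t}, k q

/-- The properties, at rational times, of a reserve `R` that starts from `x` and of dividends `z`
and injections `k` without action after ruin, and without lump dividends while the surplus is
negative. The last property, uniform in time, is stated so as to survive a passage to the limit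
from rational to real times. -/
structure IsRatControl (x : ℝ) (R z k : ℚ≥0 → ℝ) : Prop where
  R_zero : R 0 = x
  z_mono : ∀ q r, q ≤ r → z q ≤ z r
  k_mono : ∀ q r, q ≤ r → k q ≤ k r
  z_nonneg : ∀ q, 0 ≤ z q
  k_nonneg : ∀ q, 0 ≤ k q
  z_zero : ∀ n : ℕ, ∃ q, 0 < q ∧ z q < x + 1 / (n + 1)
  noAction : ∀ q₁ q₂, q₁ < q₂ → R q₁ - z q₁ + k q₂ < 0 →
    ∀ r, q₁ < r → z r = z q₁ ∧ k r = k q₂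
  lumps : ∀ m M : ℕ, ∃ n : ℕ, ∀ q₁ q₂ : ℚ≥0, q₁ < q₂ → q₂ ≤ M → q₂ < q₁ + 1 / (n + 1) →
    z q₂ - z q₁ < 1 / (m + 1) ∨ -(1 / (m + 1) : ℝ) < R q₂ - z q₂ + k q₁

theorem measurableSet_isRatControl {E : Type*} [MeasurableSpace E] (x : ℝ) {R z k : E → ℚ≥0 → ℝ}
    (hR : Measurable R) (hz : Measurable z) (hk : Measurable k) :
    MeasurableSet {e | IsRatControl x (R e) (z e) (k e)} := by
  have hR' := measurable_pi_iff.1 hR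
  have hz' := measurable_pi_iff.1 hz
  have hk' := measurable_pi_iff.1 hk
  have h : {e | IsRatControl x (R e) (z e) (k e)} =
      {e | R e 0 = x ∧ (∀ q r, q ≤ r → z e q ≤ z e r) ∧ (∀ q r, q ≤ r → k e q ≤ k e r) ∧
        (∀ q, 0 ≤ z e q) ∧ (∀ q, 0 ≤ k e q) ∧ (∀ n : ℕ, ∃ q, 0 < q ∧ z e q < x + 1 / (n + 1)) ∧
        (∀ q₁ q₂, q₁ < q₂ → R e q₁ - z e q₁ + k e q₂ < 0 →
          ∀ r, q₁ < r → z e r = z e q₁ ∧ k e r = k e q₂) ∧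
        ∀ m M : ℕ, ∃ n : ℕ, ∀ q₁ q₂ : ℚ≥0, q₁ < q₂ → q₂ ≤ M → q₂ < q₁ + 1 / (n + 1) →
          z e q₂ - z e q₁ < 1 / (m + 1) ∨ -(1 / (m + 1) : ℝ) < R e q₂ - z e q₂ + k e q₁} := by
    ext e
    exact ⟨fun h => ⟨h.1, h.2, h.3, h.4, h.5, h.6, h.7, h.8⟩,
      fun h => ⟨h.1, h.2.1, h.2.2.1, h.2.2.2.1, h.2.2.2.2.1, h.2.2.2.2.2.1, h.2.2.2.2.2.2.1,
        h.2.2.2.2.2.2.2⟩⟩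
  rw [h]
  measurability

section

variable {x : ℝ} {R z k : ℚ≥0 → ℝ}

theorem rightExt_lt_iff (hz : ∀ q, 0 ≤ z q) {t : ℝ≥0} {b : ℝ} :
    rightExt z t < b ↔ ∃ q : ℚ≥0, t < q ∧ z q < b := by
  have hne : Nonempty {q : ℚ≥0 // t < q} := by
    obtain ⟨q, hq, -⟩ := exists_nnrat_btwn_nnreal (lt_add_one t)
    exact ⟨q, hq⟩
  rw [rightExt, ciInf_lt_iff ⟨0, by rintro _ ⟨q, rfl⟩; exact hz q⟩]
  simp

theorem rightExt_le (hz : ∀ q, 0 ≤ z q) {t : ℝ≥0} {q : ℚ≥0} (h : t < q) : rightExt z t ≤ z q :=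
  ciInf_le ⟨0, by rintro _ ⟨q, rfl⟩; exact hz q⟩ (⟨q, h⟩ : {q : ℚ≥0 // t < q})

theorem le_rightExt {t : ℝ≥0} {b : ℝ} (h : ∀ q : ℚ≥0, t < q → b ≤ z q) : b ≤ rightExt z t := by
  have hne : Nonempty {q : ℚ≥0 // t < q} := by
    obtain ⟨q, hq, -⟩ := exists_nnrat_btwn_nnreal (lt_add_one t)
    exact ⟨q, hq⟩
  exact le_ciInf fun q => h q q.2

theorem monotone_rightExt (hz : ∀ q, 0 ≤ z q) : Monotone (rightExt z) := fun _ _ hst =>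
  le_rightExt fun _ hq => rightExt_le hz (hst.trans_lt hq)

theorem rightExt_rightCont (hz : ∀ q, 0 ≤ z q) (t : ℝ≥0) :
    ContinuousWithinAt (rightExt z) (Set.Ici t) t := by
  refine tendsto_order.2 ⟨fun b hb => ?_, fun b hb => ?_⟩
  · filter_upwards [self_mem_nhdsWithin] with s hs using hb.trans_le (monotone_rightExt hz hs)
  · obtain ⟨q, hq, hqb⟩ := (rightExt_lt_iff hz).1 hb
    filter_upwards [nhdsWithin_le_nhds (gt_mem_nhds hq)] with s hs
    exact (rightExt_lt_iff hz).2 ⟨q, hs, hqb⟩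

theorem leftExt_zero (k : ℚ≥0 → ℝ) : leftExt k 0 = 0 := by
  have : IsEmpty {q : ℚ≥0 // (q : ℝ≥0) < 0} := ⟨fun q => not_lt_bot q.2⟩
  rw [leftExt, Real.iSup_of_isEmpty]

theorem bddAbove_leftExt (hk : Monotone k) (t : ℝ≥0) :
    BddAbove (Set.range fun q : {q : ℚ≥0 // (q : ℝ≥0) < t} => k q) := by
  obtain ⟨r, hr, -⟩ := exists_nnrat_btwn_nnreal (lt_add_one t)
  refine ⟨k r, ?_⟩
  rintro _ ⟨q, rfl⟩
  exact hk (by exact_mod_cast (q.2.trans hr).le)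

theorem nonempty_nnrat_lt {t : ℝ≥0} (ht : 0 < t) : Nonempty {q : ℚ≥0 // (q : ℝ≥0) < t} :=
  ⟨0, by simpa using ht⟩

theorem lt_leftExt_iff (hk : Monotone k) {t : ℝ≥0} (ht : 0 < t) {b : ℝ} :
    b < leftExt k t ↔ ∃ q : ℚ≥0, (q : ℝ≥0) < t ∧ b < k q := by
  have := nonempty_nnrat_lt ht
  rw [leftExt, lt_ciSup_iff (bddAbove_leftExt hk t)]
  simp

theorem le_leftExt (hk : Monotone k) {t : ℝ≥0} {q : ℚ≥0} (h : (q : ℝ≥0) < t) :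
    k q ≤ leftExt k t :=
  le_ciSup (bddAbove_leftExt hk t) (⟨q, h⟩ : {q : ℚ≥0 // (q : ℝ≥0) < t})

theorem leftExt_le {t : ℝ≥0} (ht : 0 < t) {b : ℝ} (h : ∀ q : ℚ≥0, (q : ℝ≥0) < t → k q ≤ b) :
    leftExt k t ≤ b := by
  have := nonempty_nnrat_lt ht
  exact ciSup_le fun q => h q q.2

theorem leftExt_nonneg (hk : ∀ q, 0 ≤ k q) (t : ℝ≥0) : 0 ≤ leftExt k t :=
  Real.iSup_nonneg fun q => hk q

theorem monotone_leftExt (hk : Monotone k) (hk0 : ∀ q, 0 ≤ k q) : Monotone (leftExt k) := by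
  intro s t hst
  rcases eq_or_lt_of_le (zero_le (a := s)) with rfl | hs
  · rw [leftExt_zero]; exact leftExt_nonneg hk0 t
  · exact leftExt_le hs fun q hq => le_leftExt hk (hq.trans_le hst)

theorem leftExt_leftCont (hk : Monotone k) (hk0 : ∀ q, 0 ≤ k q) (t : ℝ≥0) :
    ContinuousWithinAt (leftExt k) (Set.Iic t) t := by
  rcases eq_or_lt_of_le (zero_le (a := t)) with rfl | ht
  · refine (continuousWithinAt_const (b := leftExt k 0)).congr (fun s hs => ?_) rfl
    rw [show s = 0 from le_antisymm hs zero_le]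
  refine tendsto_order.2 ⟨fun b hb => ?_, fun b hb => ?_⟩
  · obtain ⟨q, hq, hqb⟩ := (lt_leftExt_iff hk ht).1 hb
    filter_upwards [nhdsWithin_le_nhds (lt_mem_nhds hq)] with s hs
    exact hqb.trans_le (le_leftExt hk hs)
  · filter_upwards [self_mem_nhdsWithin] with s hs using (monotone_leftExt hk hk0 hs).trans_lt hb

/-- A right-continuous path is determined by its values at rational times. -/
theorem rightExt_restrict {V : ℝ≥0 → ℝ} (hV : Monotone V) (h0 : 0 ≤ V 0)
    (hc : ∀ t, ContinuousWithinAt V (Set.Ici t) t) : rightExt (fun q => V q) = V := by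
  funext t
  have hnn : ∀ q : ℚ≥0, 0 ≤ V q := fun q => h0.trans (hV zero_le)
  refine le_antisymm (le_of_forall_gt fun b hb => ?_) (le_rightExt fun q hq => hV hq.le)
  have h1 := ((hc t).mono Set.Ioi_subset_Ici_self).eventually (gt_mem_nhds hb)
  obtain ⟨u, hu, hu'⟩ := (mem_nhdsGT_iff_exists_Ioo_subset' (lt_add_one t)).1 h1
  obtain ⟨q, hq, hq'⟩ := exists_nnrat_btwn_nnreal (show t < u from hu)
  exact (rightExt_lt_iff hnn).2 ⟨q, hq, hu' ⟨hq, hq'⟩⟩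

/-- A left-continuous path that vanishes at `0` is determined by its values at rational times. -/
theorem leftExt_restrict {V : ℝ≥0 → ℝ} (hV : Monotone V) (h0 : V 0 = 0)
    (hc : ∀ t, ContinuousWithinAt V (Set.Iic t) t) : leftExt (fun q => V q) = V := by
  funext t
  rcases eq_or_lt_of_le (zero_le (a := t)) with rfl | ht
  · rw [leftExt_zero, h0]
  have hm : Monotone fun q : ℚ≥0 => V q := fun q r hqr => hV (by exact_mod_cast hqr)
  refine le_antisymm (leftExt_le ht fun q hq => hV hq.le) (le_of_forall_lt fun b hb => ?_)
  have h1 := ((hc t).mono Set.Iio_subset_Iic_self).eventually (lt_mem_nhds hb)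
  obtain ⟨u, hu, hu'⟩ := (mem_nhdsLT_iff_exists_Ioo_subset' ht).1 h1
  obtain ⟨q, hq, hq'⟩ := exists_nnrat_btwn_nnreal (show u < t from hu)
  exact (lt_leftExt_iff hm ht).2 ⟨q, hq', hu' ⟨hq, hq'⟩⟩

end

end HawkesDividend

namespace HawkesDividend

/-! ### From rational to real times -/

/-- The change of the dividends and the surplus around a time: either there is no large dividend,
or the surplus is not very negative. -/
theorem exists_nhds_lumps {R Z K : ℝ≥0 → ℝ} (hR : ∀ t, ContinuousWithinAt R (Set.Ici t) t)
    (hZ : Monotone Z) (hZc : ∀ t, ContinuousWithinAt Z (Set.Ici t) t)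
    (hKc : ∀ t, ContinuousWithinAt K (Set.Iic t) t) (hl : LumpsCovered R Z K) {ε : ℝ} (hε : 0 < ε)
    (t : ℝ≥0) : ∃ U ∈ 𝓝 t, ∀ q₁ ∈ U, ∀ q₂ ∈ U, q₁ < q₂ →
      Z q₂ - Z q₁ < ε ∨ -ε < R q₂ - Z q₂ + K q₁ := by
  have hright : ∀ᶠ s in 𝓝 t, t ≤ s → Z s < Z t + ε / 2 :=
    eventually_nhdsWithin_iff.1 ((hZc t).eventually (gt_mem_nhds (by linarith)))
  -- to the left of `t`, the dividends are close to their left limit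
  have hleft : ∀ᶠ s in 𝓝 t, s < t → ∀ r, s ≤ r → r < t → Z r - Z s < ε := by
    rcases eq_or_lt_of_le (zero_le (a := t)) with rfl | ht
    · exact Eventually.of_forall fun s hs => absurd hs not_lt_zero
    have hne : (Z '' Set.Iio t).Nonempty := ⟨_, 0, ht, rfl⟩
    have hbdd : BddAbove (Z '' Set.Iio t) := ⟨Z t, by rintro _ ⟨s, hs, rfl⟩; exact hZ (le_of_lt hs)⟩
    obtain ⟨_, ⟨s₀, hs₀, rfl⟩, hlt⟩ := exists_lt_of_lt_csSup hne
      (show sSup (Z '' Set.Iio t) - ε < sSup (Z '' Set.Iio t) by linarith)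
    filter_upwards [lt_mem_nhds (show s₀ < t from hs₀)] with s hs _ r _ hrt
    have h1 := hZ hs.le
    have h2 := le_csSup hbdd ⟨r, hrt, rfl⟩
    linarith
  have hmix : ∃ U ∈ 𝓝 t, ∀ s ∈ U, ∀ r ∈ U, s < t → t ≤ r →
      Z r - Z s < ε ∨ -ε < R r - Z r + K s := by
    rcases hl t with h | h
    · have h1 : ∀ᶠ r in 𝓝 t, t ≤ r → R t - Z t - ε / 2 < R r - Z r :=
        eventually_nhdsWithin_iff.1
          (((hR t).tendsto.sub (hZc t).tendsto).eventually (lt_mem_nhds (by linarith)))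
      have h2 : ∀ᶠ s in 𝓝 t, s ≤ t → K t - ε / 2 < K s :=
        eventually_nhdsWithin_iff.1 ((hKc t).eventually (lt_mem_nhds (by linarith)))
      refine ⟨_, h1.and h2, fun s hs r hr hst htr => Or.inr ?_⟩
      linarith [hs.2 hst.le, hr.1 htr]
    · rcases eq_or_lt_of_le (zero_le (a := t)) with rfl | ht
      · exact ⟨Set.univ, univ_mem, fun s _ r _ hs => absurd hs not_lt_zero⟩
      obtain ⟨s₀, hs₀, hlt⟩ := h.2 ht (ε / 2) (by linarith)
      refine ⟨_, (lt_mem_nhds hs₀).and hright, fun s hs r hr _ htr => Or.inl ?_⟩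
      linarith [hZ hs.1.le, hr.2 htr]
  obtain ⟨U, hU, hUmix⟩ := hmix
  refine ⟨_, inter_mem hU (hright.and hleft), fun q₁ h1 q₂ h2 h12 => ?_⟩
  rcases lt_or_ge q₁ t with ht1 | ht1
  · rcases lt_or_ge q₂ t with ht2 | ht2
    · exact Or.inl (h1.2.2 ht1 q₂ h12.le ht2)
    · exact hUmix q₁ h1.1 q₂ h2.1 ht1 ht2
  · left
    linarith [h2.2.1 (ht1.trans h12.le), hZ ht1]

/-- The values at rational times of a control without action after ruin. -/
theorem ControlledPath.isRatControl {R Z K : ℝ≥0 → ℝ} (h : ControlledPath R Z K)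
    (hKc : ∀ t, ContinuousWithinAt K (Set.Iic t) t) (hn : NoAction R Z K)
    (hl : LumpsCovered R Z K) {x : ℝ} (hx : 0 ≤ x) (hR0 : R 0 = x) :
    IsRatControl x (fun q => R q) (fun q => Z q) fun q => K q := by
  refine ⟨by simpa using hR0, fun q r hqr => h.Z_mono (by exact_mod_cast hqr),
    fun q r hqr => h.K_mono (by exact_mod_cast hqr), fun q => h.Z_zero.trans (h.Z_mono zero_le),
    fun q => h.K_zero.ge.trans (h.K_mono zero_le), fun n => ?_, fun q₁ q₂ h12 hneg r hr => ?_,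
    fun m M => ?_⟩
  · have h0 : Z 0 ≤ x := by
      rcases hl 0 with h0 | h0
      · rw [hR0, h.K_zero] at h0; linarith
      · rw [h0.1 rfl]; exact hx
    have hev := ((h.Z_rightCont 0).mono Set.Ioi_subset_Ici_self).eventually
      (gt_mem_nhds (show Z 0 < x + 1 / ((n : ℝ) + 1) from
        h0.trans_lt (lt_add_of_pos_right _ (by positivity))))
    obtain ⟨u, hu, hu'⟩ := (mem_nhdsGT_iff_exists_Ioo_subset' zero_lt_one).1 hev
    obtain ⟨q, hq, hq'⟩ := exists_nnrat_btwn_nnreal (show 0 < u from hu)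
    exact ⟨q, by exact_mod_cast hq, hu' ⟨hq, hq'⟩⟩
  · exact hn q₁ q₂ (by exact_mod_cast h12) hneg r (by exact_mod_cast hr)
  · choose U hU hUl using fun t => exists_nhds_lumps h.R_rightCont h.Z_mono h.Z_rightCont hKc hl
      (ε := 1 / ((m : ℝ) + 1)) (by positivity) t
    -- a Lebesgue number of the cover of `[0, M]` by these neighbourhoods
    obtain ⟨d, hd, hball⟩ := lebesgue_number_lemma_of_metric (s := Set.Icc (0 : ℝ≥0) M)
      (c := fun t => interior (U t)) isCompact_Icc (fun t => isOpen_interior) fun t _ =>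
        Set.mem_iUnion.2 ⟨t, mem_interior_iff_mem_nhds.2 (hU t)⟩
    obtain ⟨n, hn⟩ := exists_nat_one_div_lt hd
    refine ⟨n, fun q₁ q₂ h12 hM h21 => ?_⟩
    have h12' : (q₁ : ℝ≥0) < q₂ := by exact_mod_cast h12
    have h21' : ((q₂ : ℚ≥0) : ℝ) < ((q₁ + 1 / (n + 1) : ℚ≥0) : ℝ) := by exact_mod_cast h21
    push_cast at h21'
    obtain ⟨t, ht⟩ := hball q₂ ⟨zero_le, by exact_mod_cast hM⟩
    refine hUl t q₁ (interior_subset (ht ?_)) q₂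
      (interior_subset (ht (Metric.mem_ball_self hd))) h12'
    rw [Metric.mem_ball, NNReal.dist_eq, abs_sub_lt_iff]
    have h12r : ((q₁ : ℝ≥0) : ℝ) < ((q₂ : ℝ≥0) : ℝ) := h12'
    have e : ∀ q : ℚ≥0, ((q : ℝ≥0) : ℝ) = (q : ℝ) := fun q => by norm_cast
    rw [e, e] at h12r ⊢
    constructor <;> linarith

/-- A path that starts only at time `h`. -/
noncomputable def delayed (h : ℝ≥0) (V : ℝ≥0 → ℝ) (t : ℝ≥0) : ℝ := if h ≤ t then V (t - h) else 0

theorem delayed_of_lt {h : ℝ≥0} {V : ℝ≥0 → ℝ} {t : ℝ≥0} (ht : t < h) : delayed h V t = 0 :=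
  if_neg (not_le.2 ht)

theorem delayed_add (h : ℝ≥0) (V : ℝ≥0 → ℝ) (t : ℝ≥0) : delayed h V (h + t) = V t := by
  rw [delayed, if_pos le_self_add, add_tsub_cancel_left]

theorem monotone_delayed {h : ℝ≥0} {V : ℝ≥0 → ℝ} (hV : Monotone V) (h0 : 0 ≤ V 0) :
    Monotone (delayed h V) := by
  intro s t hst
  unfold delayed
  split_ifs with h1 h2 h2
  · exact hV (tsub_le_tsub_right hst h)
  · exact absurd (h1.trans hst) h2
  · exact h0.trans (hV zero_le)
  · exact le_rfl

theorem delayed_rightCont {h : ℝ≥0} {V : ℝ≥0 → ℝ}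
    (hc : ∀ t, ContinuousWithinAt V (Set.Ici t) t) (t : ℝ≥0) :
    ContinuousWithinAt (delayed h V) (Set.Ici t) t := by
  rcases lt_or_ge t h with ht | ht
  · refine (continuousWithinAt_const (b := (0 : ℝ))).congr_of_eventuallyEq ?_ (delayed_of_lt ht)
    filter_upwards [nhdsWithin_le_nhds (gt_mem_nhds ht)] with s hs using delayed_of_lt hs
  · have hsub : Continuous fun s : ℝ≥0 => s - h := by fun_prop
    refine ((hc (t - h)).comp (f := fun s : ℝ≥0 => s - h) hsub.continuousWithinAt
      fun s hs => tsub_le_tsub_right hs h).congr (fun s hs => ?_) ?_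
    · exact if_pos (ht.trans hs)
    · exact if_pos ht

theorem delayed_leftCont {h : ℝ≥0} {V : ℝ≥0 → ℝ} (h0 : V 0 = 0)
    (hc : ∀ t, ContinuousWithinAt V (Set.Iic t) t) (t : ℝ≥0) :
    ContinuousWithinAt (delayed h V) (Set.Iic t) t := by
  have e : delayed h V = fun s => V (s - h) := by
    funext s
    rcases le_or_gt h s with hs | hs
    · exact if_pos hs
    · rw [delayed_of_lt hs, tsub_eq_zero_of_le hs.le, h0]
  rw [e]
  have hsub : Continuous fun s : ℝ≥0 => s - h := by fun_prop
  exact (hc (t - h)).comp (f := fun s : ℝ≥0 => s - h) hsub.continuousWithinAt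
      fun s hs => tsub_le_tsub_right hs h

section

variable {x : ℝ} {R z k : ℚ≥0 → ℝ} (hc : IsRatControl x R z k) {h : ℝ≥0} {S : ℝ≥0 → ℝ}
  (hS : ∀ t, ContinuousWithinAt S (Set.Ici t) t) (hRS : ∀ q : ℚ≥0, R q ≤ S (h + q))
include hc hS hRS

/-- The reserve `S` just after time `h + t` controls the rational reserves just after `t`. -/
theorem IsRatControl.eventually_reserve_lt {t : ℝ≥0} {b : ℝ}
    (hb : S (h + t) - rightExt z t < b) :
    ∃ u > t, ∀ q : ℚ≥0, t < q → (q : ℝ≥0) < u → R q - z q < b := by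
  have hcont : ContinuousWithinAt (fun s => S (h + s)) (Set.Ioi t) t :=
    (hS (h + t)).comp (f := fun s : ℝ≥0 => h + s) (by fun_prop)
      fun s hs => add_le_add_right (le_of_lt hs) h
  have h1 := hcont.eventually (gt_mem_nhds (show S (h + t) < b + rightExt z t by linarith))
  obtain ⟨u, hu, hu'⟩ := (mem_nhdsGT_iff_exists_Ioo_subset' (lt_add_one t)).1 h1
  refine ⟨u, hu, fun q hq hqu => ?_⟩
  have h2 : S (h + q) < b + rightExt z t := hu' ⟨hq, hqu⟩
  have h3 := rightExt_le hc.z_nonneg hq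
  linarith [hRS q]

/-- The extension to real times of a control given at rational times, started at time `h` from a
reserve `S` that dominates `R`, does not act after ruin. -/
theorem IsRatControl.noAction_delayed (hpre : ∀ t < h, 0 ≤ S t) :
    NoAction S (delayed h (rightExt z)) (delayed h (leftExt k)) := by
  have hk : Monotone k := fun q r => hc.k_mono q r
  intro t t' htt' hneg r hr
  rcases lt_or_ge t h with ht | ht
  · rw [delayed_of_lt ht, sub_zero] at hneg
    have h1 : 0 ≤ delayed h (leftExt k) t' := by
      unfold delayed
      split_ifs
      · exact leftExt_nonneg hc.k_nonneg _
      · exact le_rfl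
    linarith [hpre t ht]
  obtain ⟨s, rfl⟩ := exists_add_of_le ht
  obtain ⟨s', rfl⟩ := exists_add_of_le (ht.trans htt'.le)
  obtain ⟨r', rfl⟩ := exists_add_of_le (ht.trans (le_of_lt hr))
  have hss : s < s' := lt_of_add_lt_add_left htt'
  have hsr : s < r' := lt_of_add_lt_add_left hr
  rw [delayed_add, delayed_add] at hneg
  simp only [delayed_add]
  obtain ⟨u, hu, hlt⟩ := hc.eventually_reserve_lt hS hRS (t := s) (b := -leftExt k s')
    (by linarith)
  have key : ∀ q₁ q₂ : ℚ≥0, s < q₁ → (q₁ : ℝ≥0) < u → q₁ < q₂ → (q₂ : ℝ≥0) < s' →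
      ∀ r, q₁ < r → z r = z q₁ ∧ k r = k q₂ := fun q₁ q₂ h1 hq1 h12 h2 =>
    hc.noAction q₁ q₂ h12 (by linarith [hlt q₁ h1 hq1, le_leftExt hk h2])
  obtain ⟨q₁, h1, h1'⟩ := exists_nnrat_btwn_nnreal (lt_min hu hss)
  obtain ⟨q₂, h2, h2'⟩ := exists_nnrat_btwn_nnreal (h1'.trans_le (min_le_right u s'))
  have h12 : q₁ < q₂ := by exact_mod_cast h2
  have hconst : ∀ q : ℚ≥0, s < q → z q = z q₁ ∧ k q = k q₂ := by
    intro q hq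
    rcases lt_or_ge q₁ q with hqq | hqq
    · exact key q₁ q₂ h1 (h1'.trans_le (min_le_left _ _)) h12 h2' q hqq
    · have hqq' : (q : ℝ≥0) ≤ q₁ := by exact_mod_cast hqq
      obtain ⟨q₀, h0, h0'⟩ := exists_nnrat_btwn_nnreal hq
      have h0q : q₀ < q := by exact_mod_cast h0'
      obtain ⟨q₃, h3, h3'⟩ := exists_nnrat_btwn_nnreal
        (h0'.trans_le (hqq'.trans (h1'.le.trans (min_le_right u s'))))
      have hk3 := key q₀ q₃ h0 (h0'.trans_le (hqq'.trans (h1'.le.trans (min_le_left u s'))))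
        (by exact_mod_cast h3) h3'
      have e1 := hk3 q h0q
      have e2 := hk3 q₁ (h0q.trans_le hqq)
      have e3 := hk3 q₂ ((h0q.trans_le hqq).trans h12)
      exact ⟨e1.1.trans e2.1.symm, e1.2.trans e3.2.symm⟩
  have hZ : ∀ w, s ≤ w → rightExt z w = z q₁ := fun w hw => by
    obtain ⟨q, hq, -⟩ := exists_nnrat_btwn_nnreal (lt_add_one w)
    refine le_antisymm ?_ (le_rightExt fun q hq => (hconst q (hw.trans_lt hq)).1.ge)
    exact (rightExt_le hc.z_nonneg hq).trans (hconst q (hw.trans_lt hq)).1.le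
  have hK : ∀ w, s < w → leftExt k w = k q₂ := fun w hw => by
    obtain ⟨q, hq, hq'⟩ := exists_nnrat_btwn_nnreal hw
    refine le_antisymm (leftExt_le (zero_le.trans_lt hw) fun q' hq' => ?_) ?_
    · rw [← (hconst (max q q') (hq.trans_le (by exact_mod_cast le_max_left q q'))).2]
      exact hk (le_max_right q q')
    · rw [← (hconst q hq).2]
      exact le_leftExt hk hq'
  exact ⟨(hZ r' hsr.le).trans (hZ s le_rfl).symm, (hK r' hsr).trans (hK s' hss).symm⟩

/-- The extension to real times has no lump dividends while the surplus is negative. -/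
theorem IsRatControl.lumpsCovered_delayed :
    LumpsCovered S (delayed h (rightExt z)) (delayed h (leftExt k)) := by
  have hk : Monotone k := fun q r => hc.k_mono q r
  intro t
  rcases lt_or_ge t h with ht | ht
  · refine Or.inr ⟨fun h0 => delayed_of_lt (h0 ▸ ht), fun h0 ε hε => ⟨0, h0, ?_⟩⟩
    rw [delayed_of_lt ht, delayed_of_lt (h0.trans ht), zero_add]
    exact hε
  obtain ⟨s, rfl⟩ := exists_add_of_le ht
  simp only [delayed_add]
  rcases eq_or_lt_of_le (zero_le (a := s)) with rfl | hs
  · left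
    have h1 : rightExt z 0 ≤ x := by
      refine le_of_forall_pos_lt_add fun ε hε => ?_
      obtain ⟨n, hn⟩ := exists_nat_one_div_lt hε
      obtain ⟨q, hq, hlt⟩ := hc.z_zero n
      exact (rightExt_lt_iff hc.z_nonneg).2 ⟨q, by exact_mod_cast hq, by linarith⟩
    have h2 := hRS 0
    rw [hc.R_zero] at h2
    simp only [NNRat.cast_zero] at h2
    rw [leftExt_zero]
    linarith
  rcases le_or_gt 0 (S (h + s) - rightExt z s + leftExt k s) with hX | hX
  · exact Or.inl hX
  right
  refine ⟨fun h0 => absurd h0 (hs.trans_le le_add_self).ne', fun _ ε hε => ?_⟩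
  by_contra hcon
  push Not at hcon
  set X := S (h + s) - rightExt z s + leftExt k s with hXdef
  obtain ⟨u, hu, hlt⟩ := hc.eventually_reserve_lt hS hRS (t := s) (b := X / 2 - leftExt k s)
    (by linarith)
  obtain ⟨m, hm⟩ := exists_nat_one_div_lt (lt_min hε (show 0 < -X / 2 by linarith))
  obtain ⟨M, hM⟩ := exists_nat_gt (s : ℝ≥0)
  obtain ⟨n, hn⟩ := hc.lumps m M
  obtain ⟨q₂, h2, h2'⟩ := exists_nnrat_btwn_nnreal (lt_min (lt_min hu hM)
    (show s < s + 1 / (n + 1) / 2 from lt_add_of_pos_right _ (by positivity)))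
  have h3 : max 0 (s - 1 / (n + 1) / 2) < s := max_lt hs (tsub_lt_self hs (by positivity))
  obtain ⟨q₁, h1, h1'⟩ := exists_nnrat_btwn_nnreal h3
  have hd : (q₂ : ℝ≥0) < q₁ + 1 / (n + 1) := by
    have e1 : s < q₁ + 1 / (n + 1) / 2 :=
      lt_add_of_tsub_lt_right ((le_max_right _ _).trans_lt h1)
    calc (q₂ : ℝ≥0) < s + 1 / (n + 1) / 2 := h2'.trans_le (min_le_right _ _)
      _ < q₁ + 1 / (n + 1) / 2 + 1 / (n + 1) / 2 := by gcongr
      _ = q₁ + 1 / (n + 1) := by rw [add_assoc, add_halves]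
  have h4 := rightExt_le hc.z_nonneg h2
  have h5 : z q₁ ≤ rightExt z q₁ := le_rightExt fun q hq => hc.z_mono _ _ (by exact_mod_cast hq.le)
  have h6 := hcon (h + q₁) (by gcongr)
  rw [delayed_add, delayed_add] at h6
  have hm1 := hm.trans_le (min_le_left _ _)
  have hm2 := hm.trans_le (min_le_right _ _)
  rcases hn q₁ q₂ (by exact_mod_cast h1'.trans h2)
    (by exact_mod_cast (h2'.le.trans (min_le_left _ _)).trans (min_le_right _ _))
    (NNRat.cast_lt (K := ℝ≥0) |>.1 (by push_cast; exact hd)) with hA | hA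
  · linarith
  · have h7 := hlt q₂ h2 (h2'.trans_le ((min_le_left _ _).trans (min_le_left _ _)))
    have h8 := le_leftExt hk h1'
    linarith

end

end HawkesDividend

namespace HawkesDividend

/-! ### Discounted values from rational times -/

/-- The discounted value of the right-continuous extension of `z`. -/
noncomputable def discountedRight (p : Params) (z : ℚ≥0 → ℝ) : ℝ≥0∞ :=
  ∫⁻ u in Set.Ioi (0 : ℝ), ENNReal.ofReal (p.ρ * Real.exp (-p.ρ * u)) *
    ⨅ q : ℚ≥0, if u < q then ENNReal.ofReal (z q) else ⊤

/-- The discounted value of the left-continuous extension of `k`. -/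
noncomputable def discountedLeft (p : Params) (k : ℚ≥0 → ℝ) : ℝ≥0∞ :=
  ∫⁻ u in Set.Ioi (0 : ℝ), ENNReal.ofReal (p.ρ * Real.exp (-p.ρ * u)) *
    ⨆ q : ℚ≥0, if (q : ℝ) < u then ENNReal.ofReal (k q) else 0

theorem measurable_discountedRight (p : Params) : Measurable (discountedRight p) := by
  refine Measurable.lintegral_prod_right' (f := fun w : (ℚ≥0 → ℝ) × ℝ =>
    ENNReal.ofReal (p.ρ * Real.exp (-p.ρ * w.2)) *
    ⨅ q : ℚ≥0, if w.2 < q then ENNReal.ofReal (w.1 q) else ⊤) ?_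
  refine Measurable.mul (by fun_prop) (Measurable.iInf fun q => Measurable.ite ?_ ?_ ?_)
  · exact measurableSet_lt measurable_snd measurable_const
  · exact ((measurable_pi_apply q).comp measurable_fst).ennreal_ofReal
  · exact measurable_const

theorem measurable_discountedLeft (p : Params) : Measurable (discountedLeft p) := by
  refine Measurable.lintegral_prod_right' (f := fun w : (ℚ≥0 → ℝ) × ℝ =>
    ENNReal.ofReal (p.ρ * Real.exp (-p.ρ * w.2)) *
    ⨆ q : ℚ≥0, if (q : ℝ) < w.2 then ENNReal.ofReal (w.1 q) else 0) ?_
  refine Measurable.mul (by fun_prop) (Measurable.iSup fun q => Measurable.ite ?_ ?_ ?_)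
  · exact measurableSet_lt measurable_const measurable_snd
  · exact ((measurable_pi_apply q).comp measurable_fst).ennreal_ofReal
  · exact measurable_const

theorem lt_toNNReal_iff_nnrat {q : ℚ≥0} {u : ℝ} : (q : ℝ≥0) < u.toNNReal ↔ (q : ℝ) < u := by
  rw [Real.lt_toNNReal_iff_coe_lt]; norm_cast

theorem toNNReal_lt_iff_nnrat {q : ℚ≥0} {u : ℝ} (hu : 0 ≤ u) :
    u.toNNReal < (q : ℝ≥0) ↔ u < q := by
  rw [Real.toNNReal_lt_iff_lt_coe hu]; norm_cast

theorem discounted_rightExt (p : Params) {z : ℚ≥0 → ℝ} (hz : ∀ q, 0 ≤ z q) :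
    discounted p (rightExt z) = discountedRight p z := by
  refine setLIntegral_congr_fun measurableSet_Ioi fun u hu => ?_
  have hu0 : (0 : ℝ) ≤ u := le_of_lt hu
  have hnn : 0 ≤ rightExt z u.toNNReal := le_rightExt fun q _ => hz q
  congr 1
  refine le_antisymm (le_iInf fun q => ?_) (le_of_forall_gt fun b hb => ?_)
  · split_ifs with h
    · exact ENNReal.ofReal_le_ofReal (rightExt_le hz ((toNNReal_lt_iff_nnrat hu0).2 h))
    · exact le_top
  · obtain ⟨r, hr, hrb⟩ := ENNReal.lt_iff_exists_nnreal_btwn.1 hb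
    obtain ⟨q, hq, hqb⟩ := (rightExt_lt_iff hz).1
      ((ENNReal.ofReal_lt_iff_lt_toReal hnn ENNReal.coe_ne_top).1 hr)
    refine (iInf_le _ q).trans_lt ?_
    rw [if_pos ((toNNReal_lt_iff_nnrat hu0).1 hq)]
    exact ((ENNReal.ofReal_lt_iff_lt_toReal (hz q) ENNReal.coe_ne_top).2 hqb).trans hrb

theorem discounted_leftExt (p : Params) {k : ℚ≥0 → ℝ} (hk : Monotone k) :
    discounted p (leftExt k) = discountedLeft p k := by
  refine setLIntegral_congr_fun measurableSet_Ioi fun u hu => ?_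
  have hu0 : 0 < u.toNNReal := Real.toNNReal_pos.2 hu
  congr 1
  refine le_antisymm (le_of_forall_lt fun b hb => ?_) (iSup_le fun q => ?_)
  · have hb' := (ENNReal.lt_ofReal_iff_toReal_lt hb.ne_top).1 hb
    obtain ⟨q, hq, hqb⟩ := (lt_leftExt_iff hk hu0).1 hb'
    refine lt_of_lt_of_le ?_ (le_iSup _ q)
    rw [if_pos (lt_toNNReal_iff_nnrat.1 hq)]
    exact (ENNReal.lt_ofReal_iff_toReal_lt hb.ne_top).2 hqb
  · split_ifs with h
    · exact ENNReal.ofReal_le_ofReal (le_leftExt hk (lt_toNNReal_iff_nnrat.2 h))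
    · exact zero_le

/-- Waiting until time `h` costs a factor `exp (-ρ h)`. -/
theorem discounted_delayed (p : Params) (h : ℝ≥0) (V : ℝ≥0 → ℝ) :
    discounted p (delayed h V) = ENNReal.ofReal (Real.exp (-p.ρ * h)) * discounted p V := by
  set G : ℝ → ℝ≥0∞ := (Set.Ioi (0 : ℝ)).indicator fun u =>
    ENNReal.ofReal (p.ρ * Real.exp (-p.ρ * u)) * ENNReal.ofReal (V u.toNNReal) with hG
  have h1 : discounted p V = ∫⁻ u, G (u - h) := by
    rw [lintegral_sub_right_eq_self, hG, lintegral_indicator measurableSet_Ioi]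
    rfl
  rw [h1, ← lintegral_const_mul' _ _ ENNReal.ofReal_ne_top, discounted,
    ← lintegral_indicator measurableSet_Ioi]
  refine lintegral_congr_ae ?_
  have hne : ∀ᵐ u : ℝ, u ≠ h := by simp [ae_iff]
  filter_upwards [hne] with u hu
  rcases lt_or_gt_of_ne hu with hlt | hgt
  · rw [hG, Set.indicator_of_notMem (s := Set.Ioi (0 : ℝ)) (a := u - h)
      (by simpa using hlt.le), mul_zero]
    by_cases hu0 : 0 < u
    · rw [Set.indicator_of_mem (show u ∈ Set.Ioi 0 from hu0), delayed_of_lt, ENNReal.ofReal_zero,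
        mul_zero]
      rwa [Real.toNNReal_lt_iff_lt_coe hu0.le]
    · exact Set.indicator_of_notMem hu0 _
  · have hu0 : 0 < u := h.coe_nonneg.trans_lt hgt
    rw [hG, Set.indicator_of_mem (show u ∈ Set.Ioi 0 from hu0),
      Set.indicator_of_mem (show u - h ∈ Set.Ioi (0 : ℝ) from sub_pos.2 hgt), ← mul_assoc,
      ← ENNReal.ofReal_mul (Real.exp_pos _).le]
    have e : u.toNNReal = h + (u - h).toNNReal := by
      rw [← NNReal.coe_inj, NNReal.coe_add, Real.coe_toNNReal u hu0.le,
        Real.coe_toNNReal _ (sub_nonneg.2 hgt.le)]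
      ring
    rw [e, delayed_add, mul_left_comm, ← Real.exp_add]
    congr 5
    ring

/-! ### Controls of the claim path -/

/-- Dividends and injections at rational times, as functions of the claim path that look ahead
only infinitesimally. -/
structure PathControl where
  z : ℚ≥0 → PathSpace → ℝ
  k : ℚ≥0 → PathSpace → ℝ
  measurable_z : ∀ q r, q < r → Measurable[pathHistory r] (z q)
  measurable_k : ∀ q r, q < r → Measurable[pathHistory r] (k q)

/-- The control is admissible along the claim path `w`, from the surplus `x`. -/
def PathControl.IsGood (φ : PathControl) (p : Params) (x : ℝ) (w : PathSpace) : Prop :=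
  IsRatControl x (fun q => x + p.c * q - (w q).2) (fun q => φ.z q w) fun q => φ.k q w

theorem PathControl.measurable_fun_z (φ : PathControl) : Measurable fun w q => φ.z q w :=
  measurable_pi_iff.2 fun q =>
    (φ.measurable_z q (q + 1) (lt_add_one q)).mono (pathHistory_le _) le_rfl

theorem PathControl.measurable_fun_k (φ : PathControl) : Measurable fun w q => φ.k q w :=
  measurable_pi_iff.2 fun q =>
    (φ.measurable_k q (q + 1) (lt_add_one q)).mono (pathHistory_le _) le_rfl

theorem PathControl.measurable_discounted_z (φ : PathControl) (p : Params) :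
    Measurable fun w => discountedRight p fun q => φ.z q w :=
  (measurable_discountedRight p).comp φ.measurable_fun_z

theorem PathControl.measurable_discounted_k (φ : PathControl) (p : Params) :
    Measurable fun w => discountedLeft p fun q => φ.k q w :=
  (measurable_discountedLeft p).comp φ.measurable_fun_k

theorem PathControl.measurableSet_isGood (φ : PathControl) (p : Params) (x : ℝ) :
    MeasurableSet {w | φ.IsGood p x w} := by
  refine measurableSet_isRatControl x (measurable_pi_iff.2 fun q => ?_) φ.measurable_fun_z
    φ.measurable_fun_k
  exact (measurable_snd.comp (measurable_pi_apply q)).const_sub _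

variable {Ω : Type*} [mΩ : MeasurableSpace Ω] {P : Measure Ω} {p : Params} {y : ℝ}
  {C : ClaimProcess Ω} {f : ℝ → ℝ}

/-- A strategy, read off from the claim path. -/
theorem IsFrozen.exists_pathControl (hC : IsHawkesModel p f P y C) {x : ℝ} (hx : 0 ≤ x)
    {α : Strategy Ω} (hα : IsFrozen p P C x α) :
    ∃ φ : PathControl, (∀ᵐ w ∂(P.map C.path), φ.IsGood p x w) ∧
      expectedDiscounted p P α.Z = ∫⁻ w, discountedRight p (fun q => φ.z q w) ∂(P.map C.path) ∧
      expectedDiscounted p P α.K = ∫⁻ w, discountedLeft p (fun q => φ.k q w) ∂(P.map C.path) := by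
  choose z hz hzae using fun q : ℚ≥0 => hC.exists_path_version q (hα.Z_adapted q)
  choose k hk hkae using fun q : ℚ≥0 => hC.exists_path_version q (hα.K_adapted q)
  have hZ : ∀ᵐ ω ∂P, ∀ q : ℚ≥0, α.Z q ω = z q (C.path ω) := ae_all_iff.2 hzae
  have hK : ∀ᵐ ω ∂P, ∀ q : ℚ≥0, α.K q ω = k q (C.path ω) := ae_all_iff.2 hkae
  have hR0 : ∀ ω, reservePath p C x ω 0 = x := fun ω => by simp [reservePath, hC.total_zero]
  have hrat : ∀ᵐ ω ∂P, IsRatControl x (fun q => reservePath p C x ω q) (fun q => α.Z q ω)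
      fun q => α.K q ω := by
    filter_upwards [hα.noAction] with ω hω
    exact (hC.controlledPath x α ω).isRatControl (α.K_leftCont ω) hω (hα.lumps ω) hx (hR0 ω)
  set φ : PathControl := ⟨z, k, fun q r h => hz q r h, fun q r h => hk q r h⟩ with hφ
  refine ⟨φ, ?_, ?_, ?_⟩
  · rw [ae_map_iff hC.measurable_path.aemeasurable (φ.measurableSet_isGood p x)]
    filter_upwards [hrat, hZ, hK] with ω h1 h2 h3
    simp only [h2, h3] at h1
    have e : (fun q : ℚ≥0 => reservePath p C x ω q) =
        fun q : ℚ≥0 => x + p.c * q - (C.path ω q).2 := funext fun q => by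
      rw [reservePath, show ((q : ℝ≥0) : ℝ) = (q : ℝ) by norm_cast]
      rfl
    rw [e] at h1
    exact h1
  · rw [lintegral_map (φ.measurable_discounted_z p) hC.measurable_path]
    refine lintegral_congr_ae ?_
    filter_upwards [hrat, hZ] with ω h1 h2
    have e : (fun q => φ.z q (C.path ω)) = fun q : ℚ≥0 => α.Z q ω := funext fun q => (h2 q).symm
    rw [e, ← discounted_rightExt p h1.z_nonneg]
    exact congrArg (discounted p) (rightExt_restrict (α.Z_mono ω) (α.Z_zero ω)
      (α.Z_rightCont ω)).symm
  · rw [lintegral_map (φ.measurable_discounted_k p) hC.measurable_path]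
    refine lintegral_congr_ae ?_
    filter_upwards [hrat, hK] with ω h1 h2
    have e : (fun q => φ.k q (C.path ω)) = fun q : ℚ≥0 => α.K q ω := funext fun q => (h2 q).symm
    rw [e, ← discounted_leftExt p fun q r => h1.k_mono q r]
    exact congrArg (discounted p) (leftExt_restrict (α.K_mono ω) (α.K_zero ω)
      (α.K_leftCont ω)).symm

end HawkesDividend

namespace HawkesDividend

/-! ### Transfer of strategies between claim processes -/

variable {Ω : Type*} [mΩ : MeasurableSpace Ω] {P : Measure Ω} {p : Params} {y y' : ℝ}
  {C C' : ClaimProcess Ω} {f : ℝ → ℝ}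

theorem ClaimProcess.measurableSet_filtration_of_null [IsProbabilityMeasure P]
    (C : ClaimProcess Ω) (t : ℝ≥0) {A : Set Ω}
    (hA : MeasurableSet A) (h0 : P A = 0) : MeasurableSet[C.filtration P t] A := by
  rw [ClaimProcess.filtration, Filtration.rightCont_eq]
  simp only [MeasurableSpace.measurableSet_iInf]
  intro s _
  have h1 : MeasurableSpace.generateFrom {A | MeasurableSet A ∧ P A = 0} ≤ C.history P s :=
    le_sup_right
  exact h1 A (MeasurableSpace.measurableSet_generateFrom ⟨hA, h0⟩)

theorem ClaimProcess.measurableSet_filtration_of_forall_gt (C : ClaimProcess Ω) {t : ℝ≥0}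
    {A : Set Ω} (h : ∀ s > t, MeasurableSet[C.filtration P s] A) :
    MeasurableSet[C.filtration P t] A := by
  have h1 : C.filtration P t = ⨅ s > t, C.filtration P s := by
    conv_lhs => rw [ClaimProcess.filtration, ← Filtration.rightCont_self, Filtration.rightCont_eq]
    rfl
  rw [h1]
  simpa only [MeasurableSpace.measurableSet_iInf] using h

open Classical in
/-- The strategy that waits until time `h`, and then follows `φ` along the claim path `θ` on the
event `E`. -/
noncomputable def PathControl.follow (φ : PathControl) (p : Params) (x : ℝ) (h : ℝ≥0)
    (E : Set Ω) (θ : Ω → PathSpace) (hE : ∀ ω ∈ E, φ.IsGood p x (θ ω)) : Strategy Ω where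
  Z t ω := if ω ∈ E then delayed h (rightExt fun q => φ.z q (θ ω)) t else 0
  K t ω := if ω ∈ E then delayed h (leftExt fun q => φ.k q (θ ω)) t else 0
  Z_mono ω := by
    by_cases hω : ω ∈ E
    · simp only [if_pos hω]
      exact monotone_delayed (monotone_rightExt (hE ω hω).z_nonneg)
        (le_rightExt fun q _ => (hE ω hω).z_nonneg q)
    · simp only [if_neg hω]; exact monotone_const
  K_mono ω := by
    by_cases hω : ω ∈ E
    · simp only [if_pos hω]
      exact monotone_delayed (monotone_leftExt (fun q r => (hE ω hω).k_mono q r)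
        (hE ω hω).k_nonneg) (leftExt_zero _).ge
    · simp only [if_neg hω]; exact monotone_const
  Z_rightCont ω := by
    by_cases hω : ω ∈ E
    · simp only [if_pos hω]
      exact delayed_rightCont (rightExt_rightCont (hE ω hω).z_nonneg)
    · simp only [if_neg hω]; exact fun t => continuousWithinAt_const
  K_leftCont ω := by
    by_cases hω : ω ∈ E
    · simp only [if_pos hω]
      exact delayed_leftCont (leftExt_zero _) (leftExt_leftCont (fun q r => (hE ω hω).k_mono q r)
        (hE ω hω).k_nonneg)
    · simp only [if_neg hω]; exact fun t => continuousWithinAt_const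
  Z_zero ω := by
    split_ifs with hω
    · unfold delayed
      split_ifs
      · exact le_rightExt fun q _ => (hE ω hω).z_nonneg q
      · exact le_rfl
    · exact le_rfl
  K_zero ω := by
    split_ifs with hω
    · unfold delayed
      rw [zero_tsub, leftExt_zero, ite_self]
    · rfl

section Follow

variable [IsProbabilityMeasure P] (hC : IsHawkesModel p f P y C) {φ : PathControl} {x : ℝ}
  {h : ℝ≥0} {E : Set Ω} {θ : Ω → PathSpace} {hE : ∀ ω ∈ E, φ.IsGood p x (θ ω)}
  (hEm : MeasurableSet[C.filtration P h] E)
  (hθ : ∀ q : ℚ≥0, Measurable[C.filtration P (h + q)] fun ω => θ ω q)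
include hEm hθ

omit [IsProbabilityMeasure P] in
/-- The control at time `t` looks ahead only infinitesimally, and the filtration is
right-continuous. -/
theorem PathControl.measurable_follow_Z (t : ℝ≥0) :
    Measurable[C.filtration P t] ((φ.follow p x h E θ hE).Z t) := by
  classical
  rcases lt_or_ge t h with ht | ht
  · have : (φ.follow p x h E θ hE).Z t = fun _ => 0 := by
      funext ω
      simp only [PathControl.follow, delayed_of_lt ht, ite_self]
    rw [this]; exact measurable_const
  obtain ⟨t, rfl⟩ := exists_add_of_le ht
  refine @measurable_of_Iio _ _ _ _ _ (C.filtration P (h + t)) _ _ _ _ fun b => ?_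
  refine C.measurableSet_filtration_of_forall_gt fun s hs => ?_
  obtain ⟨s, rfl⟩ := exists_add_of_le (ht.trans (le_of_lt hs))
  have hts : t < s := lt_of_add_lt_add_left hs
  have hEs : MeasurableSet[C.filtration P (h + s)] E :=
    (C.filtration P).mono le_self_add E hEm
  have hset : (φ.follow p x h E θ hE).Z (h + t) ⁻¹' Set.Iio b =
      (E ∩ ⋃ q : {q : ℚ≥0 // t < q ∧ (q : ℝ≥0) < s}, {ω | φ.z q (θ ω) < b}) ∪
        (Eᶜ ∩ {_ω | 0 < b}) := by
    ext ω
    by_cases hω : ω ∈ E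
    · simp only [PathControl.follow, Set.mem_preimage, Set.mem_Iio, delayed_add,
        rightExt_lt_iff (hE ω hω).z_nonneg, Set.mem_union, Set.mem_inter_iff, hω, if_true, true_and,
        Set.mem_compl_iff, not_true_eq_false, false_and, or_false, Set.mem_iUnion, Subtype.exists,
        Set.mem_ofPred_eq, exists_prop]
      constructor
      · rintro ⟨q, hq, hlt⟩
        obtain ⟨r, hr, hr'⟩ := exists_nnrat_btwn_nnreal (lt_min hq hts)
        have hrq : r ≤ q := by exact_mod_cast (hr'.trans_le (min_le_left _ _)).le
        exact ⟨r, ⟨hr, hr'.trans_le (min_le_right _ _)⟩,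
          ((hE ω hω).z_mono r q hrq).trans_lt hlt⟩
      · rintro ⟨q, ⟨hq, -⟩, hlt⟩
        exact ⟨q, hq, hlt⟩
    · simp [PathControl.follow, hω]
  rw [hset]
  refine (hEs.inter (MeasurableSet.iUnion fun q => ?_)).union
    (hEs.compl.inter (MeasurableSet.const _))
  obtain ⟨r, hr, hr'⟩ := exists_nnrat_btwn_nnreal q.2.2
  have hqr : q.1 < r := by exact_mod_cast hr
  have h1 : @Measurable _ _ (C.filtration P (h + s)) (pathHistory r) θ :=
    measurable_of_pathHistory fun q' hq' => (hθ q').mono ((C.filtration P).mono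
      (by have : (q' : ℝ≥0) ≤ r := by exact_mod_cast hq'
          gcongr; exact this.trans hr'.le)) le_rfl
  exact measurableSet_lt ((φ.measurable_z q.1 r hqr).comp h1) measurable_const

omit [IsProbabilityMeasure P] in
/-- The injections at time `t` involve only rational times before `t`. -/
theorem PathControl.measurable_follow_K (t : ℝ≥0) :
    Measurable[C.filtration P t] ((φ.follow p x h E θ hE).K t) := by
  classical
  rcases le_or_gt t h with ht | ht
  · have : (φ.follow p x h E θ hE).K t = fun _ => 0 := by
      funext ω
      rcases eq_or_lt_of_le ht with rfl | ht
      · simp only [PathControl.follow, delayed, tsub_self, leftExt_zero, ite_self]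
      · simp only [PathControl.follow, delayed_of_lt ht, ite_self]
    rw [this]; exact measurable_const
  obtain ⟨t, rfl⟩ := exists_add_of_le ht.le
  have ht0 : 0 < t := pos_of_lt_add_right ht
  refine @measurable_of_Ioi _ _ _ _ _ (C.filtration P (h + t)) _ _ _ _ fun b => ?_
  have hEs : MeasurableSet[C.filtration P (h + t)] E :=
    (C.filtration P).mono le_self_add E hEm
  have hset : (φ.follow p x h E θ hE).K (h + t) ⁻¹' Set.Ioi b =
      (E ∩ ⋃ q : {q : ℚ≥0 // (q : ℝ≥0) < t}, {ω | b < φ.k q (θ ω)}) ∪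
        (Eᶜ ∩ {_ω | b < 0}) := by
    ext ω
    by_cases hω : ω ∈ E
    · simp only [PathControl.follow, Set.mem_preimage, Set.mem_Ioi, delayed_add,
        lt_leftExt_iff (fun q r => (hE ω hω).k_mono q r) ht0, Set.mem_union, Set.mem_inter_iff, hω,
        if_true, true_and, Set.mem_compl_iff, not_true_eq_false, false_and, or_false,
        Set.mem_iUnion, Subtype.exists, Set.mem_ofPred_eq, exists_prop]
    · simp [PathControl.follow, hω]
  rw [hset]
  refine (hEs.inter (MeasurableSet.iUnion fun q => ?_)).union
    (hEs.compl.inter (MeasurableSet.const _))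
  obtain ⟨r, hr, hr'⟩ := exists_nnrat_btwn_nnreal q.2
  have hqr : q.1 < r := by exact_mod_cast hr
  have h1 : @Measurable _ _ (C.filtration P (h + t)) (pathHistory r) θ :=
    measurable_of_pathHistory fun q' hq' => (hθ q').mono ((C.filtration P).mono
      (by have : (q' : ℝ≥0) ≤ r := by exact_mod_cast hq'
          gcongr; exact this.trans hr'.le)) le_rfl
  exact measurableSet_lt measurable_const ((φ.measurable_k q.1 r hqr).comp h1)

omit hEm hθ [IsProbabilityMeasure P] in
theorem PathControl.expectedDiscounted_follow (hEm : MeasurableSet E) :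
    expectedDiscounted p P (φ.follow p x h E θ hE).Z = ENNReal.ofReal (Real.exp (-p.ρ * h)) *
      ∫⁻ ω in E, discountedRight p (fun q => φ.z q (θ ω)) ∂P ∧
    expectedDiscounted p P (φ.follow p x h E θ hE).K = ENNReal.ofReal (Real.exp (-p.ρ * h)) *
      ∫⁻ ω in E, discountedLeft p (fun q => φ.k q (θ ω)) ∂P := by
  classical
  constructor
  all_goals
    rw [← lintegral_const_mul' _ _ ENNReal.ofReal_ne_top, ← lintegral_indicator hEm]
    refine lintegral_congr fun ω => ?_
    by_cases hω : ω ∈ E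
    · rw [Set.indicator_of_mem hω]
      first
        | rw [← discounted_rightExt p (hE ω hω).z_nonneg, ← discounted_delayed]
        | rw [← discounted_leftExt p fun q r => (hE ω hω).k_mono q r, ← discounted_delayed]
      refine congrArg (discounted p) (funext fun t => ?_)
      exact if_pos hω
    · rw [Set.indicator_of_notMem hω]
      simp [PathControl.follow, hω, discounted]

include hC

omit [IsProbabilityMeasure P] in
/-- If the claims do not exceed those of the path followed, up to the premiums collected until
`h`, the strategy is admissible for them. -/
theorem PathControl.isFrozen_follow
    (hdom : ∀ ω ∈ E, ∀ q : ℚ≥0, C.total (h + q) ω ≤ (θ ω q).2 + p.c * h)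
    (hpre : ∀ ω ∈ E, ∀ t < h, C.total t ω ≤ x + p.c * t) :
    IsFrozen p P C x (φ.follow p x h E θ hE) := by
  classical
  have hRS : ∀ ω ∈ E, ∀ q : ℚ≥0, x + p.c * q - (θ ω q).2 ≤ reservePath p C x ω (h + q) := by
    intro ω hω q
    have h1 := hdom ω hω q
    have e : ((q : ℝ≥0) : ℝ) = (q : ℝ) := by norm_cast
    simp only [reservePath, NNReal.coe_add, e]
    linarith
  refine ⟨φ.measurable_follow_Z hEm hθ, φ.measurable_follow_K hEm hθ, fun ω => ?_, ?_⟩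
  · by_cases hω : ω ∈ E
    · have h1 := (hE ω hω).lumpsCovered_delayed (hC.reservePath_rightCont x ω) (hRS ω hω)
      simpa only [PathControl.follow, if_pos hω] using h1
    · simp only [PathControl.follow, if_neg hω]
      exact fun t => Or.inr ⟨fun _ => rfl, fun h0 ε hε => ⟨0, h0, by simpa using hε⟩⟩
  · refine ae_of_all _ fun ω => ?_
    by_cases hω : ω ∈ E
    · have h1 := (hE ω hω).noAction_delayed (hC.reservePath_rightCont x ω) (hRS ω hω)
        fun t ht => sub_nonneg.2 (hpre ω hω t ht)
      simpa only [PathControl.follow, if_pos hω] using h1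
    · simp only [PathControl.follow, if_neg hω]
      exact fun t t' _ _ r _ => ⟨rfl, rfl⟩

end Follow

variable [IsProbabilityMeasure P]

/-- If, from time `h` on and on the event `A`, the claims of the process `C` are dominated by a
path with the law of `C'`, which may depend on an independent randomization, then a strategy
for `C'` can be followed for `C` from time `h` on. -/
theorem IsHawkesModel.value_transfer (hC : IsHawkesModel p f P y C)
    (hC' : IsHawkesModel p f P y' C') {x : ℝ} (hx : 0 ≤ x) (h : ℝ≥0) {A : Set Ω}
    (hA : MeasurableSet[C.filtration P h] A) {U : Type*} [MeasurableSpace U] (Q : Measure U)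
    [IsProbabilityMeasure Q] {Θ : Ω × U → PathSpace} (hΘ : Measurable Θ)
    (hΘA : ∀ u (q : ℚ≥0), Measurable[C.filtration P (h + q)] fun ω => Θ (ω, u) q)
    (hlaw : ((P.restrict A).prod Q).map Θ = P A • P.map C'.path)
    (hdom : ∀ᵐ z ∂((P.restrict A).prod Q),
      ∀ q : ℚ≥0, C.total (h + q) z.1 ≤ (Θ z q).2 + p.c * h)
    (hpre : ∀ᵐ ω ∂(P.restrict A), ∀ t < h, C.total t ω ≤ x + p.c * t) :
    Real.exp (-p.ρ * h) * P.real A * (value p P C' x).toReal ≤ (value p P C x).toReal := by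
  have hAm : MeasurableSet A := (C.filtration P).le h A hA
  set γ := Real.exp (-p.ρ * h) with hγ
  have hγ0 : 0 < γ := Real.exp_pos _
  rcases eq_or_lt_of_le (measureReal_nonneg (μ := P) (s := A)) with hA0 | hA0
  · rw [← hA0, mul_zero, zero_mul]; exact hC.value_finite.2.1
  rw [mul_comm, ← le_div_iff₀ (mul_pos hγ0 hA0)]
  refine hC'.value_toReal_le fun α hα hI => ?_
  rw [le_div_iff₀ (mul_pos hγ0 hA0)]
  have hD : expectedDiscounted p P α.Z ≠ ∞ :=
    ne_top_of_le_ne_top (ENNReal.add_ne_top.2 ⟨ENNReal.ofReal_ne_top, hI⟩) (hα.dividends_le hC')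
  obtain ⟨φ, hgood, hZ, hK⟩ := hα.exists_pathControl hC' hx
  set V := (value p P C x).toReal with hV
  have hV0 : 0 ≤ V := hC.value_finite.2.1
  set DZ : U → ℝ≥0∞ := fun u => ∫⁻ ω in A, discountedRight p (fun q => φ.z q (Θ (ω, u))) ∂P with hDZ
  set DK : U → ℝ≥0∞ := fun u => ∫⁻ ω in A, discountedLeft p (fun q => φ.k q (Θ (ω, u))) ∂P with hDK
  have hgoodΘ : ∀ᵐ z ∂((P.restrict A).prod Q), φ.IsGood p x (Θ z) := by
    refine ae_of_ae_map hΘ.aemeasurable ?_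
    rw [hlaw]
    exact Measure.ae_smul_measure hgood _
  have hm1 : Measurable fun z => discountedRight p fun q => φ.z q (Θ z) :=
    (φ.measurable_discounted_z p).comp hΘ
  have hm2 : Measurable fun z => discountedLeft p fun q => φ.k q (Θ z) :=
    (φ.measurable_discounted_k p).comp hΘ
  have hav1 : ∫⁻ u, DZ u ∂Q = P A * expectedDiscounted p P α.Z := by
    rw [hZ, ← smul_eq_mul, ← lintegral_smul_measure, ← hlaw,
      lintegral_map (φ.measurable_discounted_z p) hΘ, lintegral_prod_symm _ hm1.aemeasurable]
  have hav2 : ∫⁻ u, DK u ∂Q = P A * expectedDiscounted p P α.K := by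
    rw [hK, ← smul_eq_mul, ← lintegral_smul_measure, ← hlaw,
      lintegral_map (φ.measurable_discounted_k p) hΘ, lintegral_prod_symm _ hm2.aemeasurable]
  -- for almost every value of the randomization, the strategy can be followed
  have hu : ∀ᵐ u ∂Q, ENNReal.ofReal γ * DZ u ≤
      ENNReal.ofReal V + ENNReal.ofReal p.δ * (ENNReal.ofReal γ * DK u) := by
    have h1 : ∀ᵐ u ∂Q, ∀ᵐ ω ∂(P.restrict A), φ.IsGood p x (Θ (ω, u)) ∧
        ∀ q : ℚ≥0, C.total (h + q) ω ≤ (Θ (ω, u) q).2 + p.c * h :=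
      Measure.ae_ae_of_ae_prod ((Measure.measurePreserving_swap (μ := Q)
        (ν := P.restrict A)).quasiMeasurePreserving.ae (hgoodΘ.and hdom))
    filter_upwards [h1] with u hu
    by_cases hfin : DK u = ∞
    · have : ENNReal.ofReal p.δ * (ENNReal.ofReal γ * DK u) = ∞ := by
        rw [hfin, ENNReal.mul_top (ENNReal.ofReal_pos.2 hγ0).ne',
          ENNReal.mul_top (ENNReal.ofReal_pos.2 (one_pos.trans p.one_lt_δ)).ne']
      rw [this, add_top]; exact le_top
    -- the exceptional null event is known at time `h`, by completeness
    have hnull : (P.restrict A) {ω | ¬ ((φ.IsGood p x (Θ (ω, u)) ∧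
        ∀ q : ℚ≥0, C.total (h + q) ω ≤ (Θ (ω, u) q).2 + p.c * h) ∧
        ∀ t < h, C.total t ω ≤ x + p.c * t)} = 0 := hu.and hpre
    obtain ⟨B, hBsub, hBm, hB0⟩ := exists_measurable_superset_of_null hnull
    rw [Measure.restrict_apply hBm] at hB0
    have hEm : MeasurableSet[C.filtration P h] (A \ (B ∩ A)) :=
      hA.diff (C.measurableSet_filtration_of_null h (hBm.inter hAm) hB0)
    have hEA : (A \ (B ∩ A) : Set Ω) =ᵐ[P] A := sdiff_null_ae_eq_self hB0
    have hE : ∀ ω ∈ A \ (B ∩ A), (φ.IsGood p x (Θ (ω, u)) ∧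
        ∀ q : ℚ≥0, C.total (h + q) ω ≤ (Θ (ω, u) q).2 + p.c * h) ∧
        ∀ t < h, C.total t ω ≤ x + p.c * t := fun ω hω =>
      by_contra fun hcon => hω.2 ⟨hBsub hcon, hω.1⟩
    have hfr := φ.isFrozen_follow hC (x := x) (hE := fun ω hω => (hE ω hω).1.1) hEm (hΘA u)
      (fun ω hω => (hE ω hω).1.2) fun ω hω => (hE ω hω).2
    obtain ⟨e1, e2⟩ := φ.expectedDiscounted_follow (P := P) (p := p) (x := x) (h := h)
      (hE := fun ω hω => (hE ω hω).1.1) ((C.filtration P).le h _ hEm)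
    rw [setLIntegral_congr hEA] at e1 e2
    have hKfin : ENNReal.ofReal γ * DK u ≠ ∞ := ENNReal.mul_ne_top ENNReal.ofReal_ne_top hfin
    have hle := hC.le_value hfr (e2 ▸ hKfin)
    have hDfin : expectedDiscounted p P (φ.follow p x h (A \ (B ∩ A)) (fun ω => Θ (ω, u))
        fun ω hω => (hE ω hω).1.1).Z ≠ ∞ := ne_top_of_le_ne_top
      (ENNReal.add_ne_top.2 ⟨ENNReal.ofReal_ne_top, e2 ▸ hKfin⟩) (hfr.dividends_le hC)
    rw [e2] at hle
    have hδ : 0 ≤ p.δ := (one_pos.trans p.one_lt_δ).le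
    change _ - p.δ * (ENNReal.ofReal γ * DK u).toReal ≤ V at hle
    have e1' : ENNReal.ofReal γ * DZ u = _ := e1.symm
    rw [e1', ← ENNReal.ofReal_toReal hDfin, ← ENNReal.ofReal_toReal hKfin,
      ← ENNReal.ofReal_mul hδ, ← ENNReal.ofReal_add hV0 (by positivity)]
    exact ENNReal.ofReal_le_ofReal (by linarith)
  have h2 := lintegral_mono_ae hu
  rw [lintegral_const_mul' _ _ ENNReal.ofReal_ne_top, hav1, lintegral_add_left measurable_const,
    lintegral_const_mul' _ _ ENNReal.ofReal_ne_top, lintegral_const_mul' _ _ ENNReal.ofReal_ne_top,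
    hav2, lintegral_const, measure_univ, mul_one] at h2
  have hPA : P A ≠ ∞ := measure_ne_top P A
  have hfin : ENNReal.ofReal p.δ * (ENNReal.ofReal γ * (P A * expectedDiscounted p P α.K)) ≠ ∞ :=
    ENNReal.mul_ne_top ENNReal.ofReal_ne_top (ENNReal.mul_ne_top ENNReal.ofReal_ne_top
      (ENNReal.mul_ne_top hPA hI))
  have h3 := ENNReal.toReal_mono (ENNReal.add_ne_top.2 ⟨ENNReal.ofReal_ne_top, hfin⟩) h2
  rw [ENNReal.toReal_add ENNReal.ofReal_ne_top hfin] at h3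
  simp only [ENNReal.toReal_mul, ENNReal.toReal_ofReal hγ0.le, ENNReal.toReal_ofReal hV0,
    ENNReal.toReal_ofReal (one_pos.trans p.one_lt_δ).le] at h3
  have h4 : (P A).toReal = P.real A := rfl
  rw [h4] at h3
  linarith

end HawkesDividend

namespace HawkesDividend

/-! ### Dependence of the value function on the intensity -/

variable {Ω : Type*} [mΩ : MeasurableSpace Ω] {P : Measure Ω} [IsProbabilityMeasure P]
  {p : Params} {y y' : ℝ} {C C' : ClaimProcess Ω} {f : ℝ → ℝ}

/-- More claims are worse: from the claims with the lower intensity, those with the higher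
intensity are obtained by adding independent excess claims, and a strategy for the latter can be
followed for the former, with simulated excess claims. -/
theorem IsHawkesModel.value_anti (hC : IsHawkesModel p f P y C) (hC' : IsHawkesModel p f P y' C')
    (hy : p.b ≤ y) (hyy' : y < y') {x : ℝ} (hx : 0 ≤ x) :
    (value p P C' x).toReal ≤ (value p P C x).toReal := by
  have hy₀ : 0 < y' - y := sub_pos.2 hyy'
  have hex := hC.isIncreasingPair_excess hy₀
  have h := hC.value_transfer hC' hx 0 (A := Set.univ) (@MeasurableSet.univ _ _) (expSeq.prod P)
    (Θ := C.mergedPath p (y' - y)) (hC.isIncreasingPair_merged hy₀).measurable_ratPath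
    (fun u q => ?_) ?_ ?_ ?_
  · simpa using h
  · rw [zero_add]
    exact (((measurable_from_top (f := fun k : ℕ => (k : ℝ))).comp
      (C.measurable_N_filtration P le_rfl)).add_const (excessN Ω p (y' - y) q u)).prodMk
      ((C.measurable_total_filtration P le_rfl).add_const (excessTotal C p (y' - y) q u))
  · rw [Measure.restrict_univ, measure_univ, one_smul]
    exact hC.map_mergedPath hC' hy hyy'
  · have h1 : ∀ᵐ z ∂(expSeq.prod P), ∀ q : ℚ≥0, 0 ≤ excessTotal C p (y' - y) q z := by
      filter_upwards [hex.zero, hex.mono] with z h0 hm q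
      rw [← h0.2]
      exact hm.2 zero_le
    have h2 : ∀ᵐ z ∂((P.restrict Set.univ).prod (expSeq.prod P)), ∀ q : ℚ≥0,
        0 ≤ excessTotal C p (y' - y) q z.2 := Measure.quasiMeasurePreserving_snd.ae h1
    filter_upwards [h2] with z hz q
    rw [zero_add, NNReal.coe_zero, mul_zero, add_zero]
    exact le_add_of_nonneg_right (hz q)
  · exact ae_of_all _ fun ω t ht => absurd ht not_lt_zero

/-- If there is no claim before the intensity has decreased from `y'` to `y`, then nothing is lost
by waiting until then, except for the discounting. -/
theorem IsHawkesModel.exp_mul_value_le (hC : IsHawkesModel p f P y C)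
    (hC' : IsHawkesModel p f P y' C') (hy : p.b ≤ y) (hy' : p.b ≤ y') {x : ℝ} (hx : 0 ≤ x)
    (h : ℝ≥0) (hh : freeIntensity p y' h = y) :
    Real.exp (-((p.ρ + y') * h + p.a * p.b * h ^ 2)) * (value p P C x).toReal ≤
      (value p P C' x).toReal := by
  have hA : MeasurableSet[C'.filtration P h] {ω | C'.N h ω = 0} :=
    C'.measurable_N_filtration P le_rfl (measurableSet_singleton 0)
  have hAm := (C'.filtration P).le h _ hA
  have hshift : Measurable (C'.shiftPath h) := (hC'.isIncreasingPair_shift h).measurable_ratPath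
  have key := hC'.value_transfer hC hx h hA P (Θ := C'.shiftPath h ∘ Prod.fst)
    (hshift.comp measurable_fst) (fun u q => ?_) ?_ ?_ ?_
  · refine le_trans (mul_le_mul_of_nonneg_right ?_ hC.value_finite.2.1) key
    have h1 := hC'.no_claim_ge hy' h
    refine le_trans (le_of_eq ?_) (mul_le_mul_of_nonneg_left h1 (Real.exp_pos _).le)
    rw [← Real.exp_add]
    congr 1
    ring
  · exact ((measurable_from_top (f := fun k : ℕ => (k : ℝ))).comp
      (C'.measurable_N_filtration P le_rfl)).prodMk (C'.measurable_total_filtration P le_rfl)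
  · rw [← Measure.map_map hshift measurable_fst, Measure.map_fst_prod, measure_univ, one_smul]
    exact hC.map_shiftPath hC' hy hy' h hh
  · refine ae_of_all _ fun z q => ?_
    have h1 : 0 ≤ p.c * h := mul_nonneg p.c_pos.le h.coe_nonneg
    exact le_add_of_nonneg_right h1
  · filter_upwards [ae_restrict_mem hAm] with ω hω t ht
    have hN : C'.N t ω = 0 := Nat.le_zero.1 ((hC'.N_mono ω ht.le).trans_eq hω)
    have h1 : C'.total t ω = 0 := by simp [ClaimProcess.total, hN]
    rw [h1]
    have h2 : 0 ≤ p.c * t := mul_nonneg p.c_pos.le t.coe_nonneg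
    linarith

/-- The intensity decays from `y'` to `y` in the time `log ((y' - b) / (y - b)) / a`, which is at
most `(y' - y) / (a ε)`. -/
theorem IsHawkesModel.value_sub_le (hC : IsHawkesModel p f P y C)
    (hC' : IsHawkesModel p f P y' C') {ε : ℝ} (hε : 0 < ε) (hy : p.b + ε ≤ y) (hyy' : y < y')
    {x : ℝ} (hx : 0 ≤ x) :
    (value p P C x).toReal - (value p P C' x).toReal ≤
      (x + p.c / p.ρ) * ((p.ρ + y) / (p.a * ε)) * (y' - y) +
      (x + p.c / p.ρ) * (1 / (p.a * ε) + p.b / (p.a * ε ^ 2)) * (y' - y) ^ 2 := by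
  have ha := p.a_pos
  have hb := p.b_pos
  have hρ := p.ρ_pos
  have hc := p.c_pos
  have hyb : 0 < y - p.b := by linarith
  have hd : 0 < y' - y := sub_pos.2 hyy'
  set D := (y' - y) / (p.a * ε) with hD
  have hD0 : 0 < D := by positivity
  -- the time after which the intensity has decreased from `y'` to `y`
  set h := Real.log ((y' - p.b) / (y - p.b)) / p.a with hh
  have hratio : (y' - p.b) / (y - p.b) = 1 + (y' - y) / (y - p.b) := by field_simp; ring
  have hr1 : 1 ≤ (y' - p.b) / (y - p.b) := by rw [hratio]; linarith [div_pos hd hyb]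
  have hh0 : 0 ≤ h := div_nonneg (Real.log_nonneg hr1) ha.le
  have hhD : h ≤ D := by
    have h1 : Real.log ((y' - p.b) / (y - p.b)) ≤ (y' - y) / (y - p.b) := by
      have := Real.log_le_sub_one_of_pos (one_pos.trans_le hr1)
      rw [hratio] at this ⊢
      linarith
    have h2 : (y' - y) / (y - p.b) ≤ (y' - y) / ε :=
      div_le_div_of_nonneg_left hd.le hε (by linarith)
    rw [hD, hh, mul_comm p.a ε, ← div_div]
    exact div_le_div_of_nonneg_right (h1.trans h2) ha.le
  have hfree : freeIntensity p y' (h.toNNReal : ℝ≥0) = y := by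
    rw [Real.coe_toNNReal h hh0, freeIntensity, hh, mul_div_cancel₀ _ ha.ne', Real.exp_neg,
      Real.exp_log (one_pos.trans_le hr1)]
    have : y' - p.b ≠ 0 := by linarith
    field_simp
    ring
  have h1 := hC.exp_mul_value_le hC' (by linarith) (by linarith) hx h.toNNReal hfree
  rw [Real.coe_toNNReal h hh0] at h1
  set κ := (p.ρ + y') * h + p.a * p.b * h ^ 2 with hκ
  obtain ⟨-, hv0, hv⟩ := hC.value_finite (x := x)
  rw [max_eq_left hx] at hv
  have hexp : 1 - κ ≤ Real.exp (-κ) := by linarith [Real.add_one_le_exp (-κ)]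
  have hy'0 : 0 < y' := by linarith
  have hκ0 : 0 ≤ κ := by positivity
  have hκle : κ ≤ (p.ρ + y') * D + p.a * p.b * D ^ 2 := by
    exact add_le_add (mul_le_mul_of_nonneg_left hhD (by linarith))
      (mul_le_mul_of_nonneg_left (pow_le_pow_left₀ hh0 hhD 2) (mul_pos ha hb).le)
  have h2 : (value p P C x).toReal - (value p P C' x).toReal ≤
      (x + p.c / p.ρ) * ((p.ρ + y') * D + p.a * p.b * D ^ 2) := by
    calc (value p P C x).toReal - (value p P C' x).toReal
        ≤ κ * (value p P C x).toReal := by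
          have := mul_le_mul_of_nonneg_right hexp hv0
          linarith
      _ ≤ κ * (x + p.c / p.ρ) := mul_le_mul_of_nonneg_left hv hκ0
      _ ≤ ((p.ρ + y') * D + p.a * p.b * D ^ 2) * (x + p.c / p.ρ) :=
          mul_le_mul_of_nonneg_right hκle (by positivity)
      _ = _ := mul_comm _ _
  refine h2.trans (le_of_eq ?_)
  rw [hD]
  field_simp
  ring

theorem IsHawkesModel.value_mono (hC : IsHawkesModel p f P y C) (hy : p.b ≤ y) :
    Monotone fun x => (value p P C x).toReal := by
  have hδ := p.one_lt_δ
  have hnonpos : ∀ x x', x ≤ x' → x' ≤ 0 → (value p P C x).toReal ≤ (value p P C x').toReal := by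
    intro x x' h h'
    rw [hC.value_of_nonpos hy (h.trans h'), hC.value_of_nonpos hy h']
    have := mul_le_mul_of_nonneg_left h (one_pos.trans hδ).le
    exact max_le_max_right 0 (by linarith)
  have hnonneg : ∀ x x', x ≤ x' → 0 ≤ x → (value p P C x).toReal ≤ (value p P C x').toReal := by
    intro x x' h h'
    have := hC.value_add_ge h' (sub_nonneg.2 h)
    rw [add_sub_cancel] at this
    linarith
  intro x x' h
  rcases le_total x' 0 with h' | h'
  · exact hnonpos x x' h h'
  rcases le_total 0 x with h0 | h0
  · exact hnonneg x x' h h0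
  · exact (hnonpos x 0 h0 le_rfl).trans (hnonneg 0 x' h' le_rfl)

theorem IsHawkesModel.abs_value_sub_le (hC : IsHawkesModel p f P y C) (hy : p.b ≤ y) (x x' : ℝ) :
    |(value p P C x).toReal - (value p P C x').toReal| ≤ p.δ * |x - x'| := by
  wlog h : x' ≤ x generalizing x x'
  · rw [abs_sub_comm, abs_sub_comm x]
    exact this x' x (le_of_not_ge h)
  rw [abs_of_nonneg (sub_nonneg.2 (hC.value_mono hy h)), abs_of_nonneg (sub_nonneg.2 h)]
  have := hC.value_add_le (x := x') (sub_nonneg.2 h)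
  rw [add_sub_cancel] at this
  linarith

/-- With a deficit, the value function depends on the intensity at most as much as without. -/
theorem max_sub_max_le (s u w : ℝ) (h : w ≤ u) :
    0 ≤ max (s + u) 0 - max (s + w) 0 ∧ max (s + u) 0 - max (s + w) 0 ≤ u - w := by
  constructor
  · exact sub_nonneg.2 (max_le_max_right 0 (by linarith))
  · have h1 := le_max_left (s + w) 0
    have h2 := le_max_right (s + w) 0
    have : max (s + u) 0 ≤ max (s + w) 0 + (u - w) := max_le (by linarith) (by linarith)
    linarith

theorem IsHawkesModel.abs_value_sub_le_intensity (hC : IsHawkesModel p f P y C)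
    (hC' : IsHawkesModel p f P y' C') {ε : ℝ} (hε : 0 < ε) (hy : p.b + ε ≤ y) (hyy' : y < y')
    (x : ℝ) :
    |(value p P C x).toReal - (value p P C' x).toReal| ≤
      (|x| + p.c / p.ρ) * ((p.ρ + y) / (p.a * ε)) * (y' - y) +
      (|x| + p.c / p.ρ) * (1 / (p.a * ε) + p.b / (p.a * ε ^ 2)) * (y' - y) ^ 2 := by
  have ha := p.a_pos
  have hb := p.b_pos
  have hρ := p.ρ_pos
  have hc := p.c_pos
  have hy0 : 0 < y := by linarith
  have hd : 0 < y' - y := sub_pos.2 hyy'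
  rcases le_total 0 x with hx | hx
  · rw [abs_of_nonneg hx, abs_of_nonneg (sub_nonneg.2 (hC.value_anti hC' (by linarith) hyy' hx))]
    exact hC.value_sub_le hC' hε hy hyy' hx
  · have h0 := hC.value_anti hC' (by linarith) hyy' le_rfl
    obtain ⟨h1, h2⟩ := max_sub_max_le (p.δ * x) _ _ h0
    rw [hC.value_of_nonpos (by linarith) hx, hC'.value_of_nonpos (by linarith) hx, abs_of_nonneg h1]
    have h3 := hC.value_sub_le hC' hε hy hyy' le_rfl
    refine h2.trans (h3.trans ?_)
    have := abs_nonneg x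
    gcongr

theorem locallyLipschitzOn_value {C : ℝ → ClaimProcess Ω}
    (hC : ∀ y, p.b ≤ y → IsHawkesModel p f P y (C y)) :
    LocallyLipschitzOn (Set.univ ×ˢ Set.Ioi p.b)
      fun q : ℝ × ℝ => (value p P (C q.2) q.1).toReal := by
  rintro ⟨x₀, y₀⟩ ⟨-, hy₀⟩
  have ha := p.a_pos
  have hb := p.b_pos
  have hρ := p.ρ_pos
  have hc := p.c_pos
  have hδ : 0 < p.δ := one_pos.trans p.one_lt_δ
  set ε := (y₀ - p.b) / 2 with hε
  have hy₀' : p.b < y₀ := hy₀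
  have hε0 : 0 < ε := by rw [hε]; linarith
  set M := (|x₀| + 1 + p.c / p.ρ) * ((p.ρ + (y₀ + 1)) / (p.a * ε)) +
    (|x₀| + 1 + p.c / p.ρ) * (1 / (p.a * ε) + p.b / (p.a * ε ^ 2)) * 2 with hM
  have hy0 : 0 < y₀ := hb.trans hy₀'
  have hM0 : 0 ≤ M := by positivity
  refine ⟨(p.δ + M).toNNReal, Metric.ball x₀ 1 ×ˢ Metric.ball y₀ (min ε 1),
    mem_nhdsWithin_of_mem_nhds (prod_mem_nhds (Metric.ball_mem_nhds _ one_pos)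
      (Metric.ball_mem_nhds _ (lt_min hε0 one_pos))), ?_⟩
  have hball : ∀ y ∈ Metric.ball y₀ (min ε 1), p.b + ε ≤ y ∧ |y - y₀| < 1 := by
    intro y hy
    rw [Metric.mem_ball, Real.dist_eq] at hy
    refine ⟨?_, hy.trans_le (min_le_right _ _)⟩
    have := (abs_lt.1 (hy.trans_le (min_le_left _ _))).1
    linarith
  have hint : ∀ x ∈ Metric.ball x₀ 1, ∀ y ∈ Metric.ball y₀ (min ε 1),
      ∀ y' ∈ Metric.ball y₀ (min ε 1), y < y' →
      |(value p P (C y) x).toReal - (value p P (C y') x).toReal| ≤ M * |y - y'| := by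
    intro x hx y hy y' hy' hyy'
    obtain ⟨h1, h2⟩ := hball y hy
    obtain ⟨h1', h2'⟩ := hball y' hy'
    have hd : 0 < y' - y := sub_pos.2 hyy'
    have h3 := (hC y (by linarith)).abs_value_sub_le_intensity (hC y' (by linarith)) hε0 h1 hyy' x
    have hd2 : y' - y ≤ 2 := by linarith [(abs_lt.1 h2).1, (abs_lt.1 h2').2]
    have hx1 : |x| ≤ |x₀| + 1 := by
      rw [Metric.mem_ball, Real.dist_eq] at hx
      linarith [abs_sub_abs_le_abs_sub x x₀]
    have hyy : y ≤ y₀ + 1 := by linarith [(abs_lt.1 h2).2]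
    have hypos : 0 < y := by linarith
    rw [abs_sub_comm y y', abs_of_pos hd]
    refine h3.trans ?_
    rw [hM, add_mul (_ * _) (_ * 2) _]
    have hsq : (y' - y) ^ 2 ≤ 2 * (y' - y) := by
      rw [sq]; exact mul_le_mul_of_nonneg_right hd2 hd.le
    refine add_le_add (by gcongr) ?_
    refine (mul_le_mul (mul_le_mul_of_nonneg_right (by linarith) (by positivity)) hsq
      (by positivity) (by positivity)).trans_eq (mul_assoc _ _ _).symm
  refine LipschitzOnWith.of_dist_le_mul ?_
  rintro ⟨x, y⟩ ⟨hx, hy⟩ ⟨x', y'⟩ ⟨hx', hy'⟩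
  rw [Real.coe_toNNReal _ (by positivity), Real.dist_eq]
  have hyb : p.b ≤ y := by linarith [(hball y hy).1]
  have h1 := (hC y hyb).abs_value_sub_le hyb x x'
  have h2 : |(value p P (C y) x').toReal - (value p P (C y') x').toReal| ≤ M * |y - y'| := by
    rcases lt_trichotomy y y' with h | rfl | h
    · exact hint x' hx' y hy y' hy' h
    · simp
    · rw [abs_sub_comm, abs_sub_comm y]; exact hint x' hx' y' hy' y hy h
  have h3 : |x - x'| ≤ dist (x, y) (x', y') := by
    rw [Prod.dist_eq, ← Real.dist_eq]; exact le_max_left _ _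
  have h4 : |y - y'| ≤ dist (x, y) (x', y') := by
    rw [Prod.dist_eq, ← Real.dist_eq]; exact le_max_right _ _
  calc |(value p P (C y) x).toReal - (value p P (C y') x').toReal|
      ≤ |(value p P (C y) x).toReal - (value p P (C y) x').toReal| +
        |(value p P (C y) x').toReal - (value p P (C y') x').toReal| := abs_sub_le _ _ _
    _ ≤ p.δ * |x - x'| + M * |y - y'| := add_le_add h1 h2
    _ ≤ p.δ * dist (x, y) (x', y') + M * dist (x, y) (x', y') := by gcongr
    _ = _ := by ring

theorem isLittleO_const_mul_sub_sq (κ y : ℝ) :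
    (fun y' => κ * (y' - y) ^ 2) =o[𝓝[>] y] fun y' => y' - y := by
  have h : Tendsto (fun y' => κ * (y' - y)) (𝓝[>] y) (𝓝 0) := by
    have : Continuous fun y' => κ * (y' - y) := by fun_prop
    have h1 := this.tendsto y
    simp only [sub_self, mul_zero] at h1
    exact h1.mono_left nhdsWithin_le_nhds
  have h2 := (Asymptotics.isLittleO_one_iff ℝ).2 h |>.mul_isBigO
    (Asymptotics.isBigO_refl (fun y' => y' - y) (𝓝[>] y))
  refine (h2.congr (fun y' => ?_) fun y' => ?_)
  · ring
  · ring

end HawkesDividend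

theorem mainTheorem4 {Ω : Type*} [MeasurableSpace Ω] (P : Measure Ω) [IsProbabilityMeasure P]
    (p : HawkesDividend.Params) (f : ℝ → ℝ) (hf : Measurable f) (hf0 : ∀ z, 0 ≤ f z)
    (C : ℝ → HawkesDividend.ClaimProcess Ω)
    (hC : ∀ y, p.b ≤ y → HawkesDividend.IsHawkesModel p f P y (C y))
    (v : ℝ → ℝ → ℝ) (hv : ∀ x y, v x y = (HawkesDividend.value p P (C y) x).toReal) :
    -- the value function is finite
    (∀ x y, p.b ≤ y → HawkesDividend.value p P (C y) x = (v x y : EReal)) ∧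
    -- it is locally Lipschitz continuous
    LocallyLipschitzOn (Set.univ ×ˢ Set.Ioi p.b) (fun q : ℝ × ℝ => v q.1 q.2) ∧
    -- increments in the surplus
    (∀ y x x', p.b ≤ y → 0 ≤ x → x < x' →
      x' - x ≤ v x' y - v x y ∧ v x' y - v x y ≤ p.δ * (x' - x)) ∧
    (∀ y x x', p.b ≤ y → x < x' → x' ≤ 0 →
      0 ≤ v x' y - v x y ∧
      v x' y - v x y = max (p.δ * x' + v 0 y) 0 - max (p.δ * x + v 0 y) 0 ∧
      max (p.δ * x' + v 0 y) 0 - max (p.δ * x + v 0 y) 0 ≤ p.δ * (x' - x)) ∧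
    -- increments in the intensity, non-negative surplus
    (∀ x y ε, 0 ≤ x → 0 < ε → p.b + ε ≤ y →
      ∃ r : ℝ → ℝ, r =o[𝓝[>] y] (fun y' => y' - y) ∧ ∀ y' > y,
        0 ≤ v x y - v x y' ∧
        v x y - v x y' ≤ (x + p.c / p.ρ) * ((p.ρ + y) / (p.a * ε)) * (y' - y) + r y') ∧
    -- increments in the intensity, non-positive surplus
    (∀ y ε, 0 < ε → p.b + ε ≤ y →
      ∃ r : ℝ → ℝ, r =o[𝓝[>] y] (fun y' => y' - y) ∧ ∀ x ≤ 0, ∀ y' > y,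
        v x y - v x y' ≤ max (p.δ * x + v 0 y) 0 - max (p.δ * x + v 0 y') 0 ∧
        max (p.δ * x + v 0 y) 0 - max (p.δ * x + v 0 y') 0 ≤ v 0 y - v 0 y' ∧
        v 0 y - v 0 y' ≤ p.c / p.ρ * ((p.ρ + y) / (p.a * ε)) * (y' - y) + r y') := by
  refine ⟨fun x y hy => ?_, ?_, fun y x x' hy hx hxx' => ?_, fun y x x' hy hxx' hx' => ?_,
    fun x y ε hx hε hy => ?_, fun y ε hε hy => ?_⟩
  · rw [hv]; exact (hC y hy).value_finite.1
  · simp only [hv]; exact HawkesDividend.locallyLipschitzOn_value hC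
  · have h1 := (hC y hy).value_add_ge hx (sub_pos.2 hxx').le
    have h2 := (hC y hy).value_add_le (x := x) (sub_pos.2 hxx').le
    rw [add_sub_cancel, ← hv, ← hv] at h1 h2
    constructor <;> linarith
  · have h1 := (hC y hy).value_mono hy hxx'.le
    have h2 := (hC y hy).value_add_le (x := x) (sub_pos.2 hxx').le
    have h3 := (hC y hy).value_of_nonpos hy hx'
    have h4 := (hC y hy).value_of_nonpos hy (hxx'.le.trans hx')
    simp only [← hv] at h1 h3 h4
    rw [add_sub_cancel, ← hv, ← hv] at h2
    rw [← h3, ← h4]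
    exact ⟨sub_nonneg.2 h1, rfl, by linarith⟩
  · refine ⟨fun y' => (x + p.c / p.ρ) * (1 / (p.a * ε) + p.b / (p.a * ε ^ 2)) * (y' - y) ^ 2,
      HawkesDividend.isLittleO_const_mul_sub_sq _ y, fun y' hyy' => ?_⟩
    have hyb : p.b ≤ y := by linarith
    have hyb' : p.b ≤ y' := by linarith [show y < y' from hyy']
    rw [hv, hv]
    exact ⟨sub_nonneg.2 ((hC y hyb).value_anti (hC y' hyb') hyb hyy' hx),
      (hC y hyb).value_sub_le (hC y' hyb') hε hy hyy' hx⟩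
  · refine ⟨fun y' => p.c / p.ρ * (1 / (p.a * ε) + p.b / (p.a * ε ^ 2)) * (y' - y) ^ 2,
      HawkesDividend.isLittleO_const_mul_sub_sq _ y, fun x hx y' hyy' => ?_⟩
    have hyb : p.b ≤ y := by linarith
    have hyb' : p.b ≤ y' := by linarith [show y < y' from hyy']
    have h0 := (hC y hyb).value_anti (hC y' hyb') hyb hyy' le_rfl
    have h1 := (hC y hyb).value_sub_le (hC y' hyb') hε hy hyy' le_rfl
    have h3 := (hC y hyb).value_of_nonpos hyb hx
    have h4 := (hC y' hyb').value_of_nonpos hyb' hx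
    simp only [← hv, zero_add] at h0 h1 h3 h4
    rw [h3, h4]
    exact ⟨le_rfl, (HawkesDividend.max_sub_max_le (p.δ * x) _ _ h0).2, h1⟩
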